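/- **Spaces.** Let $D=D([0,1],\mathbb R^d)$ be the space of càdlàg functions with the (strong) Skorohod $\mathcal J_1$ topology, $u(\tau^-)$ the left limit of $u\in D$ at $\tau$, $\Delta u(\tau)=u(\tau)-u(\tau^-)$, and $\operatorname{Disc}_u$ the set of discontinuities of $u$ in $(0,1)$. For $u_1,u_2:[0,1]\to\mathbb R^d$ put $d_{\widetilde D}(u_1,u_2)=\inf_\lambda\sup_{t\in[0,1]}|u_1(\lambda(t))-u_2(t)|$, the infimum being over the continuous strictly increasing bijections $\lambda$ of $[0,1]$. The decorated space $F'$ consists of the triples $\check u=(u,\mathcal S,\{e^\tau\}_{\tau\in\mathcal S})$ with $u\in D$, $\mathcal S\subset(0,1)$ at most countable, $\mathcal S\supset\operatorname{Disc}_u$, $e^\tau\in D$, $e^\tau(0)=u(\tau^-)$, $e^\tau(1)=u(\tau)$, such that for every $\epsilon>0$ only finitely many $\tau\in\mathcal S$ have $\operatorname{diam}\operatorname{range}e^\tau>\epsilon$. Let $\hat u(t)=\{u(t)\}$ for $t\notin\mathcal S$ and let $\hat u(\tau)=\prod_{k=1}^d[\inf_t p_ke^\tau(t),\sup_t p_ke^\tau(t)]$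 for $\tau\in\mathcal S$, where $p_k$ is the $k$-th coordinate. Let $\Gamma^k_{\check u}=\{(t,p_kz):t\in[0,1],\,z\in\hat u(t)\}\subset\mathbb R^2$, and let $d_E(\check u_1,\check u_2)=\max_{1\le k\le d}H(\Gamma^k_{\check u_1},\Gamma^k_{\check u_2})$ with $H$ the Hausdorff distance. Enumerate $\mathcal S=\{\tau_m\}_{m\in\kappa}$, $\kappa\subset\{1,2,\dots\}$, and let $s=\sum_{m\in\kappa}m^{-2}$. Let $\tilde u:[0,1+s]\to\mathbb R^d$ be obtained from $u$ by inserting at each $\tau_m$ an interval of length $m^{-2}$, on which $\tilde u$ is the linearly time-scaled $e^{\tau_m}$, and let $\pi\check u(t)=\tilde u(t(1+s))$. The topology of $F'$ is that of the pseudometric $d_{F'}(\check u_1,\check u_2)=d_E(\check u_1,\check u_2)+d_{\widetilde D}(\pi\check u_1,\pi\check u_2)$. **Setting.** Let $T:M\to M$ be an ergodic measure-preserving transformation of a probability space $(M,\mu)$, $X\subset M$ measurable with $\mu(X)>0$, and $\mu_X=\mu(\,\cdot\cap X)/\mu(X)$. Let $R(x)=\inf\{n\ge1:T^nx\in X\}$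 and $f=T^R:X\to X$ be the first return time and the first return map, with $R\in L^1(\mu_X)$. Let $v:M\to\mathbb R^d$ be measurable, $v_k=\sum_{j=0}^{k-1}v\circ T^j$ and $V=v_R$. Let $\alpha\in(0,2)$, $\alpha\ne1$, let $\ell$ be a positive measurable slowly varying function, and let $b_n\to\infty$ with $b_n\sim(n\,\ell(b_n))^{1/\alpha}$. Let $\omega_i\in\mathbb S^{d-1}$, $i\in\mathcal I$, be finitely many distinct unit vectors, let $a_i>0$ with $\sum_ia_i=1$, and $\nu=\sum_ia_i\delta_{\omega_i}$. Let $\tilde L_\alpha$ be the $\alpha$-stable Lévy process with spectral measure $\nu$: it has càdlàg paths, $\tilde L_\alpha(0)=0$, and stationary independent increments, and $$\mathbb E\,e^{i y\cdot\tilde L_\alpha(t)}=\exp\Big\{-t\int_{\mathbb S^{d-1}}|y\cdot x|^\alpha\big(1-i\operatorname{sgn}(y\cdot x)\tan\tfrac{\pi\alpha}2\big)\cos\tfrac{\pi\alpha}2\,\Gamma(1-\alpha)\,d\nu(x)\Big\}.$$ Let $L_\alpha=\big(\int_XR\,d\mu_X\big)^{-1/\alpha}\tilde L_\alpha$. Let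 $P_i\in D$, $i\in\mathcal I$, satisfy $P_i(0)=0$ and $P_i(1)=\omega_i$. Define $\Pi(y)=P_i$ if $\omega_i$ is the unique one of the $\omega_j$ closest to $y/|y|$, and $\Pi(y)=0$ if there is a tie or $y=0$. On $X$ define $$\xi(t)=v_{[tR]},\qquad \zeta(t)=|V|\,\Pi(V)(t)+t\{V-|V|\,\Pi(V)(1)\},\qquad t\in[0,1].$$ Let $W_n(t)=b_n^{-1}\sum_{j=0}^{[nt]-1}v\circ T^j$ on $M$ and $W_n^V(t)=b_n^{-1}\sum_{j=0}^{[nt]-1}V\circ f^j$ on $X$. Let $W_n^{F'}=(W_n,\mathcal S_n,\{e_n^\tau\})\in F'$ with $\mathcal S_n=\{j/n:1\le j\le n-1\}$ and $e_n^{j/n}(t)=W_n(\tfrac{j-1}n)+1_{[1/2,1]}(t)\,\Delta W_n(\tfrac jn)$. Let $L_\alpha^{F'}=(L_\alpha,\operatorname{Disc}_{L_\alpha},\{e^\tau\})\in F'$ with $e^\tau(t)=L_\alpha(\tau^-)+|\Delta L_\alpha(\tau)|\,P_i(t)$, where $i\in\mathcal I$ is the index with $\Delta L_\alpha(\tau)=|\Delta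 L_\alpha(\tau)|\,\omega_i$ (almost surely there is one, for every $\tau$). **Theorem.** Assume that $W_n^V$, on the probability space $(X,\mu_X)$, converges weakly to $\tilde L_\alpha$ in $D$ with the $\mathcal J_1$ topology, and that $$b_n^{-1}\max_{0\le j\le n}d_{\widetilde D}(\xi,\zeta)\circ f^j\to0\quad\text{in probability with respect to }\mu_X.$$ Then $W_n^{F'}$, on the probability space $(M,\mu)$, converges weakly to $L_\alpha^{F'}$ in $F'$. -/

import Mathlib

open Set Filter Topology MeasureTheory ProbabilityTheory
open scoped ENNReal unitInterval

namespace DecoratedLevy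

/-- `ℝ^d` with the Euclidean norm. -/
abbrev Vec (d : ℕ) := EuclideanSpace ℝ (Fin d)

/-- The unit sphere of `ℝ^d`. -/
abbrev Sph (d : ℕ) := Metric.sphere (0 : Vec d) 1

/-! ### Càdlàg functions and the `J₁` topology -/

/-- The space `D([0,1], ℝ^d)` of càdlàg functions. -/
@[ext]
structure Cadlag (d : ℕ) where
  toFun : I → Vec d
  right_cont : ∀ t, ContinuousWithinAt toFun (Ici t) t
  left_lim : ∀ t, ∃ l, Tendsto toFun (𝓝[<] t) (𝓝 l)

namespace Cadlag

variable {d : ℕ}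

instance : CoeFun (Cadlag d) (fun _ => I → Vec d) := ⟨Cadlag.toFun⟩

/-- The left limit `u(t⁻)` for `t ∈ (0,1]`. -/
noncomputable def left (u : Cadlag d) (t : I) : Vec d := Function.leftLim u t

/-- The jump `Δu(t) = u(t) - u(t⁻)`. -/
noncomputable def jump (u : Cadlag d) (t : I) : Vec d := u t - u.left t

/-- The set of discontinuities of `u` in the open interval `(0,1)`. -/
def disc (u : Cadlag d) : Set I := {t ∈ Ioo (0 : I) 1 | ¬ ContinuousAt u t}

end Cadlag

/-- The distance of `D / ∼` (functions modulo reparametrisation of time):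
`inf_λ sup_t |u₁ (λ t) - u₂ t|` over the increasing bijections `λ` of `[0,1]`
(order isomorphisms of `[0,1]` are automatically continuous). -/
noncomputable def reparamEDist {d : ℕ} (u₁ u₂ : I → Vec d) : ℝ≥0∞ :=
  ⨅ lam : I ≃o I, ⨆ t, edist (u₁ (lam t)) (u₂ t)

/-- The (strong) `J₁` distance
`inf_λ (sup_t |u₁ (λ t) - u₂ t| + sup_t |λ t - t|)`. -/
noncomputable def j1EDist {d : ℕ} (u₁ u₂ : I → Vec d) : ℝ≥0∞ :=
  ⨅ lam : I ≃o I, ((⨆ t, edist (u₁ (lam t)) (u₂ t)) + ⨆ t, edist (lam t) t)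

section Distances

variable {d : ℕ}

lemma reparamEDist_self (u : I → Vec d) : reparamEDist u u = 0 :=
  le_antisymm (iInf_le_of_le (OrderIso.refl I) (by simp)) bot_le

lemma reparamEDist_comm_le (u v : I → Vec d) : reparamEDist u v ≤ reparamEDist v u := by
  refine le_iInf fun lam => iInf_le_of_le lam.symm (iSup_le fun t => ?_)
  have h := le_iSup (fun s => edist (v (lam s)) (u s)) (lam.symm t)
  simpa [edist_comm] using h

lemma reparamEDist_comm (u v : I → Vec d) : reparamEDist u v = reparamEDist v u :=
  le_antisymm (reparamEDist_comm_le u v) (reparamEDist_comm_le v u)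

lemma reparamEDist_triangle (u v w : I → Vec d) :
    reparamEDist u w ≤ reparamEDist u v + reparamEDist v w := by
  unfold reparamEDist
  rw [ENNReal.iInf_add]
  refine le_iInf fun lam => ?_
  rw [ENNReal.add_iInf]
  refine le_iInf fun lam' => iInf_le_of_le (lam'.trans lam) (iSup_le fun t => ?_)
  refine (edist_triangle _ (v (lam' t)) _).trans (add_le_add ?_ ?_)
  · exact le_iSup (fun s => edist (u (lam s)) (v s)) (lam' t)
  · exact le_iSup (fun s => edist (v (lam' s)) (w s)) t

lemma j1EDist_self (u : I → Vec d) : j1EDist u u = 0 :=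
  le_antisymm (iInf_le_of_le (OrderIso.refl I) (by simp)) bot_le

lemma j1EDist_comm_le (u v : I → Vec d) : j1EDist u v ≤ j1EDist v u := by
  refine le_iInf fun lam => iInf_le_of_le lam.symm (add_le_add ?_ ?_)
  · refine iSup_le fun t => ?_
    have h := le_iSup (fun s => edist (v (lam s)) (u s)) (lam.symm t)
    simpa [edist_comm] using h
  · refine iSup_le fun t => ?_
    have h := le_iSup (fun s => edist (lam s) s) (lam.symm t)
    simpa [edist_comm] using h

lemma j1EDist_comm (u v : I → Vec d) : j1EDist u v = j1EDist v u :=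
  le_antisymm (j1EDist_comm_le u v) (j1EDist_comm_le v u)

lemma j1EDist_triangle (u v w : I → Vec d) :
    j1EDist u w ≤ j1EDist u v + j1EDist v w := by
  unfold j1EDist
  rw [ENNReal.iInf_add]
  refine le_iInf fun lam => ?_
  rw [ENNReal.add_iInf]
  refine le_iInf fun lam' => iInf_le_of_le (lam'.trans lam) ?_
  rw [add_add_add_comm]
  refine add_le_add (iSup_le fun t => ?_) (iSup_le fun t => ?_)
  · refine (edist_triangle _ (v (lam' t)) _).trans (add_le_add ?_ ?_)
    · exact le_iSup (fun s => edist (u (lam s)) (v s)) (lam' t)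
    · exact le_iSup (fun s => edist (v (lam' s)) (w s)) t
  · refine (edist_triangle _ (lam' t) _).trans (add_le_add ?_ ?_)
    · exact le_iSup (fun s => edist (lam s) s) (lam' t)
    · exact le_iSup (fun s => edist (lam' s) s) t

end Distances

/-- `D` carries the `J₁` topology and its Borel `σ`-algebra. -/
noncomputable instance (d : ℕ) : PseudoEMetricSpace (Cadlag d) where
  edist u v := j1EDist u v
  edist_self u := j1EDist_self u
  edist_comm u v := j1EDist_comm u v
  edist_triangle u v w := j1EDist_triangle u v w

noncomputable instance (d : ℕ) : MeasurableSpace (Cadlag d) := borel _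

instance (d : ℕ) : BorelSpace (Cadlag d) := ⟨rfl⟩

/-! ### Basic facts on càdlàg functions -/

namespace Cadlag

variable {d : ℕ}

lemma tendsto_left (u : Cadlag d) (t : I) : Tendsto u (𝓝[<] t) (𝓝 (u.left t)) :=
  tendsto_leftLim_of_tendsto (u.left_lim t)

lemma isBounded_range (u : Cadlag d) : Bornology.IsBounded (range u) := by
  have h : ∀ t ∈ (univ : Set I), ∃ s ∈ 𝓝[univ] t, Bornology.IsBounded (u '' s) := by
    intro t _
    have hl := (u.tendsto_left t) (Metric.ball_mem_nhds (u.left t) one_pos)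
    have hr := (u.right_cont t) (Metric.ball_mem_nhds (u t) one_pos)
    refine ⟨u ⁻¹' Metric.ball (u.left t) 1 ∪ u ⁻¹' Metric.ball (u t) 1, ?_, ?_⟩
    · rw [nhdsWithin_univ, ← nhdsLT_sup_nhdsGE]
      exact ⟨mem_of_superset hl subset_union_left, mem_of_superset hr subset_union_right⟩
    · rw [image_union]
      exact (Metric.isBounded_ball.subset (image_preimage_subset _ _)).union
        (Metric.isBounded_ball.subset (image_preimage_subset _ _))
  rw [← image_univ]
  refine isCompact_univ.induction_on (p := fun s => Bornology.IsBounded (u '' s)) (by simp)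
    (fun s t hst ht => ht.subset (image_mono hst))
    (fun s t hs ht => by rw [image_union]; exact hs.union ht) h

/-- A càdlàg function has finitely many jumps of size larger than `ε`. -/
lemma finite_jump (u : Cadlag d) {ε : ℝ} (hε : 0 < ε) :
    {t : I | t ∈ Ioo (0 : I) 1 ∧ ε < ‖u.jump t‖}.Finite := by
  set A := {t : I | t ∈ Ioo (0 : I) 1 ∧ ε < ‖u.jump t‖} with hA
  have key : ∀ (c : Vec d) (U : Set I), IsOpen U → (∀ x ∈ U, dist (u x) c < ε / 2) →
      ∀ x ∈ U, x ∉ A := by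
    intro c U hU h x hx hxA
    have hne : (𝓝[<] x).NeBot := by
      have : (0 : I) < x := hxA.1.1
      exact nhdsLT_neBot_of_exists_lt ⟨0, this⟩
    have h1 : dist (u.left x) c ≤ ε / 2 := by
      refine le_of_tendsto ((u.tendsto_left x).dist tendsto_const_nhds) ?_
      filter_upwards [mem_nhdsWithin_of_mem_nhds (hU.mem_nhds hx)] with y hy
      exact (h y hy).le
    have h2 : ‖u.jump x‖ ≤ dist (u x) c + dist (u.left x) c := by
      rw [jump, ← dist_eq_norm]; exact dist_triangle_right _ _ _
    have := h x hx
    have := hxA.2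
    linarith
  have h : ∀ t ∈ (univ : Set I), ∃ s ∈ 𝓝[univ] t, (s ∩ A).Finite := by
    intro t _
    have hl := (u.tendsto_left t) (Metric.ball_mem_nhds (u.left t) (half_pos hε))
    have hr := (u.right_cont t) (Metric.ball_mem_nhds (u t) (half_pos hε))
    obtain ⟨U, hU, htU, hUl⟩ := mem_nhdsWithin.1 hl
    obtain ⟨V, hV, htV, hVr⟩ := mem_nhdsWithin.1 hr
    refine ⟨U ∩ V, by
      rw [nhdsWithin_univ]; exact (hU.inter hV).mem_nhds ⟨htU, htV⟩, ?_⟩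
    refine (finite_singleton t).subset ?_
    rintro x ⟨⟨hxU, hxV⟩, hxA⟩
    by_contra hne
    rcases lt_or_gt_of_ne hne with hlt | hgt
    · exact key (u.left t) (U ∩ Iio t) (hU.inter isOpen_Iio)
        (fun y hy => hUl ⟨hy.1, hy.2⟩) x ⟨hxU, hlt⟩ hxA
    · exact key (u t) (V ∩ Ioi t) (hV.inter isOpen_Ioi)
        (fun y hy => hVr ⟨hy.1, mem_Ici.2 (mem_Ioi.1 hy.2).le⟩) x ⟨hxV, hgt⟩ hxA
  have := isCompact_univ.induction_on (p := fun s => (s ∩ A).Finite) (by simp)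
    (fun s t hst ht => ht.subset (inter_subset_inter_left _ hst))
    (fun s t hs ht => by rw [union_inter_distrib_right]; exact hs.union ht) h
  simpa using this

lemma jump_ne_zero (u : Cadlag d) {t : I} (h : t ∈ u.disc) : u.jump t ≠ 0 := by
  intro h0
  refine h.2 ?_
  have h1 : u.left t = u t := (sub_eq_zero.1 h0).symm
  have hl := u.tendsto_left t
  rw [h1] at hl
  have hr : Tendsto u (𝓝[≥] t) (𝓝 (u t)) := u.right_cont t
  have := hl.sup hr
  rwa [nhdsLT_sup_nhdsGE] at this

lemma countable_disc (u : Cadlag d) : u.disc.Countable := by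
  have : u.disc ⊆ ⋃ n : ℕ, {t : I | t ∈ Ioo (0 : I) 1 ∧ 1 / ((n : ℝ) + 1) < ‖u.jump t‖} := by
    intro t ht
    obtain ⟨n, hn⟩ := exists_nat_one_div_lt (norm_pos_iff.2 (u.jump_ne_zero ht))
    exact mem_iUnion.2 ⟨n, ht.1, hn⟩
  exact (countable_iUnion fun n =>
    (u.finite_jump (Nat.one_div_pos_of_nat (α := ℝ))).countable).mono this

/-- The càdlàg function `t ↦ c + r P(t) + t δ`. -/
def affine (c : Vec d) (r : ℝ) (P : Cadlag d) (δ : Vec d) : Cadlag d where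
  toFun t := c + r • P t + (t : ℝ) • δ
  right_cont t := by
    have h : ContinuousWithinAt (fun t : I => (t : ℝ) • δ) (Ici t) t :=
      (by fun_prop : Continuous fun t : I => (t : ℝ) • δ).continuousWithinAt
    exact (continuousWithinAt_const.add ((P.right_cont t).const_smul r)).add h
  left_lim t := by
    obtain ⟨l, hl⟩ := P.left_lim t
    have h : Tendsto (fun t : I => (t : ℝ) • δ) (𝓝[<] t) (𝓝 ((t : ℝ) • δ)) :=
      (by fun_prop : Continuous fun t : I => (t : ℝ) • δ).continuousWithinAt
    exact ⟨_, (tendsto_const_nhds.add (hl.const_smul r)).add h⟩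

/-- The scaled function `r u`. -/
def scale (r : ℝ) (u : Cadlag d) : Cadlag d where
  toFun t := r • u t
  right_cont t := (u.right_cont t).const_smul r
  left_lim t := by
    obtain ⟨l, hl⟩ := u.left_lim t
    exact ⟨_, hl.const_smul r⟩

lemma floor_eventually_right (n : ℕ) (t : I) :
    ∀ᶠ x : I in 𝓝[≥] t, ⌊(n : ℝ) * x⌋₊ = ⌊(n : ℝ) * t⌋₊ := by
  have hc : Continuous fun x : I => (n : ℝ) * x := by fun_prop
  have h1 : ∀ᶠ x : I in 𝓝 t, (n : ℝ) * x < ⌊(n : ℝ) * t⌋₊ + 1 :=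
    hc.continuousAt.eventually_lt_const (Nat.lt_floor_add_one _)
  filter_upwards [mem_nhdsWithin_of_mem_nhds h1, self_mem_nhdsWithin] with x hx hxt
  have hxt' : (t : ℝ) ≤ x := hxt
  have h0 : 0 ≤ (n : ℝ) * x := mul_nonneg (Nat.cast_nonneg _) x.2.1
  refine (Nat.floor_eq_iff h0).2 ⟨?_, hx⟩
  exact (Nat.floor_le (mul_nonneg (Nat.cast_nonneg _) t.2.1)).trans
    (mul_le_mul_of_nonneg_left hxt' (Nat.cast_nonneg _))

lemma floor_eventually_left (n : ℕ) (t : I) :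
    ∀ᶠ x : I in 𝓝[<] t, ⌊(n : ℝ) * x⌋₊ = ⌈(n : ℝ) * t⌉₊ - 1 := by
  rcases Nat.eq_zero_or_pos n with rfl | hn
  · simp
  have hn' : (0 : ℝ) < n := Nat.cast_pos.2 hn
  have hc : Continuous fun x : I => (n : ℝ) * x := by fun_prop
  rcases eq_or_lt_of_le t.2.1 with h | h
  · have : t = 0 := Subtype.ext h.symm
    have hb : 𝓝[<] t = ⊥ := by
      have : Iio t = ∅ := by
        ext x; simp only [mem_Iio, mem_empty_iff_false, iff_false, not_lt]
        rw [this]; exact x.2.1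
      rw [this]; simp
    rw [hb]; simp
  · have hpos : 0 < ⌈(n : ℝ) * t⌉₊ := Nat.ceil_pos.2 (mul_pos hn' h)
    have hcast : ((⌈(n : ℝ) * t⌉₊ - 1 : ℕ) : ℝ) = (⌈(n : ℝ) * t⌉₊ : ℝ) - 1 := by
      rw [Nat.cast_sub hpos]; simp
    have h1 : ∀ᶠ x : I in 𝓝 t, (⌈(n : ℝ) * t⌉₊ : ℝ) - 1 < (n : ℝ) * x := by
      refine hc.continuousAt.eventually_const_lt ?_
      have := Nat.ceil_lt_add_one (mul_pos hn' h).le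
      linarith
    filter_upwards [mem_nhdsWithin_of_mem_nhds h1, self_mem_nhdsWithin] with x hx hxt
    have hxt' : (x : ℝ) < t := hxt
    have h0 : 0 ≤ (n : ℝ) * x := mul_nonneg (Nat.cast_nonneg _) x.2.1
    refine (Nat.floor_eq_iff h0).2 ⟨by rw [hcast]; exact hx.le, ?_⟩
    rw [hcast]
    have := Nat.le_ceil ((n : ℝ) * t)
    have := mul_lt_mul_of_pos_left hxt' hn'
    linarith

/-- The càdlàg step function `t ↦ g([n t])`. -/
noncomputable def step (n : ℕ) (g : ℕ → Vec d) : Cadlag d where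
  toFun t := g ⌊(n : ℝ) * t⌋₊
  right_cont t := by
    refine tendsto_const_nhds.congr' ?_
    filter_upwards [floor_eventually_right n t] with x hx
    rw [hx]
  left_lim t := by
    refine ⟨g (⌈(n : ℝ) * t⌉₊ - 1), tendsto_const_nhds.congr' ?_⟩
    filter_upwards [floor_eventually_left n t] with x hx
    rw [hx]

/-- The trivial excursion `t ↦ c + 1_{[1/2,1]}(t) δ`. -/
noncomputable def trivialExcursion (c δ : Vec d) : Cadlag d where
  toFun t := c + (Icc (1 / 2 : ℝ) 1).indicator (fun _ => δ) (t : ℝ)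
  right_cont t := by
    have h := (step 2 fun k => c + if k = 0 then 0 else δ).right_cont
    convert h t using 2 with x
    have : (⌊((2 : ℕ) : ℝ) * x⌋₊ = 0) ↔ ¬ (1 / 2 : ℝ) ≤ x := by
      rw [Nat.floor_eq_zero]; push_cast; constructor <;> intro h <;> linarith
    by_cases hx : (1 / 2 : ℝ) ≤ x
    · simp only [step, this, hx, not_true_eq_false, if_false]
      rw [indicator_of_mem]; exact ⟨hx, x.2.2⟩
    · simp only [step, this, hx, not_false_eq_true, if_true]
      rw [indicator_of_notMem]; exact fun h => hx h.1
  left_lim t := by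
    have h := (step 2 fun k => c + if k = 0 then 0 else δ).left_lim t
    convert h using 4 with l x
    have : (⌊((2 : ℕ) : ℝ) * x⌋₊ = 0) ↔ ¬ (1 / 2 : ℝ) ≤ x := by
      rw [Nat.floor_eq_zero]; push_cast; constructor <;> intro h <;> linarith
    by_cases hx : (1 / 2 : ℝ) ≤ x
    · simp only [step, this, hx, not_true_eq_false, if_false]
      rw [indicator_of_mem]; exact ⟨hx, x.2.2⟩
    · simp only [step, this, hx, not_false_eq_true, if_true]
      rw [indicator_of_notMem]; exact fun h => hx h.1

/-- The grid `{j/n : 1 ≤ j ≤ n-1}`. -/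
def grid (n : ℕ) : Set I := {t | ∃ j : ℕ, 1 ≤ j ∧ j < n ∧ (t : ℝ) = j / n}

lemma finite_grid (n : ℕ) : (grid n).Finite := by
  have h : ((fun t : I => (t : ℝ)) '' grid n).Finite := by
    refine ((Finset.range n).finite_toSet.image fun j : ℕ => (j : ℝ) / n).subset ?_
    rintro _ ⟨t, ⟨j, _, hj, ht⟩, rfl⟩
    exact ⟨j, by simpa using hj, ht.symm⟩
  exact h.of_finite_image Subtype.val_injective.injOn

lemma grid_subset (n : ℕ) : grid n ⊆ Ioo (0 : I) 1 := by
  rintro t ⟨j, hj, hjn, ht⟩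
  have hn : (0 : ℝ) < n := Nat.cast_pos.2 (by omega)
  have hj' : (0 : ℝ) < j := Nat.cast_pos.2 hj
  constructor
  · show (0 : ℝ) < t
    rw [ht]; positivity
  · show (t : ℝ) < 1
    rw [ht, div_lt_one hn]; exact_mod_cast hjn

lemma disc_step_subset (n : ℕ) (g : ℕ → Vec d) : (step n g).disc ⊆ grid n := by
  rintro t ⟨⟨h0, h1⟩, hc⟩
  have h0' : (0 : ℝ) < t := h0
  have h1' : (t : ℝ) < 1 := h1
  rcases Nat.eq_zero_or_pos n with rfl | hn
  · exact absurd (by simpa [step] using continuousAt_const) hc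
  have hn' : (0 : ℝ) < n := Nat.cast_pos.2 hn
  by_contra hgrid
  refine hc ?_
  have hfl : (⌊(n : ℝ) * t⌋₊ : ℝ) ≠ (n : ℝ) * t := by
    intro he
    refine hgrid ⟨⌊(n : ℝ) * t⌋₊, ?_, ?_, ?_⟩
    · have : (0 : ℝ) < (⌊(n : ℝ) * t⌋₊ : ℝ) := by rw [he]; positivity
      exact_mod_cast this
    · have : (⌊(n : ℝ) * t⌋₊ : ℝ) < n := by rw [he]; nlinarith
      exact_mod_cast this
    · rw [he]; field_simp
  have hlt : (⌊(n : ℝ) * t⌋₊ : ℝ) < (n : ℝ) * t :=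
    lt_of_le_of_ne (Nat.floor_le (by positivity)) hfl
  have hcont : Continuous fun x : I => (n : ℝ) * x := by fun_prop
  have e1 := hcont.continuousAt.eventually_const_lt hlt
  have e2 := hcont.continuousAt.eventually_lt_const (Nat.lt_floor_add_one ((n : ℝ) * t))
  refine tendsto_const_nhds.congr' ?_
  filter_upwards [e1, e2] with x hx1 hx2
  have : ⌊(n : ℝ) * x⌋₊ = ⌊(n : ℝ) * t⌋₊ :=
    (Nat.floor_eq_iff (mul_nonneg hn'.le x.2.1)).2 ⟨hx1.le, hx2⟩
  simp [step, this]

end Cadlag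

/-! ### The decorated càdlàg space -/

/-- The space `F'([0,1], ℝ^d)` of excursion triples `(u, S, (e^τ)_{τ ∈ S})`. -/
structure Decorated (d : ℕ) where
  path : Cadlag d
  times : Set I
  countable_times : times.Countable
  times_subset : times ⊆ Ioo (0 : I) 1
  disc_subset : path.disc ⊆ times
  exc : times → Cadlag d
  exc_zero : ∀ τ, exc τ 0 = path.left τ
  exc_one : ∀ τ, exc τ 1 = path τ
  finite_large : ∀ ε : ℝ, 0 < ε → {τ | ε < Metric.diam (range (exc τ))}.Finite

namespace Decorated

variable {d : ℕ}

/-- The smallest closed box `∏ₖ [inf pₖ e, sup pₖ e]` containing the range of `e`. -/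
def box (e : Cadlag d) : Set (Vec d) := {z | ∀ k, z k ∈ Icc (⨅ t, e t k) (⨆ t, e t k)}

/-- The set-valued function `û` of the projection to `E`: `û(t)` is the box of `e^t` for `t ∈ S`
and `{u(t)}` otherwise. -/
def setValued (w : Decorated d) (t : I) : Set (Vec d) :=
  {z | (∀ h : t ∈ w.times, z ∈ box (w.exc ⟨t, h⟩)) ∧ (t ∉ w.times → z = w.path t)}

/-- The graph in the plane of the `k`-th coordinate of the set-valued function `û`,
`{(t, pₖ z) : z ∈ û(t)}`. -/
def coordGraph (w : Decorated d) (k : Fin d) : Set (WithLp 2 (ℝ × ℝ)) :=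
  {q | ∃ t : I, ∃ z ∈ w.setValued t, q = WithLp.toLp 2 ((t : ℝ), z k)}

/-- The distance `d_E` of the projections to `E`: the maximum over the coordinates of the
Hausdorff distance between the graphs. -/
noncomputable def graphEDist (w₁ w₂ : Decorated d) : ℝ≥0∞ :=
  ⨆ k : Fin d, Metric.hausdorffEDist (w₁.coordGraph k) (w₂.coordGraph k)

/-- An enumeration of `S`: a choice of distinct natural numbers `m(τ) ≥ 1`, `τ ∈ S`. -/
noncomputable def index (w : Decorated d) (τ : w.times) : ℕ :=
  Classical.choose ((countable_iff_exists_injective _).1 w.countable_times.to_subtype) τ + 1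

/-- The length `m(τ)^{-2}` of the interval that is inserted at `τ`. -/
noncomputable def len (w : Decorated d) (τ : w.times) : ℝ := ((w.index τ : ℝ) ^ 2)⁻¹

/-- The total length `s` of the inserted intervals. -/
noncomputable def totalLen (w : Decorated d) : ℝ := ∑' τ : w.times, w.len τ

/-- The left endpoint of the interval that is inserted at `τ`. -/
noncomputable def start (w : Decorated d) (τ : w.times) : ℝ :=
  (τ : I) + ∑' ρ : w.times, {ρ : w.times | (ρ : I) < τ}.indicator w.len ρ

/-- The position of the time `t` after the insertions: `φ(t) = t + ∑_{τ ≤ t} m(τ)^{-2}`. -/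
noncomputable def shift (w : Decorated d) (t : I) : ℝ :=
  (t : ℝ) + ∑' ρ : w.times, {ρ : w.times | (ρ : I) ≤ t}.indicator w.len ρ

open Classical in
/-- The function `ũ` on `[0, 1+s]`: it runs through `e^τ` on the interval inserted at `τ`, and is
`u ∘ φ⁻¹` off the inserted intervals. -/
noncomputable def stretched (w : Decorated d) (x : ℝ) : Vec d :=
  if h : ∃ τ : w.times, x ∈ Icc (w.start τ) (w.start τ + w.len τ) then
    w.exc h.choose (projIcc 0 1 zero_le_one ((x - w.start h.choose) / w.len h.choose))
  else w.path (Function.invFun w.shift x)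

/-- A representative of the projection to `D / ∼`: the function `t ↦ ũ(t (1+s))`. -/
noncomputable def unfolded (w : Decorated d) (t : I) : Vec d :=
  w.stretched ((t : ℝ) * (1 + w.totalLen))

/-- `F'` carries the topology of the pseudometric `d_E + d_{D / ∼}` of the projections, and its
Borel `σ`-algebra. -/
noncomputable instance : PseudoEMetricSpace (Decorated d) where
  edist w₁ w₂ := graphEDist w₁ w₂ + reparamEDist w₁.unfolded w₂.unfolded
  edist_self w := by simp [graphEDist, reparamEDist_self]
  edist_comm w₁ w₂ := by
    simp only [graphEDist]
    rw [reparamEDist_comm]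
    simp only [Metric.hausdorffEDist_comm]
  edist_triangle w₁ w₂ w₃ := by
    rw [add_add_add_comm]
    refine add_le_add (iSup_le fun k => ?_) (reparamEDist_triangle _ _ _)
    refine (Metric.hausdorffEDist_triangle (t := w₂.coordGraph k)).trans (add_le_add ?_ ?_)
    · exact le_iSup (fun k => Metric.hausdorffEDist (w₁.coordGraph k) (w₂.coordGraph k)) k
    · exact le_iSup (fun k => Metric.hausdorffEDist (w₂.coordGraph k) (w₃.coordGraph k)) k

noncomputable instance : MeasurableSpace (Decorated d) := borel _

instance : BorelSpace (Decorated d) := ⟨rfl⟩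

/-- The step function `t ↦ g([n t])` with the trivial excursion
`t ↦ u(τ⁻) + 1_{[1/2,1]}(t) Δu(τ)` attached at each `τ = j/n`, `1 ≤ j ≤ n-1`. Here
`u(τ⁻) = u((j-1)/n)`. -/
noncomputable def ofStep (n : ℕ) (g : ℕ → Vec d) : Decorated d where
  path := Cadlag.step n g
  times := Cadlag.grid n
  countable_times := (Cadlag.finite_grid n).countable
  times_subset := Cadlag.grid_subset n
  disc_subset := Cadlag.disc_step_subset n g
  exc τ := Cadlag.trivialExcursion ((Cadlag.step n g).left τ) ((Cadlag.step n g).jump τ)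
  exc_zero τ := by simp [Cadlag.trivialExcursion]
  exc_one τ := by
    simp only [Cadlag.trivialExcursion]
    rw [indicator_of_mem (by norm_num)]
    simp [Cadlag.jump]
  finite_large ε _ := by
    have := (Cadlag.finite_grid n).to_subtype
    exact toFinite _

end Decorated

/-! ### Profiles -/

section Profiles

variable {d : ℕ} {ι : Type*}

/-- The zero function. -/
def zeroPath (d : ℕ) : Cadlag d where
  toFun _ := 0
  right_cont _ := continuousWithinAt_const
  left_lim _ := ⟨0, tendsto_const_nhds⟩

/-- A profile in the direction `ω`: a càdlàg function from `0` to `ω`. -/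
structure IsProfile (P : Cadlag d) (ω : Sph d) : Prop where
  zero : P 0 = 0
  one : P 1 = (ω : Vec d)

open Classical in
/-- The excursion `t ↦ u(τ⁻) + |Δu(τ)| P_i(t)` at a jump `Δu(τ) = |Δu(τ)| ω_i`. At a jump that has
none of the directions `ω_i` (these do not occur, almost surely, for the Lévy processes considered
here) the excursion is linear. -/
noncomputable def profileExcursion (ω : ι → Sph d) (P : ι → Cadlag d) (u : Cadlag d) (τ : I) :
    Cadlag d :=
  if h : ∃ i, u.jump τ = ‖u.jump τ‖ • (ω i : Vec d) then
    Cadlag.affine (u.left τ) ‖u.jump τ‖ (P h.choose) 0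
  else Cadlag.affine (u.left τ) 0 (zeroPath d) (u.jump τ)

lemma diam_profileExcursion_le [Finite ι] (ω : ι → Sph d) (P : ι → Cadlag d) :
    ∃ C : ℝ, 0 < C ∧ ∀ (u : Cadlag d) (τ : I),
      Metric.diam (range (profileExcursion ω P u τ)) ≤ C * ‖u.jump τ‖ := by
  cases nonempty_fintype ι
  have hC : ∀ i, 0 ≤ Metric.diam (range (P i)) := fun i => Metric.diam_nonneg
  refine ⟨1 + ∑ i, Metric.diam (range (P i)),
    add_pos_of_pos_of_nonneg one_pos (Finset.sum_nonneg fun i _ => hC i), fun u τ => ?_⟩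
  have hS : 0 ≤ ∑ i, Metric.diam (range (P i)) := Finset.sum_nonneg fun i _ => hC i
  refine Metric.diam_le_of_forall_dist_le (by positivity) ?_
  rintro _ ⟨s, rfl⟩ _ ⟨t, rfl⟩
  unfold profileExcursion
  split_ifs with h
  · have h1 := Metric.dist_le_diam_of_mem (P h.choose).isBounded_range
      (mem_range_self s) (mem_range_self t)
    have h2 : Metric.diam (range (P h.choose)) ≤ ∑ i, Metric.diam (range (P i)) :=
      Finset.single_le_sum (f := fun i => Metric.diam (range (P i))) (fun i _ => hC i)
        (Finset.mem_univ _)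
    simp only [Cadlag.affine, smul_zero, add_zero, dist_add_left]
    rw [dist_smul₀, norm_norm, mul_comm]
    refine mul_le_mul_of_nonneg_right ?_ (norm_nonneg _)
    linarith
  · simp only [Cadlag.affine, zero_smul, add_zero, dist_add_left]
    rw [dist_eq_norm, ← sub_smul, norm_smul]
    refine mul_le_mul_of_nonneg_right ?_ (norm_nonneg _)
    have : ‖(s : ℝ) - t‖ ≤ 1 := by
      rw [Real.norm_eq_abs, abs_le]
      constructor <;> linarith [s.2.1, s.2.2, t.2.1, t.2.2]
    linarith

/-- The decoration of a càdlàg function `u` by the profiles `P_i`: at each discontinuity `τ` of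
`u`, the excursion `u(τ⁻) + |Δu(τ)| P_i` with `Δu(τ) = |Δu(τ)| ω_i` is attached. -/
noncomputable def decorate [Finite ι] (ω : ι → Sph d) (P : ι → Cadlag d)
    (hP : ∀ i, IsProfile (P i) (ω i)) (u : Cadlag d) : Decorated d where
  path := u
  times := u.disc
  countable_times := u.countable_disc
  times_subset t ht := ht.1
  disc_subset := subset_rfl
  exc τ := profileExcursion ω P u τ
  exc_zero τ := by
    unfold profileExcursion
    split_ifs with h
    · simp [Cadlag.affine, (hP _).zero]
    · simp [Cadlag.affine]
  exc_one τ := by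
    unfold profileExcursion
    split_ifs with h
    · have := h.choose_spec
      simp only [Cadlag.affine, (hP _).one, smul_zero, add_zero, ← this]
      simp [Cadlag.jump]
    · simp [Cadlag.affine, Cadlag.jump]
  finite_large ε hε := by
    obtain ⟨C, hC, h⟩ := diam_profileExcursion_le ω P
    refine ((u.finite_jump (div_pos hε hC)).preimage Subtype.val_injective.injOn).subset ?_
    intro τ hτ
    refine ⟨τ.2.1, ?_⟩
    rw [div_lt_iff₀' hC]
    exact lt_of_lt_of_le hτ (h u τ)

open Classical in
/-- The map `Π`: `Π(y) = P_i` if `ω_i` is the unique closest direction to `y/|y|`, and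
`Π(y) = 0` if there is a tie or `y = 0`. -/
noncomputable def closestProfile (ω : ι → Sph d) (P : ι → Cadlag d) (y : Vec d) : Cadlag d :=
  if h : y ≠ 0 ∧ ∃ i, ∀ j, j ≠ i →
      dist (‖y‖⁻¹ • y) (ω i : Vec d) < dist (‖y‖⁻¹ • y) (ω j : Vec d) then P h.2.choose
  else zeroPath d

end Profiles

/-! ### Stable Lévy processes -/

/-- The exponent
`∫ |s·x|^α (1 - i sgn(s·x) tan(πα/2)) cos(πα/2) Γ(1-α) dν(x)` of the `α`-stable law with spectral
measure `ν`. -/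
noncomputable def stableExponent {d : ℕ} (α : ℝ) (ν : Measure (Sph d)) (s : Vec d) : ℂ :=
  ∫ x : Sph d, ((|inner ℝ s (x : Vec d)| ^ α : ℝ) : ℂ) *
    (1 - Complex.I * (Real.sign (inner ℝ s (x : Vec d)) : ℂ) *
      (Real.tan (Real.pi * α / 2) : ℂ)) *
    ((Real.cos (Real.pi * α / 2) * Real.Gamma (1 - α) : ℝ) : ℂ) ∂ν

/-- `L` is an `α`-stable Lévy process on `[0,1]` with spectral measure `ν`: a process with càdlàg
paths that starts at `0` and has stationary independent increments, where the increment over a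
time interval of length `r` has characteristic function `exp(-r ψ)`, for the exponent `ψ` above. -/
structure IsStableLevy {d : ℕ} {Ω : Type*} [MeasurableSpace Ω] (α : ℝ) (ν : Measure (Sph d))
    (L : Ω → Cadlag d) (Pr : Measure Ω) : Prop where
  aemeasurable : ∀ t : I, AEMeasurable (fun x => L x t) Pr
  zero : ∀ᵐ x ∂Pr, L x 0 = 0
  indep : HasIndepIncrements (fun (t : I) x => L x t) Pr
  law : ∀ s t : I, s ≤ t → ∀ y : Vec d,
    charFun (Pr.map fun x => L x t - L x s) y
      = Complex.exp (-(((t : ℝ) - (s : ℝ) : ℝ) : ℂ) * stableExponent α ν y)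

/-- The finitely supported spectral measure `∑ᵢ aᵢ δ_{ωᵢ}`. -/
noncomputable def spectralMeasure {d : ℕ} {ι : Type*} [Fintype ι] (a : ι → ℝ) (ω : ι → Sph d) :
    Measure (Sph d) :=
  ∑ i, ENNReal.ofReal (a i) • Measure.dirac (ω i)

/-- `l : (0,∞) → (0,∞)` is (measurable and) slowly varying at infinity; the values of `l` off
`(0,∞)` are irrelevant. -/
structure IsSlowlyVarying (l : ℝ → ℝ) : Prop where
  measurable : Measurable l
  pos : ∀ t, 0 < t → 0 < l t
  ratio : ∀ c, 0 < c → Tendsto (fun t => l (c * t) / l t) atTop (𝓝 1)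

/-! ### The dynamical system and the processes -/

section Dynamics

variable {M : Type*} {d : ℕ}

/-- The first return time `R(x) = inf {n ≥ 1 : Tⁿ x ∈ X}` (with value `0` if there is no return;
this is a null set of points of `X` when `T` preserves a probability measure). -/
noncomputable def returnTime (T : M → M) (X : Set M) (x : M) : ℕ := sInf {n | 1 ≤ n ∧ T^[n] x ∈ X}

/-- The first return map `f = T^R`. -/
noncomputable def returnMap (T : M → M) (X : Set M) (x : M) : M := T^[returnTime T X x] x

/-- The induced observable `V = ∑_{j<R} v ∘ T^j`. -/
noncomputable def inducedObs (T : M → M) (X : Set M) (v : M → Vec d) (x : M) : Vec d :=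
  birkhoffSum T v (returnTime T X x) x

/-- The process `t ↦ b_n⁻¹ ∑_{j<[nt]} g ∘ S^j`. -/
noncomputable def sumProcess (S : M → M) (g : M → Vec d) (b : ℕ → ℝ) (n : ℕ) (x : M) : Cadlag d :=
  Cadlag.step n fun k => (b n)⁻¹ • birkhoffSum S g k x

/-- The process `t ↦ b_n⁻¹ ∑_{j<[nt]} g ∘ S^j` in `F'`, with trivial excursions attached at the
times `j/n`, `1 ≤ j ≤ n-1`. -/
noncomputable def decoratedSumProcess (S : M → M) (g : M → Vec d) (b : ℕ → ℝ) (n : ℕ) (x : M) :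
    Decorated d :=
  Decorated.ofStep n fun k => (b n)⁻¹ • birkhoffSum S g k x

/-- The excursion `ξ(t) = v_{[tR]}`. -/
noncomputable def trueExcursion (T : M → M) (X : Set M) (v : M → Vec d) (x : M) (t : I) : Vec d :=
  birkhoffSum T v ⌊(t : ℝ) * returnTime T X x⌋₊ x

/-- The profile excursion `ζ(t) = |V| Π(V)(t) + t {V - |V| Π(V)(1)}`. -/
noncomputable def idealExcursion {ι : Type*} (ω : ι → Sph d) (P : ι → Cadlag d) (V : Vec d)
    (t : I) : Vec d :=
  ‖V‖ • closestProfile ω P V t + (t : ℝ) • (V - ‖V‖ • closestProfile ω P V 1)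

/-- The function `d_{D / ∼}(ξ, ζ)` on `X`. -/
noncomputable def excursionDist {ι : Type*} (T : M → M) (X : Set M) (v : M → Vec d)
    (ω : ι → Sph d) (P : ι → Cadlag d) (x : M) : ℝ :=
  (reparamEDist (trueExcursion T X v x) (idealExcursion ω P (inducedObs T X v x))).toReal

end Dynamics

end DecoratedLevy

/-! The core is deterministic. Fix a path `u`, a speed `c` in `(0,1]`, and a step function `g` whose
values at certain return times form an induced step function. Suppose that the induced function is
J₁-close to `u`, that about `c j` returns occur before time `j`, and that between two returns `g`
runs through an excursion close to the ideal one of the same total increment. If the jumps of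
`u(c·)` have directions `ω i` and `u(c·)` is continuous at time 1, then `g` with trivial excursions
is close in `F'` to `u(c·)` decorated with the profiles (`edist_ofStep_decorate_le`). To see this,
the unfolded limit path, paired with the time that each of its points belongs to, is compared with
`g` up to reparametrisation. Such closeness can be glued, so by compactness of `[0,1]`
(`rel_zero_one_of_local`) it suffices to have it just to the left and just to the right of each
point. There either everything is almost constant, or one large jump is matched by exactly one
excursion of `g`. `edist_ofStep_le_of_reparamClose` turns this closeness into a bound on both parts
of the distance of `F'`.

For the dynamical system `c = μ(X)`. The mean ergodic theorem makes the number of visits to `X`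
linear, uniformly up to time `n` (`tendsto_measure_exists_visits`). The two convergence hypotheses
supply the rest, and a continuous mapping theorem with exceptional sets
(`tendstoInDistribution_of_approx`) gives convergence under `μ_X` to the decoration of `L(c·)`.

The direction of the jumps has to be read off the characteristic function. For a test function `f`
supported off the rays `ℝ₊ ω i`, `n E f(L(1/n))` tends to minus the integral of the Fourier
transform of `f` against the exponent. This integral vanishes because the exponent is a sum of terms
proportional to `(-i⟨y, ω i⟩)^α`, and such a power is a Laplace integral along the ray through `ω i`
after two derivatives are moved to `f` (`integral_fourier_mul_cpow_add`). Fatou's lemma for sums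
over finer and finer grids then excludes jumps in the support of `f`
(`IsStableLevy.ae_jump_direction`).

Two identifications remain. The decorations of `L(c·)` and `c^{1/α} L` have the same law: both are
almost sure limits of the same measurable function of finitely many increments, and those increments
agree in law by self-similarity (`IsStableLevy.integral_decorate_slow_eq`). Kac's lemma identifies
`c` with the inverse of the mean return time. Finally `μ_X` is replaced by `μ`: composition with `T`
changes the process by a quantity that tends to 0 in probability, so bounded Lipschitz functions of
it are asymptotically invariant and hence, by ergodicity, asymptotically uncorrelated with the
indicator of `X` (`tendsto_integral_mul_sub`). -/

namespace DecoratedLevy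

/-! ### Increasing bijections of the line -/

/-- Two increasing bijections of the line that agree at `b`, glued at `b`. -/
noncomputable def glueIso (φ ψ : ℝ ≃o ℝ) (b : ℝ) (h : φ b = ψ b) : ℝ ≃o ℝ :=
  StrictMono.orderIsoOfSurjective (fun t => if t ≤ b then φ t else ψ t)
    (by
      intro s t hst
      by_cases ht : t ≤ b
      · simp [ht, hst.le.trans ht, hst]
      · by_cases hs : s ≤ b
        · simp only [hs, ht, if_true, if_false]
          calc φ s ≤ φ b := φ.monotone hs
            _ = ψ b := h
            _ < ψ t := ψ.strictMono (not_le.1 ht)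
        · simp [hs, ht, hst])
    (by
      intro y
      rcases le_or_gt y (φ b) with hy | hy
      · refine ⟨φ.symm y, ?_⟩
        have : φ.symm y ≤ b := by rwa [φ.symm_apply_le]
        simp [this]
      · refine ⟨ψ.symm y, ?_⟩
        have : ¬ ψ.symm y ≤ b := by rw [ψ.symm_apply_le, ← h]; exact not_le.2 hy
        simp [this])

lemma glueIso_of_le {φ ψ : ℝ ≃o ℝ} {b : ℝ} (h : φ b = ψ b) {t : ℝ} (ht : t ≤ b) :
    glueIso φ ψ b h t = φ t := by
  change (if t ≤ b then φ t else ψ t) = φ t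
  simp [ht]

lemma glueIso_of_ge {φ ψ : ℝ ≃o ℝ} {b : ℝ} (h : φ b = ψ b) {t : ℝ} (ht : b ≤ t) :
    glueIso φ ψ b h t = ψ t := by
  change (if t ≤ b then φ t else ψ t) = ψ t
  rcases ht.eq_or_lt with rfl | ht'
  · simp [h]
  · simp [ht'.not_ge]

/-- The increasing affine bijection of the line that maps `[a,b]` to `[a',b']`. -/
noncomputable def affineIso (a b a' b' : ℝ) (h : a < b) (h' : a' < b') : ℝ ≃o ℝ :=
  StrictMono.orderIsoOfSurjective (fun t => a' + (t - a) * ((b' - a') / (b - a)))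
    (by
      intro s t hst
      have : 0 < (b' - a') / (b - a) := div_pos (sub_pos.2 h') (sub_pos.2 h)
      simp only
      gcongr)
    (by
      intro y
      have h1 : b - a ≠ 0 := (sub_pos.2 h).ne'
      have h2 : b' - a' ≠ 0 := (sub_pos.2 h').ne'
      refine ⟨a + (y - a') * ((b - a) / (b' - a')), ?_⟩
      field_simp
      ring)

lemma affineIso_apply {a b a' b' : ℝ} (h : a < b) (h' : a' < b') (t : ℝ) :
    affineIso a b a' b' h h' t = a' + (t - a) * ((b' - a') / (b - a)) := rfl

lemma affineIso_left {a b a' b' : ℝ} (h : a < b) (h' : a' < b') :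
    affineIso a b a' b' h h' a = a' := by simp [affineIso_apply]

lemma affineIso_right {a b a' b' : ℝ} (h : a < b) (h' : a' < b') :
    affineIso a b a' b' h h' b = b' := by
  have h1 : b - a ≠ 0 := (sub_pos.2 h).ne'
  rw [affineIso_apply]
  field_simp
  ring

/-- The extension by the identity of an increasing bijection of `[0,1]`. -/
noncomputable def extendIso (lam : I ≃o I) : ℝ ≃o ℝ :=
  StrictMono.orderIsoOfSurjective
    (fun t => if h : t ∈ Icc (0 : ℝ) 1 then ((lam ⟨t, h⟩ : I) : ℝ) else t)
    (by
      intro s t hst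
      by_cases hs : s ∈ Icc (0 : ℝ) 1 <;> by_cases ht : t ∈ Icc (0 : ℝ) 1
      · simp only [hs, ht, dite_true]
        exact lam.strictMono (show (⟨s, hs⟩ : I) < ⟨t, ht⟩ from hst)
      · simp only [hs, ht, dite_true, dite_false]
        have h1 : (lam ⟨s, hs⟩ : ℝ) ≤ 1 := (lam ⟨s, hs⟩).2.2
        have h2 : 1 < t := by
          by_contra hc
          exact ht ⟨hs.1.trans hst.le, not_lt.1 hc⟩
        linarith
      · simp only [hs, ht, dite_true, dite_false]
        have h1 : 0 ≤ (lam ⟨t, ht⟩ : ℝ) := (lam ⟨t, ht⟩).2.1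
        have h2 : s < 0 := by
          by_contra hc
          exact hs ⟨not_lt.1 hc, hst.le.trans ht.2⟩
        linarith
      · simpa only [hs, ht, dite_false] using hst)
    (by
      intro y
      by_cases hy : y ∈ Icc (0 : ℝ) 1
      · refine ⟨lam.symm ⟨y, hy⟩, ?_⟩
        have : ((lam.symm ⟨y, hy⟩ : I) : ℝ) ∈ Icc (0 : ℝ) 1 := (lam.symm ⟨y, hy⟩).2
        simp [this]
      · exact ⟨y, by simp [hy]⟩)

lemma extendIso_coe (lam : I ≃o I) (t : I) : extendIso lam t = lam t := by
  change (if h : (t : ℝ) ∈ Icc (0 : ℝ) 1 then ((lam ⟨t, h⟩ : I) : ℝ) else t) = lam t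
  have : (t : ℝ) ∈ Icc (0 : ℝ) 1 := t.2
  simp [this]

/-- An increasing bijection of the line that fixes `0` and `1` restricts to `[0,1]`. -/
noncomputable def restrictIso (φ : ℝ ≃o ℝ) (h0 : φ 0 = 0) (h1 : φ 1 = 1) : I ≃o I :=
  StrictMono.orderIsoOfSurjective
    (fun t => ⟨φ t, by rw [← h0]; exact φ.monotone t.2.1, by
      rw [← h1]; exact φ.monotone t.2.2⟩)
    (fun s t hst => show φ s < φ t from φ.strictMono hst)
    (by
      intro y
      refine ⟨⟨φ.symm y, ?_, ?_⟩, ?_⟩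
      · rw [φ.le_symm_apply, h0]; exact y.2.1
      · rw [φ.symm_apply_le, h1]; exact y.2.2
      · ext; simp)

lemma coe_restrictIso {φ : ℝ ≃o ℝ} (h0 : φ 0 = 0) (h1 : φ 1 = 1) (t : I) :
    (restrictIso φ h0 h1 t : ℝ) = φ t := rfl

/-! ### Closeness up to reparametrisation on intervals -/

/-- The functions `f` on `[a,b)` and `g` on `[a',b')` are within `η` of each other after an
increasing change of time. -/
def ReparamClose {E : Type*} [PseudoMetricSpace E] (η : ℝ) (f g : ℝ → E) (a b a' b' : ℝ) : Prop :=
  ∃ φ : ℝ ≃o ℝ, φ a = a' ∧ φ b = b' ∧ ∀ t, a ≤ t → t < b → dist (f t) (g (φ t)) ≤ η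

namespace ReparamClose

variable {E : Type*} [PseudoMetricSpace E] {η : ℝ} {f g : ℝ → E} {a b e a' b' e' : ℝ}

/-- The intervals are half-open, so `b` belongs to the second piece only. The two time changes need
to agree at `b`, but nothing has to be known about the values of `f` and `g` there. -/
lemma glue (h₁ : ReparamClose η f g a b a' b') (h₂ : ReparamClose η f g b e b' e')
    (hab : a ≤ b) (hbe : b ≤ e) : ReparamClose η f g a e a' e' := by
  obtain ⟨φ, ha, hb, hφ⟩ := h₁
  obtain ⟨ψ, hb', he, hψ⟩ := h₂
  have h : φ b = ψ b := hb.trans hb'.symm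
  refine ⟨glueIso φ ψ b h, ?_, ?_, fun t hat hte => ?_⟩
  · rw [glueIso_of_le h hab, ha]
  · rw [glueIso_of_ge h hbe, he]
  · rcases lt_or_ge t b with htb | htb
    · rw [glueIso_of_le h htb.le]; exact hφ t hat htb
    · rw [glueIso_of_ge h htb]; exact hψ t htb hte

/-- If all values of `f` are close to all values of `g`, any time change will do; the affine one is
taken. -/
lemma of_forall_dist (hab : a < b) (hab' : a' < b')
    (h : ∀ t ∈ Ico a b, ∀ s ∈ Ico a' b', dist (f t) (g s) ≤ η) :
    ReparamClose η f g a b a' b' := by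
  refine ⟨affineIso a b a' b' hab hab', affineIso_left _ _, affineIso_right _ _, fun t h1 h2 => ?_⟩
  refine h t ⟨h1, h2⟩ _ ⟨?_, ?_⟩
  · conv_lhs => rw [← affineIso_left hab hab']
    exact (affineIso a b a' b' hab hab').monotone h1
  · conv_rhs => rw [← affineIso_right hab hab']
    exact (affineIso a b a' b' hab hab').strictMono h2

lemma congr {f' g' : ℝ → E} (h : ReparamClose η f g a b a' b') (hf : EqOn f f' (Ico a b))
    (hg : EqOn g g' (Ico a' b')) : ReparamClose η f' g' a b a' b' := by
  obtain ⟨φ, ha, hb, hφ⟩ := h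
  refine ⟨φ, ha, hb, fun t h1 h2 => ?_⟩
  rw [← hf ⟨h1, h2⟩, ← hg ⟨?_, ?_⟩]
  · exact hφ t h1 h2
  · rw [← ha]; exact φ.monotone h1
  · rw [← hb]; exact φ.strictMono h2

/-- Closeness up to reparametrisation after affine changes of time. -/
lemma comp_affine (h : ReparamClose η f g a b a' b') {p q p' q' : ℝ} (hab : a < b)
    (hab' : a' < b') (hpq : p < q) (hpq' : p' < q') :
    ReparamClose η (fun x => f (affineIso p q a b hpq hab x))
      (fun x => g (affineIso p' q' a' b' hpq' hab' x)) p q p' q' := by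
  obtain ⟨φ, ha, hb, hφ⟩ := h
  set A := affineIso p q a b hpq hab
  set A' := affineIso p' q' a' b' hpq' hab'
  have hA0 : A p = a := affineIso_left _ _
  have hA1 : A q = b := affineIso_right _ _
  have hA0' : A' p' = a' := affineIso_left _ _
  have hA1' : A' q' = b' := affineIso_right _ _
  refine ⟨(A.trans φ).trans A'.symm, ?_, ?_, fun t h1 h2 => ?_⟩
  · simp [hA0, ha, ← hA0']
  · simp [hA1, hb, ← hA1']
  · have := hφ (A t) (by rw [← hA0]; exact A.monotone h1) (by rw [← hA1]; exact A.strictMono h2)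
    simpa using this

end ReparamClose

section Conversions

variable {d : ℕ}

lemma edist_le_ofReal_of_dist_le {E : Type*} [PseudoMetricSpace E] {x y : E} {η : ℝ}
    (h : dist x y ≤ η) : edist x y ≤ ENNReal.ofReal η := by
  rw [edist_dist]; exact ENNReal.ofReal_le_ofReal h

/-- `ReparamClose` says nothing about the right end, so the values there are compared separately,
through `hend`. -/
lemma reparamEDist_le_of_reparamClose {η : ℝ} {f g : ℝ → Vec d} {b b' : ℝ} (hb : 0 < b)
    (hb' : 0 < b') (h : ReparamClose η f g 0 b 0 b') (hend : dist (f b) (g b') ≤ η) :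
    reparamEDist (fun t : I => f ((t : ℝ) * b)) (fun t : I => g ((t : ℝ) * b'))
      ≤ ENNReal.ofReal η := by
  obtain ⟨φ, h0, h1, hφ⟩ := h.comp_affine (p := 0) (q := 1) (p' := 0) (q' := 1) hb hb'
    zero_lt_one zero_lt_one
  have key : ∀ t : ℝ, t ∈ Icc (0 : ℝ) 1 → dist (f (t * b)) (g (φ t * b')) ≤ η := by
    intro t ht
    rcases ht.2.eq_or_lt with rfl | hlt
    · rw [h1, one_mul, one_mul]; exact hend
    · simpa [affineIso_apply] using hφ t ht.1 hlt
  -- The time change of `ReparamClose` acts on the second function, that of `reparamEDist` on the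
  -- first.
  rw [reparamEDist_comm]
  refine iInf_le_of_le (restrictIso φ h0 h1) (iSup_le fun t => ?_)
  rw [edist_comm]
  exact edist_le_ofReal_of_dist_le (by simpa [coe_restrictIso] using key t t.2)

/-- The converse passage, with arbitrary intervals as domains. It is used to lay one excursion over
an inserted interval on one side and over the time between two returns on the other. -/
lemma reparamClose_of_reparamEDist_lt {η : ℝ} {F G : I → Vec d}
    (h : reparamEDist F G < ENNReal.ofReal η) {p q p' q' : ℝ} (hpq : p < q) (hpq' : p' < q') :
    ReparamClose η (fun x => F (projIcc 0 1 zero_le_one ((x - p) / (q - p))))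
      (fun x => G (projIcc 0 1 zero_le_one ((x - p') / (q' - p')))) p q p' q' := by
  rw [reparamEDist_comm] at h
  obtain ⟨lam, hlam⟩ := iInf_lt_iff.1 h
  have h01 : ReparamClose η (fun x => F (projIcc 0 1 zero_le_one x))
      (fun x => G (projIcc 0 1 zero_le_one x)) 0 1 0 1 := by
    refine ⟨extendIso lam, ?_, ?_, fun t h0 h1 => ?_⟩
    · have := extendIso_coe lam 0
      rw [show lam 0 = 0 from lam.map_bot] at this
      simpa using this
    · have := extendIso_coe lam 1
      rw [show lam 1 = 1 from lam.map_top] at this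
      simpa using this
    · have ht : t ∈ Icc (0 : ℝ) 1 := ⟨h0, h1.le⟩
      have h2 := extendIso_coe lam ⟨t, ht⟩
      simp only at h2
      simp only [h2, projIcc_of_mem _ ht, projIcc_val]
      rw [dist_comm]
      have h3 := (le_iSup (fun t => edist (G (lam t)) (F t)) ⟨t, ht⟩).trans hlam.le
      rw [edist_dist] at h3
      by_contra hc
      have h4 : 0 < η := by
        by_contra hη
        rw [ENNReal.ofReal_of_nonpos (not_lt.1 hη)] at h
        exact not_lt_bot h
      exact absurd ((ENNReal.ofReal_le_ofReal_iff h4.le).1 h3) hc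
  have := h01.comp_affine (p := p) (q := q) (p' := p') (q' := q') zero_lt_one zero_lt_one hpq hpq'
  refine this.congr (fun x _ => ?_) (fun x _ => ?_)
  · simp [affineIso_apply, div_eq_mul_inv]
  · simp [affineIso_apply, div_eq_mul_inv]

/-- Pairing a function with the time variable makes the displacement of the time change part of the
distance. This reduces J₁-closeness to `ReparamClose`, which can be glued. The factor 2 appears
because the J₁ distance adds the two suprema. -/
lemma j1EDist_le_of_reparamClose {η : ℝ} (hη : 0 ≤ η) {f g : ℝ → Vec d}
    (h : ReparamClose η (fun t => (t, f t)) (fun t => (t, g t)) 0 1 0 1)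
    (hend : dist (f 1) (g 1) ≤ η) :
    j1EDist (fun t : I => f t) (fun t : I => g t) ≤ ENNReal.ofReal (2 * η) := by
  obtain ⟨φ, h0, h1, hφ⟩ := h
  have key : ∀ t : ℝ, t ∈ Icc (0 : ℝ) 1 → dist t (φ t) ≤ η ∧ dist (f t) (g (φ t)) ≤ η := by
    intro t ht
    rcases ht.2.eq_or_lt with rfl | hlt
    · rw [h1]; exact ⟨by simpa using hη, hend⟩
    · have := hφ t ht.1 hlt
      rw [Prod.dist_eq] at this
      exact max_le_iff.1 this
  rw [j1EDist_comm]
  refine iInf_le_of_le (restrictIso φ h0 h1) ?_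
  rw [two_mul, ENNReal.ofReal_add hη hη]
  refine add_le_add (iSup_le fun t => ?_) (iSup_le fun t => ?_)
  · rw [edist_comm]
    exact edist_le_ofReal_of_dist_le (by simpa [coe_restrictIso] using (key t t.2).2)
  · rw [edist_comm]
    refine edist_le_ofReal_of_dist_le ?_
    rw [Subtype.dist_eq, coe_restrictIso]
    exact (key t t.2).1

lemma exists_iso_of_j1EDist_lt {δ : ℝ} {u v : I → Vec d}
    (h : j1EDist u v < ENNReal.ofReal δ) :
    ∃ lam : I ≃o I, (∀ t, dist (u (lam t)) (v t) < δ) ∧ ∀ t, dist (lam t) t < δ := by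
  have hδ : 0 < δ := by
    by_contra hc
    rw [ENNReal.ofReal_of_nonpos (not_lt.1 hc)] at h
    exact not_lt_bot h
  obtain ⟨lam, hlam⟩ := iInf_lt_iff.1 h
  refine ⟨lam, fun t => ?_, fun t => ?_⟩
  · have := (le_iSup (fun t => edist (u (lam t)) (v t)) t).trans_lt (le_self_add.trans_lt hlam)
    rwa [edist_dist, ENNReal.ofReal_lt_ofReal_iff hδ] at this
  · have := (le_iSup (fun t => edist (lam t) t) t).trans_lt (le_add_self.trans_lt hlam)
    rwa [edist_dist, ENNReal.ofReal_lt_ofReal_iff hδ] at this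

end Conversions

/-! ### Càdlàg functions: local oscillation and sampling -/

/-- A transitive relation on `[0,1]` that holds between each point and the nearby points on its
left and on its right holds between `0` and `1`. -/
lemma rel_zero_one_of_local {Q : I → I → Prop}
    (trans : ∀ s t w, s < t → t < w → Q s t → Q t w → Q s w)
    (left : ∀ t, 0 < t → ∀ᶠ s in 𝓝[<] t, Q s t) (right : ∀ t, t < 1 → ∀ᶠ w in 𝓝[>] t, Q t w) :
    Q 0 1 := by
  -- Induction along the interval. `A` is an initial segment that contains 0 vacuously. Its supremum
  -- belongs to it because of `left`, and if the supremum were below 1, `right` would extend `A`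
  -- beyond it.
  set A : Set I := {t | ∀ s, 0 < s → s ≤ t → Q 0 s} with hA
  have h0A : (0 : I) ∈ A := fun s hs hs' => absurd hs' (not_le.2 hs)
  obtain ⟨m, hm⟩ : ∃ m, IsLUB A m := ⟨sSup A, isLUB_sSup A⟩
  have hlt : ∀ s, s < m → s ∈ A := by
    intro s hs
    obtain ⟨t, htA, hst⟩ := (lt_isLUB_iff hm).1 hs
    exact fun r hr hrs => htA r hr (hrs.trans hst.le)
  have hQm : 0 < m → Q 0 m := by
    intro hpos
    have hne : (𝓝[<] m).NeBot := nhdsLT_neBot_of_exists_lt ⟨0, hpos⟩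
    obtain ⟨s, hs, hs0, hsm⟩ := ((left m hpos).and
      (Ioo_mem_nhdsLT hpos : ∀ᶠ s in 𝓝[<] m, s ∈ Ioo 0 m)).exists
    exact trans 0 s m hs0 hsm (hlt s hsm s hs0 le_rfl) hs
  have hmA : m ∈ A := by
    intro s hs hsm
    rcases hsm.eq_or_lt with rfl | hlt'
    · exact hQm hs
    · exact hlt s hlt' s hs le_rfl
  rcases eq_or_lt_of_le (show m ≤ 1 from m.2.2) with h1 | h1
  · exact hmA 1 zero_lt_one h1.ge
  · exfalso
    have hne : (𝓝[>] m).NeBot := nhdsGT_neBot_of_exists_gt ⟨1, h1⟩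
    obtain ⟨b, hb, hbQ⟩ := (mem_nhdsGT_iff_exists_Ioo_subset' h1).1 (right m h1)
    obtain ⟨w, hw⟩ := exists_between (show m < b from hb)
    have : w ∈ A := by
      intro s hs hsw
      rcases le_or_gt s m with hle | hgt
      · exact hmA s hs hle
      · have hQ : Q m s := hbQ ⟨hgt, hsw.trans_lt hw.2⟩
        rcases eq_or_lt_of_le (show 0 ≤ m from m.2.1) with h | h
        · rw [h]; exact hQ
        · exact trans 0 m s h hgt (hQm h) hQ
    exact absurd (hm.1 this) (not_le.2 hw.1)

lemma eventually_abs_sub_lt (t : I) {η : ℝ} (hη : 0 < η) : ∀ᶠ s : I in 𝓝 t, |(s : ℝ) - t| < η := by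
  have hc : Continuous fun s : I => |(s : ℝ) - t| := by fun_prop
  exact hc.continuousAt.eventually_lt_const (by simpa using hη)

namespace Cadlag

variable {d : ℕ}

lemma eventually_osc_left (u : Cadlag d) (t : I) {η : ℝ} (hη : 0 < η) :
    ∀ᶠ s in 𝓝[<] t, ∀ y, s ≤ y → y < t → dist (u y) (u.left t) < η := by
  by_cases ht : (0 : I) < t
  · obtain ⟨a, ha, hsub⟩ := (mem_nhdsLT_iff_exists_Ioo_subset' ht).1
      (u.tendsto_left t (Metric.ball_mem_nhds _ hη))
    filter_upwards [Ioo_mem_nhdsLT (show a < t from ha)] with s hs y hsy hyt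
    exact hsub ⟨hs.1.trans_le hsy, hyt⟩
  · filter_upwards [self_mem_nhdsWithin] with s hs
    exact absurd (lt_of_le_of_lt (show 0 ≤ s from s.2.1) hs) ht

lemma eventually_osc_right (u : Cadlag d) (t : I) {η : ℝ} (hη : 0 < η) :
    ∀ᶠ w in 𝓝[>] t, ∀ y, t ≤ y → y ≤ w → dist (u y) (u t) < η := by
  by_cases ht : t < 1
  · have h := u.right_cont t (Metric.ball_mem_nhds _ hη)
    obtain ⟨b, hb, hsub⟩ := (mem_nhdsGE_iff_exists_Ico_subset' ht).1 h
    filter_upwards [Ioo_mem_nhdsGT (show t < b from hb)] with w hw y hty hyw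
    exact hsub ⟨hty, hyw.trans_lt hw.2⟩
  · filter_upwards [self_mem_nhdsWithin] with w hw
    exact absurd (lt_of_lt_of_le hw (show w ≤ 1 from w.2.2)) ht

/-- The function `u` extended to the line by constants. -/
noncomputable def extend (u : Cadlag d) (x : ℝ) : Vec d := u (projIcc 0 1 zero_le_one x)

lemma extend_coe (u : Cadlag d) (t : I) : u.extend t = u t := by simp [extend]

/-- The step function with the values of `u` on the grid `{k/n}`. -/
noncomputable def sample (n : ℕ) (u : Cadlag d) : Cadlag d :=
  step n fun k => u.extend ((k : ℝ) / n)

lemma dist_prod_le {x y : ℝ} {p q : Vec d} {η : ℝ} (h1 : |x - y| ≤ η) (h2 : dist p q ≤ η) :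
    dist (x, p) (y, q) ≤ η := by
  rw [Prod.dist_eq]; exact max_le (by rwa [Real.dist_eq]) h2

/-- The samples of a càdlàg function on finer and finer grids converge to it. -/
lemma tendsto_sample (u : Cadlag d) : Tendsto (fun n => sample n u) atTop (𝓝 u) := by
  rw [EMetric.tendsto_nhds]
  intro ε hε
  obtain ⟨η, hη, hηε⟩ : ∃ η : ℝ, 0 < η ∧ ENNReal.ofReal (2 * η) < ε := by
    obtain ⟨r, hr0, hr⟩ := ENNReal.lt_iff_exists_nnreal_btwn.1 hε
    refine ⟨r / 2, by have : 0 < r := by simpa using hr0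
                      positivity, ?_⟩
    rw [mul_div_cancel₀ _ two_ne_zero, ENNReal.ofReal_coe_nnreal]; exact hr
  set S : ℕ → ℝ → Vec d := fun n y => u.extend ((⌊(n : ℝ) * y⌋₊ : ℝ) / n) with hS
  -- A piece on which `u` stays near `p`. The grid points `k/n` in `[s,t)` are those with `⌈ns⌉ ≤ k
  -- < ⌈nt⌉`, so on `[⌈ns⌉/n, ⌈nt⌉/n)` the sample takes only values of `u` at points of `[s,t)`.
  -- These cut points glue, and they are 0 and 1 for `s = 0` and `t = 1`.
  have base : ∀ (s t : I) (p : Vec d), s < t → (t : ℝ) - s ≤ η / 2 →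
      (∀ y, s ≤ y → y < t → dist (u y) p ≤ η / 2) →
      ∀ᶠ n : ℕ in atTop, ReparamClose η (fun x => (x, u.extend x)) (fun x => (x, S n x)) s t
        (⌈(n : ℝ) * s⌉₊ / n) (⌈(n : ℝ) * t⌉₊ / n) := by
    intro s t p hst hts hosc
    have hst' : (s : ℝ) < t := hst
    filter_upwards [eventually_gt_atTop 0,
      (tendsto_natCast_atTop_atTop (R := ℝ)).eventually_gt_atTop (1 / ((t : ℝ) - s)),
      (tendsto_natCast_atTop_atTop (R := ℝ)).eventually_gt_atTop (1 / (η / 2))] with n hn hn1 hn2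
    have hn' : (0 : ℝ) < n := Nat.cast_pos.2 hn
    rw [div_lt_iff₀ (sub_pos.2 hst')] at hn1
    rw [div_lt_iff₀ (half_pos hη)] at hn2
    have hc1 := Nat.le_ceil ((n : ℝ) * s)
    have hc2 := Nat.ceil_lt_add_one (mul_nonneg hn'.le s.2.1)
    have hc3 := Nat.le_ceil ((n : ℝ) * t)
    have hc4 := Nat.ceil_lt_add_one (mul_nonneg hn'.le t.2.1)
    refine ReparamClose.of_forall_dist hst' ?_ ?_
    · gcongr
      have : (⌈(n : ℝ) * s⌉₊ : ℝ) < ⌈(n : ℝ) * t⌉₊ := by nlinarith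
      exact_mod_cast this
    · rintro x ⟨hx1, hx2⟩ y ⟨hy1, hy2⟩
      rw [div_le_iff₀ hn'] at hy1
      rw [lt_div_iff₀ hn'] at hy2
      have hy0 : 0 ≤ y := by
        by_contra hc
        have : y * n < 0 := mul_neg_of_neg_of_pos (not_le.1 hc) hn'
        linarith [(Nat.cast_nonneg ⌈(n : ℝ) * s⌉₊ : (0 : ℝ) ≤ _)]
      have hf1 : ⌈(n : ℝ) * s⌉₊ ≤ ⌊(n : ℝ) * y⌋₊ := Nat.le_floor (by linarith)
      have hf2 : ⌊(n : ℝ) * y⌋₊ < ⌈(n : ℝ) * t⌉₊ :=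
        (Nat.floor_lt (by positivity)).2 (by linarith)
      have hf3 : (⌊(n : ℝ) * y⌋₊ : ℝ) < n * t := Nat.lt_ceil.1 hf2
      have hf1' : (n : ℝ) * s ≤ ⌊(n : ℝ) * y⌋₊ := hc1.trans (by exact_mod_cast hf1)
      have hq1 : (s : ℝ) ≤ (⌊(n : ℝ) * y⌋₊ : ℝ) / n := by rw [le_div_iff₀ hn']; linarith
      have hq2 : (⌊(n : ℝ) * y⌋₊ : ℝ) / n < t := by rw [div_lt_iff₀ hn']; linarith
      have hxI : x ∈ Icc (0 : ℝ) 1 := ⟨s.2.1.trans hx1, hx2.le.trans t.2.2⟩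
      have hqI : (⌊(n : ℝ) * y⌋₊ : ℝ) / n ∈ Icc (0 : ℝ) 1 :=
        ⟨by positivity, hq2.le.trans t.2.2⟩
      refine dist_prod_le ?_ ?_
      · rw [abs_le]
        have e1 : y < t + η / 2 := by
          have : y * n < (t + η / 2) * n := by nlinarith
          exact lt_of_mul_lt_mul_right this hn'.le
        have e2 : (s : ℝ) ≤ y := by
          have : (s : ℝ) * n ≤ y * n := by linarith
          exact le_of_mul_le_mul_right this hn'
        constructor <;> linarith
      · have h1 := hosc ⟨x, hxI⟩ hx1 hx2
        have h2 := hosc ⟨_, hqI⟩ hq1 hq2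
        simp only [hS, extend, projIcc_of_mem _ hxI, projIcc_of_mem _ hqI]
        exact (dist_triangle_right _ _ p).trans (by linarith)
  have main : ∀ᶠ n : ℕ in atTop, ReparamClose η (fun x => (x, u.extend x)) (fun x => (x, S n x))
      ((0 : I) : ℝ) ((1 : I) : ℝ) (⌈(n : ℝ) * (0 : I)⌉₊ / n) (⌈(n : ℝ) * (1 : I)⌉₊ / n) := by
    refine rel_zero_one_of_local (Q := fun s t => ∀ᶠ n : ℕ in atTop,
      ReparamClose η (fun x => (x, u.extend x)) (fun x => (x, S n x)) s t
        (⌈(n : ℝ) * s⌉₊ / n) (⌈(n : ℝ) * t⌉₊ / n)) ?_ ?_ ?_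
    · intro s t w hst htw h1 h2
      filter_upwards [h1, h2] with n h1 h2
      exact h1.glue h2 (le_of_lt hst) (le_of_lt htw)
    · intro t _
      filter_upwards [u.eventually_osc_left t (half_pos hη), self_mem_nhdsWithin,
        mem_nhdsWithin_of_mem_nhds (eventually_abs_sub_lt t (half_pos hη))] with s hs hst hd
      exact base s t _ hst (by have := (abs_lt.1 hd).1; linarith) fun y h1 h2 => (hs y h1 h2).le
    · intro t _
      filter_upwards [u.eventually_osc_right t (half_pos hη), self_mem_nhdsWithin,
        mem_nhdsWithin_of_mem_nhds (eventually_abs_sub_lt t (half_pos hη))] with w hw htw hd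
      exact base t w _ htw (by have := (abs_lt.1 hd).2; linarith) fun y h1 h2 =>
        (hw y h1 h2.le).le
  filter_upwards [main, eventually_gt_atTop 0] with n hn hn0
  have hn' : (n : ℝ) ≠ 0 := Nat.cast_ne_zero.2 hn0.ne'
  have hn2 : ReparamClose η (fun x => (x, u.extend x)) (fun x => (x, S n x)) 0 1 0 1 := by
    simpa [hn'] using hn
  have := j1EDist_le_of_reparamClose hη.le hn2 (by simp [hS, hn', hη.le])
  rw [edist_comm]
  refine lt_of_le_of_lt ?_ hηε
  change j1EDist u (sample n u) ≤ _
  rw [show (u : I → Vec d) = fun t : I => u.extend t by funext t; rw [extend_coe]]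
  exact this

end Cadlag

end DecoratedLevy

namespace DecoratedLevy

namespace Decorated

variable {d : ℕ} (w : Decorated d)

/-! ### The stretched function -/

lemma len_pos (τ : w.times) : 0 < w.len τ := by
  have : 0 < (w.index τ : ℝ) := by unfold index; positivity
  unfold len; positivity

lemma summable_len : Summable w.len := by
  have h1 : Summable fun n : ℕ => (((n + 1 : ℕ) : ℝ) ^ 2)⁻¹ :=
    (summable_nat_add_iff 1).2 (Real.summable_nat_pow_inv.2 one_lt_two)
  exact h1.comp_injective
    (Classical.choose_spec ((countable_iff_exists_injective _).1 w.countable_times.to_subtype))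

/-- The total length of the intervals that are inserted at the times in `A`. -/
noncomputable def mass (A : Set w.times) : ℝ := ∑' ρ : w.times, A.indicator w.len ρ

lemma mass_mono {A B : Set w.times} (h : A ⊆ B) : w.mass A ≤ w.mass B :=
  (w.summable_len.indicator A).tsum_le_tsum
    (fun ρ => indicator_le_indicator_of_subset h (fun a => (w.len_pos a).le) ρ)
    (w.summable_len.indicator B)

lemma mass_union_singleton {A : Set w.times} {τ : w.times} (h : τ ∉ A) :
    w.mass (insert τ A) = w.mass A + w.len τ := by
  classical
  have h1 : w.mass {τ} = w.len τ := by
    unfold mass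
    rw [tsum_eq_single τ (fun ρ hρ => by simp [hρ])]
    simp
  rw [← h1, add_comm]
  unfold mass
  rw [← (w.summable_len.indicator _).tsum_add (w.summable_len.indicator _)]
  refine tsum_congr fun ρ => ?_
  by_cases hρ : ρ = τ
  · subst hρ; simp [h]
  · by_cases hA : ρ ∈ A <;> simp [hρ, hA]

/-- The left limit of `shift` at `t`, that is `t + ∑_{τ < t} m(τ)^{-2}`. -/
noncomputable def preShift (t : I) : ℝ := (t : ℝ) + w.mass {ρ | (ρ : I) < t}

lemma shift_eq (t : I) : w.shift t = (t : ℝ) + w.mass {ρ | (ρ : I) ≤ t} := rfl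

lemma start_eq (τ : w.times) : w.start τ = w.preShift τ := rfl

lemma preShift_le_shift (t : I) : w.preShift t ≤ w.shift t :=
  add_le_add le_rfl (w.mass_mono fun ρ (h : (ρ : I) < t) => show (ρ : I) ≤ t from h.le)

/-- Every time `t` owns the closed interval from `preShift t` to `shift t`, degenerate when nothing
is inserted. This inequality says that these intervals are disjoint and ordered as the times are. -/
lemma shift_lt_preShift {s t : I} (h : s < t) : w.shift s < w.preShift t :=
  add_lt_add_of_lt_of_le h (w.mass_mono fun ρ (hr : (ρ : I) ≤ s) => show (ρ : I) < t from hr.trans_lt h)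

lemma shift_eq_preShift_add (τ : w.times) : w.shift τ = w.preShift τ + w.len τ := by
  rw [shift_eq, preShift, add_assoc, ← w.mass_union_singleton (by simp)]
  congr 2
  ext ρ
  simp only [mem_ofPred_eq, mem_insert_iff, le_iff_eq_or_lt, Subtype.ext_iff]

lemma shift_eq_preShift {t : I} (h : t ∉ w.times) : w.shift t = w.preShift t := by
  rw [shift_eq, preShift]
  congr 2
  ext ρ
  have hne : (ρ : I) ≠ t := fun he => h (he ▸ ρ.2)
  exact ⟨fun h' : (ρ : I) ≤ t => lt_of_le_of_ne h' hne, fun h' : (ρ : I) < t => h'.le⟩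

lemma strictMono_shift : StrictMono w.shift := fun _ _ h =>
  (w.shift_lt_preShift h).trans_le (w.preShift_le_shift _)

lemma strictMono_preShift : StrictMono w.preShift := fun _ _ h =>
  (w.preShift_le_shift _).trans_lt (w.shift_lt_preShift h)

lemma zero_notMem_times : (0 : I) ∉ w.times := fun h => lt_irrefl _ (w.times_subset h).1

lemma one_notMem_times : (1 : I) ∉ w.times := fun h => lt_irrefl _ (w.times_subset h).2

lemma shift_zero : w.shift 0 = 0 := by
  rw [shift_eq, show {ρ : w.times | (ρ : I) ≤ 0} = ∅ from ?_]
  · simp [mass]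
  · ext ρ
    simpa using (w.times_subset ρ.2).1.ne'

lemma shift_one : w.shift 1 = 1 + w.totalLen := by
  rw [shift_eq, show {ρ : w.times | (ρ : I) ≤ 1} = univ from ?_]
  · simp [mass, totalLen]
  · ext ρ
    simpa using (show (ρ : I) ≤ 1 from (ρ : I).2.2)

lemma totalLen_nonneg : 0 ≤ w.totalLen := tsum_nonneg fun τ => (w.len_pos τ).le

/-- Each summand is eventually constant as `s ↑ t`, and `len` dominates the sum. -/
lemma tendsto_preShift_left (t : I) : Tendsto w.preShift (𝓝[<] t) (𝓝 (w.preShift t)) := by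
  refine Tendsto.add (continuous_subtype_val.continuousWithinAt) ?_
  refine tendsto_tsum_of_dominated_convergence w.summable_len (fun ρ => ?_)
    (Eventually.of_forall fun s ρ => ?_)
  · refine tendsto_const_nhds.congr' ?_
    by_cases h : (ρ : I) < t
    · filter_upwards [mem_nhdsWithin_of_mem_nhds (isOpen_Ioi.mem_nhds h)] with s hs
      simp [h, show (ρ : I) < s from hs]
    · filter_upwards [self_mem_nhdsWithin] with s hs
      have : ¬ (ρ : I) < s := fun h' => h (h'.trans hs)
      simp [h, this]
  · rw [Real.norm_of_nonneg (indicator_nonneg (fun _ _ => (w.len_pos _).le) _)]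
    exact indicator_le_self' (fun _ _ => (w.len_pos _).le) ρ

lemma tendsto_preShift_right (t : I) : Tendsto w.preShift (𝓝[>] t) (𝓝 (w.shift t)) := by
  refine Tendsto.add (continuous_subtype_val.continuousWithinAt) ?_
  refine tendsto_tsum_of_dominated_convergence w.summable_len (fun ρ => ?_)
    (Eventually.of_forall fun s ρ => ?_)
  · refine tendsto_const_nhds.congr' ?_
    by_cases h : (ρ : I) ≤ t
    · filter_upwards [self_mem_nhdsWithin] with s hs
      simp [h, show (ρ : I) < s from lt_of_le_of_lt h hs]
    · filter_upwards [mem_nhdsWithin_of_mem_nhds (isOpen_Iio.mem_nhds (not_le.1 h))] with s hs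
      simp [h, not_lt.2 (le_of_lt (show s < (ρ : I) from hs))]
  · rw [Real.norm_of_nonneg (indicator_nonneg (fun _ _ => (w.len_pos _).le) _)]
    exact indicator_le_self' (fun _ _ => (w.len_pos _).le) ρ

/-- Every point of `[0,1+s]` comes from a time `t`. -/
lemma exists_preShift_le_le_shift {x : ℝ} (h0 : 0 ≤ x) (h1 : x ≤ 1 + w.totalLen) :
    ∃ t, w.preShift t ≤ x ∧ x ≤ w.shift t := by
  -- The time sought is the supremum of `A`: left continuity of `preShift` gives the first
  -- inequality, and its right limit `shift` gives the second.
  set A : Set I := {t | w.preShift t ≤ x}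
  have h0A : (0 : I) ∈ A := by
    change w.preShift 0 ≤ x
    rwa [← w.shift_eq_preShift w.zero_notMem_times, w.shift_zero]
  have hlub := isLUB_sSup A
  set m := sSup A
  refine ⟨m, ?_, ?_⟩
  · rcases eq_or_lt_of_le (show 0 ≤ m from m.2.1) with h | h
    · rw [← h]; exact h0A
    · have hne : (𝓝[<] m).NeBot := nhdsLT_neBot_of_exists_lt ⟨0, h⟩
      refine le_of_tendsto (w.tendsto_preShift_left m) ?_
      filter_upwards [self_mem_nhdsWithin] with s hs
      obtain ⟨t, htA, hst⟩ := (lt_isLUB_iff hlub).1 hs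
      exact (w.strictMono_preShift hst).le.trans htA
  · rcases eq_or_lt_of_le (show m ≤ 1 from m.2.2) with h | h
    · rw [h, w.shift_one]; exact h1
    · have hne : (𝓝[>] m).NeBot := nhdsGT_neBot_of_exists_gt ⟨1, h⟩
      refine ge_of_tendsto (w.tendsto_preShift_right m) ?_
      filter_upwards [self_mem_nhdsWithin] with s hs
      by_contra hc
      exact absurd (hlub.1 (show s ∈ A from (not_le.1 hc).le)) (not_le.2 hs)

lemma eq_of_mem_insertion {τ ρ : w.times} {x : ℝ}
    (hτ : x ∈ Icc (w.start τ) (w.start τ + w.len τ))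
    (hρ : x ∈ Icc (w.start ρ) (w.start ρ + w.len ρ)) : τ = ρ := by
  rw [start_eq, ← shift_eq_preShift_add] at hτ hρ
  rcases lt_trichotomy (τ : I) ρ with h | h | h
  · have := w.shift_lt_preShift h
    linarith [hτ.2, hρ.1]
  · exact Subtype.ext h
  · have := w.shift_lt_preShift h
    linarith [hρ.2, hτ.1]

/-- The inserted intervals are disjoint even as closed intervals, so the choice in `stretched` can
only return `τ`. -/
lemma stretched_of_mem {τ : w.times} {x : ℝ} (hx : x ∈ Icc (w.preShift τ) (w.shift τ)) :
    w.stretched x = w.exc τ (projIcc 0 1 zero_le_one ((x - w.preShift τ) / w.len τ)) := by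
  have hx' : x ∈ Icc (w.start τ) (w.start τ + w.len τ) := by
    rwa [start_eq, ← shift_eq_preShift_add]
  have h : ∃ τ : w.times, x ∈ Icc (w.start τ) (w.start τ + w.len τ) := ⟨τ, hx'⟩
  have he : h.choose = τ := w.eq_of_mem_insertion h.choose_spec hx'
  rw [stretched, dif_pos h, he, start_eq]

lemma stretched_shift (t : I) : w.stretched (w.shift t) = w.path t := by
  by_cases ht : t ∈ w.times
  · have h := w.stretched_of_mem (τ := ⟨t, ht⟩) (x := w.shift t)
      ⟨w.preShift_le_shift t, le_rfl⟩
    have h2 := w.shift_eq_preShift_add ⟨t, ht⟩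
    simp only at h h2
    rw [h, h2, add_sub_cancel_left, div_self (w.len_pos _).ne', projIcc_right]
    exact w.exc_one ⟨t, ht⟩
  · have h : ¬ ∃ τ : w.times, w.shift t ∈ Icc (w.start τ) (w.start τ + w.len τ) := by
      rintro ⟨τ, hτ⟩
      rw [start_eq, ← shift_eq_preShift_add] at hτ
      rcases lt_trichotomy (τ : I) t with h | h | h
      · exact absurd hτ.2 (not_le.2 (w.strictMono_shift h))
      · exact ht (h ▸ τ.2)
      · exact absurd hτ.1 (not_le.2 (w.shift_lt_preShift h))
    rw [stretched, dif_neg h, Function.leftInverse_invFun w.strictMono_shift.injective t]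

/-- Where the path and the excursions are close to a point, the stretched function is. -/
lemma dist_stretched_le {s t : I} {c : Vec d} {η : ℝ}
    (hpath : ∀ y, s ≤ y → y < t → dist (w.path y) c ≤ η)
    (hexc : ∀ τ : w.times, s < τ → (τ : I) < t → ∀ a, dist (w.exc τ a) c ≤ η)
    {x : ℝ} (hx : x ∈ Ico (w.shift s) (w.preShift t)) : dist (w.stretched x) c ≤ η := by
  obtain ⟨y, hy1, hy2⟩ := w.exists_preShift_le_le_shift (x := x)
    (by
      rw [← w.shift_zero]
      exact (w.strictMono_shift.monotone (show 0 ≤ s from s.2.1)).trans hx.1)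
    (by
      rw [← w.shift_one]
      exact hx.2.le.trans ((w.preShift_le_shift t).trans
        (w.strictMono_shift.monotone (show t ≤ 1 from t.2.2))))
  have hyt : y < t := w.strictMono_preShift.lt_iff_lt.1 (hy1.trans_lt hx.2)
  have hsy : s ≤ y := w.strictMono_shift.le_iff_le.1 (hx.1.trans hy2)
  by_cases hyT : y ∈ w.times
  · rcases eq_or_lt_of_le hsy with h | h
    -- At `y = s` the point `x` is the right end of the interval inserted at `s`, where the value is
    -- that of the path. The rest of the excursion at `s` lies outside the piece and need not be
    -- close to `c`.
    · have : x = w.shift y := le_antisymm hy2 (h ▸ hx.1)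
      rw [this, w.stretched_shift]
      exact hpath y hsy hyt
    · rw [w.stretched_of_mem (τ := ⟨y, hyT⟩) ⟨hy1, hy2⟩]
      exact hexc ⟨y, hyT⟩ h hyt _
  · have : x = w.shift y := le_antisymm hy2 (w.shift_eq_preShift hyT ▸ hy1)
    rw [this, w.stretched_shift]
    exact hpath y hsy hyt

end Decorated

end DecoratedLevy

namespace DecoratedLevy

/-! ### Graphs of decorated functions -/

lemma edist_plane_le {a b c e η₁ η₂ : ℝ} (h1 : |a - c| ≤ η₁) (h2 : |b - e| ≤ η₂) :
    edist (WithLp.toLp 2 (a, b)) (WithLp.toLp 2 (c, e)) ≤ ENNReal.ofReal (η₁ + η₂) := by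
  refine edist_le_ofReal_of_dist_le ?_
  rw [WithLp.prod_dist_eq_of_L2]
  simp only [Real.dist_eq, WithLp.toLp_fst, WithLp.toLp_snd]
  have h3 := abs_nonneg (a - c)
  have h4 := abs_nonneg (b - e)
  refine Real.sqrt_le_iff.2 ⟨by linarith, ?_⟩
  nlinarith

namespace Cadlag

variable {d : ℕ}

lemma bddBelow_coord (u : Cadlag d) (k : Fin d) : BddBelow (range fun t => u t k) := by
  obtain ⟨C, hC⟩ := u.isBounded_range.exists_norm_le
  refine ⟨-C, ?_⟩
  rintro _ ⟨t, rfl⟩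
  have h1 := (PiLp.norm_apply_le (u t) k).trans (hC _ (mem_range_self t))
  exact (abs_le.1 h1).1

lemma bddAbove_coord (u : Cadlag d) (k : Fin d) : BddAbove (range fun t => u t k) := by
  obtain ⟨C, hC⟩ := u.isBounded_range.exists_norm_le
  refine ⟨C, ?_⟩
  rintro _ ⟨t, rfl⟩
  have h1 := (PiLp.norm_apply_le (u t) k).trans (hC _ (mem_range_self t))
  exact (abs_le.1 h1).2

lemma left_zero (u : Cadlag d) : u.left 0 = u 0 := by
  have hbot : 𝓝[<] (0 : I) = ⊥ := by
    rw [show Iio (0 : I) = ∅ from ?_, nhdsWithin_empty]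
    ext x
    simp
  exact leftLim_eq_of_eq_bot _ hbot

lemma left_eq_of_continuousAt {u : Cadlag d} {t : I} (h : ContinuousAt u t) : u.left t = u t := by
  rcases eq_or_lt_of_le (show 0 ≤ t from t.2.1) with h0 | h0
  · rw [← h0]; exact u.left_zero
  · have hne : (𝓝[<] t).NeBot := nhdsLT_neBot_of_exists_lt ⟨0, h0⟩
    exact tendsto_nhds_unique (u.tendsto_left t) (h.mono_left nhdsWithin_le_nhds)

lemma left_eq_of_notMem_disc {u : Cadlag d} {t : I} (h1 : t < 1) (h : t ∉ u.disc) :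
    u.left t = u t := by
  rcases eq_or_lt_of_le (show 0 ≤ t from t.2.1) with h0 | h0
  · rw [← h0]; exact u.left_zero
  · refine left_eq_of_continuousAt ?_
    by_contra hc
    exact h ⟨⟨h0, h1⟩, hc⟩

lemma left_step (n : ℕ) (g : ℕ → Vec d) {t : I} (ht : 0 < t) :
    (step n g).left t = g (⌈(n : ℝ) * t⌉₊ - 1) := by
  have hne : (𝓝[<] t).NeBot := nhdsLT_neBot_of_exists_lt ⟨0, ht⟩
  refine tendsto_nhds_unique ((step n g).tendsto_left t) (tendsto_const_nhds.congr' ?_)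
  filter_upwards [floor_eventually_left n t] with x hx
  simp [step, hx]

lemma trivialExcursion_apply (c δ : Vec d) (t : I) :
    trivialExcursion c δ t = if (1 / 2 : ℝ) ≤ t then c + δ else c := by
  change c + (Icc (1 / 2 : ℝ) 1).indicator (fun _ => δ) (t : ℝ) = _
  by_cases h : (1 / 2 : ℝ) ≤ t
  · rw [indicator_of_mem (show (t : ℝ) ∈ Icc (1 / 2 : ℝ) 1 from ⟨h, t.2.2⟩), if_pos h]
  · rw [indicator_of_notMem (fun h' => h h'.1), if_neg h, add_zero]

end Cadlag

namespace Decorated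

variable {d : ℕ}

/-- The `k`-th projection of a box is its whole `k`-th side: a point `y` of that side is completed
to a point of the box by the other coordinates of `e(0)`. -/
lemma mem_coordGraph (w : Decorated d) (k : Fin d) (q : WithLp 2 (ℝ × ℝ)) :
    q ∈ w.coordGraph k ↔ ∃ (t : I) (y : ℝ), q = WithLp.toLp 2 ((t : ℝ), y) ∧
      (∀ h : t ∈ w.times, y ∈ Icc (⨅ s, w.exc ⟨t, h⟩ s k) (⨆ s, w.exc ⟨t, h⟩ s k)) ∧
      (t ∉ w.times → y = w.path t k) := by
  classical
  constructor
  · rintro ⟨t, z, hz, rfl⟩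
    exact ⟨t, z k, rfl, fun h => hz.1 h k, fun h => by rw [hz.2 h]⟩
  · rintro ⟨t, y, rfl, h1, h2⟩
    by_cases h : t ∈ w.times
    · refine ⟨t, WithLp.toLp 2 (Function.update (fun j => w.exc ⟨t, h⟩ 0 j) k y),
        ⟨fun _ j => ?_, fun h' => absurd h h'⟩, by simp⟩
      by_cases hj : j = k
      · subst hj; simpa using h1 h
      · simp only [Function.update_of_ne hj]
        exact ⟨ciInf_le ((w.exc ⟨t, h⟩).bddBelow_coord j) 0,
          le_ciSup ((w.exc ⟨t, h⟩).bddAbove_coord j) 0⟩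
    · exact ⟨t, w.path t, ⟨fun h' => absurd h' h, fun _ => rfl⟩, by rw [h2 h]⟩

/-- A trivial excursion takes two values only, so its box has the left limit and the value as
opposite corners. -/
lemma mem_coordGraph_ofStep (n : ℕ) (g : ℕ → Vec d) (k : Fin d) (q : WithLp 2 (ℝ × ℝ)) :
    q ∈ (ofStep n g).coordGraph k ↔ ∃ (t : I) (y : ℝ), q = WithLp.toLp 2 ((t : ℝ), y) ∧
      (t ∈ Cadlag.grid n → y ∈ uIcc ((Cadlag.step n g).left t k) (Cadlag.step n g t k)) ∧
      (t ∉ Cadlag.grid n → y = Cadlag.step n g t k) := by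
  rw [mem_coordGraph]
  refine exists_congr fun t => exists_congr fun y => and_congr_right fun _ => and_congr_left fun _ =>
    forall_congr' fun h => ?_
  set e := (ofStep n g).exc ⟨t, h⟩ with he
  have hev : ∀ s : I, e s = if (1 / 2 : ℝ) ≤ s then Cadlag.step n g t
      else (Cadlag.step n g).left t := by
    intro s
    change Cadlag.trivialExcursion _ _ s = _
    rw [Cadlag.trivialExcursion_apply]
    simp [Cadlag.jump]
  have h0 : e 0 k = (Cadlag.step n g).left t k := by rw [hev]; norm_num
  have h1 : e 1 k = Cadlag.step n g t k := by rw [hev]; norm_num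
  have hinf : ⨅ s, e s k = (Cadlag.step n g).left t k ⊓ Cadlag.step n g t k := by
    refine le_antisymm (le_inf ?_ ?_) (le_ciInf fun s => ?_)
    · rw [← h0]; exact ciInf_le (e.bddBelow_coord k) 0
    · rw [← h1]; exact ciInf_le (e.bddBelow_coord k) 1
    · rw [hev]; split_ifs <;> simp
  have hsup : ⨆ s, e s k = (Cadlag.step n g).left t k ⊔ Cadlag.step n g t k := by
    refine le_antisymm (ciSup_le fun s => ?_) (sup_le ?_ ?_)
    · rw [hev]; split_ifs <;> simp
    · rw [← h0]; exact le_ciSup (e.bddAbove_coord k) 0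
    · rw [← h1]; exact le_ciSup (e.bddAbove_coord k) 1
  rw [hinf, hsup, uIcc]

/-! ### The unfolding of a step function -/

lemma step_apply (n : ℕ) (g : ℕ → Vec d) (t : I) : Cadlag.step n g t = g ⌊(n : ℝ) * t⌋₊ := rfl

/-- The point `j/n` of `[0,1]`, for `j ≤ n`. -/
noncomputable def gridPoint (n j : ℕ) : I := projIcc 0 1 zero_le_one ((j : ℝ) / n)

lemma coe_gridPoint {n j : ℕ} (h : j ≤ n) : (gridPoint n j : ℝ) = j / n := by
  have : ((j : ℝ) / n) ∈ Icc (0 : ℝ) 1 :=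
    ⟨by positivity, div_le_one_of_le₀ (by exact_mod_cast h) (by positivity)⟩
  rw [gridPoint, projIcc_of_mem _ this]

/-- The middle of the interval inserted at `t`. -/
noncomputable def mid (w : Decorated d) (t : I) : ℝ := (w.preShift t + w.shift t) / 2

lemma mid_lt_mid (w : Decorated d) {s t : I} (h : s < t) : w.mid s < w.mid t := by
  have h1 := w.shift_lt_preShift h
  have h2 := w.preShift_le_shift s
  have h3 := w.preShift_le_shift t
  unfold mid; linarith

/-- A trivial excursion jumps in the middle of its inserted interval. Between consecutive midpoints
the unfolding runs through the second half of one excursion, the stretch of path after it and the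
first half of the next excursion, and all of these have the value `g j`. At 0 and 1 nothing is
inserted and the midpoint is the point itself. -/
lemma stretched_ofStep {n : ℕ} (g : ℕ → Vec d) {j : ℕ} (hj : j < n) {x : ℝ}
    (hx : x ∈ Ico ((ofStep n g).mid (gridPoint n j)) ((ofStep n g).mid (gridPoint n (j + 1)))) :
    (ofStep n g).stretched x = g j := by
  set w := ofStep n g with hw
  have hn : (0 : ℝ) < n := Nat.cast_pos.2 (by omega)
  have hc1 := coe_gridPoint hj.le
  have hc2 := coe_gridPoint (show j + 1 ≤ n from hj)
  have hmem : ∀ {t : I}, w.preShift t < w.shift t → t ∈ w.times := by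
    intro t ht
    by_contra hc
    exact ht.ne (w.shift_eq_preShift hc).symm
  rcases lt_or_ge x (w.shift (gridPoint n j)) with h1 | h1
  · have h2 : w.preShift (gridPoint n j) < w.shift (gridPoint n j) := by
      have := hx.1; unfold mid at this; linarith
    have hT := hmem h2
    have h3 : w.preShift (gridPoint n j) ≤ x := by
      have := hx.1; unfold mid at this; linarith
    have hlen := w.shift_eq_preShift_add ⟨_, hT⟩
    have hlp := w.len_pos ⟨_, hT⟩
    simp only at hlen
    rw [w.stretched_of_mem (τ := ⟨_, hT⟩) ⟨h3, h1.le⟩]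
    change Cadlag.trivialExcursion _ _ _ = _
    rw [Cadlag.trivialExcursion_apply, if_pos, Cadlag.jump, add_sub_cancel, step_apply]
    · simp only [hc1]
      rw [mul_div_cancel₀ _ hn.ne', Nat.floor_natCast]
    · have h4 : (x - w.preShift (gridPoint n j)) / w.len ⟨_, hT⟩ ∈ Icc (0 : ℝ) 1 :=
        ⟨div_nonneg (by linarith) hlp.le, div_le_one_of_le₀ (by linarith) hlp.le⟩
      rw [projIcc_of_mem _ h4]
      simp only
      rw [le_div_iff₀ hlp]
      have := hx.1; unfold mid at this; linarith
  rcases lt_or_ge x (w.preShift (gridPoint n (j + 1))) with h2 | h2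
  · rw [← dist_le_zero]
    refine w.dist_stretched_le ?_ ?_ ⟨h1, h2⟩
    · intro y hy1 hy2
      have hy1' : ((j : ℝ) / n) ≤ y := by rw [← hc1]; exact hy1
      have hy2' : (y : ℝ) < ((j + 1 : ℕ) : ℝ) / n := by rw [← hc2]; exact hy2
      change dist (g ⌊(n : ℝ) * y⌋₊) _ ≤ 0
      rw [div_le_iff₀ hn] at hy1'
      rw [lt_div_iff₀ hn] at hy2'
      push_cast at hy2'
      have hfl : ⌊(n : ℝ) * y⌋₊ = j :=
        (Nat.floor_eq_iff (mul_nonneg hn.le y.2.1)).2 ⟨by linarith, by linarith⟩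
      rw [hfl, dist_self]
    · rintro ⟨τ, i, hi1, hi2, hi3⟩ h4 h5
      exfalso
      have h4' : ((j : ℝ) / n) < i / n := by rw [← hc1, ← hi3]; exact h4
      have h5' : (i : ℝ) / n < ((j + 1 : ℕ) : ℝ) / n := by rw [← hc2, ← hi3]; exact h5
      rw [div_lt_div_iff_of_pos_right hn] at h4' h5'
      have : j < i := by exact_mod_cast h4'
      have : i < j + 1 := by exact_mod_cast h5'
      omega
  · have h3 : w.preShift (gridPoint n (j + 1)) < w.shift (gridPoint n (j + 1)) := by
      have := hx.2; unfold mid at this; linarith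
    have hT := hmem h3
    have h4 : x ≤ w.shift (gridPoint n (j + 1)) := by
      have := hx.2; unfold mid at this; linarith
    have hlen := w.shift_eq_preShift_add ⟨_, hT⟩
    have hlp := w.len_pos ⟨_, hT⟩
    simp only at hlen
    rw [w.stretched_of_mem (τ := ⟨_, hT⟩) ⟨h2, h4⟩]
    change Cadlag.trivialExcursion _ _ _ = _
    rw [Cadlag.trivialExcursion_apply, if_neg]
    · have hpos : (0 : I) < gridPoint n (j + 1) := by
        change (0 : ℝ) < _
        rw [hc2]; positivity
      simp only
      rw [Cadlag.left_step n g hpos, hc2, mul_div_cancel₀ _ hn.ne', Nat.ceil_natCast]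
      simp
    · have h5 : (x - w.preShift (gridPoint n (j + 1))) / w.len ⟨_, hT⟩ ∈ Icc (0 : ℝ) 1 :=
        ⟨div_nonneg (by linarith) hlp.le, div_le_one_of_le₀ (by linarith) hlp.le⟩
      rw [projIcc_of_mem _ h5]
      simp only
      rw [not_le, div_lt_iff₀ hlp]
      have := hx.2; unfold mid at this; linarith

/-- The unfolding of a step function with trivial excursions is the step function itself, up to
reparametrisation. -/
lemma reparamEDist_unfolded_ofStep {n : ℕ} (hn : 0 < n) (g : ℕ → Vec d) :
    reparamEDist (ofStep n g).unfolded (Cadlag.step n g) = 0 := by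
  have hn' : (0 : ℝ) < n := Nat.cast_pos.2 hn
  set w := ofStep n g with hw
  have hg0 : gridPoint n 0 = 0 := by
    apply Subtype.ext; rw [coe_gridPoint (Nat.zero_le n)]; simp
  have hgn : gridPoint n n = 1 := by
    apply Subtype.ext; rw [coe_gridPoint le_rfl]; simp [hn'.ne']
  have hm0 : w.mid 0 = 0 := by
    rw [mid, ← w.shift_eq_preShift w.zero_notMem_times, w.shift_zero]; simp
  have hm1 : w.mid 1 = 1 + w.totalLen := by
    rw [mid, ← w.shift_eq_preShift w.one_notMem_times, w.shift_one]; ring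
  have hlt : ∀ i j, i < j → j ≤ n → gridPoint n i < gridPoint n j := by
    intro i j hij hj
    change (gridPoint n i : ℝ) < gridPoint n j
    rw [coe_gridPoint (hij.le.trans hj), coe_gridPoint hj]
    gcongr
  -- Exact equality after a change of time, obtained by gluing the pieces between midpoints to the
  -- cells `[j/n, (j+1)/n)`.
  have key : ∀ j, j < n → ReparamClose 0 w.stretched (fun y => g ⌊(n : ℝ) * y⌋₊)
      0 (w.mid (gridPoint n (j + 1))) 0 (((j + 1 : ℕ) : ℝ) / n) := by
    have piece : ∀ j, j < n → ReparamClose 0 w.stretched (fun y => g ⌊(n : ℝ) * y⌋₊)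
        (w.mid (gridPoint n j)) (w.mid (gridPoint n (j + 1))) ((j : ℝ) / n)
        (((j + 1 : ℕ) : ℝ) / n) := by
      intro j hj
      refine ReparamClose.of_forall_dist (w.mid_lt_mid (hlt j (j + 1) (by omega) hj))
        (by gcongr; omega) ?_
      rintro x hx y ⟨hy1, hy2⟩
      rw [div_le_iff₀ hn'] at hy1
      rw [lt_div_iff₀ hn'] at hy2
      push_cast at hy2
      have hfl : ⌊(n : ℝ) * y⌋₊ = j := by
        rw [mul_comm]
        refine (Nat.floor_eq_iff ?_).2 ⟨hy1, hy2⟩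
        linarith [(Nat.cast_nonneg j : (0 : ℝ) ≤ j)]
      rw [stretched_ofStep g hj hx, hfl, dist_self]
    intro j
    induction j with
    | zero =>
      intro h
      have := piece 0 h
      rw [hg0, hm0] at this
      simpa using this
    | succ j ih =>
      intro h
      refine (ih (by omega)).glue (piece (j + 1) h) ?_ ?_
      · rw [← hm0]
        have h0 := hlt 0 (j + 1) (by omega) h.le
        rw [hg0] at h0
        exact (w.mid_lt_mid h0).le
      · exact (w.mid_lt_mid (hlt _ _ (by omega) h)).le
  have hk := key (n - 1) (by omega)
  rw [Nat.sub_add_cancel hn, hgn, hm1, div_self hn'.ne'] at hk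
  have h1 : 0 < 1 + w.totalLen := by linarith [w.totalLen_nonneg]
  have := reparamEDist_le_of_reparamClose h1 one_pos hk (by
    rw [← w.shift_one, w.stretched_shift]
    change dist (g ⌊(n : ℝ) * ((1 : I) : ℝ)⌋₊) _ ≤ 0
    simp)
  rw [ENNReal.ofReal_zero] at this
  refine le_antisymm ?_ bot_le
  simp only [mul_one] at this
  exact this

/-! ### The distance of step functions -/

/-- The witness is the point of the second interval nearest to `y`, written with `max` and `min`. -/
lemma exists_mem_uIcc_abs_sub_le {a b a' b' y δ : ℝ} (ha : |a - a'| ≤ δ) (hb : |b - b'| ≤ δ)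
    (hy : y ∈ uIcc a b) : ∃ y' ∈ uIcc a' b', |y - y'| ≤ δ := by
  rw [abs_le] at ha hb
  rcases le_total a' b' with h | h
  · rw [uIcc_of_le h]
    refine ⟨max a' (min y b'), ⟨le_max_left _ _, max_le h (min_le_right _ _)⟩, ?_⟩
    have h1 := hy.1
    have h2 := hy.2
    rw [inf_le_iff] at h1
    rw [le_sup_iff] at h2
    rw [abs_le]
    constructor
    · rcases max_cases a' (min y b') with h3 | h3 <;> rcases min_cases y b' with h4 | h4 <;>
        rcases h1 with h1 | h1 <;> linarith
    · rcases max_cases a' (min y b') with h3 | h3 <;> rcases min_cases y b' with h4 | h4 <;>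
        rcases h2 with h2 | h2 <;> linarith
  · rw [uIcc_of_ge h]
    refine ⟨max b' (min y a'), ⟨le_max_left _ _, max_le h (min_le_right _ _)⟩, ?_⟩
    have h1 := hy.1
    have h2 := hy.2
    rw [inf_le_iff] at h1
    rw [le_sup_iff] at h2
    rw [abs_le]
    constructor
    · rcases max_cases b' (min y a') with h3 | h3 <;> rcases min_cases y a' with h4 | h4 <;>
        rcases h1 with h1 | h1 <;> linarith
    · rcases max_cases b' (min y a') with h3 | h3 <;> rcases min_cases y a' with h4 | h4 <;>
        rcases h2 with h2 | h2 <;> linarith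

lemma abs_coord_sub_le (p q : Vec d) (k : Fin d) : |p k - q k| ≤ dist p q := by
  rw [dist_eq_norm]
  simpa using PiLp.norm_apply_le (p - q) k

/-- An order isomorphism maps left neighbourhoods to left neighbourhoods, so a bound on the values
passes to the left limits. -/
lemma dist_left_le_of_iso {u v : Cadlag d} {lam : I ≃o I} {δ : ℝ}
    (h : ∀ t, dist (u (lam t)) (v t) < δ) {t : I} (ht : 0 < t) :
    dist (u.left (lam t)) (v.left t) ≤ δ := by
  have hne : (𝓝[<] t).NeBot := nhdsLT_neBot_of_exists_lt ⟨0, ht⟩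
  have hlam : Tendsto lam (𝓝[<] t) (𝓝[<] (lam t)) :=
    tendsto_nhdsWithin_of_tendsto_nhds_of_eventually_within _
      (lam.continuous.continuousWithinAt)
      (by filter_upwards [self_mem_nhdsWithin] with s hs using lam.strictMono hs)
  refine le_of_tendsto (((u.tendsto_left (lam t)).comp hlam).dist (v.tendsto_left t)) ?_
  exact Eventually.of_forall fun s => (h s).le

/-- The vertical segment over a time is compared with the segment over the matched time. Both of
their ends are close, because values and left limits are matched. -/
lemma exists_mem_coordGraph_ofStep {n m : ℕ} {g g' : ℕ → Vec d} {lam : I ≃o I} {δ : ℝ}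
    (h1 : ∀ t, dist (Cadlag.step n g (lam t)) (Cadlag.step m g' t) < δ)
    (h2 : ∀ t, dist (lam t) t < δ) (k : Fin d) {q : WithLp 2 (ℝ × ℝ)}
    (hq : q ∈ (ofStep n g).coordGraph k) :
    ∃ q' ∈ (ofStep m g').coordGraph k, edist q q' ≤ ENNReal.ofReal (δ + δ) := by
  obtain ⟨t, y, rfl, ht1, ht2⟩ := (mem_coordGraph_ofStep n g k q).1 hq
  obtain ⟨s, rfl⟩ := lam.surjective t
  have hts : |((lam s : I) : ℝ) - s| ≤ δ := by
    have := (h2 s).le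
    rwa [Subtype.dist_eq, Real.dist_eq] at this
  have hval : |Cadlag.step n g (lam s) k - Cadlag.step m g' s k| ≤ δ :=
    (abs_coord_sub_le _ _ k).trans (h1 s).le
  by_cases ht : lam s ∈ Cadlag.grid n
  · have hmem := Cadlag.grid_subset n ht
    have hs0 : 0 < s := by
      rw [← lam.lt_iff_lt, show lam 0 = 0 from lam.map_bot]; exact hmem.1
    have hs1 : s < 1 := by
      rw [← lam.lt_iff_lt, show lam 1 = 1 from lam.map_top]; exact hmem.2
    have hleft : |(Cadlag.step n g).left (lam s) k - (Cadlag.step m g').left s k| ≤ δ :=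
      (abs_coord_sub_le _ _ k).trans (dist_left_le_of_iso h1 hs0)
    obtain ⟨y', hy', hyy⟩ := exists_mem_uIcc_abs_sub_le hleft hval (ht1 ht)
    refine ⟨WithLp.toLp 2 ((s : ℝ), y'), (mem_coordGraph_ofStep m g' k _).2
      ⟨s, y', rfl, fun _ => hy', fun hs => ?_⟩, edist_plane_le hts hyy⟩
    -- Off the second grid the step function is continuous, so the segment between left limit and
    -- value is a point, which lies on the graph.
    have he : (Cadlag.step m g').left s = Cadlag.step m g' s :=
      Cadlag.left_eq_of_notMem_disc hs1 fun h => hs (Cadlag.disc_step_subset m g' h)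
    rw [he, uIcc_self] at hy'
    exact hy'
  · refine ⟨WithLp.toLp 2 ((s : ℝ), Cadlag.step m g' s k), (mem_coordGraph_ofStep m g' k _).2
      ⟨s, _, rfl, fun _ => right_mem_uIcc, fun _ => rfl⟩, edist_plane_le hts ?_⟩
    rw [ht2 ht]; exact hval

/-- The `J₁` distance of step functions controls the distance of the step functions with trivial
excursions. -/
lemma edist_ofStep_le {n m : ℕ} (hn : 0 < n) (hm : 0 < m) {g g' : ℕ → Vec d} {δ : ℝ}
    (h : j1EDist (Cadlag.step n g) (Cadlag.step m g') < ENNReal.ofReal δ) :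
    edist (ofStep n g) (ofStep m g') ≤ ENNReal.ofReal (3 * δ) := by
  obtain ⟨lam, h1, h2⟩ := exists_iso_of_j1EDist_lt h
  have hδ : 0 ≤ δ := dist_nonneg.trans (h2 0).le
  have h1' : ∀ t, dist (Cadlag.step m g' (lam.symm t)) (Cadlag.step n g t) < δ := fun t => by
    have := h1 (lam.symm t)
    rwa [lam.apply_symm_apply, dist_comm] at this
  have h2' : ∀ t, dist (lam.symm t) t < δ := fun t => by
    have := h2 (lam.symm t)
    rwa [lam.apply_symm_apply, dist_comm] at this
  have hgraph : graphEDist (ofStep n g) (ofStep m g') ≤ ENNReal.ofReal (δ + δ) :=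
    iSup_le fun k => Metric.hausdorffEDist_le_of_mem_edist
      (fun q hq => exists_mem_coordGraph_ofStep h1 h2 k hq)
      (fun q hq => exists_mem_coordGraph_ofStep h1' h2' k hq)
  have hrep : reparamEDist (ofStep n g).unfolded (ofStep m g').unfolded ≤ ENNReal.ofReal δ := by
    refine (reparamEDist_triangle _ (Cadlag.step n g) _).trans ?_
    rw [reparamEDist_unfolded_ofStep hn, zero_add]
    refine (reparamEDist_triangle _ (Cadlag.step m g') _).trans ?_
    rw [reparamEDist_comm (Cadlag.step m g'), reparamEDist_unfolded_ofStep hm, add_zero]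
    exact iInf_le_of_le lam (iSup_le fun t => edist_le_ofReal_of_dist_le (h1 t).le)
  refine (add_le_add hgraph hrep).trans ?_
  rw [← ENNReal.ofReal_add (by positivity) hδ]
  exact ENNReal.ofReal_le_ofReal (by linarith)

end Decorated

end DecoratedLevy

namespace DecoratedLevy

namespace Decorated

variable {d : ℕ} (w : Decorated d)

/-! ### From closeness of unfoldings with their times to closeness of decorated functions -/

open Classical in
/-- The time to which the point `x` of `[0,1+s]` belongs. -/
noncomputable def time (x : ℝ) : I :=
  if h : ∃ t, w.preShift t ≤ x ∧ x ≤ w.shift t then h.choose else 0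

lemma time_eq {x : ℝ} {t : I} (h1 : w.preShift t ≤ x) (h2 : x ≤ w.shift t) : w.time x = t := by
  have h : ∃ t, w.preShift t ≤ x ∧ x ≤ w.shift t := ⟨t, h1, h2⟩
  rw [time, dif_pos h]
  obtain ⟨h3, h4⟩ := h.choose_spec
  refine le_antisymm ?_ ?_ <;> by_contra hc <;> have := w.shift_lt_preShift (not_le.1 hc) <;>
    linarith

lemma path_mem_coordGraph (t : I) (k : Fin d) :
    WithLp.toLp 2 ((t : ℝ), w.path t k) ∈ w.coordGraph k := by
  refine (w.mem_coordGraph k _).2 ⟨t, _, rfl, fun h => ?_, fun _ => rfl⟩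
  have := w.exc_one ⟨t, h⟩
  simp only at this
  rw [← this]
  exact ⟨ciInf_le ((w.exc ⟨t, h⟩).bddBelow_coord k) 1, le_ciSup ((w.exc ⟨t, h⟩).bddAbove_coord k) 1⟩

lemma stretched_mem_coordGraph {x : ℝ} (h0 : 0 ≤ x) (h1 : x ≤ 1 + w.totalLen) (k : Fin d) :
    WithLp.toLp 2 ((w.time x : ℝ), w.stretched x k) ∈ w.coordGraph k := by
  obtain ⟨t, ht1, ht2⟩ := w.exists_preShift_le_le_shift h0 h1
  rw [w.time_eq ht1 ht2]
  by_cases ht : t ∈ w.times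
  · refine (w.mem_coordGraph k _).2 ⟨t, _, rfl, fun h => ?_, fun h => absurd ht h⟩
    rw [w.stretched_of_mem (τ := ⟨t, ht⟩) ⟨ht1, ht2⟩]
    exact ⟨ciInf_le ((w.exc ⟨t, h⟩).bddBelow_coord k) _,
      le_ciSup ((w.exc ⟨t, h⟩).bddAbove_coord k) _⟩
  · have : x = w.shift t := le_antisymm ht2 (w.shift_eq_preShift ht ▸ ht1)
    rw [this, w.stretched_shift]
    exact w.path_mem_coordGraph t k

lemma left_mem_coordGraph {t : I} (ht1 : t < 1) (k : Fin d) :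
    WithLp.toLp 2 ((t : ℝ), w.path.left t k) ∈ w.coordGraph k := by
  by_cases ht : t ∈ w.times
  · refine (w.mem_coordGraph k _).2 ⟨t, _, rfl, fun h => ?_, fun h => absurd ht h⟩
    have := w.exc_zero ⟨t, h⟩
    simp only at this
    rw [← this]
    exact ⟨ciInf_le ((w.exc ⟨t, h⟩).bddBelow_coord k) _,
      le_ciSup ((w.exc ⟨t, h⟩).bddAbove_coord k) _⟩
  · rw [Cadlag.left_eq_of_notMem_disc ht1 fun h => ht (w.disc_subset h)]
    exact w.path_mem_coordGraph t k

lemma stretched_preShift {t : I} (ht1 : t < 1) :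
    w.stretched (w.preShift t) = w.path.left t := by
  by_cases ht : t ∈ w.times
  · rw [w.stretched_of_mem (τ := ⟨t, ht⟩) ⟨le_rfl, w.preShift_le_shift t⟩]
    simp only [sub_self, zero_div, projIcc_left]
    exact w.exc_zero ⟨t, ht⟩
  · rw [← w.shift_eq_preShift ht, w.stretched_shift,
      Cadlag.left_eq_of_notMem_disc ht1 fun h => ht (w.disc_subset h)]

/-- Before a time `t`, the path and the excursions are close to the left limit of the path. -/
lemma eventually_exc_close (t : I) {ε : ℝ} (hε : 0 < ε) :
    ∀ᶠ s : I in 𝓝[<] t, ∀ τ : w.times, s < (τ : I) → (τ : I) < t →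
      ∀ a, dist (w.exc τ a) (w.path.left t) ≤ ε := by
  -- Only finitely many excursions are large, and `s` is taken beyond all of those that precede `t`.
  -- The others have small diameter and end at `w.path τ`, which is close to the left limit.
  set F : Set I := Subtype.val '' {τ : w.times | ε / 2 < Metric.diam (range (w.exc τ))}
  have hF : F.Finite := (w.finite_large (ε / 2) (half_pos hε)).image _
  have h1 : ∀ᶠ s in 𝓝[<] t, ∀ τ ∈ F, τ < t → τ ≤ s := by
    rw [hF.eventually_all]
    intro τ _
    by_cases h : τ < t
    · filter_upwards [Ioo_mem_nhdsLT h] with s hs _ using hs.1.le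
    · exact Eventually.of_forall fun s h' => absurd h' h
  filter_upwards [h1, w.path.eventually_osc_left t (half_pos hε)] with s hs1 hs2 τ hsτ hτt a
  have hτF : (τ : I) ∉ F := fun h => absurd (hs1 τ h hτt) (not_le.2 hsτ)
  have hdiam : Metric.diam (range (w.exc τ)) ≤ ε / 2 := by
    by_contra hc
    exact hτF ⟨τ, not_le.1 hc, rfl⟩
  have hd := (Metric.dist_le_diam_of_mem (w.exc τ).isBounded_range (mem_range_self a)
    (mem_range_self 1)).trans hdiam
  rw [w.exc_one] at hd
  have := hs2 τ hsτ.le hτt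
  exact (dist_triangle _ _ _).trans (by linarith)

lemma tendsto_stretched_left {t : I} (ht : 0 < t) :
    Tendsto w.stretched (𝓝[<] (w.preShift t)) (𝓝 (w.path.left t)) := by
  rw [Metric.tendsto_nhds]
  intro ε hε
  have hne : (𝓝[<] t).NeBot := nhdsLT_neBot_of_exists_lt ⟨0, ht⟩
  obtain ⟨s, h1, h2, hst⟩ := ((w.eventually_exc_close t (half_pos hε)).and
    ((w.path.eventually_osc_left t (half_pos hε)).and
      (self_mem_nhdsWithin : ∀ᶠ s in 𝓝[<] t, s ∈ Iio t))).exists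
  filter_upwards [Ico_mem_nhdsLT (w.shift_lt_preShift hst)] with x hx
  exact (w.dist_stretched_le (fun y hy1 hy2 => (h2 y hy1 hy2).le) h1 hx).trans_lt (half_lt_self hε)

/-- A discrete intermediate value theorem. -/
lemma exists_consecutive_uIcc {h : ℕ → ℝ} {y : ℝ} {i j : ℕ} (hij : i ≤ j)
    (hy : y ∈ uIcc (h i) (h j)) (hne : i ≠ j) :
    ∃ m, i ≤ m ∧ m < j ∧ y ∈ uIcc (h m) (h (m + 1)) := by
  induction j, hij using Nat.le_induction with
  | base => exact absurd rfl hne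
  | succ j hij ih =>
    by_cases h1 : y ∈ uIcc (h j) (h (j + 1))
    · exact ⟨j, hij, by omega, h1⟩
    · have h2 : y ∈ uIcc (h i) (h j) := by
        rcases uIcc_subset_uIcc_union_uIcc (b := h j) hy with h2 | h2
        · exact h2
        · exact absurd h2 h1
      by_cases hij' : i = j
      · subst hij'
        rw [uIcc_self] at h2
        exact absurd (by rw [show y = h i from h2]; exact left_mem_uIcc) h1
      · obtain ⟨m, hm1, hm2, hm3⟩ := ih h2 hij'
        exact ⟨m, hm1, by omega, hm3⟩

lemma step_left_gridPoint {n m : ℕ} (hn : 0 < n) (g : ℕ → Vec d) (hm : m + 1 ≤ n) :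
    (Cadlag.step n g).left (gridPoint n (m + 1)) = g m := by
  have hn' : (0 : ℝ) < n := Nat.cast_pos.2 hn
  have hpos : (0 : I) < gridPoint n (m + 1) := by
    change (0 : ℝ) < _
    rw [coe_gridPoint hm]; positivity
  rw [Cadlag.left_step n g hpos, coe_gridPoint hm, mul_div_cancel₀ _ hn'.ne', Nat.ceil_natCast]
  simp

lemma step_gridPoint {n m : ℕ} (hn : 0 < n) (g : ℕ → Vec d) (hm : m ≤ n) :
    Cadlag.step n g (gridPoint n m) = g m := by
  have hn' : (0 : ℝ) < n := Nat.cast_pos.2 hn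
  rw [step_apply, coe_gridPoint hm, mul_div_cancel₀ _ hn'.ne', Nat.floor_natCast]

/-- A point of the plane over which the graph of a step function with trivial excursions passes. -/
lemma exists_mem_coordGraph_ofStep_between {n : ℕ} (hn : 0 < n) (g : ℕ → Vec d) (k : Fin d)
    {y₁ y₂ z τ η ε : ℝ} (hy₁ : y₁ ∈ Ico (0 : ℝ) 1) (hy₂ : y₂ ∈ Ico (0 : ℝ) 1)
    (h₁ : |τ - y₁| ≤ η) (h₂ : |τ - y₂| ≤ η)
    (hg₁ : g ⌊(n : ℝ) * y₁⌋₊ k ≤ z + ε) (hg₂ : z - ε ≤ g ⌊(n : ℝ) * y₂⌋₊ k) (hε : 0 ≤ ε) :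
    ∃ q ∈ (ofStep n g).coordGraph k, edist (WithLp.toLp 2 (τ, z)) q ≤ ENNReal.ofReal (η + ε) := by
  have hn' : (0 : ℝ) < n := Nat.cast_pos.2 hn
  -- If one of the two values is within `ε` of `z`, the corresponding point of the path serves.
  by_cases hc1 : z - ε ≤ g ⌊(n : ℝ) * y₁⌋₊ k
  · refine ⟨_, (ofStep n g).path_mem_coordGraph ⟨y₁, hy₁.1, hy₁.2.le⟩ k, edist_plane_le h₁ ?_⟩
    change |z - g ⌊(n : ℝ) * y₁⌋₊ k| ≤ ε
    rw [abs_le]; constructor <;> linarith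
  by_cases hc2 : g ⌊(n : ℝ) * y₂⌋₊ k ≤ z + ε
  · refine ⟨_, (ofStep n g).path_mem_coordGraph ⟨y₂, hy₂.1, hy₂.2.le⟩ k, edist_plane_le h₂ ?_⟩
    change |z - g ⌊(n : ℝ) * y₂⌋₊ k| ≤ ε
    rw [abs_le]; constructor <;> linarith
  rw [not_le] at hc1 hc2
  -- Otherwise `z` lies strictly between the two values and hence between two consecutive ones, so
  -- the vertical segment over the grid point `(m+1)/n` contains the height `z`. That grid point
  -- lies between the two times and is therefore as close to `τ` as they are.
  have aux : ∀ {y₁ y₂ : ℝ}, y₁ ∈ Ico (0 : ℝ) 1 → y₂ ∈ Ico (0 : ℝ) 1 → |τ - y₁| ≤ η →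
      |τ - y₂| ≤ η → ⌊(n : ℝ) * y₁⌋₊ < ⌊(n : ℝ) * y₂⌋₊ →
      z ∈ uIcc (g ⌊(n : ℝ) * y₁⌋₊ k) (g ⌊(n : ℝ) * y₂⌋₊ k) →
      ∃ q ∈ (ofStep n g).coordGraph k,
        edist (WithLp.toLp 2 (τ, z)) q ≤ ENNReal.ofReal (η + ε) := by
    intro y₁ y₂ hy₁ hy₂ h₁ h₂ hlt hz
    obtain ⟨m, hm1, hm2, hm3⟩ := exists_consecutive_uIcc (h := fun j => g j k) hlt.le hz hlt.ne
    have hmn : m + 1 < n := by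
      have h1 : (⌊(n : ℝ) * y₂⌋₊ : ℝ) ≤ n * y₂ := Nat.floor_le (mul_nonneg hn'.le hy₂.1)
      have h2 : (⌊(n : ℝ) * y₂⌋₊ : ℝ) < n := by nlinarith [hy₂.2]
      have h3 : ⌊(n : ℝ) * y₂⌋₊ < n := by exact_mod_cast h2
      omega
    have hc := coe_gridPoint hmn.le
    refine ⟨WithLp.toLp 2 ((gridPoint n (m + 1) : ℝ), z), (mem_coordGraph_ofStep n g k _).2
      ⟨gridPoint n (m + 1), z, rfl, fun _ => ?_, fun h => absurd ⟨m + 1, by omega, hmn, hc⟩ h⟩,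
      edist_plane_le ?_ (by simpa using hε)⟩
    · rw [step_left_gridPoint hn g hmn.le, step_gridPoint hn g hmn.le]
      exact hm3
    · rw [hc]
      have e1 : y₁ ≤ ((m + 1 : ℕ) : ℝ) / n := by
        rw [le_div_iff₀ hn']
        have := Nat.lt_floor_add_one ((n : ℝ) * y₁)
        have hm1' : (⌊(n : ℝ) * y₁⌋₊ : ℝ) ≤ m := by exact_mod_cast hm1
        push_cast
        linarith
      have e2 : ((m + 1 : ℕ) : ℝ) / n ≤ y₂ := by
        rw [div_le_iff₀ hn']
        have := Nat.floor_le (mul_nonneg hn'.le hy₂.1)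
        have hm2' : ((m + 1 : ℕ) : ℝ) ≤ ⌊(n : ℝ) * y₂⌋₊ := by exact_mod_cast hm2
        linarith
      rw [abs_le] at h₁ h₂ ⊢
      constructor <;> linarith
  rcases lt_trichotomy ⌊(n : ℝ) * y₁⌋₊ ⌊(n : ℝ) * y₂⌋₊ with h | h | h
  · exact aux hy₁ hy₂ h₁ h₂ h (by rw [uIcc_of_le (by linarith)]; constructor <;> linarith)
  · rw [h] at hc1; linarith
  · exact aux hy₂ hy₁ h₂ h₁ h (by rw [uIcc_of_ge (by linarith)]; constructor <;> linarith)

lemma exists_mem_Icc_abs_sub_le_of_uIcc {a b p q z η : ℝ} (hpq : p ≤ q)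
    (ha : p - η ≤ a ∧ a ≤ q + η) (hb : p - η ≤ b ∧ b ≤ q + η) (hη : 0 ≤ η) (hz : z ∈ uIcc a b) :
    ∃ y ∈ Icc p q, |z - y| ≤ η := by
  have h1 : p - η ≤ z := le_trans (le_inf ha.1 hb.1) hz.1
  have h2 : z ≤ q + η := hz.2.trans (sup_le ha.2 hb.2)
  refine ⟨max p (min z q), ⟨le_max_left _ _, max_le hpq (min_le_right _ _)⟩, ?_⟩
  rw [abs_le]
  constructor <;> rcases max_cases p (min z q) with h3 | h3 <;>
    rcases min_cases z q with h4 | h4 <;> linarith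

/-- If the unfolding of `w`, with its times, is close to a step function up to reparametrisation,
then `w` is close to the step function with trivial excursions. -/
lemma edist_ofStep_le_of_reparamClose {n : ℕ} (hn : 0 < n) (g : ℕ → Vec d) {η : ℝ} (hη : 0 < η)
    (h : ReparamClose η (fun x => ((w.time x : ℝ), w.stretched x))
      (fun y => (y, g ⌊(n : ℝ) * y⌋₊)) 0 (1 + w.totalLen) 0 1)
    (hend : dist (w.path 1) (g n) ≤ η) :
    edist (ofStep n g) w ≤ ENNReal.ofReal (4 * η) := by
  have hn' : (0 : ℝ) < n := Nat.cast_pos.2 hn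
  have hs := w.totalLen_nonneg
  obtain ⟨φ, h0, h1, hφ⟩ := h
  have hval : ∀ x, 0 ≤ x → x < 1 + w.totalLen →
      |(w.time x : ℝ) - φ x| ≤ η ∧ dist (w.stretched x) (g ⌊(n : ℝ) * φ x⌋₊) ≤ η := by
    intro x hx0 hx1
    have := hφ x hx0 hx1
    rw [Prod.dist_eq, Real.dist_eq] at this
    exact max_le_iff.1 this
  have hφmem : ∀ x, 0 ≤ x → x < 1 + w.totalLen → φ x ∈ Ico (0 : ℝ) 1 := by
    intro x hx0 hx1
    refine ⟨?_, ?_⟩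
    · rw [← h0]; exact φ.monotone hx0
    · rw [← h1]; exact φ.strictMono hx1
  have hsymm : ∀ y, 0 ≤ y → y < 1 → 0 ≤ φ.symm y ∧ φ.symm y < 1 + w.totalLen := by
    intro y hy0 hy1
    refine ⟨?_, ?_⟩
    · rw [φ.le_symm_apply, h0]; exact hy0
    · rw [φ.symm_apply_lt, h1]; exact hy1
  have hval' : ∀ y, 0 ≤ y → y < 1 → |y - (w.time (φ.symm y) : ℝ)| ≤ η ∧
      dist (w.stretched (φ.symm y)) (g ⌊(n : ℝ) * y⌋₊) ≤ η := by
    intro y hy0 hy1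
    have := hval _ (hsymm y hy0 hy1).1 (hsymm y hy0 hy1).2
    rwa [φ.apply_symm_apply, abs_sub_comm] at this
  -- the unfolded functions
  have hrep : reparamEDist (ofStep n g).unfolded w.unfolded ≤ ENNReal.ofReal η := by
    refine (reparamEDist_triangle _ (Cadlag.step n g) _).trans ?_
    rw [reparamEDist_unfolded_ofStep hn, zero_add, reparamEDist_comm]
    have := reparamEDist_le_of_reparamClose (b := 1 + w.totalLen) (b' := 1) (by linarith) one_pos
      (η := η) (f := w.stretched) (g := fun y => g ⌊(n : ℝ) * y⌋₊)
      ⟨φ, h0, h1, fun x hx0 hx1 => (hval x hx0 hx1).2⟩ (by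
        rw [← w.shift_one, w.stretched_shift]
        simpa using hend)
    simp only [mul_one] at this
    exact this
  -- the graphs
  have hgraph : graphEDist (ofStep n g) w ≤ ENNReal.ofReal (η + 2 * η) := by
    refine iSup_le fun k => Metric.hausdorffEDist_le_of_mem_edist ?_ ?_
    · intro q hq
      obtain ⟨y, z, rfl, hy1, hy2⟩ := (mem_coordGraph_ofStep n g k q).1 hq
      -- Over a grid point there is a vertical segment. Its upper time end, the value at `y`, is
      -- seen by `w` at `x = φ⁻¹ y`; the left limit is seen at the points just before `x`, which `φ`
      -- maps into the preceding cell.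
      by_cases hgrid : y ∈ Cadlag.grid n
      · have hmem := Cadlag.grid_subset n hgrid
        have hypos : (0 : ℝ) < y := hmem.1
        have hylt : (y : ℝ) < 1 := hmem.2
        obtain ⟨hx0, hx1⟩ := hsymm y hypos.le hylt
        obtain ⟨ht, hv⟩ := hval' y hypos.le hylt
        set x := φ.symm y with hx
        have hne : (𝓝[<] x).NeBot := inferInstance
        have hxpos : 0 < x := by rw [hx, φ.lt_symm_apply, h0]; exact hypos
        have hφx : φ x = y := φ.apply_symm_apply _
        have htend : Tendsto φ (𝓝[<] x) (𝓝[<] (y : ℝ)) := by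
          rw [← hφx]
          exact tendsto_nhdsWithin_of_tendsto_nhds_of_eventually_within _
            (φ.continuous.continuousWithinAt)
            (by filter_upwards [self_mem_nhdsWithin] with s hs using φ.strictMono hs)
        obtain ⟨t, ht1, ht2⟩ := w.exists_preShift_le_le_shift hx0 hx1.le
        have hleft : ∀ᶠ x' in 𝓝[<] x,
            dist (w.stretched x') ((Cadlag.step n g).left y) ≤ η := by
          obtain ⟨j, hj1, hj2, hj3⟩ := hgrid
          have hjle : ((j - 1 : ℕ) : ℝ) / n < y := by
            rw [hj3]; gcongr; omega
          filter_upwards [htend (Ioo_mem_nhdsLT hjle), Ioo_mem_nhdsLT hxpos] with x' hx' hx''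
          have h3 := (hval x' hx''.1.le (hx''.2.trans hx1)).2
          have hfl : ⌊(n : ℝ) * φ x'⌋₊ = j - 1 := by
            have e1 := hx'.1
            have e2 := hx'.2
            rw [div_lt_iff₀ hn'] at e1
            rw [hj3, lt_div_iff₀ hn'] at e2
            refine (Nat.floor_eq_iff (by nlinarith [(Nat.cast_nonneg (j - 1) :
              (0 : ℝ) ≤ ((j - 1 : ℕ) : ℝ))])).2 ⟨by linarith, ?_⟩
            have : ((j - 1 : ℕ) : ℝ) + 1 = j := by
              rw [Nat.cast_sub hj1]; simp
            linarith
          rw [hfl] at h3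
          rw [Cadlag.left_step n g hmem.1, hj3, mul_div_cancel₀ _ hn'.ne', Nat.ceil_natCast]
          exact h3
        rcases ht1.eq_or_lt with heq | hlt
        -- Here `x` is the first point that belongs to `t`, so the points before it belong to
        -- earlier times and their values tend to the left limit of the path at `t`. Both ends of
        -- the segment are then within `η` of this left limit, which lies on the graph.
        · have htime : w.time x = t := w.time_eq ht1 ht2
          have ht0 : 0 < t := by
            rcases eq_or_lt_of_le (show 0 ≤ t from t.2.1) with h | h
            · rw [← h, ← w.shift_eq_preShift w.zero_notMem_times, w.shift_zero] at heq
              exact absurd heq hxpos.ne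
            · exact h
          have ht1' : t < 1 := by
            rcases eq_or_lt_of_le (show t ≤ 1 from t.2.2) with h | h
            · rw [h, ← w.shift_eq_preShift w.one_notMem_times, w.shift_one] at heq
              exact absurd heq hx1.ne'
            · exact h
          have hL1 : dist (w.path.left t) ((Cadlag.step n g).left y) ≤ η := by
            refine le_of_tendsto ((w.tendsto_stretched_left ht0).dist tendsto_const_nhds) ?_
            rw [heq]; exact hleft
          have hL2 : dist (w.path.left t) (Cadlag.step n g y) ≤ η := by
            rw [← w.stretched_preShift ht1', heq]; exact hv
          refine ⟨_, w.left_mem_coordGraph ht1' k, edist_plane_le (by rwa [← htime]) ?_⟩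
          have e1 := abs_le.1 ((abs_coord_sub_le _ _ k).trans hL1)
          have e2 := abs_le.1 ((abs_coord_sub_le _ _ k).trans hL2)
          obtain ⟨y', hy', hyy'⟩ := exists_mem_Icc_abs_sub_le_of_uIcc (le_refl (w.path.left t k))
            (η := η) ⟨by linarith, by linarith⟩ ⟨by linarith, by linarith⟩ hη.le (hy1 hgrid)
          rw [Icc_self] at hy'
          rw [← show y' = _ from hy']
          linarith
        -- Here `x` is strictly inside the interval inserted at `t`, and points just before it are
        -- in the same interval. Both ends of the segment are within `η` of values of one excursion,
        -- hence the segment is within `η` of the side of its box.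
        · have htime : w.time x = t := w.time_eq ht1 ht2
          have hT : t ∈ w.times := by
            by_contra hc
            exact (hlt.trans_le ht2).ne (w.shift_eq_preShift hc).symm
          obtain ⟨x', hx'1, hx'2⟩ := (hleft.and (Ioo_mem_nhdsLT hlt :
            ∀ᶠ x' in 𝓝[<] x, x' ∈ Ioo (w.preShift t) x)).exists
          have hx'3 := w.stretched_of_mem (τ := ⟨t, hT⟩) (x := x')
            ⟨hx'2.1.le, hx'2.2.le.trans ht2⟩
          have hx3 := w.stretched_of_mem (τ := ⟨t, hT⟩) (x := x) ⟨hlt.le, ht2⟩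
          have e1 := abs_le.1 ((abs_coord_sub_le _ _ k).trans hx'1)
          have e2 := abs_le.1 ((abs_coord_sub_le _ _ k).trans hv)
          rw [hx'3] at e1
          rw [hx3] at e2
          have b1 := fun a => ciInf_le ((w.exc ⟨t, hT⟩).bddBelow_coord k) a
          have b2 := fun a => le_ciSup ((w.exc ⟨t, hT⟩).bddAbove_coord k) a
          obtain ⟨y', hy', hyy'⟩ := exists_mem_Icc_abs_sub_le_of_uIcc
            ((b1 0).trans (b2 0)) (η := η)
            (a := (Cadlag.step n g).left y k) (b := Cadlag.step n g y k)
            ⟨by linarith [b1 (projIcc 0 1 zero_le_one ((x' - w.preShift t) / w.len ⟨t, hT⟩))],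
              by linarith [b2 (projIcc 0 1 zero_le_one ((x' - w.preShift t) / w.len ⟨t, hT⟩))]⟩
            ⟨by have := b1 (projIcc 0 1 zero_le_one ((x - w.preShift t) / w.len ⟨t, hT⟩))
                change _ ≤ g ⌊(n : ℝ) * y⌋₊ k
                linarith,
              by have := b2 (projIcc 0 1 zero_le_one ((x - w.preShift t) / w.len ⟨t, hT⟩))
                 change g ⌊(n : ℝ) * y⌋₊ k ≤ _
                 linarith⟩ hη.le (hy1 hgrid)
          refine ⟨WithLp.toLp 2 ((t : ℝ), y'), (w.mem_coordGraph k _).2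
            ⟨t, y', rfl, fun _ => hy', fun h => absurd hT h⟩,
            edist_plane_le (by rwa [← htime]) (by linarith)⟩
      · rw [hy2 hgrid]
        rcases eq_or_lt_of_le (show y ≤ 1 from y.2.2) with h | h
        · rw [h]
          refine ⟨_, w.path_mem_coordGraph 1 k, edist_plane_le (by simpa using hη.le) ?_⟩
          refine (abs_coord_sub_le _ _ k).trans ?_
          rw [step_apply, dist_comm]
          simp only [Icc.coe_one, mul_one, Nat.floor_natCast]
          linarith
        · obtain ⟨ht, hv⟩ := hval' y y.2.1 h
          obtain ⟨hx0, hx1⟩ := hsymm y y.2.1 h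
          refine ⟨_, w.stretched_mem_coordGraph hx0 hx1.le k, edist_plane_le ht ?_⟩
          refine (abs_coord_sub_le _ _ k).trans ?_
          rw [step_apply, dist_comm]
          linarith
    · intro q hq
      obtain ⟨t, z, rfl, ht1, ht2⟩ := (w.mem_coordGraph k q).1 hq
      by_cases hT : t ∈ w.times
      · have hmem := w.times_subset hT
        have hz := ht1 hT
        -- The infimum and supremum over the excursion need not be attained, so parameters with
        -- values below `z + η` and above `z - η` are taken. Their images under `φ` are two times
        -- close to `t` between which the step function crosses the height `z`, up to `2η`.
        obtain ⟨a₁, ha₁⟩ : ∃ a, w.exc ⟨t, hT⟩ a k < z + η :=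
          exists_lt_of_ciInf_lt (lt_of_le_of_lt hz.1 (by linarith))
        obtain ⟨a₂, ha₂⟩ : ∃ a, z - η < w.exc ⟨t, hT⟩ a k :=
          exists_lt_of_lt_ciSup (lt_of_lt_of_le (by linarith) hz.2)
        have hlen := w.shift_eq_preShift_add ⟨t, hT⟩
        have hlp := w.len_pos ⟨t, hT⟩
        simp only at hlen
        have hx : ∀ a : I, ∃ y ∈ Ico (0 : ℝ) 1, |(t : ℝ) - y| ≤ η ∧
            dist (w.exc ⟨t, hT⟩ a) (g ⌊(n : ℝ) * y⌋₊) ≤ η := by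
          intro a
          have hx1 : w.preShift t ≤ w.preShift t + a * w.len ⟨t, hT⟩ := by
            have := mul_nonneg a.2.1 hlp.le
            linarith
          have hx2 : w.preShift t + a * w.len ⟨t, hT⟩ ≤ w.shift t := by
            have := mul_le_of_le_one_left hlp.le a.2.2
            linarith
          have hx0 : 0 ≤ w.preShift t + a * w.len ⟨t, hT⟩ := by
            refine le_trans ?_ hx1
            rw [← w.shift_zero]
            exact (w.shift_lt_preShift hmem.1).le
          have hx3 : w.preShift t + a * w.len ⟨t, hT⟩ < 1 + w.totalLen := by
            refine lt_of_le_of_lt hx2 ?_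
            rw [← w.shift_one]
            exact w.strictMono_shift hmem.2
          obtain ⟨e1, e2⟩ := hval _ hx0 hx3
          rw [w.time_eq hx1 hx2] at e1
          rw [w.stretched_of_mem (τ := ⟨t, hT⟩) ⟨hx1, hx2⟩] at e2
          simp only [add_sub_cancel_left, mul_div_cancel_right₀ _ hlp.ne', projIcc_val] at e2
          exact ⟨_, hφmem _ hx0 hx3, e1, e2⟩
        obtain ⟨y₁, hy₁, ht₁, hd₁⟩ := hx a₁
        obtain ⟨y₂, hy₂, ht₂, hd₂⟩ := hx a₂
        have e1 := abs_le.1 ((abs_coord_sub_le _ _ k).trans hd₁)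
        have e2 := abs_le.1 ((abs_coord_sub_le _ _ k).trans hd₂)
        exact exists_mem_coordGraph_ofStep_between hn g k hy₁ hy₂ ht₁ ht₂ (by linarith)
          (by linarith) (by linarith)
      · rw [ht2 hT]
        rcases eq_or_lt_of_le (show t ≤ 1 from t.2.2) with h | h
        · rw [h]
          refine ⟨_, (ofStep n g).path_mem_coordGraph 1 k, edist_plane_le (by simpa using hη.le) ?_⟩
          refine (abs_coord_sub_le _ _ k).trans ?_
          change dist _ (g ⌊(n : ℝ) * ((1 : I) : ℝ)⌋₊) ≤ _
          simp only [Icc.coe_one, mul_one, Nat.floor_natCast]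
          linarith
        · have hx0 : 0 ≤ w.shift t := by
            rw [← w.shift_zero]
            exact w.strictMono_shift.monotone (show 0 ≤ t from t.2.1)
          have hx3 : w.shift t < 1 + w.totalLen := by
            rw [← w.shift_one]
            exact w.strictMono_shift h
          obtain ⟨e1, e2⟩ := hval _ hx0 hx3
          rw [w.time_eq (w.preShift_le_shift t) le_rfl] at e1
          rw [w.stretched_shift] at e2
          have hy := hφmem _ hx0 hx3
          refine ⟨_, (ofStep n g).path_mem_coordGraph ⟨φ (w.shift t), hy.1, hy.2.le⟩ k,
            edist_plane_le e1 ?_⟩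
          refine (abs_coord_sub_le _ _ k).trans ?_
          change dist _ (g ⌊(n : ℝ) * φ (w.shift t)⌋₊) ≤ _
          linarith
  refine (add_le_add hgraph hrep).trans ?_
  rw [← ENNReal.ofReal_add (by positivity) hη.le]
  exact ENNReal.ofReal_le_ofReal (by linarith)

end Decorated

end DecoratedLevy

namespace DecoratedLevy

/-! ### Profiles -/

section ProfileBounds

variable {d : ℕ} {ι : Type*}

lemma exists_profile_bound [Finite ι] (P : ι → Cadlag d) : ∃ C : ℝ, 1 ≤ C ∧ ∀ i t, ‖P i t‖ ≤ C := by
  have h : ∀ i, ∃ C, ∀ t, ‖P i t‖ ≤ C := fun i => by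
    obtain ⟨C, hC⟩ := (P i).isBounded_range.exists_norm_le
    exact ⟨C, fun t => hC _ (mem_range_self t)⟩
  choose C hC using h
  obtain ⟨B, hB⟩ := (Set.finite_range C).bddAbove
  exact ⟨max 1 B, le_max_left _ _, fun i t =>
    ((hC i t).trans (hB (mem_range_self i))).trans (le_max_right _ _)⟩

lemma norm_closestProfile_le {ω : ι → Sph d} {P : ι → Cadlag d} {C : ℝ} (hC1 : 1 ≤ C)
    (hC : ∀ i t, ‖P i t‖ ≤ C) (y : Vec d) (t : I) : ‖closestProfile ω P y t‖ ≤ C := by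
  unfold closestProfile
  split_ifs with h
  · exact hC _ t
  · simpa [zeroPath] using zero_le_one.trans hC1

lemma norm_idealExcursion_le {ω : ι → Sph d} {P : ι → Cadlag d} {C : ℝ} (hC1 : 1 ≤ C)
    (hC : ∀ i t, ‖P i t‖ ≤ C) (V : Vec d) (t : I) :
    ‖idealExcursion ω P V t‖ ≤ (2 * C + 1) * ‖V‖ := by
  have h1 := norm_closestProfile_le (ω := ω) hC1 hC V t
  have h2 := norm_closestProfile_le (ω := ω) hC1 hC V 1
  have hV := norm_nonneg V
  unfold idealExcursion
  refine (norm_add_le _ _).trans ?_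
  rw [norm_smul, norm_smul, norm_norm, Real.norm_of_nonneg t.2.1]
  have h3 : ‖V - ‖V‖ • closestProfile ω P V 1‖ ≤ ‖V‖ + ‖V‖ * C := by
    refine (norm_sub_le _ _).trans ?_
    rw [norm_smul, norm_norm]
    gcongr
  have h4 : (t : ℝ) * ‖V - ‖V‖ • closestProfile ω P V 1‖ ≤ 1 * (‖V‖ + ‖V‖ * C) :=
    mul_le_mul t.2.2 h3 (norm_nonneg _) zero_le_one
  have h5 : ‖V‖ * ‖closestProfile ω P V t‖ ≤ ‖V‖ * C := by gcongr
  linarith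

lemma closestProfile_eq_of_forall_lt {ω : ι → Sph d} {P : ι → Cadlag d} {y : Vec d} (hy : y ≠ 0)
    {i : ι} (h : ∀ j, j ≠ i → dist (‖y‖⁻¹ • y) (ω i : Vec d) < dist (‖y‖⁻¹ • y) (ω j : Vec d)) :
    closestProfile ω P y = P i := by
  have h' : y ≠ 0 ∧ ∃ i, ∀ j, j ≠ i →
      dist (‖y‖⁻¹ • y) (ω i : Vec d) < dist (‖y‖⁻¹ • y) (ω j : Vec d) := ⟨hy, i, h⟩
  rw [closestProfile, dif_pos h']
  congr 1
  by_contra hne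
  have h1 := h'.2.choose_spec i (Ne.symm hne)
  have h2 := h _ hne
  exact lt_asymm h1 h2

/-- Near a multiple of `ω_i`, the closest profile is `P_i`. -/
lemma eventually_closestProfile_eq [Finite ι] {ω : ι → Sph d} (hω : Function.Injective ω)
    (P : ι → Cadlag d) (i : ι) {ρ : ℝ} (hρ : 0 < ρ) :
    ∀ᶠ y in 𝓝 (ρ • (ω i : Vec d)), closestProfile ω P y = P i := by
  have hn : ‖(ω i : Vec d)‖ = 1 := by simp
  have h0 : ρ • (ω i : Vec d) ≠ 0 := by
    rw [smul_ne_zero_iff]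
    exact ⟨hρ.ne', fun h => by rw [h, norm_zero] at hn; exact zero_ne_one hn⟩
  have hval : ‖ρ • (ω i : Vec d)‖⁻¹ • ρ • (ω i : Vec d) = ω i := by
    rw [norm_smul, hn, mul_one, Real.norm_of_nonneg hρ.le, smul_smul, inv_mul_cancel₀ hρ.ne',
      one_smul]
  have hcont : ContinuousAt (fun y : Vec d => ‖y‖⁻¹ • y) (ρ • (ω i : Vec d)) :=
    (continuousAt_id.norm.inv₀ (norm_ne_zero_iff.2 h0)).smul continuousAt_id
  -- At the point itself the normalised vector is `ω i`, with distance 0 to `ω i` and positive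
  -- distance to the other directions. The strict inequalities persist nearby.
  have h1 : ∀ j, ∀ᶠ y in 𝓝 (ρ • (ω i : Vec d)), j ≠ i →
      dist (‖y‖⁻¹ • y) (ω i : Vec d) < dist (‖y‖⁻¹ • y) (ω j : Vec d) := by
    intro j
    by_cases hj : j = i
    · exact Eventually.of_forall fun _ h => absurd hj h
    · have hlt : dist (‖ρ • (ω i : Vec d)‖⁻¹ • ρ • (ω i : Vec d)) (ω i : Vec d)
          < dist (‖ρ • (ω i : Vec d)‖⁻¹ • ρ • (ω i : Vec d)) (ω j : Vec d) := by
        rw [hval, dist_self]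
        exact dist_pos.2 fun h => hj (hω (Subtype.ext h)).symm
      filter_upwards [(hcont.dist continuousAt_const).eventually_lt
        (hcont.dist continuousAt_const) hlt] with y hy _ using hy
  filter_upwards [eventually_all.2 h1, eventually_ne_nhds h0] with y hy hy0
  exact closestProfile_eq_of_forall_lt hy0 hy

/-- The difference consists of `(‖J‖ - ‖V‖) P i` and of the linear correction `V - ‖V‖ ω i`, which
vanishes for `V = J`. Both are of order `‖V - J‖`. -/
lemma dist_idealExcursion_le {ω : ι → Sph d} {P : ι → Cadlag d} (hP : ∀ i, IsProfile (P i) (ω i))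
    {C : ℝ} (hC : ∀ i t, ‖P i t‖ ≤ C) {i : ι} {V J : Vec d} (hJ : J = ‖J‖ • (ω i : Vec d))
    (hV : closestProfile ω P V = P i) (t : I) :
    dist (‖J‖ • P i t) (idealExcursion ω P V t) ≤ (C + 2) * ‖V - J‖ := by
  have hn : ‖(ω i : Vec d)‖ = 1 := by simp
  have h1 : |‖J‖ - ‖V‖| ≤ ‖V - J‖ := by rw [← norm_neg (V - J), neg_sub]; exact abs_norm_sub_norm_le _ _
  unfold idealExcursion
  rw [hV, (hP i).one, dist_eq_norm]
  have e : ‖J‖ • P i t - (‖V‖ • P i t + (t : ℝ) • (V - ‖V‖ • (ω i : Vec d)))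
      = (‖J‖ - ‖V‖) • P i t - (t : ℝ) • ((V - J) + (‖J‖ - ‖V‖) • (ω i : Vec d)) := by
    rw [show (V - J) + (‖J‖ - ‖V‖) • (ω i : Vec d) = V - ‖V‖ • (ω i : Vec d) by
      conv_lhs => rw [sub_smul, ← hJ]
      abel]
    rw [sub_smul]; abel
  rw [e]
  refine (norm_sub_le _ _).trans ?_
  rw [norm_smul, norm_smul, Real.norm_of_nonneg t.2.1, Real.norm_eq_abs]
  have h2 : ‖(V - J) + (‖J‖ - ‖V‖) • (ω i : Vec d)‖ ≤ 2 * ‖V - J‖ := by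
    refine (norm_add_le _ _).trans ?_
    rw [norm_smul, hn, Real.norm_eq_abs, mul_one]
    linarith
  have h3 : (t : ℝ) * ‖(V - J) + (‖J‖ - ‖V‖) • (ω i : Vec d)‖ ≤ 1 * (2 * ‖V - J‖) :=
    mul_le_mul t.2.2 h2 (norm_nonneg _) zero_le_one
  have h4 : |‖J‖ - ‖V‖| * ‖P i t‖ ≤ ‖V - J‖ * C :=
    mul_le_mul h1 (hC i t) (norm_nonneg _) (norm_nonneg _)
  linarith

lemma exists_profileExcursion_eq {ω : ι → Sph d} {P : ι → Cadlag d} {u : Cadlag d} {τ : I}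
    (h : ∃ i, u.jump τ = ‖u.jump τ‖ • (ω i : Vec d)) :
    ∃ i, u.jump τ = ‖u.jump τ‖ • (ω i : Vec d) ∧
      ∀ a, profileExcursion ω P u τ a = u.left τ + ‖u.jump τ‖ • P i a := by
  refine ⟨h.choose, h.choose_spec, fun a => ?_⟩
  rw [profileExcursion, dif_pos h]
  simp [Cadlag.affine]

end ProfileBounds

/-! ### Slowed down paths -/

namespace Cadlag

variable {d : ℕ}

lemma mul_lt_mul_left_I {c s t : I} (hc : 0 < c) (h : s < t) : c * s < c * t := by
  change (c : ℝ) * s < c * t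
  exact mul_lt_mul_of_pos_left h hc

lemma tendsto_mul_left_nhdsLT {c : I} (hc : 0 < c) (t : I) :
    Tendsto (fun s => c * s) (𝓝[<] t) (𝓝[<] (c * t)) :=
  tendsto_nhdsWithin_of_tendsto_nhds_of_eventually_within _
    ((continuous_const_mul c).continuousWithinAt)
    (by filter_upwards [self_mem_nhdsWithin] with s hs using mul_lt_mul_left_I hc hs)

lemma tendsto_mul_left_nhdsGT {c : I} (hc : 0 < c) (t : I) :
    Tendsto (fun s => c * s) (𝓝[>] t) (𝓝[>] (c * t)) :=
  tendsto_nhdsWithin_of_tendsto_nhds_of_eventually_within _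
    ((continuous_const_mul c).continuousWithinAt)
    (by filter_upwards [self_mem_nhdsWithin] with s hs using mul_lt_mul_left_I hc hs)

/-- The slowed down function `t ↦ u(c t)`. -/
noncomputable def slow (c : I) (hc : 0 < c) (u : Cadlag d) : Cadlag d where
  toFun t := u (c * t)
  right_cont t := by
    have h1 : ContinuousWithinAt (fun s : I => c * s) (Ici t) t :=
      (continuous_const_mul c).continuousWithinAt
    refine ContinuousWithinAt.comp (u.right_cont (c * t)) h1 fun s hs => ?_
    change (c : ℝ) * t ≤ c * s
    exact mul_le_mul_of_nonneg_left hs c.2.1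
  left_lim t := ⟨_, (u.tendsto_left (c * t)).comp (tendsto_mul_left_nhdsLT hc t)⟩

lemma slow_apply (c : I) (hc : 0 < c) (u : Cadlag d) (t : I) : u.slow c hc t = u (c * t) := rfl

lemma left_slow (c : I) (hc : 0 < c) (u : Cadlag d) {t : I} (ht : 0 < t) :
    (u.slow c hc).left t = u.left (c * t) := by
  have hne : (𝓝[<] t).NeBot := nhdsLT_neBot_of_exists_lt ⟨0, ht⟩
  exact tendsto_nhds_unique ((u.slow c hc).tendsto_left t)
    ((u.tendsto_left (c * t)).comp (tendsto_mul_left_nhdsLT hc t))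

end Cadlag

namespace Decorated

variable {d : ℕ} (w : Decorated d)

/-- The variant of `dist_stretched_le` in which the interval inserted at `t` is part of the piece.
-/
lemma dist_stretched_le_of_mem_Icc {s t : I} {c : Vec d} {η : ℝ} (hst : s < t)
    (hpath : ∀ y, s ≤ y → y ≤ t → dist (w.path y) c ≤ η)
    (hexc : ∀ τ : w.times, s < (τ : I) → (τ : I) ≤ t → ∀ a, dist (w.exc τ a) c ≤ η)
    {x : ℝ} (hx : x ∈ Icc (w.shift s) (w.shift t)) : dist (w.stretched x) c ≤ η := by
  rcases lt_or_ge x (w.preShift t) with h | h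
  · exact w.dist_stretched_le (fun y h1 h2 => hpath y h1 h2.le) (fun τ h1 h2 => hexc τ h1 h2.le)
      ⟨hx.1, h⟩
  · by_cases ht : t ∈ w.times
    · rw [w.stretched_of_mem (τ := ⟨t, ht⟩) ⟨h, hx.2⟩]
      exact hexc ⟨t, ht⟩ hst le_rfl _
    · have : x = w.shift t := le_antisymm hx.2 (w.shift_eq_preShift ht ▸ h)
      rw [this, w.stretched_shift]
      exact hpath t hst.le le_rfl

lemma time_mem_of_mem_Icc {s t : I} {x : ℝ} (hx : x ∈ Icc (w.shift s) (w.shift t)) :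
    s ≤ w.time x ∧ w.time x ≤ t := by
  obtain ⟨y, hy1, hy2⟩ := w.exists_preShift_le_le_shift (x := x)
    (by
      rw [← w.shift_zero]
      exact (w.strictMono_shift.monotone (show 0 ≤ s from s.2.1)).trans hx.1)
    (by
      rw [← w.shift_one]
      exact hx.2.trans (w.strictMono_shift.monotone (show t ≤ 1 from t.2.2)))
  rw [w.time_eq hy1 hy2]
  refine ⟨w.strictMono_shift.le_iff_le.1 (hx.1.trans hy2), ?_⟩
  by_contra hc
  have := w.shift_lt_preShift (not_le.1 hc)
  linarith [hx.2]

end Decorated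

/-! ### Step functions that follow the excursions of an induced step function -/

section Induced

variable {d : ℕ} {ι : Type*}

/-- The `n`-step function with the values `g` runs, between the times `r k / n` and `r (k+1) / n`,
through excursions that are `δ`-close to the ideal ones, and the induced `m`-step function with the
values `g (r k)` is `δ`-close to `u` after the change of time `lam`. The induced function runs at
the speed `c`, up to `δ`. -/
structure IsInducedApprox (ω : ι → Sph d) (P : ι → Cadlag d) (u : Cadlag d) (c : I) (δ : ℝ)
    (n m : ℕ) (g : ℕ → Vec d) (r : ℕ → ℕ) (lam : I ≃o I) : Prop where
  one_le_n : 1 ≤ δ * n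
  one_le_m : 1 ≤ δ * m
  strictMono : StrictMono r
  zero : r 0 = 0
  le : n ≤ r m
  time : ∀ k j, r k ≤ j → j < r (k + 1) → j ≤ n → |(k : ℝ) / m - c * (j / n)| ≤ δ
  exc : ∀ k, k < m → reparamEDist
    (fun t : I => g (r k + ⌊(t : ℝ) * ((r (k + 1) - r k : ℕ) : ℝ)⌋₊) - g (r k))
    (idealExcursion ω P (g (r (k + 1)) - g (r k))) < ENNReal.ofReal δ
  val : ∀ t, dist (Cadlag.step m (g ∘ r) (lam t)) (u t) < δ
  iso : ∀ t, |((lam t : I) : ℝ) - t| < δ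

namespace IsInducedApprox

variable {ω : ι → Sph d} {P : ι → Cadlag d} {u : Cadlag d} {c : I} {δ : ℝ}
  {n m : ℕ} {g : ℕ → Vec d} {r : ℕ → ℕ} {lam : I ≃o I}

lemma mono {δ' : ℝ} (h : IsInducedApprox ω P u c δ n m g r lam) (hδ : δ ≤ δ') :
    IsInducedApprox ω P u c δ' n m g r lam where
  one_le_n := h.one_le_n.trans (by gcongr)
  one_le_m := h.one_le_m.trans (by gcongr)
  strictMono := h.strictMono
  zero := h.zero
  le := h.le
  time k j h1 h2 h3 := (h.time k j h1 h2 h3).trans hδ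
  exc k hk := (h.exc k hk).trans_le (ENNReal.ofReal_le_ofReal hδ)
  val t := (h.val t).trans_le hδ
  iso t := (h.iso t).trans_le hδ

lemma pos (h : IsInducedApprox ω P u c δ n m g r lam) : 0 < δ := dist_nonneg.trans_lt (h.val 0)

lemma n_pos (h : IsInducedApprox ω P u c δ n m g r lam) : (0 : ℝ) < n := by
  have := h.one_le_n
  by_contra hc
  have hn : (n : ℝ) = 0 := le_antisymm (not_lt.1 hc) (Nat.cast_nonneg n)
  rw [hn] at this
  linarith

lemma m_pos (h : IsInducedApprox ω P u c δ n m g r lam) : (0 : ℝ) < m := by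
  have := h.one_le_m
  by_contra hc
  have hn : (m : ℝ) = 0 := le_antisymm (not_lt.1 hc) (Nat.cast_nonneg m)
  rw [hn] at this
  linarith

lemma exists_between (h : IsInducedApprox ω P u c δ n m g r lam) (j : ℕ) : ∃ k, r k ≤ j ∧ j < r (k + 1) := by
  have h1 : ∃ k, j < r k := ⟨j + 1, (Nat.lt_succ_self j).trans_le (h.strictMono.le_apply)⟩
  classical
  have h2 := Nat.find_spec h1
  have h3 : Nat.find h1 ≠ 0 := by
    intro h0
    rw [h0, h.zero] at h2
    exact absurd h2 (Nat.not_lt_zero j)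
  obtain ⟨k, hk⟩ := Nat.exists_eq_succ_of_ne_zero h3
  refine ⟨k, not_lt.1 (Nat.find_min h1 (by omega)), ?_⟩
  rw [hk] at h2
  exact h2

/-- The number of steps of the induced function before the time that corresponds to `s`. -/
noncomputable def count (m : ℕ) (lam : I ≃o I) (c s : I) : ℕ := ⌊(m : ℝ) * (lam (c * s) : I)⌋₊

lemma count_le (s : I) : (count m lam c s : ℝ) ≤ (m : ℝ) * (lam (c * s) : I) :=
  Nat.floor_le (mul_nonneg (Nat.cast_nonneg _) (lam (c * s)).2.1)

lemma lt_count_add_one (s : I) : (m : ℝ) * (lam (c * s) : I) < count m lam c s + 1 :=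
  Nat.lt_floor_add_one _

lemma count_le_m (s : I) : count m lam c s ≤ m := by
  have h1 := count_le (m := m) (lam := lam) (c := c) s
  have h2 : (m : ℝ) * (lam (c * s) : I) ≤ m := mul_le_of_le_one_right (Nat.cast_nonneg _)
    (lam (c * s)).2.2
  exact_mod_cast h1.trans h2

/-- The values of the induced function are close to values of `u`. -/
lemma exists_dist_lt (h : IsInducedApprox ω P u c δ n m g r lam) {s : I} {k : ℕ} (hk : count m lam c s ≤ k) (hkm : k ≤ m) :
    ∃ z : I, c * s ≤ z ∧ dist (g (r k)) (u z) < δ ∧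
      (z = c * s ∨ (lam z : ℝ) = k / m) := by
  -- For `k = count` the value is the one at the matched time `c * s`. A larger `k` is itself a
  -- break point of the induced function, and the time matched with `k/m` is beyond `c * s`.
  rcases hk.eq_or_lt with rfl | hlt
  · exact ⟨c * s, le_rfl, h.val (c * s), Or.inl rfl⟩
  · have hm := h.m_pos
    have hmem : (k : ℝ) / m ∈ Icc (0 : ℝ) 1 :=
      ⟨by positivity, div_le_one_of_le₀ (by exact_mod_cast hkm) hm.le⟩
    have hz : ((lam (lam.symm ⟨(k : ℝ) / m, hmem⟩) : I) : ℝ) = k / m := by simp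
    refine ⟨lam.symm ⟨(k : ℝ) / m, hmem⟩, ?_, ?_, Or.inr hz⟩
    · rw [lam.le_symm_apply]
      change ((lam (c * s) : I) : ℝ) ≤ k / m
      rw [le_div_iff₀ hm]
      have h1 := lt_count_add_one (m := m) (lam := lam) (c := c) s
      have h2 : ((count m lam c s : ℕ) : ℝ) + 1 ≤ k := by exact_mod_cast hlt
      linarith
    · have := h.val (lam.symm ⟨(k : ℝ) / m, hmem⟩)
      rw [Decorated.step_apply, hz, mul_div_cancel₀ _ hm.ne', Nat.floor_natCast] at this
      exact this

/-- Two successive return values near `p` have a difference of norm at most `2 * e`. The ideal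
excursion is bounded by `2 * C + 1` times this difference, and the actual one follows it up to `δ`.
-/
lemma dist_le_of_between (h : IsInducedApprox ω P u c δ n m g r lam) {C : ℝ} (hC1 : 1 ≤ C) (hC : ∀ i t, ‖P i t‖ ≤ C) {k j : ℕ} (hk : k < m)
    {p : Vec d} {e : ℝ} (h1 : dist (g (r k)) p ≤ e) (h2 : dist (g (r (k + 1))) p ≤ e)
    (hj1 : r k ≤ j) (hj2 : j < r (k + 1)) :
    dist (g j) p ≤ e + (2 * C + 1) * (2 * e) + δ := by
  have hR : (0 : ℝ) < ((r (k + 1) - r k : ℕ) : ℝ) :=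
    Nat.cast_pos.2 (Nat.sub_pos_of_lt (h.strictMono (Nat.lt_succ_self k)))
  have hmem : ((j - r k : ℕ) : ℝ) / ((r (k + 1) - r k : ℕ) : ℝ) ∈ Icc (0 : ℝ) 1 := by
    refine ⟨by positivity, div_le_one_of_le₀ ?_ hR.le⟩
    exact_mod_cast (by omega : j - r k ≤ r (k + 1) - r k)
  -- The parameter `(j - r k)/(r (k+1) - r k)` of the excursion is the one at which it reads off `g
  -- j`.
  obtain ⟨lam', hlam'⟩ := iInf_lt_iff.1 (h.exc k hk)
  have h3 := (le_iSup _ (lam'.symm ⟨_, hmem⟩)).trans hlam'.le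
  rw [edist_dist, ENNReal.ofReal_le_ofReal_iff h.pos.le, lam'.apply_symm_apply] at h3
  simp only [div_mul_cancel₀ _ hR.ne', Nat.floor_natCast] at h3
  rw [Nat.add_sub_cancel' hj1] at h3
  have h4 := norm_idealExcursion_le (ω := ω) hC1 hC (g (r (k + 1)) - g (r k))
    (lam'.symm ⟨_, hmem⟩)
  have h5 : ‖g (r (k + 1)) - g (r k)‖ ≤ 2 * e := by
    rw [← dist_eq_norm]
    exact (dist_triangle_right _ _ p).trans (by linarith)
  have h6 : ‖g j - g (r k)‖ ≤ δ + (2 * C + 1) * (2 * e) := by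
    rw [dist_eq_norm] at h3
    have h7 : ‖idealExcursion ω P (g (r (k + 1)) - g (r k)) (lam'.symm ⟨_, hmem⟩)‖
        ≤ (2 * C + 1) * (2 * e) := h4.trans (by gcongr)
    have h8 := norm_le_norm_add_norm_sub'
      (g j - g (r k)) (idealExcursion ω P (g (r (k + 1)) - g (r k)) (lam'.symm ⟨_, hmem⟩))
    linarith
  have h7 := dist_triangle (g j) (g (r k)) p
  rw [dist_eq_norm (g j) (g (r k))] at h7
  linarith

lemma dist_le_of_mem_range (h : IsInducedApprox ω P u c δ n m g r lam) {C : ℝ} (hC1 : 1 ≤ C) (hC : ∀ i t, ‖P i t‖ ≤ C) {k₀ k₁ : ℕ}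
    (hk₁ : k₁ ≤ m) {p : Vec d} {e : ℝ} (hp : ∀ k, k₀ ≤ k → k ≤ k₁ → dist (g (r k)) p ≤ e)
    {j : ℕ} (hj0 : r k₀ ≤ j) (hj1 : j ≤ r k₁) :
    dist (g j) p ≤ e + (2 * C + 1) * (2 * e) + δ := by
  have hk01 : k₀ ≤ k₁ := h.strictMono.le_iff_le.1 (hj0.trans hj1)
  have he : 0 ≤ e := dist_nonneg.trans (hp k₀ le_rfl hk01)
  rcases hj1.eq_or_lt with rfl | hlt
  · have := hp k₁ hk01 le_rfl
    have h1 : 0 ≤ (2 * C + 1) * (2 * e) := by positivity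
    linarith [h.pos]
  · obtain ⟨k, hk1, hk2⟩ := h.exists_between j
    have h1 : k < k₁ := h.strictMono.lt_iff_lt.1 (hk1.trans_lt hlt)
    have h2 : k₀ < k + 1 := h.strictMono.lt_iff_lt.1 (hj0.trans_lt hk2)
    exact h.dist_le_of_between hC1 hC (h1.trans_le hk₁) (hp k (by omega) h1.le)
      (hp (k + 1) (by omega) h1) hk1 hk2

/-- The induced index at the end. -/
lemma exists_last (h : IsInducedApprox ω P u c δ n m g r lam) : ∃ k, r k ≤ n ∧ n < r (k + 1) ∧ |(k : ℝ) / m - c| ≤ δ := by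
  obtain ⟨k, h1, h2⟩ := h.exists_between n
  refine ⟨k, h1, h2, ?_⟩
  have := h.time k n h1 h2 le_rfl
  rwa [div_self h.n_pos.ne', mul_one] at this

/-- Rounding costs `1/m ≤ δ`, and the time change `lam` costs another `δ`. -/
lemma count_div_lt (h : IsInducedApprox ω P u c δ n m g r lam) (s : I) : |(count m lam c s : ℝ) / m - c * s| < 2 * δ := by
  have h1 := count_le (m := m) (lam := lam) (c := c) s
  have h2 := lt_count_add_one (m := m) (lam := lam) (c := c) s
  have h3 := abs_lt.1 (h.iso (c * s))
  have h4 : (c * s : I) = (c : ℝ) * s := rfl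
  have hm := h.m_pos
  have hm1 := h.one_le_m
  rw [h4] at h3
  rw [abs_lt]
  constructor
  · rw [← sub_pos]
    have : (m : ℝ) * ((lam (c * s) : I) - δ) ≤ count m lam c s := by nlinarith
    have h5 : ((lam (c * s) : I) : ℝ) - δ ≤ (count m lam c s : ℝ) / m := by
      rw [le_div_iff₀ hm]; linarith
    linarith
  · have h5 : (count m lam c s : ℝ) / m ≤ ((lam (c * s) : I) : ℝ) := by
      rw [div_le_iff₀ hm]; linarith
    linarith [h.pos]

/-- The last return before `n` has an index `k` with `k/m ≥ c - δ`, while the count at `s` is below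
`c s + 2δ`. The sum of the errors gives the constant 3. -/
lemma r_count_lt (h : IsInducedApprox ω P u c δ n m g r lam) {s : I} (hs : 3 * δ ≤ c * (1 - s)) : r (count m lam c s) < n := by
  obtain ⟨k, h1, h2, h3⟩ := h.exists_last
  refine lt_of_lt_of_le (h.strictMono ?_) h1
  have h4 := abs_lt.1 (h.count_div_lt s)
  have h5 := abs_le.1 h3
  have h6 : (count m lam c s : ℝ) / m < (k : ℝ) / m := by linarith
  rw [div_lt_div_iff_of_pos_right h.m_pos] at h6
  exact_mod_cast h6

lemma abs_r_count_sub_le (h : IsInducedApprox ω P u c δ n m g r lam) {s : I} (hs : r (count m lam c s) ≤ n) :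
    |(c : ℝ) * (r (count m lam c s) / n) - c * s| ≤ 3 * δ := by
  have h1 := abs_le.1 (h.time _ _ le_rfl (h.strictMono (Nat.lt_succ_self _)) hs)
  have h2 := abs_lt.1 (h.count_div_lt s)
  rw [abs_le]
  constructor <;> linarith

/-- A gain of `q` indices needs time `q/m ≤ q δ`, and `lam` can take away `2δ`. -/
lemma count_add_le (h : IsInducedApprox ω P u c δ n m g r lam) {s t : I} {q : ℕ} (hst : (q + 2) * δ ≤ c * (t - s)) :
    count m lam c s + q ≤ count m lam c t := by
  have hm := h.m_pos
  have hm1 := h.one_le_m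
  have h1 := count_le (m := m) (lam := lam) (c := c) s
  have h3 := abs_lt.1 (h.iso (c * s))
  have h4 : (c * s : I) = (c : ℝ) * s := rfl
  have h5 := abs_lt.1 (h.iso (c * t))
  have h6 : (c * t : I) = (c : ℝ) * t := rfl
  rw [h4] at h3
  rw [h6] at h5
  refine Nat.le_floor ?_
  push_cast
  have h7 : ((lam (c * s) : I) : ℝ) + q * δ ≤ (lam (c * t) : I) := by nlinarith
  have h8 : (m : ℝ) * ((lam (c * s) : I) + q * δ) ≤ m * (lam (c * t) : I) := by gcongr
  have h9 : (q : ℝ) * 1 ≤ q * (δ * m) := by gcongr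
  nlinarith

end IsInducedApprox

end Induced

end DecoratedLevy

namespace DecoratedLevy

/-! ### Local comparison with the decorated path, and gluing. -/

section Induced

variable {d : ℕ} {ι : Type*}

namespace IsInducedApprox

variable {ω : ι → Sph d} {P : ι → Cadlag d} {u : Cadlag d} {c : I} {δ : ℝ}
  {n m : ℕ} {g : ℕ → Vec d} {r : ℕ → ℕ} {lam : I ≃o I}

/-- Closeness on a piece where all functions are almost constant. -/
lemma reparamClose_of_const (h : IsInducedApprox ω P u c δ n m g r lam) (w : Decorated d)
    {C : ℝ} (hC1 : 1 ≤ C) (hC : ∀ i t, ‖P i t‖ ≤ C) {k₀ k₁ : ℕ} (hk₁ : k₁ ≤ m) {p : Vec d}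
    {η X₀ X₁ Y₁ s t : ℝ} (hδ : δ ≤ η)
    (hp : ∀ k, k₀ ≤ k → k ≤ k₁ → dist (g (r k)) p ≤ η + δ)
    (hX : X₀ < X₁) (hw : ∀ x ∈ Ico X₀ X₁, dist (w.stretched x) p ≤ (1 + 2 * C) * η)
    (htime : ∀ x ∈ Ico X₀ X₁, s ≤ w.time x ∧ w.time x ≤ t)
    (hY : (r k₀ : ℝ) / n < Y₁) (hY₁ : Y₁ ≤ (r k₁ : ℝ) / n)
    (hYs : |(r k₀ : ℝ) / n - s| ≤ η) (hYt : |Y₁ - t| ≤ η) (hst : t - s ≤ η) :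
    ReparamClose (18 * C * η) (fun x => ((w.time x : ℝ), w.stretched x))
      (fun y => (y, g ⌊(n : ℝ) * y⌋₊)) X₀ X₁ ((r k₀ : ℝ) / n) Y₁ := by
  have hn := h.n_pos
  have hη : 0 < η := h.pos.trans_le hδ
  have hCη : η ≤ C * η := le_mul_of_one_le_left hη.le hC1
  refine ReparamClose.of_forall_dist hX hY ?_
  rintro x hx y ⟨hy1, hy2⟩
  refine Cadlag.dist_prod_le ?_ ?_
  · obtain ⟨h1, h2⟩ := htime x hx
    rw [abs_le] at hYs hYt ⊢
    constructor <;> linarith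
  · have hj0 : r k₀ ≤ ⌊(n : ℝ) * y⌋₊ := by
      refine Nat.le_floor ?_
      rw [div_le_iff₀ hn] at hy1
      linarith
    have hj1 : ⌊(n : ℝ) * y⌋₊ ≤ r k₁ := by
      refine Nat.floor_le_of_le ?_
      have := hy2.le.trans hY₁
      rw [le_div_iff₀ hn] at this
      linarith
    have h1 := h.dist_le_of_mem_range hC1 hC hk₁ hp hj0 hj1
    have h2 := hw x hx
    refine (dist_triangle_right _ _ p).trans ?_
    -- The unfolding contributes `(1 + 2C)η`, the step function at most `2η + 4(2C + 1)η + η`. The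
    -- sum `(10C + 8)η` is at most `18Cη` since `C ≥ 1`.
    have h3 : (2 * C + 1) * (2 * (η + δ)) ≤ (2 * C + 1) * (2 * (η + η)) := by gcongr
    nlinarith

lemma abs_div_sub_le_of_mul {c x y δ η : ℝ} (hc : 0 < c) (h : |c * x - c * y| ≤ 4 * δ)
    (hδ : 4 * δ ≤ c * η) : |x - y| ≤ η := by
  rw [← mul_sub, abs_mul, abs_of_pos hc] at h
  exact le_of_mul_le_mul_left (h.trans hδ) hc

lemma dist_left_le_of_osc {p : Vec d} {η : ℝ} {s t : I} (hst : s < t)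
    (hosc : ∀ z, s ≤ z → z < t → dist (u z) p ≤ η) : dist (u.left t) p ≤ η := by
  have hne : (𝓝[<] t).NeBot := nhdsLT_neBot_of_exists_lt ⟨s, hst⟩
  refine le_of_tendsto ((u.tendsto_left t).dist tendsto_const_nhds) ?_
  filter_upwards [Ico_mem_nhdsLT hst] with z hz using hosc z hz.1 hz.2

/-- A jump of `u` is matched by an excursion of the step function. -/
lemma exists_matching_excursion (h : IsInducedApprox ω P u c δ n m g r lam) {z : I} (hz : 0 < z)
    (hjump : 2 * δ < ‖u.jump z‖) :
    ∃ k, ((k + 1 : ℕ) : ℝ) = m * (lam z : I) ∧ dist (g (r k)) (u.left z) ≤ δ ∧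
      dist (g (r (k + 1))) (u z) < δ := by
  have hm := h.m_pos
  have h1 := Decorated.dist_left_le_of_iso h.val hz
  have h2 := h.val z
  have hlz : 0 < lam z := by
    have := lam.strictMono hz
    rwa [show lam 0 = 0 from lam.map_bot] at this
  have hlz' : (0 : ℝ) < (lam z : I) := hlz
  rw [Cadlag.left_step m _ hlz] at h1
  rw [Decorated.step_apply] at h2
  simp only [Function.comp] at h1 h2
  have hpos : 0 < ⌈(m : ℝ) * (lam z : I)⌉₊ := Nat.ceil_pos.2 (by positivity)
  -- The matched time is a break point of the induced function. Otherwise the value and the left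
  -- limit of that function would coincide there, and the jump of `u` would be at most `2δ`.
  have hfc : ⌊(m : ℝ) * (lam z : I)⌋₊ = ⌈(m : ℝ) * (lam z : I)⌉₊ := by
    by_contra hne
    have h3 : ⌊(m : ℝ) * (lam z : I)⌋₊ = ⌈(m : ℝ) * (lam z : I)⌉₊ - 1 := by
      have := Nat.floor_le_ceil ((m : ℝ) * (lam z : I))
      have := Nat.ceil_le_floor_add_one ((m : ℝ) * (lam z : I))
      omega
    rw [h3] at h2
    have : ‖u.jump z‖ ≤ 2 * δ := by
      rw [Cadlag.jump, ← dist_eq_norm]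
      exact (dist_triangle_left _ _ _).trans (by linarith)
    linarith
  refine ⟨⌈(m : ℝ) * (lam z : I)⌉₊ - 1, ?_, h1, ?_⟩
  · rw [Nat.sub_add_cancel hpos]
    refine le_antisymm ?_ (Nat.le_ceil _)
    rw [← hfc]
    exact Nat.floor_le (by positivity)
  · rw [Nat.sub_add_cancel hpos, ← hfc]
    exact h2

variable [Finite ι] {hP : ∀ i, IsProfile (P i) (ω i)}

/-- Both one-sided values being within `η` of `p`, the jump has norm at most `2η`, and the profile
enlarges it by at most `C`. -/
lemma dist_exc_decorate_le {C : ℝ} (hC : ∀ i t, ‖P i t‖ ≤ C) {p : Vec d} {η : ℝ}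
    (hdir : ∀ t ∈ u.disc, ∃ i, u.jump t = ‖u.jump t‖ • (ω i : Vec d))
    (τ : (decorate ω P hP u).times) (h1 : dist (u.left τ) p ≤ η) (h2 : dist (u τ) p ≤ η) (a : I) :
    dist ((decorate ω P hP u).exc τ a) p ≤ (1 + 2 * C) * η := by
  obtain ⟨i, -, hi⟩ := exists_profileExcursion_eq (P := P) (hdir τ τ.2)
  have hj : ‖u.jump τ‖ ≤ 2 * η := by
    rw [Cadlag.jump, ← dist_eq_norm]
    exact (dist_triangle_right _ _ p).trans (by linarith)
  change dist (profileExcursion ω P u τ a) p ≤ _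
  rw [hi a]
  have h3 : ‖‖u.jump τ‖ • P i a‖ ≤ 2 * η * C := by
    rw [norm_smul, norm_norm]
    exact mul_le_mul hj (hC i a) (norm_nonneg _) ((norm_nonneg _).trans hj)
  calc dist (u.left τ + ‖u.jump τ‖ • P i a) p
      ≤ dist (u.left τ + ‖u.jump τ‖ • P i a) (u.left τ) + dist (u.left τ) p := dist_triangle _ _ _
    _ ≤ 2 * η * C + η := by
        refine add_le_add ?_ h1
        rw [dist_eq_norm, add_sub_cancel_left]
        exact h3
    _ = (1 + 2 * C) * η := by ring

/-- Closeness on a piece before the end where `u` is almost constant. -/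
lemma reparamClose_of_osc (h : IsInducedApprox ω P u c δ n m g r lam) (hc : 0 < c)
    {C : ℝ} (hC1 : 1 ≤ C) (hC : ∀ i t, ‖P i t‖ ≤ C)
    (hdir : ∀ t ∈ (u.slow c hc).disc,
      ∃ i, (u.slow c hc).jump t = ‖(u.slow c hc).jump t‖ • (ω i : Vec d))
    {η : ℝ} {s t : I} (hst : s < t) {p : Vec d}
    (hosc : ∀ z, c * s ≤ z → z ≤ c * t → dist (u z) p ≤ η) (hη : (t : ℝ) - s ≤ η) (hδ : δ ≤ η)
    (hδ1 : 4 * δ ≤ c * η) (hδ2 : 4 * δ ≤ c * ((t : ℝ) - s)) (hδ3 : 4 * δ ≤ c * (1 - (t : ℝ))) :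
    ReparamClose (18 * C * η)
      (fun x => (((decorate ω P hP (u.slow c hc)).time x : ℝ),
        (decorate ω P hP (u.slow c hc)).stretched x))
      (fun y => (y, g ⌊(n : ℝ) * y⌋₊))
      ((decorate ω P hP (u.slow c hc)).shift s) ((decorate ω P hP (u.slow c hc)).shift t)
      ((r (count m lam c s) : ℝ) / n) ((r (count m lam c t) : ℝ) / n) := by
  have hpos := h.pos
  have hn := h.n_pos
  have hm := h.m_pos
  have hc' : (0 : ℝ) < c := hc
  have hst' : (s : ℝ) < t := hst
  set w := decorate ω P hP (u.slow c hc) with hw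
  have hcnt : count m lam c s + 1 ≤ count m lam c t :=
    h.count_add_le (by push_cast; linarith)
  have hrt : r (count m lam c t) < n := h.r_count_lt (by linarith)
  have hrs : r (count m lam c s) < n := (h.strictMono hcnt).trans hrt
  have hosc' : ∀ y : I, s ≤ y → y ≤ t → dist (u.slow c hc y) p ≤ η := fun y h1 h2 =>
    hosc (c * y) (mul_le_mul_of_nonneg_left h1 hc'.le) (mul_le_mul_of_nonneg_left h2 hc'.le)
  refine h.reparamClose_of_const w hC1 hC (s := s) (t := t) (p := p) (count_le_m t) hδ ?_
    (w.strictMono_shift hst) ?_ ?_ ?_ le_rfl ?_ ?_ hη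
  · intro k hk0 hk1
    -- The relevant return values are near values of `u` at times between `c s` and `c t`, where the
    -- oscillation of `u` is controlled.
    obtain ⟨z, hz1, hz2, hz3⟩ := h.exists_dist_lt hk0 (hk1.trans (count_le_m t))
    have hz4 : z ≤ c * t := by
      rcases hz3 with rfl | hz3
      · exact (Cadlag.mul_lt_mul_left_I hc hst).le
      · rw [← lam.le_iff_le]
        change ((lam z : I) : ℝ) ≤ (lam (c * t) : I)
        rw [hz3, div_le_iff₀ hm]
        have h1 := count_le (m := m) (lam := lam) (c := c) t
        have h2 : (k : ℝ) ≤ count m lam c t := by exact_mod_cast hk1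
        linarith
    have := hosc z hz1 hz4
    exact (dist_triangle _ _ _).trans (by linarith)
  · intro x hx
    have hη0 : 0 ≤ η := hpos.le.trans hδ
    refine w.dist_stretched_le_of_mem_Icc hst (fun y h1 h2 => ?_) (fun τ h1 h2 a => ?_)
      ⟨hx.1, hx.2.le⟩
    · have := hosc' y h1 h2
      exact this.trans (by nlinarith)
    · exact dist_exc_decorate_le hC hdir τ
        (dist_left_le_of_osc h1 fun z hz1 hz2 => hosc' z hz1 (hz2.le.trans h2))
        (hosc' τ h1.le h2) a
  · intro x hx
    exact w.time_mem_of_mem_Icc ⟨hx.1, hx.2.le⟩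
  · rw [div_lt_div_iff_of_pos_right hn]
    exact_mod_cast h.strictMono hcnt
  · exact abs_div_sub_le_of_mul hc' ((h.abs_r_count_sub_le hrs.le).trans (by linarith)) hδ1
  · exact abs_div_sub_le_of_mul hc' ((h.abs_r_count_sub_le hrt.le).trans (by linarith)) hδ1

/-- Closeness on the last piece. -/
lemma reparamClose_end (h : IsInducedApprox ω P u c δ n m g r lam) (hc : 0 < c)
    {C : ℝ} (hC1 : 1 ≤ C) (hC : ∀ i t, ‖P i t‖ ≤ C)
    (hdir : ∀ t ∈ (u.slow c hc).disc,
      ∃ i, (u.slow c hc).jump t = ‖(u.slow c hc).jump t‖ • (ω i : Vec d))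
    {η : ℝ} {s : I} (hst : s < 1) {p : Vec d}
    (hosc : ∀ z, c * s ≤ z → (z : ℝ) ≤ c + 4 * δ → dist (u z) p ≤ η) (hη : 1 - (s : ℝ) ≤ η)
    (hδ : δ ≤ η) (hδ1 : 4 * δ ≤ c * η) (hδ3 : 4 * δ ≤ c * (1 - (s : ℝ))) :
    ReparamClose (18 * C * η)
      (fun x => (((decorate ω P hP (u.slow c hc)).time x : ℝ),
        (decorate ω P hP (u.slow c hc)).stretched x))
      (fun y => (y, g ⌊(n : ℝ) * y⌋₊))
      ((decorate ω P hP (u.slow c hc)).shift s) ((decorate ω P hP (u.slow c hc)).shift 1)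
      ((r (count m lam c s) : ℝ) / n) 1 ∧
    dist (u.slow c hc 1) (g n) ≤ 18 * C * η := by
  have hpos := h.pos
  have hη0 : 0 ≤ η := hpos.le.trans hδ
  have hn := h.n_pos
  have hm := h.m_pos
  have hm1 := h.one_le_m
  have hc' : (0 : ℝ) < c := hc
  have hst' : (s : ℝ) < 1 := hst
  set w := decorate ω P hP (u.slow c hc) with hw
  have hrs : r (count m lam c s) < n := h.r_count_lt (by linarith)
  have hosc' : ∀ y : I, s ≤ y → dist (u.slow c hc y) p ≤ η := fun y h1 =>
    hosc (c * y) (mul_le_mul_of_nonneg_left h1 hc'.le) (by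
      have : ((c * y : I) : ℝ) = c * y := rfl
      rw [this]
      have := mul_le_of_le_one_right hc'.le y.2.2
      linarith)
  obtain ⟨q, hq1, hq2, hq3⟩ := h.exists_last
  -- Time `n` may fall inside an excursion, so the index after the last return is included. The
  -- minimum with `m` keeps the index in the range in which excursions and values are controlled.
  have hlast : n ≤ r (min (q + 1) m) := by
    rcases min_choice (q + 1) m with h1 | h1
    · rw [h1]; exact hq2.le
    · rw [h1]; exact h.le
  -- The indices involved can exceed `c m` slightly, so their values are compared with `u` slightly
  -- beyond time `c`. This is why the hypothesis on the oscillation extends to `c + 4δ`.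
  have hgood : ∀ k, count m lam c s ≤ k → k ≤ min (q + 1) m → dist (g (r k)) p ≤ η + δ := by
    intro k hk0 hk1
    obtain ⟨z, hz1, hz2, hz3⟩ := h.exists_dist_lt hk0 (hk1.trans (min_le_right _ _))
    have hz4 : (z : ℝ) ≤ c + 4 * δ := by
      rcases hz3 with rfl | hz3
      · have : ((c * s : I) : ℝ) = c * s := rfl
        rw [this]
        have := mul_le_of_le_one_right hc'.le s.2.2
        linarith
      · have h1 := abs_lt.1 (h.iso z)
        rw [hz3] at h1
        have h2 : (k : ℝ) ≤ q + 1 := by exact_mod_cast hk1.trans (min_le_left _ _)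
        have h3 : (k : ℝ) / m ≤ q / m + δ := by
          rw [div_add' _ _ _ hm.ne']
          gcongr
          linarith
        have h4 := abs_le.1 hq3
        linarith
    have := hosc z hz1 hz4
    exact (dist_triangle _ _ _).trans (by linarith)
  refine ⟨?_, ?_⟩
  · refine h.reparamClose_of_const w hC1 hC (s := s) (t := 1) (p := p)
      (min_le_right (q + 1) m) hδ hgood (w.strictMono_shift hst) ?_ ?_ ?_ ?_ ?_ ?_ hη
    · intro x hx
      refine w.dist_stretched_le_of_mem_Icc hst (fun y h1 h2 => ?_) (fun τ h1 h2 a => ?_)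
        ⟨hx.1, hx.2.le⟩
      · have := hosc' y h1
        exact this.trans (by nlinarith)
      · exact dist_exc_decorate_le hC hdir τ
          (dist_left_le_of_osc h1 fun z hz1 _ => hosc' z hz1) (hosc' τ h1.le) a
    · intro x hx
      exact w.time_mem_of_mem_Icc (s := s) (t := 1) ⟨hx.1, hx.2.le⟩
    · rw [div_lt_one hn]; exact_mod_cast hrs
    · rw [le_div_iff₀ hn, one_mul]; exact_mod_cast hlast
    · exact abs_div_sub_le_of_mul hc' ((h.abs_r_count_sub_le hrs.le).trans (by linarith)) hδ1
    · simpa using hη0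
  · have h1 := h.dist_le_of_mem_range hC1 hC (min_le_right (q + 1) m) hgood hrs.le hlast
    have h2 := hosc' 1 (show s ≤ 1 from s.2.2)
    refine (dist_triangle_right _ _ p).trans ?_
    have h3 : (2 * C + 1) * (2 * (η + δ)) ≤ (2 * C + 1) * (2 * (η + η)) := by gcongr
    nlinarith

/-- Closeness on a piece that ends with a jump of `u`. -/
lemma reparamClose_jump (h : IsInducedApprox ω P u c δ n m g r lam) (hc : 0 < c)
    {C : ℝ} (hC1 : 1 ≤ C) (hC : ∀ i t, ‖P i t‖ ≤ C)
    (hdir : ∀ t ∈ (u.slow c hc).disc,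
      ∃ i, (u.slow c hc).jump t = ‖(u.slow c hc).jump t‖ • (ω i : Vec d))
    {η : ℝ} {s t : I} (hst : s < t) (ht : t ∈ (u.slow c hc).disc) {p : Vec d}
    (hosc : ∀ z, c * s ≤ z → z < c * t → dist (u z) p ≤ η) (hη : (t : ℝ) - s ≤ η) (hδ : δ ≤ η)
    (hδ1 : 4 * δ ≤ c * η) (hδ2 : 4 * δ ≤ c * ((t : ℝ) - s)) (hδ3 : 4 * δ ≤ c * (1 - (t : ℝ)))
    (hjump : 2 * δ < ‖(u.slow c hc).jump t‖)
    (hclosest : ∀ i, (u.slow c hc).jump t = ‖(u.slow c hc).jump t‖ • (ω i : Vec d) →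
      ∀ V, ‖V - (u.slow c hc).jump t‖ ≤ 2 * δ → closestProfile ω P V = P i) :
    ReparamClose (18 * C * η)
      (fun x => (((decorate ω P hP (u.slow c hc)).time x : ℝ),
        (decorate ω P hP (u.slow c hc)).stretched x))
      (fun y => (y, g ⌊(n : ℝ) * y⌋₊))
      ((decorate ω P hP (u.slow c hc)).shift s) ((decorate ω P hP (u.slow c hc)).shift t)
      ((r (count m lam c s) : ℝ) / n) ((r (count m lam c t) : ℝ) / n) := by
  have hpos := h.pos
  have hη0 : 0 < η := hpos.trans_le hδ
  have hn := h.n_pos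
  have hm := h.m_pos
  have hm1 := h.one_le_m
  have hc' : (0 : ℝ) < c := hc
  have hst' : (s : ℝ) < t := hst
  have ht0 : 0 < t := ht.1.1
  set w := decorate ω P hP (u.slow c hc) with hw
  have hct : 0 < c * t := by
    have := Cadlag.mul_lt_mul_left_I hc ht0
    rwa [mul_zero] at this
  have hleft := u.left_slow c hc ht0
  have hjumpeq : (u.slow c hc).jump t = u.jump (c * t) := by
    rw [Cadlag.jump, Cadlag.jump, hleft]; rfl
  obtain ⟨k, hk1, hk2, hk3⟩ := h.exists_matching_excursion hct (hjumpeq ▸ hjump)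
  have hkt : count m lam c t = k + 1 := by
    rw [count, ← hk1, Nat.floor_natCast]
  have hkm : k < m := by
    have := count_le_m (m := m) (lam := lam) (c := c) t
    omega
  -- Two indices are gained, one for the excursion that carries the jump and one so that the piece
  -- before it is not empty.
  have hcnt : count m lam c s + 2 ≤ count m lam c t :=
    h.count_add_le (by push_cast; linarith)
  have hrt : r (k + 1) < n := hkt ▸ h.r_count_lt (by linarith)
  have hrk : r k < n := (h.strictMono (Nat.lt_succ_self k)).trans hrt
  have hrs : r (count m lam c s) < n := (h.strictMono.monotone (by omega)).trans_lt hrk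
  have hosc' : ∀ y : I, s ≤ y → y < t → dist (u.slow c hc y) p ≤ η := fun y h1 h2 =>
    hosc (c * y) (mul_le_mul_of_nonneg_left h1 hc'.le) (Cadlag.mul_lt_mul_left_I hc h2)
  have hYk : |(r k : ℝ) / n - t| ≤ η := by
    refine abs_div_sub_le_of_mul hc' ?_ hδ1
    have h1 := abs_le.1 (h.time k (r k) le_rfl (h.strictMono (Nat.lt_succ_self _)) hrk.le)
    have h2 := abs_lt.1 (h.count_div_lt t)
    rw [hkt] at h2
    have h3 : ((k + 1 : ℕ) : ℝ) / m ≤ k / m + δ := by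
      rw [div_add' _ _ _ hm.ne']
      gcongr
      push_cast
      linarith
    have h4 : (k : ℝ) / m ≤ ((k + 1 : ℕ) : ℝ) / m := by gcongr; omega
    rw [abs_le]
    constructor <;> linarith
  have hYt : |(r (k + 1) : ℝ) / n - t| ≤ η := by
    refine abs_div_sub_le_of_mul hc' ?_ hδ1
    rw [← hkt]
    exact (h.abs_r_count_sub_le (hkt ▸ hrt.le)).trans (by linarith)
  -- Before the jump everything is almost constant. This piece ends at the insertion on one side and
  -- at the return `r k` on the other.
  have piece1 : ReparamClose (18 * C * η) (fun x => ((w.time x : ℝ), w.stretched x))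
      (fun y => (y, g ⌊(n : ℝ) * y⌋₊)) (w.shift s) (w.preShift t)
      ((r (count m lam c s) : ℝ) / n) ((r k : ℝ) / n) := by
    refine h.reparamClose_of_const w hC1 hC (s := s) (t := t) (p := p) hkm.le hδ ?_
      (w.shift_lt_preShift hst) ?_ ?_ ?_ le_rfl ?_ hYk hη
    · intro i hi0 hi1
      obtain ⟨z, hz1, hz2, hz3⟩ := h.exists_dist_lt hi0 (hi1.trans hkm.le)
      have hz4 : z < c * t := by
        rcases hz3 with rfl | hz3
        · exact Cadlag.mul_lt_mul_left_I hc hst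
        · rw [← lam.lt_iff_lt]
          change ((lam z : I) : ℝ) < (lam (c * t) : I)
          rw [hz3, div_lt_iff₀ hm, mul_comm, ← hk1]
          exact_mod_cast Nat.lt_succ_of_le hi1
      have := hosc z hz1 hz4
      exact (dist_triangle _ _ _).trans (by linarith)
    · intro x hx
      refine w.dist_stretched_le (fun y h1 h2 => ?_) (fun τ h1 h2 a => ?_) hx
      · have := hosc' y h1 h2
        exact this.trans (by nlinarith)
      · exact dist_exc_decorate_le hC hdir τ
          (dist_left_le_of_osc h1 fun z hz1 hz2 => hosc' z hz1 (hz2.trans h2))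
          (hosc' τ h1.le h2) a
    · intro x hx
      exact w.time_mem_of_mem_Icc ⟨hx.1, hx.2.le.trans (w.preShift_le_shift t)⟩
    · rw [div_lt_div_iff_of_pos_right hn]
      exact_mod_cast h.strictMono (by omega : count m lam c s < k)
    · exact abs_div_sub_le_of_mul hc' ((h.abs_r_count_sub_le hrs.le).trans (by linarith)) hδ1
  have hT : t ∈ w.times := ht
  have hlen := w.shift_eq_preShift_add ⟨t, hT⟩
  have hlp := w.len_pos ⟨t, hT⟩
  simp only at hlen
  -- The inserted interval is laid over the excursion that starts at the return `r k`, with the time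
  -- change that makes this excursion close to the ideal one.
  have piece2 : ReparamClose (18 * C * η) (fun x => ((w.time x : ℝ), w.stretched x))
      (fun y => (y, g ⌊(n : ℝ) * y⌋₊)) (w.preShift t) (w.shift t)
      ((r k : ℝ) / n) ((r (k + 1) : ℝ) / n) := by
    obtain ⟨i, hi1, hi2⟩ := exists_profileExcursion_eq (P := P) (hdir t ht)
    set J := (u.slow c hc).jump t with hJ
    set V := g (r (k + 1)) - g (r k) with hV
    -- The induced increment differs from the jump by one `δ` at each end.
    have hVJ : ‖V - J‖ ≤ 2 * δ := by
      have e : V - J = (g (r (k + 1)) - u (c * t)) - (g (r k) - u.left (c * t)) := by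
        rw [hV, hjumpeq, Cadlag.jump]; abel
      rw [e]
      refine (norm_sub_le _ _).trans ?_
      rw [← dist_eq_norm, ← dist_eq_norm]
      linarith
    have hexc := h.exc k hkm
    rw [reparamEDist_comm] at hexc
    have hYlt : (r k : ℝ) / n < (r (k + 1) : ℝ) / n := by
      rw [div_lt_div_iff_of_pos_right hn]
      exact_mod_cast h.strictMono (Nat.lt_succ_self k)
    obtain ⟨φ, hφ0, hφ1, hφ⟩ := reparamClose_of_reparamEDist_lt hexc
      (show w.preShift t < w.shift t by linarith) hYlt
    refine ⟨φ, hφ0, hφ1, fun x hx0 hx1 => Cadlag.dist_prod_le ?_ ?_⟩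
    · rw [w.time_eq hx0 hx1.le]
      have e1 : (r k : ℝ) / n ≤ φ x := by rw [← hφ0]; exact φ.monotone hx0
      have e2 : φ x ≤ (r (k + 1) : ℝ) / n := by rw [← hφ1]; exact φ.monotone hx1.le
      rw [abs_le] at hYk hYt ⊢
      have : η ≤ C * η := le_mul_of_one_le_left hη0.le hC1
      constructor <;> linarith
    · have e1 : (r k : ℝ) / n ≤ φ x := by rw [← hφ0]; exact φ.monotone hx0
      have e2 : φ x < (r (k + 1) : ℝ) / n := by rw [← hφ1]; exact φ.strictMono hx1
      have hφx := hφ x hx0 hx1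
      rw [w.stretched_of_mem (τ := ⟨t, hT⟩) ⟨hx0, hx1.le⟩]
      rw [show w.shift t - w.preShift t = w.len ⟨t, hT⟩ by linarith] at hφx
      set a := projIcc (0 : ℝ) 1 zero_le_one ((x - w.preShift t) / w.len ⟨t, hT⟩)
      change dist (profileExcursion ω P (u.slow c hc) t a) _ ≤ _
      rw [hi2 a]
      have hb : (φ x - (r k : ℝ) / n) / ((r (k + 1) : ℝ) / n - (r k : ℝ) / n) ∈ Icc (0 : ℝ) 1 :=
        ⟨div_nonneg (by linarith) (by linarith), div_le_one_of_le₀ (by linarith) (by linarith)⟩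
      have hRpos : (0 : ℝ) < (r (k + 1) : ℝ) - r k := by
        rw [sub_pos]; exact_mod_cast h.strictMono (Nat.lt_succ_self k)
      -- The parameter of the excursion, rescaled from its cell of times, reads off the value of `g`
      -- at the index `⌊n φ(x)⌋`.
      have hfloor : r k + ⌊((φ x - (r k : ℝ) / n) / ((r (k + 1) : ℝ) / n - (r k : ℝ) / n))
          * ((r (k + 1) - r k : ℕ) : ℝ)⌋₊ = ⌊(n : ℝ) * φ x⌋₊ := by
        rw [Nat.cast_sub (h.strictMono (Nat.lt_succ_self k)).le, ← sub_div]
        have e3 : (φ x - (r k : ℝ) / n) / (((r (k + 1) : ℝ) - r k) / n)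
            * ((r (k + 1) : ℝ) - r k) = n * φ x - r k := by
          field_simp
        rw [e3, Nat.floor_sub_natCast]
        refine Nat.add_sub_cancel' (Nat.le_floor ?_)
        rw [div_le_iff₀ hn] at e1
        linarith
      simp only [projIcc_of_mem _ hb, hfloor] at hφx
      have hcl := hclosest i hi1 V hVJ
      have h5 := dist_idealExcursion_le hP hC hi1 hcl a
      have h6 : dist ((u.slow c hc).left t) (g (r k)) ≤ δ := by
        rw [hleft, dist_comm]; exact hk2
      have h7 : (C + 2) * ‖V - J‖ ≤ (C + 2) * (2 * δ) := by gcongr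
      have h8 : dist ((u.slow c hc).left t + ‖J‖ • P i a) (g ⌊(n : ℝ) * φ x⌋₊)
          ≤ dist ((u.slow c hc).left t) (g (r k)) + dist (‖J‖ • P i a)
            (g ⌊(n : ℝ) * φ x⌋₊ - g (r k)) := by
        have := dist_add_add_le ((u.slow c hc).left t) (‖J‖ • P i a) (g (r k))
          (g ⌊(n : ℝ) * φ x⌋₊ - g (r k))
        rwa [add_sub_cancel] at this
      have h9 := dist_triangle (‖J‖ • P i a) (idealExcursion ω P V a)
        (g ⌊(n : ℝ) * φ x⌋₊ - g (r k))
      have h10 : δ ≤ C * δ := le_mul_of_one_le_left hpos.le hC1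
      have h11 : C * δ ≤ C * η := by gcongr
      linarith
  rw [hkt]
  exact piece1.glue piece2 (w.shift_lt_preShift hst).le (w.preShift_le_shift t)

end IsInducedApprox

open IsInducedApprox in
/-- A step function whose excursions are close to ideal ones, and whose induced step function is
close to `u`, is close to the path `t ↦ u(c t)` decorated with profiles. -/
theorem edist_ofStep_decorate_le [Finite ι] {ω : ι → Sph d} (hω : Function.Injective ω)
    {P : ι → Cadlag d} (hP : ∀ i, IsProfile (P i) (ω i)) (u : Cadlag d) (c : I) (hc : 0 < c)
    (hdir : ∀ t ∈ (u.slow c hc).disc,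
      ∃ i, (u.slow c hc).jump t = ‖(u.slow c hc).jump t‖ • (ω i : Vec d))
    (hend : (u.slow c hc).left 1 = u.slow c hc 1) {ε : ℝ} (hε : 0 < ε) :
    ∃ δ : ℝ, 0 < δ ∧ ∀ (n m : ℕ) (g : ℕ → Vec d) (r : ℕ → ℕ) (lam : I ≃o I),
      IsInducedApprox ω P u c δ n m g r lam →
      edist (Decorated.ofStep n g) (decorate ω P hP (u.slow c hc)) ≤ ENNReal.ofReal ε := by
  obtain ⟨C, hC1, hC⟩ := exists_profile_bound P
  have hc' : (0 : ℝ) < c := hc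
  -- `72 = 4 * 18`: the pieces are close up to `18 * C * η`, and the passage to the distance of `F'`
  -- costs a factor 4.
  set η : ℝ := ε / (72 * C) with hη
  have hη0 : 0 < η := by positivity
  have hηε : 4 * (18 * C * η) = ε := by rw [hη]; field_simp; norm_num
  set w := decorate ω P hP (u.slow c hc) with hw
  -- The cut of the step function that corresponds to `t`. It is a return time except for `t = 1`,
  -- where the step function simply stops, possibly inside an excursion.
  set b : ℕ → ℕ → (ℕ → ℕ) → (I ≃o I) → I → ℝ := fun n m r lam t =>
    if t = 1 then 1 else (r (count m lam c t) : ℝ) / n with hb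
  have main : ∃ δ : ℝ, 0 < δ ∧ ∀ (n m : ℕ) (g : ℕ → Vec d) (r : ℕ → ℕ) (lam : I ≃o I),
      IsInducedApprox ω P u c δ n m g r lam →
      ReparamClose (18 * C * η) (fun x => ((w.time x : ℝ), w.stretched x))
        (fun y => (y, g ⌊(n : ℝ) * y⌋₊)) (w.shift 0) (w.shift 1)
        (b n m r lam 0) (b n m r lam 1) ∧
      ((1 : I) = 1 → dist (u.slow c hc 1) (g n) ≤ 18 * C * η) := by
    -- The threshold `δ` is quantified inside the relation, so transitivity takes the smaller of two
    -- thresholds. The clause for `t = 1` carries along the comparison of the end values, which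
    -- half-open pieces do not see.
    refine rel_zero_one_of_local (Q := fun s t => ∃ δ : ℝ, 0 < δ ∧
      ∀ (n m : ℕ) (g : ℕ → Vec d) (r : ℕ → ℕ) (lam : I ≃o I),
      IsInducedApprox ω P u c δ n m g r lam →
      ReparamClose (18 * C * η) (fun x => ((w.time x : ℝ), w.stretched x))
        (fun y => (y, g ⌊(n : ℝ) * y⌋₊)) (w.shift s) (w.shift t)
        (b n m r lam s) (b n m r lam t) ∧
      (t = 1 → dist (u.slow c hc 1) (g n) ≤ 18 * C * η)) ?_ ?_ ?_
    · rintro s t q hst htq ⟨δ₁, hδ₁, h₁⟩ ⟨δ₂, hδ₂, h₂⟩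
      refine ⟨min δ₁ δ₂, lt_min hδ₁ hδ₂, fun n m g r lam h => ?_⟩
      have e1 := h₁ n m g r lam (h.mono (min_le_left _ _))
      have e2 := h₂ n m g r lam (h.mono (min_le_right _ _))
      exact ⟨e1.1.glue e2.1 (w.strictMono_shift hst).le (w.strictMono_shift htq).le, e2.2⟩
    · intro t ht0
      have hosc := (Cadlag.tendsto_mul_left_nhdsLT hc t).eventually
        (u.eventually_osc_left (c * t) hη0)
      have hclose : ∀ᶠ s : I in 𝓝[<] t, |(s : ℝ) - t| < η :=
        mem_nhdsWithin_of_mem_nhds (eventually_abs_sub_lt t hη0)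
      filter_upwards [hosc, hclose, self_mem_nhdsWithin] with s hs1 hs2 hst
      have hst' : (s : ℝ) < t := hst
      have hs2' : (t : ℝ) - s ≤ η := by linarith [(abs_lt.1 hs2).1]
      have hs1ne : s ≠ 1 := (lt_of_lt_of_le hst (show t ≤ 1 from t.2.2)).ne
      rcases eq_or_lt_of_le (show t ≤ 1 from t.2.2) with ht1 | ht1
      · subst ht1
        -- Continuity at the end: `u` is near `u c` on both sides of `c`, as needed because the step
        -- function may run slightly too fast or too slow.
        have hcc : u.left (c * 1) = u c := by
          rw [← u.left_slow c hc zero_lt_one, hend, Cadlag.slow_apply, mul_one]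
        rw [hcc, mul_one] at hs1
        obtain ⟨ε₀, hε₀, hright⟩ : ∃ ε₀ > (0 : ℝ), ∀ z : I, c ≤ z → (z : ℝ) ≤ c + ε₀ →
            dist (u z) (u c) ≤ η := by
          have h1 := u.right_cont c (Metric.closedBall_mem_nhds (u c) hη0)
          obtain ⟨ε₁, hε₁, hsub⟩ := Metric.mem_nhdsWithin_iff.1 h1
          refine ⟨ε₁ / 2, half_pos hε₁, fun z hz1 hz2 => hsub ⟨?_, hz1⟩⟩
          have hz1' : (c : ℝ) ≤ z := hz1
          rw [Metric.mem_ball, Subtype.dist_eq, Real.dist_eq, abs_lt]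
          constructor <;> linarith
        have hs' : (0 : ℝ) < 1 - s := by
          have : ((1 : I) : ℝ) = 1 := rfl
          linarith
        refine ⟨min (min η (ε₀ / 4)) (min (c * η / 4) (c * (1 - s) / 4)),
          by positivity, fun n m g r lam h => ?_⟩
        have key := h.reparamClose_end (hP := hP) hc hC1 hC hdir (η := η) hst (p := u c)
          (fun z hz1 hz2 => ?_) hs2' ((min_le_left _ _).trans (min_le_left _ _)) ?_ ?_
        · refine ⟨?_, fun _ => key.2⟩
          simp only [hb, if_true, hs1ne, if_false]
          exact key.1
        · rcases lt_or_ge z c with hzc | hzc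
          · exact (hs1 z hz1 hzc).le
          · refine hright z hzc (hz2.trans ?_)
            have : min (min η (ε₀ / 4)) (min (c * η / 4) (c * (1 - s) / 4)) ≤ ε₀ / 4 :=
              (min_le_left _ _).trans (min_le_right _ _)
            linarith
        · have : min (min η (ε₀ / 4)) (min (c * η / 4) (c * (1 - s) / 4)) ≤ c * η / 4 :=
            (min_le_right _ _).trans (min_le_left _ _)
          linarith
        · have : min (min η (ε₀ / 4)) (min (c * η / 4) (c * (1 - s) / 4)) ≤ c * (1 - s) / 4 :=
            (min_le_right _ _).trans (min_le_right _ _)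
          linarith
      · have ht1' : (0 : ℝ) < 1 - t := by
          have : (t : ℝ) < 1 := ht1
          linarith
        have hts : (0 : ℝ) < t - s := by linarith
        have hbs : ∀ n m r lam, b n m r lam s = (r (count m lam c s) : ℝ) / n := fun n m r lam => by
          simp only [hb, hs1ne, if_false]
        have hbt : ∀ n m r lam, b n m r lam t = (r (count m lam c t) : ℝ) / n := fun n m r lam => by
          simp only [hb, ht1.ne, if_false]
        set δ₀ : ℝ := min (min η (c * η / 4)) (min (c * (t - s) / 4) (c * (1 - t) / 4)) with hδ₀
        have hδ₀pos : 0 < δ₀ := by positivity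
        have d1 : δ₀ ≤ η := (min_le_left _ _).trans (min_le_left _ _)
        have d2 : δ₀ ≤ c * η / 4 := (min_le_left _ _).trans (min_le_right _ _)
        have d3 : δ₀ ≤ c * (t - s) / 4 := (min_le_right _ _).trans (min_le_left _ _)
        have d4 : δ₀ ≤ c * (1 - t) / 4 := (min_le_right _ _).trans (min_le_right _ _)
        by_cases htd : t ∈ (u.slow c hc).disc
        · have hJ := Cadlag.jump_ne_zero _ htd
          have hJn := norm_pos_iff.2 hJ
          obtain ⟨i, hi⟩ := hdir t htd
          obtain ⟨ε₁, hε₁, hcl⟩ := Metric.eventually_nhds_iff.1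
            (eventually_closestProfile_eq hω P i hJn)
          rw [← hi] at hcl
          -- The bound by the size of the jump forces the jump to be matched by one excursion; the
          -- bound by `ε₁` makes the direction of the induced increment select the right profile.
          set δ₁ := min δ₀ (min (‖(u.slow c hc).jump t‖ / 4) (ε₁ / 4)) with hδ₁
          have d5 : δ₁ ≤ δ₀ := min_le_left _ _
          have d6 : δ₁ ≤ ‖(u.slow c hc).jump t‖ / 4 := (min_le_right _ _).trans (min_le_left _ _)
          have d7 : δ₁ ≤ ε₁ / 4 := (min_le_right _ _).trans (min_le_right _ _)
          refine ⟨δ₁, by positivity, fun n m g r lam h => ⟨?_, fun h1 => absurd h1 ht1.ne⟩⟩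
          rw [hbs, hbt]
          refine h.reparamClose_jump (hP := hP) hc hC1 hC hdir hst htd
            (fun z hz1 hz2 => (hs1 z hz1 hz2).le) hs2' (d5.trans d1) (by linarith) (by linarith)
            (by linarith) (by linarith) ?_
          intro j hj V hV
          have hij : i = j := by
            apply hω
            have h1 := hi.symm.trans hj
            exact Subtype.ext (smul_right_injective _ hJn.ne' h1)
          rw [← hij]
          refine hcl ?_
          rw [dist_eq_norm]
          linarith
        · refine ⟨δ₀, hδ₀pos, fun n m g r lam h => ⟨?_, fun h1 => absurd h1 ht1.ne⟩⟩
          rw [hbs, hbt]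
          -- Without a jump the left limit is the value, so the piece may be closed at `t`.
          have hle : u.left (c * t) = u (c * t) := by
            rw [← u.left_slow c hc ht0, Cadlag.left_eq_of_notMem_disc ht1 htd]
            rfl
          refine h.reparamClose_of_osc (hP := hP) hc hC1 hC hdir hst (p := u.left (c * t))
            (fun z hz1 hz2 => ?_) hs2' d1 (by linarith) (by linarith) (by linarith)
          rcases hz2.eq_or_lt with rfl | hlt
          · rw [hle, dist_self]; exact hη0.le
          · exact (hs1 z hz1 hlt).le
    · intro t ht1
      have hosc := (Cadlag.tendsto_mul_left_nhdsGT hc t).eventually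
        (u.eventually_osc_right (c * t) hη0)
      have hclose : ∀ᶠ s : I in 𝓝[>] t, |(s : ℝ) - t| < η :=
        mem_nhdsWithin_of_mem_nhds (eventually_abs_sub_lt t hη0)
      filter_upwards [hosc, hclose, Ioo_mem_nhdsGT ht1] with q hq1 hq2 hq3
      obtain ⟨htq, hq1'⟩ := hq3
      have htq' : (0 : ℝ) < q - t := by
        have : (t : ℝ) < q := htq
        linarith
      have hq' : (0 : ℝ) < 1 - q := by
        have : (q : ℝ) < 1 := hq1'
        linarith
      set δ₀ : ℝ := min (min η (c * η / 4)) (min (c * (q - t) / 4) (c * (1 - q) / 4)) with hδ₀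
      have hδ₀pos : 0 < δ₀ := by positivity
      have d1 : δ₀ ≤ η := (min_le_left _ _).trans (min_le_left _ _)
      have d2 : δ₀ ≤ c * η / 4 := (min_le_left _ _).trans (min_le_right _ _)
      have d3 : δ₀ ≤ c * (q - t) / 4 := (min_le_right _ _).trans (min_le_left _ _)
      have d4 : δ₀ ≤ c * (1 - q) / 4 := (min_le_right _ _).trans (min_le_right _ _)
      refine ⟨δ₀, hδ₀pos, fun n m g r lam h => ⟨?_, fun h1 => absurd h1 hq1'.ne⟩⟩
      simp only [hb, ht1.ne, hq1'.ne, if_false]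
      exact h.reparamClose_of_osc (hP := hP) hc hC1 hC hdir htq (p := u (c * t))
        (fun z hz1 hz2 => (hq1 z hz1 hz2).le) (by linarith [(abs_lt.1 hq2).2]) d1 (by linarith)
        (by linarith) (by linarith)
  obtain ⟨δ, hδ, h⟩ := main
  refine ⟨δ, hδ, fun n m g r lam hap => ?_⟩
  obtain ⟨h1, h2⟩ := h n m g r lam hap
  have hb0 : b n m r lam 0 = 0 := by
    have : count m lam c 0 = 0 := by
      rw [count, mul_zero, show lam 0 = 0 from lam.map_bot]; simp
    simp [hb, this, hap.zero]
  have hb1 : b n m r lam 1 = 1 := by simp [hb]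
  rw [w.shift_zero, w.shift_one, hb0, hb1] at h1
  rw [← hηε]
  exact w.edist_ofStep_le_of_reparamClose (by exact_mod_cast hap.n_pos) g (by positivity) h1 (h2 rfl)

end Induced

end DecoratedLevy

namespace DecoratedLevy

/-! ### The Laplace transform of a power in the right half-plane. -/

section GammaIntegral

lemma integrableOn_rpow_mul_exp_neg_mul {a b : ℝ} (ha : -1 < a) (hb : 0 < b) :
    IntegrableOn (fun t : ℝ => t ^ a * Real.exp (-b * t)) (Ioi 0) := by
  simpa using integrableOn_rpow_mul_exp_neg_mul_rpow ha (zero_lt_one' ℝ) hb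

lemma norm_exp_neg_mul_ofReal (z : ℂ) (t : ℝ) :
    ‖Complex.exp (-z * t)‖ = Real.exp (-z.re * t) := by
  rw [Complex.norm_exp]; simp

/-- Differentiation under the integral: for `w` within `Re z / 2` of `z`, the integrand decays at
least like `exp(-t Re z / 2)`. -/
lemma differentiableAt_laplace_rpow {a : ℝ} (ha : -1 < a) {z : ℂ} (hz : 0 < z.re) :
    DifferentiableAt ℂ
      (fun z : ℂ => ∫ t : ℝ in Ioi 0, ((t ^ a : ℝ) : ℂ) * Complex.exp (-z * t)) z := by
  have hz2 : 0 < z.re / 2 := half_pos hz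
  have hmeas : ∀ (b : ℝ) (w : ℂ), AEStronglyMeasurable
      (fun t : ℝ => ((t ^ b : ℝ) : ℂ) * Complex.exp (-w * t)) (volume.restrict (Ioi 0)) := by
    intro b w
    exact (by fun_prop : Measurable fun t : ℝ =>
      ((t ^ b : ℝ) : ℂ) * Complex.exp (-w * t)).aestronglyMeasurable
  have hnorm : ∀ (b : ℝ) (w : ℂ) (t : ℝ), 0 < t →
      ‖((t ^ b : ℝ) : ℂ) * Complex.exp (-w * t)‖ = t ^ b * Real.exp (-w.re * t) := by
    intro b w t ht
    rw [norm_mul, norm_exp_neg_mul_ofReal, Complex.norm_real, Real.norm_eq_abs,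
      abs_of_nonneg (Real.rpow_nonneg ht.le _)]
  refine (hasDerivAt_integral_of_dominated_loc_of_deriv_le (μ := volume.restrict (Ioi 0))
    (F' := fun w t => -(((t ^ (a + 1) : ℝ) : ℂ) * Complex.exp (-w * t)))
    (bound := fun t => t ^ (a + 1) * Real.exp (-(z.re / 2) * t))
    (Metric.ball_mem_nhds z hz2) (Eventually.of_forall fun w => hmeas a w) ?_
    (hmeas (a + 1) z).neg ?_ (integrableOn_rpow_mul_exp_neg_mul (by linarith) hz2) ?_).2.differentiableAt
  · refine Integrable.mono (integrableOn_rpow_mul_exp_neg_mul ha hz) (hmeas a z) ?_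
    filter_upwards [ae_restrict_mem measurableSet_Ioi] with t ht
    rw [hnorm a z t ht]
    exact le_abs_self _
  · filter_upwards [ae_restrict_mem measurableSet_Ioi] with t ht w hw
    have ht' : 0 < t := ht
    rw [norm_neg, hnorm _ w t ht]
    refine mul_le_mul_of_nonneg_left (Real.exp_le_exp.2 ?_) (Real.rpow_nonneg ht'.le _)
    have h1 : |w.re - z.re| < z.re / 2 := by
      rw [← Complex.sub_re]
      exact (Complex.abs_re_le_norm _).trans_lt (by rwa [← dist_eq_norm])
    nlinarith [(abs_lt.1 h1).1]
  · filter_upwards [ae_restrict_mem measurableSet_Ioi] with t ht w _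
    have ht' : 0 < t := ht
    have h1 : HasDerivAt (fun w : ℂ => -w * (t : ℂ)) (-(t : ℂ)) w := by
      simpa using (hasDerivAt_id w).neg.mul_const (t : ℂ)
    have h2 := (h1.cexp).const_mul ((t ^ a : ℝ) : ℂ)
    convert! h2 using 1
    rw [Real.rpow_add ht', Real.rpow_one]
    push_cast
    ring

/-- The Laplace transform of a power: `∫₀^∞ t^a e^{-zt} dt = Γ(a+1) z^{-(a+1)}` for `Re z > 0`. -/
lemma integral_rpow_mul_cexp_neg_mul {a : ℝ} (ha : -1 < a) {z : ℂ} (hz : 0 < z.re) :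
    ∫ t : ℝ in Ioi 0, ((t ^ a : ℝ) : ℂ) * Complex.exp (-z * t)
      = (Real.Gamma (a + 1) : ℂ) * z ^ (-((a + 1 : ℝ) : ℂ)) := by
  have hopen : IsOpen {z : ℂ | 0 < z.re} := isOpen_lt continuous_const Complex.continuous_re
  have hconn : IsPreconnected {z : ℂ | 0 < z.re} := (convex_halfSpace_re_gt 0).isPreconnected
  have hF : AnalyticOnNhd ℂ
      (fun z : ℂ => ∫ t : ℝ in Ioi 0, ((t ^ a : ℝ) : ℂ) * Complex.exp (-z * t))
      {z : ℂ | 0 < z.re} :=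
    DifferentiableOn.analyticOnNhd
      (fun z hz => (differentiableAt_laplace_rpow ha hz).differentiableWithinAt) hopen
  have hG : AnalyticOnNhd ℂ
      (fun z : ℂ => (Real.Gamma (a + 1) : ℂ) * z ^ (-((a + 1 : ℝ) : ℂ))) {z : ℂ | 0 < z.re} := by
    refine DifferentiableOn.analyticOnNhd (fun z hz => ?_) hopen
    refine DifferentiableAt.differentiableWithinAt ?_
    exact (differentiableAt_id.cpow_const (Or.inl hz)).const_mul _
  have hreal : ∀ x : ℝ, 0 < x →
      ∫ t : ℝ in Ioi 0, ((t ^ a : ℝ) : ℂ) * Complex.exp (-(x : ℂ) * t)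
        = (Real.Gamma (a + 1) : ℂ) * (x : ℂ) ^ (-((a + 1 : ℝ) : ℂ)) := by
    intro x hx
    have h := Real.integral_rpow_mul_exp_neg_mul_Ioi (a := a + 1) (by linarith) hx
    rw [add_sub_cancel_right] at h
    have h1 : ∀ t : ℝ, ((t ^ a : ℝ) : ℂ) * Complex.exp (-(x : ℂ) * t)
        = ((t ^ a * Real.exp (-(x * t)) : ℝ) : ℂ) := by
      intro t; push_cast; ring_nf
    simp only [h1]
    rw [integral_complex_ofReal, h, Complex.ofReal_mul, mul_comm, one_div, Real.inv_rpow hx.le,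
      ← Real.rpow_neg hx.le, Complex.ofReal_cpow hx.le]
    push_cast
    rfl
  -- Identity theorem: both sides are analytic in the half-plane, and by the real Gamma integral
  -- they agree at the points `1 + 1/(n+1)`, which accumulate at 1.
  refine hF.eqOn_of_preconnected_of_frequently_eq hG hconn
    (show (1 : ℂ) ∈ {z : ℂ | 0 < z.re} by simp) ?_ hz
  have hseq : Tendsto (fun n : ℕ => ((1 + 1 / ((n : ℝ) + 1) : ℝ) : ℂ)) atTop (𝓝[≠] 1) := by
    refine tendsto_nhdsWithin_iff.2 ⟨?_, Eventually.of_forall fun n => ?_⟩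
    · have h := tendsto_one_div_add_atTop_nhds_zero_nat (𝕜 := ℝ)
      have h2 := (Complex.continuous_ofReal.tendsto _).comp (h.const_add 1)
      simpa [Function.comp_def] using h2
    · have h0 : (0 : ℝ) < 1 / ((n : ℝ) + 1) := by positivity
      intro h1
      have h2 : (1 + 1 / ((n : ℝ) + 1) : ℝ) = 1 := Complex.ofReal_injective (by simpa using h1)
      linarith
  exact hseq.frequently (Frequently.of_forall fun n => hreal _ (by positivity))

end GammaIntegral

/-! ### The stable exponent as a sum of complex powers. -/

section Exponent

variable {d : ℕ}

/-- The one-dimensional exponent, `Γ(1-α) (-is)^α`. -/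
noncomputable def scalarExponent (α s : ℝ) : ℂ :=
  (Real.Gamma (1 - α) : ℂ) * (-(Complex.I * s)) ^ (α : ℂ)

/-- For `s ≠ 0` the number `-is` has modulus `|s|` and argument `-sgn(s) π/2`, so its principal
power has argument `-sgn(s) πα/2`. Since `α ≠ 1`, the cosine does not vanish and the tangent can be
multiplied out. -/
lemma scalarExponent_eq {α : ℝ} (hα0 : 0 < α) (hα2 : α < 2) (hα1 : α ≠ 1) (s : ℝ) :
    ((|s| ^ α : ℝ) : ℂ) *
      (1 - Complex.I * (Real.sign s : ℂ) * (Real.tan (Real.pi * α / 2) : ℂ)) *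
      ((Real.cos (Real.pi * α / 2) * Real.Gamma (1 - α) : ℝ) : ℂ) = scalarExponent α s := by
  have hcos : Real.cos (Real.pi * α / 2) ≠ 0 := by
    intro h
    rw [Real.cos_eq_zero_iff] at h
    obtain ⟨k, hk⟩ := h
    have hpi := Real.pi_pos
    have h1 : α = 2 * k + 1 := by
      have : Real.pi * α = Real.pi * (2 * k + 1) := by linarith
      exact mul_left_cancel₀ hpi.ne' this
    have h2 : (k : ℝ) < 1 := by linarith
    have h3 : (-1 : ℝ) < k := by linarith
    have h4 : k < 1 := by exact_mod_cast h2
    have h5 : -1 < k := by exact_mod_cast h3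
    have h6 : k = 0 := by omega
    exact hα1 (by rw [h1, h6]; norm_num)
  have htan : (Real.tan (Real.pi * α / 2) : ℂ) * (Real.cos (Real.pi * α / 2) : ℂ)
      = (Real.sin (Real.pi * α / 2) : ℂ) := by
    rw [← Complex.ofReal_mul, Real.tan_mul_cos hcos]
  have hpow : (-(Complex.I * s)) ^ (α : ℂ)
      = ((|s| ^ α : ℝ) : ℂ) * (Real.cos (Real.pi * α / 2)
        - Complex.I * (Real.sign s : ℂ) * Real.sin (Real.pi * α / 2)) := by
    have key : ∀ (x : ℂ) (θ : ℝ), x ≠ 0 → s ≠ 0 → Complex.log x = θ * Complex.I →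
        (((|s| : ℝ) : ℂ) * x) ^ (α : ℂ) = ((|s| ^ α : ℝ) : ℂ) *
          (Real.cos (θ * α) + Real.sin (θ * α) * Complex.I) := by
      intro x θ hx hs hlog
      have hs' : 0 < |s| := abs_pos.2 hs
      rw [Complex.cpow_def_of_ne_zero (mul_ne_zero (by exact_mod_cast hs'.ne') hx),
        Complex.log_ofReal_mul hs' hx, add_mul, Complex.exp_add, hlog, Real.rpow_def_of_pos hs',
        Complex.ofReal_cos, Complex.ofReal_sin, ← Complex.exp_mul_I]
      push_cast
      ring_nf
    rcases lt_trichotomy s 0 with hs | rfl | hs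
    · have h1 : -(Complex.I * (s : ℂ)) = ((|s| : ℝ) : ℂ) * Complex.I := by
        rw [abs_of_neg hs]; push_cast; ring
      rw [h1, key _ (Real.pi / 2) Complex.I_ne_zero hs.ne (by rw [Complex.log_I]; push_cast; ring),
        Real.sign_of_neg hs, div_mul_eq_mul_div]
      push_cast
      ring
    · simp [hα0.ne']
    · have h1 : -(Complex.I * (s : ℂ)) = ((|s| : ℝ) : ℂ) * (-Complex.I) := by
        rw [abs_of_pos hs]; ring
      rw [h1, key _ (-(Real.pi / 2)) (neg_ne_zero.2 Complex.I_ne_zero) hs.ne'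
        (by rw [Complex.log_neg_I]; push_cast; ring), Real.sign_of_pos hs, neg_mul,
        Real.cos_neg, Real.sin_neg, div_mul_eq_mul_div]
      push_cast
      ring
  rw [scalarExponent, hpow, Complex.ofReal_mul]
  linear_combination (-((|s| ^ α : ℝ) : ℂ) * Complex.I * (Real.sign s : ℂ) *
    (Real.Gamma (1 - α) : ℂ)) * htan

lemma stableExponent_spectralMeasure {ι : Type*} [Fintype ι] {α : ℝ} (hα0 : 0 < α) (hα2 : α < 2)
    (hα1 : α ≠ 1) {a : ι → ℝ} (ha : ∀ i, 0 < a i) (ω : ι → Sph d) (y : Vec d) :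
    stableExponent α (spectralMeasure a ω) y
      = ∑ i, (a i : ℂ) * scalarExponent α (inner ℝ y (ω i : Vec d)) := by
  simp only [stableExponent, spectralMeasure, scalarExponent_eq hα0 hα2 hα1]
  rw [integral_finsetSum_measure fun i _ => ?_]
  · refine Finset.sum_congr rfl fun i _ => ?_
    rw [integral_smul_measure, integral_dirac, ENNReal.toReal_ofReal (ha i).le,
      Complex.real_smul]
  · exact (integrable_dirac (by simp)).smul_measure ENNReal.ofReal_ne_top

/-- A crude quadratic bound that suffices for integrability against Schwartz functions. -/
lemma norm_scalarExponent_le {α : ℝ} (hα0 : 0 < α) (hα2 : α < 2) (s : ℝ) :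
    ‖scalarExponent α s‖ ≤ |Real.Gamma (1 - α)| * (1 + |s|) ^ 2 := by
  rw [scalarExponent, norm_mul, Complex.norm_real, Real.norm_eq_abs, Complex.norm_cpow_real]
  refine mul_le_mul_of_nonneg_left ?_ (abs_nonneg _)
  have h1 : ‖-(Complex.I * (s : ℂ))‖ = |s| := by simp
  rw [h1, ← Real.rpow_natCast]
  calc |s| ^ α ≤ (1 + |s|) ^ α := Real.rpow_le_rpow (abs_nonneg _) (by linarith) hα0.le
    _ ≤ (1 + |s|) ^ ((2 : ℕ) : ℝ) :=
        Real.rpow_le_rpow_of_exponent_le (by linarith [abs_nonneg s]) (by push_cast; linarith)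

lemma continuous_scalarExponent {α : ℝ} (hα0 : 0 < α) : Continuous (scalarExponent α) := by
  unfold scalarExponent
  refine continuous_const.mul ?_
  rw [continuous_iff_continuousAt]
  intro s
  refine ContinuousAt.comp (f := fun s : ℝ => -(Complex.I * (s : ℂ)))
    (Complex.continuousAt_cpow_const_of_re_pos (by simp) (by simpa using hα0)) (by fun_prop)

end Exponent

end DecoratedLevy

namespace DecoratedLevy

/-! ### Test functions supported off the rays, and small times. -/

section FourierSide

open scoped SchwartzMap LineDeriv FourierTransform

variable {d : ℕ}

lemma integrable_norm_mul_one_add_sq (f : 𝓢(Vec d, ℂ)) (K : ℝ) :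
    Integrable fun y => ‖f y‖ * (1 + K * ‖y‖) ^ 2 := by
  have h0 := f.integrable_pow_mul volume 0
  have h1 := f.integrable_pow_mul volume 1
  have h2 := f.integrable_pow_mul volume 2
  refine ((h0.add (h1.const_mul (2 * K))).add (h2.const_mul (K ^ 2))).congr
    (Eventually.of_forall fun y => ?_)
  simp only [Pi.add_apply]
  ring

lemma integral_fourier_mul_exp (f : 𝓢(Vec d, ℂ)) (x : Vec d) :
    ∫ y, 𝓕 f y * Complex.exp (2 * Real.pi * inner ℝ y x * Complex.I) = f x := by
  have h : (𝓕⁻ (𝓕 f)) x = f x := by rw [FourierTransform.fourierInv_fourier_eq]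
  rw [← h, SchwartzMap.fourierInv_coe, Real.fourierInv_eq']
  refine integral_congr_ae (Eventually.of_forall fun y => ?_)
  simp only [smul_eq_mul]
  push_cast
  rw [mul_comm]

/-- The differential operator `(ε - ∂_ω)²`. -/
noncomputable def squareOp (ε : ℝ) (w : Vec d) (f : 𝓢(Vec d, ℂ)) : 𝓢(Vec d, ℂ) :=
  (ε : ℂ) ^ 2 • f - (2 * ε : ℂ) • ∂_{w} f + ∂_{w} (∂_{w} f)

lemma fourier_lineDeriv_apply (f : 𝓢(Vec d, ℂ)) (w y : Vec d) :
    𝓕 (∂_{w} f) y = 2 * Real.pi * inner ℝ y w * Complex.I * 𝓕 f y := by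
  have : (inner ℝ · w : Vec d → ℝ).HasTemperateGrowth := ((innerSL ℝ).flip w).hasTemperateGrowth
  rw [SchwartzMap.fourier_lineDerivOp_eq, smul_apply,
    SchwartzMap.smulLeftCLM_apply_apply this, smul_eq_mul, Complex.real_smul]
  ring

/-- This is the factor `z²` for `z = ε - 2πi⟨y,w⟩`, which turns a power of exponent `α - 2 < 0` into
one of exponent `α`. -/
lemma fourier_squareOp (ε : ℝ) (w : Vec d) (f : 𝓢(Vec d, ℂ)) (y : Vec d) :
    𝓕 (squareOp ε w f) y = ((ε : ℂ) - 2 * Real.pi * inner ℝ y w * Complex.I) ^ 2 * 𝓕 f y := by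
  have h : 𝓕 (squareOp ε w f)
      = (ε : ℂ) ^ 2 • 𝓕 f - (2 * ε : ℂ) • 𝓕 (∂_{w} f) + 𝓕 (∂_{w} (∂_{w} f)) := by
    simp only [squareOp, ← SchwartzMap.fourierTransformCLM_apply (𝕜 := ℂ), map_add, map_sub,
      map_smul]
  rw [h]
  simp only [add_apply, sub_apply, smul_apply, smul_eq_mul,
    fourier_lineDeriv_apply]
  ring

/-- A differential operator is local. -/
lemma squareOp_eq_zero (ε : ℝ) (w : Vec d) {f : 𝓢(Vec d, ℂ)} {x : Vec d} (h : f =ᶠ[𝓝 x] 0) :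
    squareOp ε w f x = 0 := by
  have h1 : ∀ {f : 𝓢(Vec d, ℂ)}, f =ᶠ[𝓝 x] 0 → ⇑(∂_{w} f : 𝓢(Vec d, ℂ)) =ᶠ[𝓝 x] 0 := by
    intro f hf
    filter_upwards [hf.eventuallyEq_nhds] with y hy
    rw [SchwartzMap.lineDerivOp_apply_eq_fderiv, hy.fderiv_eq]
    simp
  have e0 := h.eq_of_nhds
  have e1 := (h1 h).eq_of_nhds
  have e2 := (h1 (h1 h)).eq_of_nhds
  simp only [Pi.zero_apply] at e0 e1 e2
  simp [squareOp, e0, e1, e2]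

/-- Write `z^α = z² z^{-(2-α)}`. The factor `z²` replaces `f` by `(ε - ∂_w)² f`, and the other
factor is a multiple of `∫ r^{1-α} e^{-zr} dr`. After Fubini, Fourier inversion evaluates `(ε -
∂_w)² f` at the points `r w`, near which `f` vanishes. The positive `ε` makes the integral over `r`
absolutely convergent. -/
lemma integral_fourier_mul_cpow_add {α : ℝ} (hα2 : α < 2) {w : Vec d}
    {f : 𝓢(Vec d, ℂ)} (hf : ∀ r : ℝ, 0 < r → f =ᶠ[𝓝 (r • w)] 0) {ε : ℝ} (hε : 0 < ε) :
    ∫ y, 𝓕 f y * ((ε : ℂ) - 2 * Real.pi * inner ℝ y w * Complex.I) ^ (α : ℂ) = 0 := by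
  set z : Vec d → ℂ := fun y => (ε : ℂ) - 2 * Real.pi * inner ℝ y w * Complex.I with hz
  have hre : ∀ y, (z y).re = ε := by intro y; simp [hz]
  have hΓ : (Real.Gamma (2 - α) : ℂ) ≠ 0 := by
    exact_mod_cast (Real.Gamma_pos_of_pos (by linarith)).ne'
  have hexp : (-1 : ℝ) < 1 - α := by linarith
  have h1 : ∀ y, 𝓕 f y * z y ^ (α : ℂ) = (Real.Gamma (2 - α) : ℂ)⁻¹ *
      ∫ r : ℝ in Ioi 0, 𝓕 (squareOp ε w f) y *
        (((r ^ (1 - α) : ℝ) : ℂ) * Complex.exp (-z y * r)) := by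
    intro y
    have hz0 : z y ≠ 0 := by
      intro h0
      have := hre y
      rw [h0] at this
      exact hε.ne this
    rw [integral_const_mul, integral_rpow_mul_cexp_neg_mul hexp (by rw [hre]; exact hε),
      fourier_squareOp, show 1 - α + 1 = 2 - α by ring]
    have h2 : z y ^ (α : ℂ) = z y ^ 2 * z y ^ (-((2 - α : ℝ) : ℂ)) := by
      rw [← Complex.cpow_ofNat, ← Complex.cpow_add _ _ hz0]
      congr 1
      push_cast
      ring
    rw [h2]
    field_simp
    ring
  rw [integral_congr_ae (Eventually.of_forall h1)]
  rw [integral_const_mul, integral_integral_swap]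
  · have h3 : ∀ r ∈ Ioi (0 : ℝ), ∫ y, 𝓕 (squareOp ε w f) y *
        (((r ^ (1 - α) : ℝ) : ℂ) * Complex.exp (-z y * r)) = 0 := by
      intro r hr
      have h4 : ∀ y, 𝓕 (squareOp ε w f) y *
          (((r ^ (1 - α) : ℝ) : ℂ) * Complex.exp (-z y * r))
          = (((r ^ (1 - α) : ℝ) : ℂ) * Complex.exp (-ε * r)) * (𝓕 (squareOp ε w f) y *
            Complex.exp (2 * Real.pi * inner ℝ y (r • w) * Complex.I)) := by
        intro y
        have h5 : Complex.exp (-z y * r) = Complex.exp (-ε * r) *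
            Complex.exp (2 * Real.pi * inner ℝ y (r • w) * Complex.I) := by
          rw [← Complex.exp_add, inner_smul_right]
          congr 1
          simp only [hz]
          push_cast
          ring
        rw [h5]
        ring
      simp only [h4]
      rw [integral_const_mul, integral_fourier_mul_exp, squareOp_eq_zero ε w (hf r hr), mul_zero]
    rw [setIntegral_congr_fun measurableSet_Ioi h3]
    simp
  · have hprod : Integrable (fun p : Vec d × ℝ => ‖𝓕 (squareOp ε w f) p.1‖ *
        (p.2 ^ (1 - α) * Real.exp (-ε * p.2))) (volume.prod (volume.restrict (Ioi 0))) :=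
      (SchwartzMap.integrable (𝓕 (squareOp ε w f))).norm.mul_prod
        (integrableOn_rpow_mul_exp_neg_mul hexp hε)
    refine hprod.mono ?_ ?_
    · have hm1 : Continuous fun y => 𝓕 (squareOp ε w f) y := SchwartzMap.continuous _
      have : Measurable fun p : Vec d × ℝ => 𝓕 (squareOp ε w f) p.1 *
          (((p.2 ^ (1 - α) : ℝ) : ℂ) * Complex.exp (-z p.1 * p.2)) := by
        have := hm1.measurable
        have hzm : Measurable z := by fun_prop
        fun_prop
      exact this.aestronglyMeasurable
    · have hpos : ∀ᵐ p : Vec d × ℝ ∂(volume.prod (volume.restrict (Ioi 0))), p.2 ∈ Ioi (0 : ℝ) :=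
        Measure.quasiMeasurePreserving_snd.ae (ae_restrict_mem measurableSet_Ioi)
      filter_upwards [hpos] with p hp
      have hp' : 0 < p.2 := hp
      rw [Function.uncurry_def, norm_mul, norm_mul, norm_exp_neg_mul_ofReal, hre, Complex.norm_real,
        norm_mul, norm_mul, norm_norm, Real.norm_eq_abs (Real.exp _), Real.abs_exp]

/-- A function that vanishes near the ray through `w` is orthogonal to the exponent of the stable
law concentrated on that ray. -/
lemma integral_fourier_mul_scalarExponent {α : ℝ} (hα0 : 0 < α) (hα2 : α < 2) {w : Vec d}
    {f : 𝓢(Vec d, ℂ)} (hf : ∀ r : ℝ, 0 < r → f =ᶠ[𝓝 (r • w)] 0) :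
    ∫ y, 𝓕 f y * scalarExponent α (2 * Real.pi * inner ℝ y w) = 0 := by
  have key : ∫ y, 𝓕 f y * (-(Complex.I * ((2 * Real.pi * inner ℝ y w : ℝ) : ℂ))) ^ (α : ℂ) = 0 := by
    -- The regularisation `ε = 1/(n+1)` is removed by dominated convergence; the dominating function
    -- uses `ε ≤ 1` and `α < 2`.
    have hlim : Tendsto (fun n : ℕ => ∫ y, 𝓕 f y *
        (((1 / ((n : ℝ) + 1) : ℝ) : ℂ) - 2 * Real.pi * inner ℝ y w * Complex.I) ^ (α : ℂ)) atTop
        (𝓝 (∫ y, 𝓕 f y * (-(Complex.I * ((2 * Real.pi * inner ℝ y w : ℝ) : ℂ))) ^ (α : ℂ))) := by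
      refine tendsto_integral_of_dominated_convergence
        (fun y => ‖𝓕 f y‖ * (1 + 2 * Real.pi * ‖w‖ * ‖y‖) ^ 2) (fun n => ?_)
        (integrable_norm_mul_one_add_sq _ _) (fun n => Eventually.of_forall fun y => ?_)
        (Eventually.of_forall fun y => ?_)
      · have hm1 : Continuous fun y => 𝓕 f y := SchwartzMap.continuous _
        have hm2 : Measurable fun y : Vec d => (((1 / ((n : ℝ) + 1) : ℝ) : ℂ) -
          2 * Real.pi * inner ℝ y w * Complex.I) ^ (α : ℂ) := by fun_prop
        exact (hm1.measurable.mul hm2).aestronglyMeasurable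
      · rw [norm_mul, Complex.norm_cpow_real]
        refine mul_le_mul_of_nonneg_left ?_ (norm_nonneg _)
        have h1 : ‖((1 / ((n : ℝ) + 1) : ℝ) : ℂ) - 2 * Real.pi * inner ℝ y w * Complex.I‖
            ≤ 1 + 2 * Real.pi * ‖w‖ * ‖y‖ := by
          refine (norm_sub_le _ _).trans (add_le_add ?_ ?_)
          · rw [Complex.norm_real, Real.norm_eq_abs, abs_of_pos (by positivity)]
            exact (div_le_one (by positivity)).2 (by linarith [(n.cast_nonneg : (0 : ℝ) ≤ n)])
          · rw [norm_mul, Complex.norm_I, mul_one, norm_mul, Complex.norm_real, norm_mul,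
              Complex.norm_real, Complex.norm_ofNat, Real.norm_eq_abs Real.pi,
              abs_of_pos Real.pi_pos, mul_assoc _ ‖w‖, mul_comm ‖w‖]
            exact mul_le_mul_of_nonneg_left (norm_inner_le_norm y w) (by positivity)
        calc _ ≤ (1 + 2 * Real.pi * ‖w‖ * ‖y‖) ^ α :=
              Real.rpow_le_rpow (norm_nonneg _) h1 hα0.le
          _ ≤ (1 + 2 * Real.pi * ‖w‖ * ‖y‖) ^ ((2 : ℕ) : ℝ) := by
              refine Real.rpow_le_rpow_of_exponent_le ?_ (by push_cast; linarith)
              have : 0 ≤ 2 * Real.pi * ‖w‖ * ‖y‖ := by positivity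
              linarith
          _ = _ := Real.rpow_natCast _ _
      · refine Tendsto.const_mul _ ?_
        refine (Complex.continuousAt_cpow_const_of_re_pos (by simp) (by simpa using hα0)).tendsto.comp
          ?_
        have h := tendsto_one_div_add_atTop_nhds_zero_nat (𝕜 := ℝ)
        have h2 := ((Complex.continuous_ofReal.tendsto _).comp h).sub_const
          (2 * Real.pi * inner ℝ y w * Complex.I)
        convert h2 using 2
        · rfl
        · push_cast
          ring
    refine tendsto_nhds_unique hlim ?_
    have : ∀ n : ℕ, ∫ y, 𝓕 f y *
        (((1 / ((n : ℝ) + 1) : ℝ) : ℂ) - 2 * Real.pi * inner ℝ y w * Complex.I) ^ (α : ℂ) = 0 :=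
      fun n => integral_fourier_mul_cpow_add hα2 hf (by positivity)
    simp only [this]
    exact tendsto_const_nhds
  simp only [scalarExponent]
  have h : ∀ y, 𝓕 f y * ((Real.Gamma (1 - α) : ℂ) *
      (-(Complex.I * ((2 * Real.pi * inner ℝ y w : ℝ) : ℂ))) ^ (α : ℂ))
      = (Real.Gamma (1 - α) : ℂ) * (𝓕 f y *
        (-(Complex.I * ((2 * Real.pi * inner ℝ y w : ℝ) : ℂ))) ^ (α : ℂ)) := fun y => by ring
  simp only [h]
  rw [integral_const_mul, key, mul_zero]

/-- Fourier inversion of `f` and Fubini. The factor `2π` reconciles the conventions of the Fourier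
transform and of the characteristic function. -/
lemma integral_eq_integral_fourier_mul_charFun (f : 𝓢(Vec d, ℂ)) (ρ : Measure (Vec d))
    [IsProbabilityMeasure ρ] :
    ∫ x, f x ∂ρ = ∫ y, 𝓕 f y * charFun ρ ((2 * Real.pi) • y) := by
  have hc : Continuous fun y => 𝓕 f y := SchwartzMap.continuous _
  have h1 : ∀ y, 𝓕 f y * charFun ρ ((2 * Real.pi) • y)
      = ∫ x, 𝓕 f y * Complex.exp (2 * Real.pi * inner ℝ y x * Complex.I) ∂ρ := by
    intro y
    rw [charFun_apply, integral_const_mul]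
    congr 2
    ext x
    rw [inner_smul_right, real_inner_comm]
    push_cast
    ring_nf
  simp only [h1]
  rw [integral_integral_swap]
  · exact integral_congr_ae (Eventually.of_forall fun x => (integral_fourier_mul_exp f x).symm)
  · have hprod : Integrable (fun p : Vec d × Vec d => ‖𝓕 f p.1‖ * (1 : ℝ)) (volume.prod ρ) :=
      (SchwartzMap.integrable (𝓕 f)).norm.mul_prod (integrable_const (1 : ℝ))
    refine hprod.mono ?_ (Eventually.of_forall fun p => ?_)
    · have : Measurable fun p : Vec d × Vec d => 𝓕 f p.1 *
          Complex.exp (2 * Real.pi * inner ℝ p.1 p.2 * Complex.I) := by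
        have := hc.measurable
        fun_prop
      exact this.aestronglyMeasurable
    · have h2 : (2 * Real.pi * inner ℝ p.1 p.2 * Complex.I : ℂ)
          = ((2 * Real.pi * inner ℝ p.1 p.2 : ℝ) : ℂ) * Complex.I := by push_cast; ring
      rw [Function.uncurry_def, norm_mul, h2, Complex.norm_exp_ofReal_mul_I]
      simp

/-- For `‖w‖ ≤ 1` this is the Taylor bound; for `‖w‖ ≥ 1` the left side is at most 2. It provides a
bound on `n (e^{-ψ/n} - 1)` that does not depend on `n`. -/
lemma norm_exp_sub_one_le_two_mul {w : ℂ} (h : ‖Complex.exp w‖ ≤ 1) :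
    ‖Complex.exp w - 1‖ ≤ 2 * ‖w‖ := by
  rcases le_total ‖w‖ 1 with hw | hw
  · exact Complex.norm_exp_sub_one_le hw
  · refine (norm_sub_le _ _).trans ?_
    rw [norm_one]
    linarith

lemma tendsto_nat_mul_exp_sub_one (z : ℂ) :
    Tendsto (fun n : ℕ => (n : ℂ) * (Complex.exp (-((1 / (n : ℝ) : ℝ) : ℂ) * z) - 1)) atTop
      (𝓝 (-z)) := by
  rw [tendsto_iff_norm_sub_tendsto_zero]
  have hlim : Tendsto (fun n : ℕ => ‖z‖ ^ 2 / (n : ℝ)) atTop (𝓝 0) :=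
    tendsto_const_div_atTop_nhds_zero_nat _
  refine squeeze_zero' (Eventually.of_forall fun n => norm_nonneg _) ?_ hlim
  filter_upwards [eventually_ge_atTop 1, eventually_ge_atTop ⌈‖z‖⌉₊] with n hn1 hn
  have hn0 : (0 : ℝ) < n := by exact_mod_cast hn1
  have hz : ‖z‖ ≤ n := Nat.ceil_le.1 hn
  have hw : ‖-((1 / (n : ℝ) : ℝ) : ℂ) * z‖ = ‖z‖ / n := by
    rw [norm_mul, norm_neg, Complex.norm_real, Real.norm_eq_abs, abs_of_pos (by positivity)]
    ring
  have h := Complex.norm_exp_sub_one_sub_id_le (x := -((1 / (n : ℝ) : ℝ) : ℂ) * z)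
    (by rw [hw]; exact (div_le_one hn0).2 hz)
  have e : (n : ℂ) * (Complex.exp (-((1 / (n : ℝ) : ℝ) : ℂ) * z) - 1) - -z
      = (n : ℂ) * (Complex.exp (-((1 / (n : ℝ) : ℝ) : ℂ) * z) - 1
        - -((1 / (n : ℝ) : ℝ) : ℂ) * z) := by
    have : (n : ℂ) ≠ 0 := by exact_mod_cast hn0.ne'
    push_cast
    field_simp
  rw [e, norm_mul, Complex.norm_natCast]
  rw [hw] at h
  calc (n : ℝ) * _ ≤ n * (‖z‖ / n) ^ 2 := mul_le_mul_of_nonneg_left h hn0.le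
    _ = ‖z‖ ^ 2 / n := by field_simp

/-- The small-time limit of `t⁻¹ E f(L_t)` vanishes for `f` supported off the rays that carry the
spectral measure. -/
lemma tendsto_nat_mul_integral_of_charFun {ι : Type*} [Fintype ι] {α : ℝ} (hα0 : 0 < α)
    (hα2 : α < 2) (hα1 : α ≠ 1) {a : ι → ℝ} (ha : ∀ i, 0 < a i) {ω : ι → Sph d}
    {f : 𝓢(Vec d, ℂ)} (hf0 : f 0 = 0)
    (hf : ∀ i, ∀ r : ℝ, 0 < r → f =ᶠ[𝓝 (r • (ω i : Vec d))] 0)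
    (ρ : ℕ → Measure (Vec d)) (hρ : ∀ n, IsProbabilityMeasure (ρ n))
    (hchar : ∀ n, 0 < n → ∀ y, charFun (ρ n) y
      = Complex.exp (-((1 / (n : ℝ) : ℝ) : ℂ) * stableExponent α (spectralMeasure a ω) y)) :
    Tendsto (fun n : ℕ => (n : ℂ) * ∫ x, f x ∂(ρ n)) atTop (𝓝 0) := by
  have hF : Continuous fun y => 𝓕 f y := SchwartzMap.continuous _
  set ψ : Vec d → ℂ := fun y =>
    ∑ i, (a i : ℂ) * scalarExponent α (2 * Real.pi * inner ℝ y (ω i : Vec d)) with hψ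
  have hψ' : ∀ y, stableExponent α (spectralMeasure a ω) ((2 * Real.pi) • y) = ψ y := by
    intro y
    rw [stableExponent_spectralMeasure hα0 hα2 hα1 ha]
    simp only [hψ, real_inner_smul_left]
  have hψc : Continuous ψ := by
    refine continuous_finsetSum _ fun i _ => continuous_const.mul ?_
    exact (continuous_scalarExponent hα0).comp (by fun_prop)
  have hψb : ∀ i (y : Vec d), ‖scalarExponent α (2 * Real.pi * inner ℝ y (ω i : Vec d))‖
      ≤ |Real.Gamma (1 - α)| * (1 + 2 * Real.pi * ‖y‖) ^ 2 := by
    intro i y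
    refine (norm_scalarExponent_le hα0 hα2 _).trans ?_
    refine mul_le_mul_of_nonneg_left ?_ (abs_nonneg _)
    have h1 : |2 * Real.pi * inner ℝ y (ω i : Vec d)| ≤ 2 * Real.pi * ‖y‖ := by
      rw [abs_mul, abs_of_pos (by positivity : 0 < 2 * Real.pi)]
      refine mul_le_mul_of_nonneg_left ?_ (by positivity)
      have := abs_real_inner_le_norm y (ω i : Vec d)
      rwa [norm_eq_of_mem_sphere, mul_one] at this
    exact pow_le_pow_left₀ (by positivity) (by linarith) 2
  have hint : ∀ i, Integrable fun y =>
      𝓕 f y * scalarExponent α (2 * Real.pi * inner ℝ y (ω i : Vec d)) := by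
    intro i
    refine ((integrable_norm_mul_one_add_sq (𝓕 f) (2 * Real.pi)).const_mul
      |Real.Gamma (1 - α)|).mono' ?_ (Eventually.of_forall fun y => ?_)
    · exact (hF.mul ((continuous_scalarExponent hα0).comp (by fun_prop))).aestronglyMeasurable
    · rw [norm_mul]
      calc _ ≤ ‖𝓕 f y‖ * (|Real.Gamma (1 - α)| * (1 + 2 * Real.pi * ‖y‖) ^ 2) :=
            mul_le_mul_of_nonneg_left (hψb i y) (norm_nonneg _)
        _ = _ := by ring
  have hterm : ∀ y, 𝓕 f y * ψ y
      = ∑ i, (a i : ℂ) * (𝓕 f y * scalarExponent α (2 * Real.pi * inner ℝ y (ω i : Vec d))) := by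
    intro y
    simp only [hψ, Finset.mul_sum]
    exact Finset.sum_congr rfl fun i _ => by ring
  have hψint : Integrable fun y => 𝓕 f y * ψ y := by
    simp only [hterm]
    exact integrable_finsetSum _ fun i _ => (hint i).const_mul _
  have hzero : ∫ y, 𝓕 f y * -ψ y = 0 := by
    simp only [mul_neg, integral_neg, hterm]
    rw [integral_finsetSum _ fun i _ => (hint i).const_mul _]
    simp only [integral_const_mul, integral_fourier_mul_scalarExponent hα0 hα2 (hf _), mul_zero,
      Finset.sum_const_zero, neg_zero]
  -- This is `f 0 = 0`; it allows 1 to be subtracted from the characteristic function.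
  have hF0 : ∫ y, 𝓕 f y = 0 := by
    have := integral_fourier_mul_exp f 0
    simpa [hf0] using this
  have hchar' : ∀ n, 0 < n → ∀ y, charFun (ρ n) ((2 * Real.pi) • y)
      = Complex.exp (-((1 / (n : ℝ) : ℝ) : ℂ) * ψ y) := fun n hn y => by rw [hchar n hn, hψ']
  -- No sign of the real part of `ψ` has to be computed: the exponential is the characteristic
  -- function of a probability measure.
  have hexp1 : ∀ n : ℕ, 0 < n → ∀ y, ‖Complex.exp (-((1 / (n : ℝ) : ℝ) : ℂ) * ψ y)‖ ≤ 1 := by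
    intro n hn y
    rw [← hchar' n hn]
    exact norm_charFun_le_one _
  have hFi : Integrable fun y => 𝓕 f y := SchwartzMap.integrable (𝓕 f)
  have heq : (fun n : ℕ => (n : ℂ) * ∫ x, f x ∂(ρ n)) =ᶠ[atTop] fun n : ℕ =>
      ∫ y, 𝓕 f y * ((n : ℂ) * (Complex.exp (-((1 / (n : ℝ) : ℝ) : ℂ) * ψ y) - 1)) := by
    filter_upwards [eventually_gt_atTop 0] with n hn
    have hi : Integrable fun y => 𝓕 f y * Complex.exp (-((1 / (n : ℝ) : ℝ) : ℂ) * ψ y) := by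
      refine hFi.norm.mono' (by fun_prop) (Eventually.of_forall fun y => ?_)
      rw [norm_mul]
      exact mul_le_of_le_one_right (norm_nonneg _) (hexp1 n hn y)
    have h2 : ∀ y, 𝓕 f y * ((n : ℂ) * (Complex.exp (-((1 / (n : ℝ) : ℝ) : ℂ) * ψ y) - 1))
        = (n : ℂ) * (𝓕 f y * Complex.exp (-((1 / (n : ℝ) : ℝ) : ℂ) * ψ y) - 𝓕 f y) := by
      intro y; ring
    simp only [h2]
    rw [integral_const_mul, integral_sub hi hFi, hF0, sub_zero,
      integral_eq_integral_fourier_mul_charFun]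
    simp only [hchar' n hn]
  refine Tendsto.congr' heq.symm ?_
  rw [← hzero]
  refine tendsto_integral_filter_of_dominated_convergence (fun y => 2 * ‖𝓕 f y * ψ y‖)
    (Eventually.of_forall fun n => by fun_prop) ?_ (hψint.norm.const_mul 2)
    (Eventually.of_forall fun y => (tendsto_nat_mul_exp_sub_one (ψ y)).const_mul _)
  filter_upwards [eventually_gt_atTop 0] with n hn
  refine Eventually.of_forall fun y => ?_
  have hn0 : (0 : ℝ) < n := by exact_mod_cast hn
  rw [norm_mul, norm_mul, norm_mul, Complex.norm_natCast]
  have h3 := norm_exp_sub_one_le_two_mul (hexp1 n hn y)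
  rw [norm_mul, norm_neg, Complex.norm_real, Real.norm_eq_abs, abs_of_pos (by positivity)] at h3
  have h4 : (n : ℝ) * ‖Complex.exp (-((1 / (n : ℝ) : ℝ) : ℂ) * ψ y) - 1‖ ≤ 2 * ‖ψ y‖ := by
    calc _ ≤ (n : ℝ) * (2 * (1 / n * ‖ψ y‖)) := mul_le_mul_of_nonneg_left h3 hn0.le
      _ = 2 * ‖ψ y‖ := by field_simp
  calc _ ≤ ‖𝓕 f y‖ * (2 * ‖ψ y‖) := mul_le_mul_of_nonneg_left h4 (norm_nonneg _)
    _ = _ := by ring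

end FourierSide

end DecoratedLevy

namespace DecoratedLevy

/-! ### Jumps and increments of the stable process. -/

section LevyPaths

open Decorated (gridPoint coe_gridPoint)

variable {d : ℕ}

lemma monotone_gridPoint (n : ℕ) : Monotone (gridPoint n) := fun i j hij => by
  refine monotone_projIcc _ ?_
  gcongr

/-- The increment of a càdlàg function over the grid interval around `t` tends to the jump at
`t`. -/
lemma Cadlag.tendsto_grid_increment (u : Cadlag d) {t : I} (ht : 0 < t) :
    Tendsto (fun n : ℕ => u (gridPoint n ((⌈(n : ℝ) * t⌉₊ - 1) + 1))
      - u (gridPoint n (⌈(n : ℝ) * t⌉₊ - 1))) atTop (𝓝 (u.jump t)) := by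
  have ht0 : (0 : ℝ) < t := ht
  have hlim : ∀ x : ℕ → I, (∀ᶠ n : ℕ in atTop, |(x n : ℝ) - t| ≤ 1 / n) →
      Tendsto x atTop (𝓝 t) := by
    intro x hx
    rw [tendsto_subtype_rng, tendsto_iff_dist_tendsto_zero]
    refine squeeze_zero' (Eventually.of_forall fun n => dist_nonneg) ?_
      tendsto_one_div_atTop_nhds_zero_nat
    filter_upwards [hx] with n hn
    rwa [Real.dist_eq]
  -- With `k = ⌈nt⌉ - 1` the grid interval satisfies `k/n < t ≤ (k+1)/n`. Its left end tends to `t`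
  -- strictly from the left, and its right end from the right with equality allowed, which suits
  -- left limits and right continuity.
  have hk : ∀ n : ℕ, 0 < n → ⌈(n : ℝ) * t⌉₊ - 1 + 1 ≤ n ∧
      ((⌈(n : ℝ) * t⌉₊ - 1 : ℕ) : ℝ) < n * t ∧ (n : ℝ) * t ≤ ((⌈(n : ℝ) * t⌉₊ - 1 + 1 : ℕ) : ℝ) := by
    intro n hn
    have hn0 : (0 : ℝ) < n := by exact_mod_cast hn
    have hpos : 0 < ⌈(n : ℝ) * t⌉₊ := Nat.ceil_pos.2 (by positivity)
    refine ⟨?_, ?_, ?_⟩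
    · rw [Nat.sub_add_cancel hpos, Nat.ceil_le]
      exact mul_le_of_le_one_right hn0.le t.2.2
    · rw [← Nat.lt_ceil]; omega
    · rw [Nat.sub_add_cancel hpos]; exact Nat.le_ceil _
  refine Tendsto.sub ?_ ?_
  · refine (u.right_cont t).tendsto.comp (tendsto_nhdsWithin_iff.2 ⟨hlim _ ?_, ?_⟩)
    · filter_upwards [eventually_gt_atTop 0] with n hn
      obtain ⟨h1, h2, h3⟩ := hk n hn
      have hn0 : (0 : ℝ) < n := by exact_mod_cast hn
      rw [coe_gridPoint h1, abs_le]
      push_cast at h3 ⊢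
      constructor
      · rw [neg_le_sub_iff_le_add, ← sub_le_iff_le_add, ← sub_nonneg]
        have : ((⌈(n : ℝ) * t⌉₊ - 1 : ℕ) + 1 : ℝ) / n - (t - 1 / n)
            = (((⌈(n : ℝ) * t⌉₊ - 1 : ℕ) + 1 : ℝ) - n * t + 1) / n := by field_simp; ring
        rw [this]
        exact div_nonneg (by linarith) hn0.le
      · rw [← sub_nonneg]
        have : 1 / (n : ℝ) - (((⌈(n : ℝ) * t⌉₊ - 1 : ℕ) + 1 : ℝ) / n - t)
            = (n * t - ((⌈(n : ℝ) * t⌉₊ - 1 : ℕ) : ℝ)) / n := by field_simp; ring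
        rw [this]
        exact div_nonneg (by linarith) hn0.le
    · filter_upwards [eventually_gt_atTop 0] with n hn
      obtain ⟨h1, h2, h3⟩ := hk n hn
      have hn0 : (0 : ℝ) < n := by exact_mod_cast hn
      change (t : ℝ) ≤ gridPoint n _
      rw [coe_gridPoint h1, le_div_iff₀ hn0]
      linarith
  · refine (u.tendsto_left t).comp (tendsto_nhdsWithin_iff.2 ⟨hlim _ ?_, ?_⟩)
    · filter_upwards [eventually_gt_atTop 0] with n hn
      obtain ⟨h1, h2, h3⟩ := hk n hn
      have hn0 : (0 : ℝ) < n := by exact_mod_cast hn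
      rw [coe_gridPoint (by omega), abs_le]
      push_cast at h3
      constructor
      · rw [← sub_nonneg]
        have : ((⌈(n : ℝ) * t⌉₊ - 1 : ℕ) : ℝ) / n - t - -(1 / n)
            = (((⌈(n : ℝ) * t⌉₊ - 1 : ℕ) : ℝ) + 1 - n * t) / n := by field_simp; ring
        rw [this]
        exact div_nonneg (by linarith) hn0.le
      · rw [← sub_nonneg]
        have : 1 / (n : ℝ) - (((⌈(n : ℝ) * t⌉₊ - 1 : ℕ) : ℝ) / n - t)
            = (n * t - ((⌈(n : ℝ) * t⌉₊ - 1 : ℕ) : ℝ) + 1) / n := by field_simp; ring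
        rw [this]
        exact div_nonneg (by linarith) hn0.le
    · filter_upwards [eventually_gt_atTop 0] with n hn
      obtain ⟨h1, h2, h3⟩ := hk n hn
      have hn0 : (0 : ℝ) < n := by exact_mod_cast hn
      change (gridPoint n _ : ℝ) < t
      rw [coe_gridPoint (by omega), div_lt_iff₀ hn0]
      linarith

/-- The closed set formed by the rays in the directions `ω i`, together with the origin. -/
def rays {ι : Type*} (ω : ι → Sph d) : Set (Vec d) :=
  insert 0 (⋃ i, (fun r : ℝ => r • (ω i : Vec d)) '' Ici 0)

lemma isClosed_rays {ι : Type*} [Finite ι] (ω : ι → Sph d) : IsClosed (rays ω) := by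
  rw [rays, insert_eq]
  refine isClosed_singleton.union (isClosed_iUnion_of_finite fun i => ?_)
  have hne : (ω i : Vec d) ≠ 0 := ne_zero_of_mem_unit_sphere (ω i)
  exact (isClosedEmbedding_smul_left hne).isClosedMap _ isClosed_Ici

lemma eq_norm_smul_of_mem_rays {ι : Type*} {ω : ι → Sph d} {y : Vec d} (hy : y ∈ rays ω)
    (h0 : y ≠ 0) : ∃ i, y = ‖y‖ • (ω i : Vec d) := by
  rcases hy with rfl | hy
  · exact absurd rfl h0
  · obtain ⟨i, r, hr, rfl⟩ := mem_iUnion.1 hy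
    refine ⟨i, ?_⟩
    have hr' : (0 : ℝ) ≤ r := hr
    simp only [norm_smul, norm_eq_of_mem_sphere, mul_one, Real.norm_eq_abs, abs_of_nonneg hr']

variable {ι : Type*} [Fintype ι] {α : ℝ} {a : ι → ℝ} {ω : ι → Sph d}
  {Ω : Type*} [MeasurableSpace Ω] {Pr : Measure Ω} [IsProbabilityMeasure Pr] {L : Ω → Cadlag d}

lemma IsStableLevy.map_eq {ν : Measure (Sph d)} (hL : IsStableLevy α ν L Pr) {s t s' t' : I}
    (hst : s ≤ t) (hst' : s' ≤ t') (h : (t : ℝ) - s = t' - s') :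
    Pr.map (fun x => L x t - L x s) = Pr.map (fun x => L x t' - L x s') := by
  have := Measure.isProbabilityMeasure_map (μ := Pr) ((hL.aemeasurable t).sub (hL.aemeasurable s))
  have := Measure.isProbabilityMeasure_map (μ := Pr) ((hL.aemeasurable t').sub (hL.aemeasurable s'))
  refine Measure.ext_of_charFun ?_
  ext y
  rw [hL.law s t hst y, hL.law s' t' hst' y, h]

-- The sum of `G` over the `n` grid increments has expectation `n E G(L(1/n))`, which tends to 0. By
-- Fatou its lower limit vanishes almost surely, while the interval around `t` contributes a term
-- that tends to `G` of the jump at `t`. The null set comes from the sums, so it does not depend on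
-- `t`.
open scoped SchwartzMap in
lemma IsStableLevy.ae_jump_eq_zero_of_test (hα0 : 0 < α) (hα2 : α < 2) (hα1 : α ≠ 1)
    (ha : ∀ i, 0 < a i) (hL : IsStableLevy α (spectralMeasure a ω) L Pr)
    {G : Vec d → ℝ} (hG : ContDiff ℝ (⊤ : ℕ∞) G) (hGc : HasCompactSupport G) (hG0 : ∀ y, 0 ≤ G y)
    (hGr : ∀ y ∈ rays ω, G =ᶠ[𝓝 y] 0) :
    ∀ᵐ x ∂Pr, ∀ t : I, 0 < t → G ((L x).jump t) = 0 := by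
  have hGcont : Continuous G := hG.continuous
  have hcs : HasCompactSupport fun y => (G y : ℂ) := hGc.comp_left (g := Complex.ofReal) rfl
  set f : 𝓢(Vec d, ℂ) := hcs.toSchwartzMap (Complex.ofRealCLM.contDiff.comp hG) with hf
  have hfG : ∀ y, f y = (G y : ℂ) := fun y => rfl
  have hfr : ∀ y ∈ rays ω, f =ᶠ[𝓝 y] 0 := by
    intro y hy
    filter_upwards [hGr y hy] with z hz
    rw [hfG, hz]; simp
  set ρ : ℕ → Measure (Vec d) := fun n =>
    Pr.map fun x => L x (gridPoint n 1) - L x (gridPoint n 0) with hρ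
  have hincr : ∀ s t : I, AEMeasurable (fun x => L x t - L x s) Pr := fun s t =>
    (hL.aemeasurable t).sub (hL.aemeasurable s)
  have hρp : ∀ n, IsProbabilityMeasure (ρ n) := fun n =>
    Measure.isProbabilityMeasure_map (hincr _ _)
  have hlim := tendsto_nat_mul_integral_of_charFun (f := f) hα0 hα2 hα1 ha
    ((hfr 0 (mem_insert _ _)).eq_of_nhds)
    (fun i r hr => hfr _ (mem_insert_of_mem _ (mem_iUnion.2 ⟨i, r, hr.le, rfl⟩))) ρ hρp
    (fun n hn y => by
      rw [hρ, hL.law _ _ (monotone_gridPoint n zero_le_one),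
        coe_gridPoint (show 1 ≤ n from hn),
        coe_gridPoint (Nat.zero_le n)]
      simp)
  have hlimR : Tendsto (fun n : ℕ => (n : ℝ) * ∫ y, G y ∂(ρ n)) atTop (𝓝 0) := by
    have h1 : ∀ n, ∫ y, f y ∂(ρ n) = ((∫ y, G y ∂(ρ n) : ℝ) : ℂ) := fun n => by
      simp only [hfG]; exact integral_ofReal
    have h2 := (Complex.continuous_re.tendsto 0).comp hlim
    simp only [Function.comp_def, h1, Complex.zero_re] at h2
    refine h2.congr fun n => ?_
    rw [← Complex.ofReal_natCast, ← Complex.ofReal_mul, Complex.ofReal_re]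
  set S : ℕ → Ω → ℝ≥0∞ := fun n x => ∑ k ∈ Finset.range n,
    ENNReal.ofReal (G (L x (gridPoint n (k + 1)) - L x (gridPoint n k))) with hS
  have hmeas : ∀ n k, AEMeasurable
      (fun x => ENNReal.ofReal (G (L x (gridPoint n (k + 1)) - L x (gridPoint n k)))) Pr :=
    fun n k => (hGcont.measurable.comp_aemeasurable (hincr _ _)).ennreal_ofReal
  have hSint : ∀ n, ∫⁻ x, S n x ∂Pr = ENNReal.ofReal (n * ∫ y, G y ∂(ρ n)) := by
    intro n
    rw [hS, lintegral_finsetSum' _ fun k _ => hmeas n k]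
    have h1 : ∀ k ∈ Finset.range n,
        ∫⁻ x, ENNReal.ofReal (G (L x (gridPoint n (k + 1)) - L x (gridPoint n k))) ∂Pr
          = ENNReal.ofReal (∫ y, G y ∂(ρ n)) := by
      intro k hk
      have hkn : k + 1 ≤ n := by simpa using hk
      rw [ofReal_integral_eq_lintegral_ofReal (hGcont.integrable_of_hasCompactSupport hGc)
        (Eventually.of_forall hG0)]
      have h2 : ρ n = Pr.map fun x => L x (gridPoint n (k + 1)) - L x (gridPoint n k) := by
        refine hL.map_eq (monotone_gridPoint n zero_le_one)
          (monotone_gridPoint n (Nat.le_succ k)) ?_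
        rw [coe_gridPoint (by omega), coe_gridPoint (by omega), coe_gridPoint (by omega),
          coe_gridPoint (by omega)]
        push_cast
        ring
      rw [h2, lintegral_map' hGcont.measurable.ennreal_ofReal.aemeasurable (hincr _ _)]
    rw [Finset.sum_congr rfl h1, Finset.sum_const, Finset.card_range, nsmul_eq_mul,
      ENNReal.ofReal_mul (Nat.cast_nonneg n), ENNReal.ofReal_natCast]
  have hfatou : ∫⁻ x, liminf (fun n => S n x) atTop ∂Pr = 0 := by
    refine le_antisymm ((lintegral_liminf_le' fun n => ?_).trans ?_) bot_le
    · exact Finset.aemeasurable_fun_sum _ fun k _ => hmeas n k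
    · simp only [hSint]
      have := ENNReal.tendsto_ofReal hlimR
      rw [ENNReal.ofReal_zero] at this
      exact this.liminf_eq.le
  have hSm : ∀ n, AEMeasurable (S n) Pr := fun n =>
    Finset.aemeasurable_fun_sum _ fun k _ => hmeas n k
  have hliminf : AEMeasurable (fun x => liminf (fun n => S n x) atTop) Pr := by
    refine ⟨fun x => liminf (fun n => (hSm n).mk _ x) atTop,
      Measurable.liminf fun n => (hSm n).measurable_mk, ?_⟩
    filter_upwards [ae_all_iff.2 fun n => (hSm n).ae_eq_mk] with x hx
    simp only [hx]
  rw [lintegral_eq_zero_iff' hliminf] at hfatou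
  filter_upwards [hfatou] with x hx t ht
  have h1 := (hGcont.tendsto _).comp ((L x).tendsto_grid_increment ht)
  have h2 := ENNReal.tendsto_ofReal h1
  have h3 : ENNReal.ofReal (G ((L x).jump t)) ≤ liminf (fun n => S n x) atTop := by
    rw [← h2.liminf_eq]
    refine liminf_le_liminf ?_
    filter_upwards [eventually_gt_atTop 0] with n hn
    have hn0 : (0 : ℝ) < n := by exact_mod_cast hn
    have ht0 : (0 : ℝ) < t := ht
    have hpos : 0 < ⌈(n : ℝ) * t⌉₊ := Nat.ceil_pos.2 (by positivity)
    have hle : ⌈(n : ℝ) * t⌉₊ ≤ n := Nat.ceil_le.2 (mul_le_of_le_one_right hn0.le t.2.2)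
    exact Finset.single_le_sum (f := fun k =>
      ENNReal.ofReal (G (L x (gridPoint n (k + 1)) - L x (gridPoint n k))))
      (fun _ _ => bot_le) (Finset.mem_range.2 (by omega : ⌈(n : ℝ) * t⌉₊ - 1 < n))
  rw [hx] at h3
  have h4 : ENNReal.ofReal (G ((L x).jump t)) = 0 := le_antisymm h3 bot_le
  exact le_antisymm (ENNReal.ofReal_eq_zero.1 h4) (hG0 _)

/-- The jumps of the stable process have the directions that carry the spectral measure. -/
lemma IsStableLevy.ae_jump_direction (hα0 : 0 < α) (hα2 : α < 2) (hα1 : α ≠ 1)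
    (ha : ∀ i, 0 < a i) (hL : IsStableLevy α (spectralMeasure a ω) L Pr) :
    ∀ᵐ x ∂Pr, ∀ t : I, 0 < t → (L x).jump t ≠ 0 →
      ∃ i, (L x).jump t = ‖(L x).jump t‖ • (ω i : Vec d) := by
  have hopen : IsOpen (rays ω)ᶜ := (isClosed_rays ω).isOpen_compl
  have htest : ∀ p : Vec d, ∃ G : Vec d → ℝ, p ∈ (rays ω)ᶜ → tsupport G ⊆ (rays ω)ᶜ ∧
      HasCompactSupport G ∧ ContDiff ℝ (⊤ : ℕ∞) G ∧ range G ⊆ Icc 0 1 ∧ G p = 1 := by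
    intro p
    by_cases hp : p ∈ (rays ω)ᶜ
    · obtain ⟨G, hG⟩ := exists_contDiff_tsupport_subset (n := (⊤ : ℕ∞)) (hopen.mem_nhds hp)
      exact ⟨G, fun _ => hG⟩
    · exact ⟨0, fun h => absurd h hp⟩
  choose G hG using htest
  -- Countably many of the sets where some test function is nonzero cover the complement of the
  -- rays, so a single null set suffices.
  have hnhds : ∀ p ∈ (rays ω)ᶜ, {y | G p y ≠ 0} ∈ 𝓝[(rays ω)ᶜ] p := by
    intro p hp
    obtain ⟨-, -, h3, -, h5⟩ := hG p hp
    refine mem_nhdsWithin_of_mem_nhds (h3.continuous.continuousAt.eventually_ne ?_)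
    rw [h5]; exact one_ne_zero
  obtain ⟨s, hsub, hs, hcov⟩ := TopologicalSpace.countable_cover_nhdsWithin hnhds
  have hae : ∀ᵐ x ∂Pr, ∀ p ∈ s, ∀ t : I, 0 < t → G p ((L x).jump t) = 0 := by
    rw [ae_ball_iff hs]
    intro p hp
    obtain ⟨h1, h2, h3, h4, -⟩ := hG p (hsub hp)
    refine hL.ae_jump_eq_zero_of_test hα0 hα2 hα1 ha h3 h2 (fun y => (h4 (mem_range_self y)).1) ?_
    intro y hy
    exact notMem_tsupport_iff_eventuallyEq.1 fun h => h1 h hy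
  filter_upwards [hae] with x hx t ht h0
  refine eq_norm_smul_of_mem_rays ?_ h0
  by_contra hmem
  obtain ⟨p, hp, hne⟩ := mem_iUnion₂.1 (hcov hmem)
  exact hne (hx p hp t ht)

/-- The stable process has no jump at a fixed time. -/
lemma IsStableLevy.ae_left_eq {ν : Measure (Sph d)} (hL : IsStableLevy α ν L Pr) {t : I}
    (ht : 0 < t) : ∀ᵐ x ∂Pr, (L x).left t = L x t := by
  have ht0 : (0 : ℝ) < t := ht
  set D : ℕ → Ω → Vec d := fun n x => L x (gridPoint n ((⌈(n : ℝ) * t⌉₊ - 1) + 1))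
      - L x (gridPoint n (⌈(n : ℝ) * t⌉₊ - 1)) with hD
  have hDm : ∀ n, AEMeasurable (D n) Pr := fun n =>
    (hL.aemeasurable _).sub (hL.aemeasurable _)
  have hlim : ∀ x, Tendsto (fun n => D n x) atTop (𝓝 ((L x).jump t)) := fun x =>
    (L x).tendsto_grid_increment ht
  have hJ : AEMeasurable (fun x => (L x).jump t) Pr :=
    aemeasurable_of_tendsto_metrizable_ae atTop hDm (Eventually.of_forall hlim)
  have hprob := Measure.isProbabilityMeasure_map hJ
  -- The jump is the pointwise limit of increments over intervals of length `1/n`, whose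
  -- characteristic functions tend to 1. Hence its law is the Dirac mass at 0.
  have hchar : charFun (Pr.map fun x => (L x).jump t) = charFun (Measure.dirac (0 : Vec d)) := by
    ext y
    rw [charFun_dirac, inner_zero_left, Complex.ofReal_zero, zero_mul, Complex.exp_zero]
    have hm : Continuous fun z : Vec d => Complex.exp (inner ℝ z y * Complex.I) := by fun_prop
    have h1 : Tendsto (fun n => charFun (Pr.map (D n)) y) atTop
        (𝓝 (charFun (Pr.map fun x => (L x).jump t) y)) := by
      simp only [charFun_apply]
      rw [integral_map hJ hm.aestronglyMeasurable]
      have h2 : ∀ n, ∫ z, Complex.exp (inner ℝ z y * Complex.I) ∂(Pr.map (D n))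
          = ∫ x, Complex.exp (inner ℝ (D n x) y * Complex.I) ∂Pr := fun n =>
        integral_map (hDm n) hm.aestronglyMeasurable
      simp only [h2]
      refine tendsto_integral_of_dominated_convergence (fun _ => (1 : ℝ))
        (fun n => (hm.measurable.comp_aemeasurable (hDm n)).aestronglyMeasurable)
        (integrable_const _) (fun n => Eventually.of_forall fun x => ?_)
        (Eventually.of_forall fun x => (hm.tendsto _).comp (hlim x))
      rw [Complex.norm_exp_ofReal_mul_I]
    refine tendsto_nhds_unique h1 ?_
    have h3 : ∀ᶠ n : ℕ in atTop, Complex.exp (-((1 / (n : ℝ) : ℝ) : ℂ) * stableExponent α ν y)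
        = charFun (Pr.map (D n)) y := by
      filter_upwards [eventually_gt_atTop 0] with n hn
      have hn0 : (0 : ℝ) < n := by exact_mod_cast hn
      have hpos : 0 < ⌈(n : ℝ) * t⌉₊ := Nat.ceil_pos.2 (by positivity)
      have hle : ⌈(n : ℝ) * t⌉₊ ≤ n := Nat.ceil_le.2 (mul_le_of_le_one_right hn0.le t.2.2)
      rw [hD, hL.law _ _ (monotone_gridPoint n (Nat.le_succ _)), coe_gridPoint (by omega),
        coe_gridPoint (by omega)]
      congr 4
      push_cast
      ring
    refine Tendsto.congr' h3 ?_
    have h4 : Tendsto (fun n : ℕ => Complex.exp (-((1 / (n : ℝ) : ℝ) : ℂ) * stableExponent α ν y))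
        atTop (𝓝 (Complex.exp (-((0 : ℝ) : ℂ) * stableExponent α ν y))) := by
      refine (Complex.continuous_exp.tendsto _).comp (Tendsto.mul_const _ (Tendsto.neg ?_))
      exact (Complex.continuous_ofReal.tendsto _).comp tendsto_one_div_atTop_nhds_zero_nat
    simpa using h4
  have hdirac := Measure.ext_of_charFun hchar
  have h5 : ∀ᵐ z ∂(Pr.map fun x => (L x).jump t), z = 0 := by
    rw [hdirac, ae_dirac_eq]
    exact eventually_pure.2 rfl
  filter_upwards [ae_of_ae_map hJ h5] with x hx
  exact (sub_eq_zero.1 hx).symm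

lemma stableExponent_smul (ν : Measure (Sph d)) {r : ℝ} (hr : 0 < r) (y : Vec d) :
    stableExponent α ν (r • y) = ((r ^ α : ℝ) : ℂ) * stableExponent α ν y := by
  rw [stableExponent, stableExponent, ← integral_const_mul]
  congr 1
  ext x
  rw [real_inner_smul_left, abs_mul, abs_of_pos hr, Real.mul_rpow hr.le (abs_nonneg _)]
  have hs : Real.sign (r * inner ℝ y (x : Vec d)) = Real.sign (inner ℝ y (x : Vec d)) := by
    rcases lt_trichotomy (inner ℝ y (x : Vec d)) 0 with h | h | h
    · rw [Real.sign_of_neg h, Real.sign_of_neg (mul_neg_of_pos_of_neg hr h)]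
    · rw [h, mul_zero]
    · rw [Real.sign_of_pos h, Real.sign_of_pos (mul_pos hr h)]
  rw [hs]
  push_cast
  ring

/-- Self-similarity of the increments of a stable process. -/
lemma IsStableLevy.map_increments_eq {ν : Measure (Sph d)} (hα0 : 0 < α)
    (hL : IsStableLevy α ν L Pr) {c : I} (hc : 0 < c) (n : ℕ) :
    Pr.map (fun x (k : Fin n) => L x (c * gridPoint n (k + 1)) - L x (c * gridPoint n k))
      = Pr.map (fun x (k : Fin n) => ((c : ℝ) ^ (1 / α)) • L x (gridPoint n (k + 1))
        - ((c : ℝ) ^ (1 / α)) • L x (gridPoint n k)) := by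
  have hc' : (0 : ℝ) < c := hc
  have hr : 0 < (c : ℝ) ^ (1 / α) := Real.rpow_pos_of_pos hc' _
  have hmono : Monotone fun k : Fin (n + 1) => c * gridPoint n k := fun i j hij =>
    mul_le_mul_of_nonneg_left (monotone_gridPoint n hij) hc'.le
  have hmono' : Monotone fun k : Fin (n + 1) => gridPoint n k := fun i j hij =>
    monotone_gridPoint n hij
  have h1 := hL.indep n _ hmono
  have h2 := (hL.indep.smul ((c : ℝ) ^ (1 / α))) n _ hmono'
  simp only [Fin.val_succ, Fin.val_castSucc] at h1 h2
  have m1 : ∀ k : Fin n, AEMeasurable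
      (fun x => L x (c * gridPoint n (k + 1)) - L x (c * gridPoint n k)) Pr := fun k =>
    (hL.aemeasurable _).sub (hL.aemeasurable _)
  have m2 : ∀ k : Fin n, AEMeasurable (fun x => L x (gridPoint n (k + 1)) - L x (gridPoint n k))
      Pr := fun k => (hL.aemeasurable _).sub (hL.aemeasurable _)
  -- The increments are independent on both sides, so the two laws are product measures and only the
  -- marginals need to be compared.
  rw [h1.map_fun_eq_pi_map m1, h2.map_fun_eq_pi_map fun k => by
    simp only [← smul_sub]; exact (m2 k).const_smul ((c : ℝ) ^ (1 / α))]
  congr 1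
  ext1 k
  have := Measure.isProbabilityMeasure_map (m1 k)
  have := Measure.isProbabilityMeasure_map ((m2 k).const_smul ((c : ℝ) ^ (1 / α)))
  simp only [← smul_sub]
  refine Measure.ext_of_charFun ?_
  ext y
  have e2 := charFun_map_smul_comp (m2 k) ((c : ℝ) ^ (1 / α)) y
  rw [e2, hL.law _ _ (monotone_gridPoint n (Nat.le_succ _)),
    hL.law _ _ (mul_le_mul_of_nonneg_left (monotone_gridPoint n (Nat.le_succ _)) hc'.le),
    stableExponent_smul ν hr, ← Real.rpow_mul hc'.le, one_div_mul_cancel hα0.ne', Real.rpow_one]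
  push_cast
  ring_nf

end LevyPaths

end DecoratedLevy

namespace DecoratedLevy

/-! ### Approximation of decorated paths through finitely many increments. -/

section Approximants

open Decorated (gridPoint coe_gridPoint)

variable {d : ℕ} {ι : Type*} {ω : ι → Sph d} {P : ι → Cadlag d}

lemma gridPoint_zero (n : ℕ) : gridPoint n 0 = 0 := by
  ext; rw [coe_gridPoint (Nat.zero_le n)]; simp

lemma gridPoint_self {n : ℕ} (hn : 0 < n) : gridPoint n n = 1 := by
  ext
  rw [coe_gridPoint le_rfl, div_self (by exact_mod_cast hn.ne')]
  rfl

lemma closestProfile_zero (hP : ∀ i, IsProfile (P i) (ω i)) (V : Vec d) :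
    closestProfile ω P V 0 = 0 := by
  unfold closestProfile
  split_ifs with h
  · exact (hP _).zero
  · rfl

lemma idealExcursion_zero (hP : ∀ i, IsProfile (P i) (ω i)) (V : Vec d) :
    idealExcursion ω P V 0 = 0 := by
  simp [idealExcursion, closestProfile_zero hP]

lemma idealExcursion_one (V : Vec d) : idealExcursion ω P V 1 = V := by
  simp [idealExcursion]

/-- The path with increments `D k`, each of them refined to `n` steps along the ideal excursion. -/
noncomputable def refinedPath (ω : ι → Sph d) (P : ι → Cadlag d) (n : ℕ) (D : ℕ → Vec d)
    (j : ℕ) : Vec d :=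
  ∑ k ∈ Finset.range (j / n), D k + idealExcursion ω P (D (j / n)) (gridPoint n (j % n))

lemma refinedPath_mul (hP : ∀ i, IsProfile (P i) (ω i)) {n : ℕ} (hn : 0 < n) (D : ℕ → Vec d)
    (k : ℕ) : refinedPath ω P n D (n * k) = ∑ i ∈ Finset.range k, D i := by
  rw [refinedPath, Nat.mul_div_cancel_left k hn, Nat.mul_mod_right, gridPoint_zero,
    idealExcursion_zero hP, add_zero]

lemma refinedPath_mul_add (hP : ∀ i, IsProfile (P i) (ω i)) {n : ℕ} (hn : 0 < n) (D : ℕ → Vec d)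
    (k : ℕ) {i : ℕ} (hi : i ≤ n) : refinedPath ω P n D (n * k + i)
      = ∑ i ∈ Finset.range k, D i + idealExcursion ω P (D k) (gridPoint n i) := by
  rcases hi.eq_or_lt with rfl | hi
  · rw [← Nat.mul_succ, refinedPath_mul hP hn, Finset.sum_range_succ, gridPoint_self hn,
      idealExcursion_one]
  · rw [refinedPath, Nat.mul_add_div hn, Nat.div_eq_of_lt hi, add_zero, Nat.mul_add_mod,
      Nat.mod_eq_of_lt hi]

/-- Sampled ideal excursions are close to the ideal excursions, uniformly on bounded sets. -/
lemma eventually_reparamEDist_idealExcursion_lt [Finite ι] (K : ℝ) {η : ℝ} (hη : 0 < η) :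
    ∀ᶠ n : ℕ in atTop, ∀ V : Vec d, ‖V‖ ≤ K →
      reparamEDist (fun t : I => idealExcursion ω P V (gridPoint n ⌊(t : ℝ) * n⌋₊))
        (idealExcursion ω P V) < ENNReal.ofReal η := by
  obtain ⟨C, hC1, hC⟩ := exists_profile_bound P
  wlog hK : 0 < K generalizing K
  · filter_upwards [this 1 one_pos] with n hn V hV
    exact hn V (hV.trans (by linarith))
  -- The sampled profile differs by `θ` after a change of time that moves the argument by at most
  -- `2θ`. This gives `Kθ` for the profile and `2θ(C+1)K` for the linear correction, in total `η/2`.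
  -- Uniformity in `V` holds because only finitely many profiles occur.
  set θ : ℝ := η / (2 * (K * (2 * C + 3))) with hθ
  have hθ0 : 0 < θ := by positivity
  have hprof : ∀ p : Cadlag d, ∀ᶠ n : ℕ in atTop,
      j1EDist (Cadlag.sample n p) p < ENNReal.ofReal θ := by
    intro p
    exact EMetric.tendsto_nhds.1 p.tendsto_sample _ (ENNReal.ofReal_pos.2 hθ0)
  have hn1 : ∀ᶠ n : ℕ in atTop, 1 / (n : ℝ) < θ :=
    (tendsto_one_div_atTop_nhds_zero_nat (𝕜 := ℝ)).eventually_lt_const hθ0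
  filter_upwards [eventually_all.2 fun i => hprof (P i), hprof (zeroPath d), hn1,
    eventually_gt_atTop 0] with n h1 h2 h3 hn V hV
  have hn0 : (0 : ℝ) < n := by exact_mod_cast hn
  have hp : j1EDist (Cadlag.sample n (closestProfile ω P V)) (closestProfile ω P V)
      < ENNReal.ofReal θ := by
    unfold closestProfile
    split_ifs with h
    · exact h1 _
    · exact h2
  obtain ⟨lam, e1, e2⟩ := exists_iso_of_j1EDist_lt hp
  set p := closestProfile ω P V with hpdef
  refine (iInf_le_of_le lam (iSup_le fun t => edist_le_ofReal_of_dist_le (?_ :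
    _ ≤ K * (2 * C + 3) * θ))).trans_lt ?_
  · have hfl : ⌊((lam t : I) : ℝ) * n⌋₊ ≤ n :=
      Nat.floor_le_of_le (mul_le_of_le_one_left hn0.le (lam t).2.2)
    have e3 : dist (p (gridPoint n ⌊((lam t : I) : ℝ) * n⌋₊)) (p t) < θ := by
      have := e1 t
      simp only [Cadlag.sample, Decorated.step_apply, mul_comm (n : ℝ)] at this
      exact this
    have e4 : |(gridPoint n ⌊((lam t : I) : ℝ) * n⌋₊ : ℝ) - t| ≤ 2 * θ := by
      rw [coe_gridPoint hfl]
      have e5 : |((lam t : I) : ℝ) - t| < θ := by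
        have := e2 t
        rwa [Subtype.dist_eq, Real.dist_eq] at this
      have e6 : |(⌊((lam t : I) : ℝ) * n⌋₊ : ℝ) / n - (lam t : I)| ≤ 1 / n := by
        have a1 := Nat.floor_le (mul_nonneg (lam t).2.1 hn0.le)
        have a2 := (Nat.lt_floor_add_one (((lam t : I) : ℝ) * n)).le
        have : (⌊((lam t : I) : ℝ) * n⌋₊ : ℝ) / n - (lam t : I)
            = ((⌊((lam t : I) : ℝ) * n⌋₊ : ℝ) - (lam t : I) * n) / n := by field_simp
        rw [this, abs_div, abs_of_pos hn0]
        gcongr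
        rw [abs_le]
        constructor <;> linarith
      calc _ ≤ |(⌊((lam t : I) : ℝ) * n⌋₊ : ℝ) / n - (lam t : I)| + |((lam t : I) : ℝ) - t| :=
            abs_sub_le _ _ _
        _ ≤ 2 * θ := by linarith
    have hW : ‖V - ‖V‖ • p 1‖ ≤ (C + 1) * K := by
      refine (norm_sub_le _ _).trans ?_
      rw [norm_smul, norm_norm]
      have := norm_closestProfile_le (ω := ω) hC1 hC V 1
      nlinarith [norm_nonneg V, norm_nonneg (p 1)]
    rw [dist_eq_norm]
    have : idealExcursion ω P V (gridPoint n ⌊((lam t : I) : ℝ) * n⌋₊) - idealExcursion ω P V t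
        = ‖V‖ • (p (gridPoint n ⌊((lam t : I) : ℝ) * n⌋₊) - p t)
          + ((gridPoint n ⌊((lam t : I) : ℝ) * n⌋₊ : ℝ) - t) • (V - ‖V‖ • p 1) := by
      simp only [idealExcursion, ← hpdef, smul_sub, sub_smul]
      abel
    rw [this]
    refine (norm_add_le _ _).trans ?_
    rw [norm_smul, norm_smul, norm_norm, Real.norm_eq_abs, ← dist_eq_norm]
    calc _ ≤ K * θ + 2 * θ * ((C + 1) * K) := by
          refine add_le_add (mul_le_mul hV e3.le dist_nonneg hK.le) ?_
          exact mul_le_mul e4 hW (norm_nonneg _) (by positivity)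
      _ = K * (2 * C + 3) * θ := by ring
  · rw [ENNReal.ofReal_lt_ofReal_iff hη, hθ]
    have : 0 < K * (2 * C + 3) := by positivity
    rw [mul_div_assoc', mul_comm, mul_div_mul_right _ _ this.ne']
    linarith

/-- The increments of `u` on the grid `{k/n}`. -/
noncomputable def gridIncrement (n : ℕ) (u : Cadlag d) (k : ℕ) : Vec d :=
  u (gridPoint n (k + 1)) - u (gridPoint n k)

/-- An approximation of the decorated path that depends on finitely many increments only. -/
noncomputable def approximant (ω : ι → Sph d) (P : ι → Cadlag d) (n : ℕ) (u : Cadlag d) :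
    Decorated d :=
  Decorated.ofStep (n * n) (refinedPath ω P n (gridIncrement n u))

lemma sum_gridIncrement (n : ℕ) (u : Cadlag d) (k : ℕ) :
    ∑ i ∈ Finset.range k, gridIncrement n u i = u (gridPoint n k) - u 0 := by
  rw [← gridPoint_zero n]
  exact Finset.sum_range_sub (fun i => u (gridPoint n i)) k

lemma Cadlag.slow_one (u : Cadlag d) : u.slow 1 zero_lt_one = u := by
  ext t : 2
  rw [slow_apply, one_mul]

/-- The approximant is an instance of the deterministic theorem at speed 1: it has `n * n` steps,
returns at the multiples of `n`, the sample of `u` as induced function, and sampled ideal excursions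
between the returns. -/
lemma tendsto_approximant [Finite ι] (hω : Function.Injective ω)
    (hP : ∀ i, IsProfile (P i) (ω i)) {u : Cadlag d} (h0 : u 0 = 0)
    (hdir : ∀ t ∈ u.disc, ∃ i, u.jump t = ‖u.jump t‖ • (ω i : Vec d)) (hend : u.left 1 = u 1) :
    Tendsto (fun n => approximant ω P n u) atTop (𝓝 (decorate ω P hP u)) := by
  rw [EMetric.tendsto_nhds]
  intro ε hε
  obtain ⟨e, he0, he⟩ := ENNReal.lt_iff_exists_real_btwn.1 hε
  have he1 : 0 < e := ENNReal.ofReal_pos.1 he.1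
  have hu := u.slow_one
  obtain ⟨δ, hδ, h⟩ := edist_ofStep_decorate_le hω hP u 1 zero_lt_one (by rwa [hu])
    (by rwa [hu]) he1
  rw [hu] at h
  obtain ⟨K, hK⟩ := u.isBounded_range.exists_norm_le
  have hn1 : ∀ᶠ n : ℕ in atTop, 1 ≤ δ * n :=
    ((tendsto_natCast_atTop_atTop (R := ℝ)).const_mul_atTop hδ).eventually_ge_atTop 1
  have hsample : ∀ᶠ n : ℕ in atTop, j1EDist (Cadlag.sample n u) u < ENNReal.ofReal δ :=
    EMetric.tendsto_nhds.1 u.tendsto_sample _ (ENNReal.ofReal_pos.2 hδ)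
  filter_upwards [hn1, hsample, eventually_gt_atTop 0,
    eventually_reparamEDist_idealExcursion_lt (ω := ω) (P := P) (K + K) hδ] with n hn hs hnpos hexc
  refine lt_of_le_of_lt ?_ he.2
  obtain ⟨lam, e1, e2⟩ := exists_iso_of_j1EDist_lt hs
  have hn0 : (0 : ℝ) < n := by exact_mod_cast hnpos
  have hn1' : (1 : ℝ) ≤ n := by exact_mod_cast hnpos
  have hval : ∀ k, refinedPath ω P n (gridIncrement n u) (n * k) = u (gridPoint n k) := fun k => by
    rw [refinedPath_mul hP hnpos, sum_gridIncrement, h0, sub_zero]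
  refine h (n * n) n _ (fun k => n * k) lam ⟨?_, hn, ?_, mul_zero n, le_rfl, ?_, ?_, ?_, ?_⟩
  · push_cast
    nlinarith
  · exact strictMono_mul_left_of_pos hnpos
  · intro k j h1 h2 _
    have h1' : (n : ℝ) * k ≤ j := by exact_mod_cast h1
    have h2' : (j : ℝ) ≤ n * (k + 1) := by exact_mod_cast h2.le
    have : (k : ℝ) / n - ((1 : I) : ℝ) * (j / ((n * n : ℕ) : ℝ)) = (n * k - j) / n / n := by
      push_cast
      field_simp
    rw [this, div_div, abs_div, abs_of_pos (by positivity : (0 : ℝ) < n * n),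
      div_le_iff₀ (by positivity), abs_le]
    constructor <;> nlinarith
  · intro k hk
    have e3 := hexc (gridIncrement n u k) ((norm_sub_le _ _).trans
      (add_le_add (hK _ (mem_range_self _)) (hK _ (mem_range_self _))))
    have e4 : n * (k + 1) - n * k = n := by rw [Nat.mul_succ, Nat.add_sub_cancel_left]
    have e5 : refinedPath ω P n (gridIncrement n u) (n * (k + 1))
        - refinedPath ω P n (gridIncrement n u) (n * k) = gridIncrement n u k := by
      rw [hval, hval]; rfl
    rw [e5]
    convert e3 using 3 with t
    rw [e4, refinedPath_mul_add hP hnpos _ _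
      (Nat.floor_le_of_le (mul_le_of_le_one_left hn0.le t.2.2)), refinedPath_mul hP hnpos,
      add_sub_cancel_left]
  · intro t
    have := e1 t
    rw [Cadlag.sample, Decorated.step_apply] at this
    rw [Decorated.step_apply, Function.comp, hval]
    exact this
  · intro t
    have := e2 t
    rwa [Subtype.dist_eq, Real.dist_eq] at this

lemma Decorated.ofStep_congr {n : ℕ} {g g' : ℕ → Vec d} (h : ∀ k ≤ n, g k = g' k) :
    ofStep n g = ofStep n g' := by
  have hs : Cadlag.step n g = Cadlag.step n g' := by
    ext t : 2
    rw [step_apply, step_apply]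
    exact h _ (Nat.floor_le_of_le (mul_le_of_le_one_right (Nat.cast_nonneg n) t.2.2))
  simp only [ofStep, hs]

/-- The decorated step function depends continuously on the values. -/
lemma Decorated.continuous_ofStep {n : ℕ} (hn : 0 < n) :
    Continuous fun y : Fin (n + 1) → Vec d => ofStep n fun k => y (Fin.ofNat (n + 1) k) := by
  rw [continuous_iff_continuousAt]
  intro y
  rw [ContinuousAt, EMetric.tendsto_nhds]
  intro ε hε
  obtain ⟨e, he0, he⟩ := ENNReal.lt_iff_exists_real_btwn.1 hε
  have he1 : 0 < e := ENNReal.ofReal_pos.1 he.1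
  filter_upwards [Metric.ball_mem_nhds y (by positivity : 0 < e / 6)] with z hz
  refine lt_of_le_of_lt ?_ he.2
  have h : j1EDist (Cadlag.step n fun k => z (Fin.ofNat (n + 1) k))
      (Cadlag.step n fun k => y (Fin.ofNat (n + 1) k)) < ENNReal.ofReal (e / 3) := by
    refine lt_of_le_of_lt (iInf_le_of_le (OrderIso.refl I) ?_)
      ((ENNReal.ofReal_lt_ofReal_iff (by positivity)).2 (by linarith : e / 6 < e / 3))
    have h2 : ⨆ t : I, edist ((OrderIso.refl I) t) t = 0 := by simp
    rw [h2, add_zero]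
    refine iSup_le fun t => edist_le_ofReal_of_dist_le ?_
    simp only [step_apply, OrderIso.refl_apply]
    exact (dist_le_pi_dist z y _).trans (Metric.mem_ball.1 hz).le
  have := edist_ofStep_le hn hn h
  rwa [mul_div_cancel₀ _ (by norm_num : (3 : ℝ) ≠ 0)] at this

/-- The map factors through finitely many vectors, on which the decorated step function depends
continuously. No separability of `F'` is used. -/
lemma Decorated.measurable_ofStep {Ω : Type*} [MeasurableSpace Ω] {n : ℕ} (hn : 0 < n)
    {g : Ω → ℕ → Vec d} (hg : ∀ k, Measurable fun x => g x k) :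
    Measurable fun x => ofStep n (g x) := by
  have h : (fun x => ofStep n (g x))
      = (fun y : Fin (n + 1) → Vec d => ofStep n fun k => y (Fin.ofNat (n + 1) k)) ∘
        fun x (k : Fin (n + 1)) => g x k := by
    ext1 x
    refine ofStep_congr fun k hk => ?_
    simp [Nat.mod_eq_of_lt (Nat.lt_succ_of_le hk)]
  rw [h]
  exact (continuous_ofStep hn).measurable.comp (measurable_pi_lambda _ fun k => hg k)

/-- The closest profile takes finitely many values, each of them on a set given by strict
inequalities between measurable functions of `V`. -/
lemma measurable_idealExcursion [Finite ι] (t : I) :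
    Measurable fun V => idealExcursion ω P V t := by
  cases nonempty_fintype ι
  have hprof : ∀ t : I, Measurable fun V => closestProfile ω P V t := by
    intro t
    set S : ι → Set (Vec d) := fun i => {y | y ≠ 0 ∧ ∀ j, j ≠ i →
      dist (‖y‖⁻¹ • y) (ω i : Vec d) < dist (‖y‖⁻¹ • y) (ω j : Vec d)} with hS
    have hm : ∀ i, MeasurableSet (S i) := by
      intro i
      have : S i = {0}ᶜ ∩ ⋂ j, ⋂ _ : j ≠ i,
          {y | dist (‖y‖⁻¹ • y) (ω i : Vec d) < dist (‖y‖⁻¹ • y) (ω j : Vec d)} := by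
        ext y; simp [hS]
      rw [this]
      refine (measurableSet_singleton (0 : Vec d)).compl.inter ?_
      refine MeasurableSet.iInter fun j => MeasurableSet.iInter fun _ => ?_
      exact measurableSet_lt (by fun_prop) (by fun_prop)
    have heq : (fun V => closestProfile ω P V t)
        = fun V => ∑ i, (S i).indicator (fun _ => P i t) V := by
      ext1 V
      by_cases h : V ≠ 0 ∧ ∃ i, ∀ j, j ≠ i →
          dist (‖V‖⁻¹ • V) (ω i : Vec d) < dist (‖V‖⁻¹ • V) (ω j : Vec d)
      · obtain ⟨hV, i, hi⟩ := h
        rw [closestProfile_eq_of_forall_lt hV hi, Finset.sum_eq_single i]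
        · rw [indicator_of_mem]
          exact ⟨hV, hi⟩
        · intro j _ hj
          refine indicator_of_notMem (fun hmem => ?_) _
          exact lt_asymm (hi j hj) (hmem.2 i hj.symm)
        · simp
      · rw [closestProfile, dif_neg h, Finset.sum_eq_zero]
        · rfl
        · intro i _
          exact indicator_of_notMem (fun hmem => h ⟨hmem.1, i, hmem.2⟩) _
    rw [heq]
    exact Finset.measurable_fun_sum _ fun i _ => measurable_const.indicator (hm i)
  unfold idealExcursion
  have h1 := hprof t
  have h2 := hprof 1
  fun_prop

/-- The approximant as a function of the increments. -/
noncomputable def approximantOfIncrements (ω : ι → Sph d) (P : ι → Cadlag d) (n : ℕ)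
    (D : Fin n → Vec d) : Decorated d :=
  Decorated.ofStep (n * n) (refinedPath ω P n fun k => if h : k < n then D ⟨k, h⟩ else 0)

lemma measurable_approximantOfIncrements [Finite ι] {n : ℕ} (hn : 0 < n) :
    Measurable (approximantOfIncrements ω P n) := by
  have hm : ∀ k, Measurable fun D : Fin n → Vec d => if h : k < n then D ⟨k, h⟩ else 0 := by
    intro k
    split_ifs
    · exact measurable_pi_apply _
    · exact measurable_const
  refine Decorated.measurable_ofStep (Nat.mul_pos hn hn) fun j => ?_
  refine (Finset.measurable_fun_sum _ fun k _ => hm k).add ?_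
  exact (measurable_idealExcursion _).comp (hm _)

lemma approximant_eq {n : ℕ} (hn : 0 < n) (u : Cadlag d) :
    approximant ω P n u
      = approximantOfIncrements ω P n fun k => u (gridPoint n (k + 1)) - u (gridPoint n k) := by
  have h : gridIncrement n u = fun k => if h : k < n then
      (fun k : Fin n => u (gridPoint n (k + 1)) - u (gridPoint n k)) ⟨k, h⟩ else 0 := by
    ext1 k
    split_ifs with hk
    · rfl
    -- Grid points beyond `n` are clamped to 1, so the increments there vanish, in agreement with
    -- the default value 0.
    · have h1 : ∀ k, n ≤ k → gridPoint n k = 1 := fun k hk => by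
        refine projIcc_of_right_le _ ?_
        rw [one_le_div (by exact_mod_cast hn)]
        exact_mod_cast hk
      rw [gridIncrement, h1 k (by omega), h1 (k + 1) (by omega), sub_self]
  rw [approximant, approximantOfIncrements, h]

end Approximants

/-! ### The law of the decorated limit process. -/

section LimitLaw

variable {d : ℕ} {ι : Type*} [Fintype ι] {α : ℝ} {a : ι → ℝ} {ω : ι → Sph d} {P : ι → Cadlag d}
  {Ω : Type*} [MeasurableSpace Ω] {Pr : Measure Ω} {L : Ω → Cadlag d}

lemma Cadlag.left_scale (u : Cadlag d) (r : ℝ) {t : I} (ht : 0 < t) :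
    (u.scale r).left t = r • u.left t := by
  have hne : (𝓝[<] t).NeBot := nhdsLT_neBot_of_exists_lt ⟨0, ht⟩
  exact tendsto_nhds_unique ((u.scale r).tendsto_left t) ((u.tendsto_left t).const_smul r)

lemma Cadlag.scale_apply (u : Cadlag d) (r : ℝ) (t : I) : u.scale r t = r • u t := rfl

lemma Cadlag.jump_scale (u : Cadlag d) (r : ℝ) {t : I} (ht : 0 < t) :
    (u.scale r).jump t = r • u.jump t := by
  rw [jump, jump, left_scale u r ht, scale_apply, smul_sub]

lemma Cadlag.jump_slow (u : Cadlag d) {c : I} (hc : 0 < c) {t : I} (ht : 0 < t) :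
    (u.slow c hc).jump t = u.jump (c * t) := by
  rw [jump, jump, left_slow c hc u ht, slow_apply]

lemma aemeasurable_approximant {u : Ω → Cadlag d} (hu : ∀ t, AEMeasurable (fun x => u x t) Pr)
    {n : ℕ} (hn : 0 < n) : AEMeasurable (fun x => approximant ω P n (u x)) Pr := by
  simp only [approximant_eq hn]
  exact (measurable_approximantOfIncrements hn).comp_aemeasurable
    (aemeasurable_pi_lambda _ fun k => (hu _).sub (hu _))

/-- The decoration is an almost sure limit of approximants, each a measurable function of finitely
many increments. The index is shifted because the grid with `n = 0` is degenerate. -/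
lemma aemeasurable_decorate_of_tendsto (hP : ∀ i, IsProfile (P i) (ω i)) {u : Ω → Cadlag d}
    (hu : ∀ t, AEMeasurable (fun x => u x t) Pr)
    (h : ∀ᵐ x ∂Pr, Tendsto (fun n => approximant ω P n (u x)) atTop (𝓝 (decorate ω P hP (u x)))) :
    AEMeasurable (fun x => decorate ω P hP (u x)) Pr := by
  refine aemeasurable_of_tendsto_metrizable_ae atTop
    (f := fun n x => approximant ω P (n + 1) (u x))
    (fun n => aemeasurable_approximant hu n.succ_pos) ?_
  filter_upwards [h] with x hx
  exact hx.comp (tendsto_add_atTop_nat 1)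

variable [IsProbabilityMeasure Pr]

/-- The jumps of `L(c·)` are jumps of `L`, and continuity of `L(c·)` at time 1 amounts to the almost
sure absence of a jump of `L` at the fixed time `c`. -/
lemma IsStableLevy.ae_tendsto_approximant_slow (hω : Function.Injective ω)
    (hP : ∀ i, IsProfile (P i) (ω i)) (hα0 : 0 < α) (hα2 : α < 2) (hα1 : α ≠ 1)
    (ha : ∀ i, 0 < a i) (hL : IsStableLevy α (spectralMeasure a ω) L Pr) {c : I} (hc : 0 < c) :
    ∀ᵐ x ∂Pr, (∀ t ∈ ((L x).slow c hc).disc, ∃ i, ((L x).slow c hc).jump t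
        = ‖((L x).slow c hc).jump t‖ • (ω i : Vec d)) ∧
      ((L x).slow c hc).left 1 = (L x).slow c hc 1 ∧
      Tendsto (fun n => approximant ω P n ((L x).slow c hc)) atTop
        (𝓝 (decorate ω P hP ((L x).slow c hc))) := by
  filter_upwards [hL.zero, hL.ae_jump_direction hα0 hα2 hα1 ha, hL.ae_left_eq hc]
    with x h0 hdir hleft
  have h1 : ∀ t ∈ ((L x).slow c hc).disc, ∃ i, ((L x).slow c hc).jump t
      = ‖((L x).slow c hc).jump t‖ • (ω i : Vec d) := by
    intro t ht
    have hne := Cadlag.jump_ne_zero _ ht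
    have ht0 : 0 < t := ht.1.1
    rw [Cadlag.jump_slow _ hc ht0] at hne ⊢
    refine hdir _ ?_ hne
    have : (0 : ℝ) < c * t := mul_pos hc ht0
    exact this
  have h2 : ((L x).slow c hc).left 1 = (L x).slow c hc 1 := by
    rw [Cadlag.left_slow c hc _ zero_lt_one, Cadlag.slow_apply, mul_one, hleft]
  exact ⟨h1, h2, tendsto_approximant hω hP (by rw [Cadlag.slow_apply, mul_zero, h0]) h1 h2⟩

lemma IsStableLevy.ae_tendsto_approximant_scale (hω : Function.Injective ω)
    (hP : ∀ i, IsProfile (P i) (ω i)) (hα0 : 0 < α) (hα2 : α < 2) (hα1 : α ≠ 1)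
    (ha : ∀ i, 0 < a i) (hL : IsStableLevy α (spectralMeasure a ω) L Pr) {r : ℝ} (hr : 0 < r) :
    ∀ᵐ x ∂Pr, Tendsto (fun n => approximant ω P n ((L x).scale r)) atTop
        (𝓝 (decorate ω P hP ((L x).scale r))) := by
  filter_upwards [hL.zero, hL.ae_jump_direction hα0 hα2 hα1 ha, hL.ae_left_eq zero_lt_one]
    with x h0 hdir hleft
  refine tendsto_approximant hω hP (by rw [Cadlag.scale_apply, h0, smul_zero]) ?_ ?_
  · intro t ht
    have hne := Cadlag.jump_ne_zero _ ht
    have ht0 : 0 < t := ht.1.1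
    rw [Cadlag.jump_scale _ _ ht0] at hne ⊢
    obtain ⟨i, hi⟩ := hdir t ht0 (right_ne_zero_of_smul hne)
    refine ⟨i, ?_⟩
    rw [norm_smul, Real.norm_eq_abs, abs_of_pos hr, mul_smul, ← hi]
  · rw [Cadlag.left_scale _ _ zero_lt_one, Cadlag.scale_apply, hleft]

/-- The decorated time-changed process and the decorated scaled process have the same law. -/
lemma IsStableLevy.integral_decorate_slow_eq (hω : Function.Injective ω)
    (hP : ∀ i, IsProfile (P i) (ω i)) (hα0 : 0 < α) (hα2 : α < 2) (hα1 : α ≠ 1)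
    (ha : ∀ i, 0 < a i) (hL : IsStableLevy α (spectralMeasure a ω) L Pr) {c : I} (hc : 0 < c)
    {φ : Decorated d → ℝ} (hφ : Continuous φ) {B : ℝ} (hB : ∀ w, ‖φ w‖ ≤ B) :
    ∫ x, φ (decorate ω P hP ((L x).slow c hc)) ∂Pr
      = ∫ x, φ (decorate ω P hP ((L x).scale ((c : ℝ) ^ (1 / α)))) ∂Pr := by
  have hr : 0 < (c : ℝ) ^ (1 / α) := Real.rpow_pos_of_pos hc _
  have m1 : ∀ t, AEMeasurable (fun x => (L x).slow c hc t) Pr := fun t => hL.aemeasurable (c * t)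
  have m2 : ∀ t, AEMeasurable (fun x => (L x).scale ((c : ℝ) ^ (1 / α)) t) Pr := fun t =>
    (hL.aemeasurable t).const_smul ((c : ℝ) ^ (1 / α))
  -- Both expectations are limits of expectations of the same functional of finitely many
  -- increments, so equality in law of the increment vectors is enough.
  have key : ∀ u : Ω → Cadlag d, (∀ t, AEMeasurable (fun x => u x t) Pr) →
      (∀ᵐ x ∂Pr, Tendsto (fun n => approximant ω P n (u x)) atTop
        (𝓝 (decorate ω P hP (u x)))) →
      Tendsto (fun n : ℕ => ∫ x, φ (approximant ω P (n + 1) (u x)) ∂Pr) atTop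
        (𝓝 (∫ x, φ (decorate ω P hP (u x)) ∂Pr)) := by
    intro u hu hlim
    refine tendsto_integral_of_dominated_convergence (fun _ => B)
      (fun n => (hφ.measurable.comp_aemeasurable
        (aemeasurable_approximant hu n.succ_pos)).aestronglyMeasurable)
      (integrable_const _) (fun n => Eventually.of_forall fun x => hB _) ?_
    filter_upwards [hlim] with x hx
    exact (hφ.tendsto _).comp (hx.comp (tendsto_add_atTop_nat 1))
  have k1 := key _ m1 (by
    filter_upwards [hL.ae_tendsto_approximant_slow hω hP hα0 hα2 hα1 ha hc] with x hx using hx.2.2)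
  have k2 := key _ m2 (hL.ae_tendsto_approximant_scale hω hP hα0 hα2 hα1 ha hr)
  refine tendsto_nhds_unique k1 (k2.congr fun n => ?_)
  have hn := n.succ_pos
  simp only [approximant_eq hn]
  have hmeas : Measurable fun D => φ (approximantOfIncrements ω P (n + 1) D) :=
    hφ.measurable.comp (measurable_approximantOfIncrements hn)
  have e1 := integral_map (aemeasurable_pi_lambda _ fun k : Fin (n + 1) =>
    (m1 (Decorated.gridPoint (n + 1) (k + 1))).sub (m1 (Decorated.gridPoint (n + 1) k)))
    hmeas.aestronglyMeasurable
  have e2 := integral_map (aemeasurable_pi_lambda _ fun k : Fin (n + 1) =>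
    (m2 (Decorated.gridPoint (n + 1) (k + 1))).sub (m2 (Decorated.gridPoint (n + 1) k)))
    hmeas.aestronglyMeasurable
  refine e2.symm.trans (Eq.trans ?_ e1)
  exact congrArg (fun ρ => ∫ D, φ (approximantOfIncrements ω P (n + 1) D) ∂ρ)
    (hL.map_increments_eq hα0 hc (n + 1)).symm

end LimitLaw

end DecoratedLevy

namespace DecoratedLevy

/-! ### Visits to the base. -/

section Visits

variable {M : Type*} {T : M → M} {X : Set M}

/-- The number of visits to `X` before time `n`. -/
noncomputable def visits (T : M → M) (X : Set M) (n : ℕ) (x : M) : ℝ :=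
  birkhoffSum T (X.indicator 1) n x

lemma visits_mono (x : M) : Monotone fun n => visits T X n x := by
  refine monotone_nat_of_le_succ fun n => ?_
  rw [visits, visits, birkhoffSum_succ]
  exact le_add_of_nonneg_right (indicator_nonneg (fun _ _ => zero_le_one) _)

lemma visits_add_le (n m : ℕ) (x : M) : visits T X (n + m) x ≤ visits T X n x + m := by
  induction m with
  | zero => simp
  | succ m ih =>
    rw [← add_assoc, visits, birkhoffSum_succ]
    have : X.indicator (1 : M → ℝ) (T^[n + m] x) ≤ 1 :=
      indicator_le_self' (fun _ _ => zero_le_one) _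
    rw [visits] at ih
    push_cast
    linarith

/-- In `m` steps the number of visits grows by an amount between 0 and `m`, and so does `c` times
the time. Control on a coarse grid thus extends to all times. -/
lemma abs_visits_sub_le {c : ℝ} (hc0 : 0 ≤ c) (hc1 : c ≤ 1) (n m : ℕ) (x : M) :
    |visits T X (n + m) x - c * ((n + m : ℕ) : ℝ)| ≤ |visits T X n x - c * n| + m := by
  have h1 := visits_add_le (T := T) (X := X) n m x
  have h2 := visits_mono (T := T) (X := X) x (Nat.le_add_right n m)
  have hm : (0 : ℝ) ≤ m := Nat.cast_nonneg m
  have h3 : c * m ≤ m := mul_le_of_le_one_left hm hc1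
  have h4 : 0 ≤ c * m := mul_nonneg hc0 hm
  simp only at h2
  have h5 := le_abs_self (visits T X n x - c * n)
  have h6 := neg_abs_le (visits T X n x - c * n)
  push_cast
  rw [abs_le]
  constructor <;> linarith

end Visits

/-! ### The mean ergodic theorem and uniform linear growth of the visits. -/

section MeanErgodic

variable {M : Type*} [MeasurableSpace M] {μ : Measure M} {T : M → M}

lemma memLp_birkhoffSum (hT : MeasurePreserving T μ μ) {h : M → ℝ} {p : ℝ≥0∞}
    (hh : MemLp h p μ) (n : ℕ) : MemLp (birkhoffSum T h n) p μ := by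
  have h1 : birkhoffSum T h n = fun x => ∑ j ∈ Finset.range n, h (T^[j] x) := rfl
  rw [h1]
  exact memLp_finsetSum _ fun j _ => hh.comp_measurePreserving (hT.iterate j)

lemma integral_birkhoffSum (hT : MeasurePreserving T μ μ) {h : M → ℝ} (hh : Integrable h μ)
    (n : ℕ) : ∫ x, birkhoffSum T h n x ∂μ = n * ∫ x, h x ∂μ := by
  simp only [birkhoffSum]
  have hi : ∀ j, Integrable (fun x => h (T^[j] x)) μ := fun j =>
    (hT.iterate j).integrable_comp_of_integrable hh
  rw [integral_finsetSum _ fun j _ => hi j]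
  have : ∀ j, ∫ x, h (T^[j] x) ∂μ = ∫ x, h x ∂μ := fun j => by
      conv_rhs => rw [← (hT.iterate j).map_eq]
      rw [integral_map (hT.iterate j).measurable.aemeasurable]
      rw [(hT.iterate j).map_eq]
      exact hh.aestronglyMeasurable
  simp [this]

/-- The mean ergodic theorem for an ergodic transformation, in `L¹`. -/
lemma tendsto_eLpNorm_birkhoffAverage [IsProbabilityMeasure μ] (hT : Ergodic T μ) {h : M → ℝ}
    (hh : MemLp h 2 μ) :
    Tendsto (fun n : ℕ => eLpNorm (fun x => (n : ℝ)⁻¹ * birkhoffSum T h n x - ∫ x, h x ∂μ) 1 μ)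
      atTop (𝓝 0) := by
  have hTm := hT.toMeasurePreserving
  obtain ⟨U, hUn, hU⟩ : ∃ U : Lp ℝ 2 μ →L[ℝ] Lp ℝ 2 μ, ‖U‖ ≤ 1 ∧
      ∀ f, U f = Lp.compMeasurePreserving T hTm f := by
    obtain ⟨V, hV⟩ : ∃ V : Lp ℝ 2 μ →ₗᵢ[ℝ] Lp ℝ 2 μ,
        ∀ f, V f = Lp.compMeasurePreserving T hTm f :=
      ⟨Lp.compMeasurePreservingₗᵢ ℝ T hTm, fun f => rfl⟩
    exact ⟨V.toContinuousLinearMap, V.norm_toContinuousLinearMap_le, hV⟩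
  -- By von Neumann's theorem the averages converge in `L²` to the projection `y` on the invariant
  -- functions; ergodicity makes `y` a constant `κ`.
  set y := (U.eqLocus (1 : Lp ℝ 2 μ →L[ℝ] Lp ℝ 2 μ)).orthogonalProjectionOnto (hh.toLp h) with hy
  have hlim := U.tendsto_birkhoffAverage_orthogonalProjection hUn (hh.toLp h)
  have hiter : ∀ j, U^[j] (hh.toLp h) = (hh.comp_measurePreserving (hTm.iterate j)).toLp _ := by
    intro j
    induction j with
    | zero => rfl
    | succ j ih =>
      rw [Function.iterate_succ_apply', ih, hU, Lp.toLp_compMeasurePreserving]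
      rfl
  have hsum : ∀ n, birkhoffSum U _root_.id n (hh.toLp h)
      = (memLp_birkhoffSum hTm hh n).toLp (birkhoffSum T h n) := by
    intro n
    induction n with
    | zero =>
      rw [birkhoffSum_zero]
      simp only [birkhoffSum_zero']
      rfl
    | succ n ih =>
      rw [birkhoffSum_succ, ih, id, hiter, ← MemLp.toLp_add]
      congr 1
      ext x
      rw [birkhoffSum_succ]
      rfl
  obtain ⟨κ, hκ⟩ : ∃ κ : ℝ, (y : Lp ℝ 2 μ) =ᵐ[μ] fun _ => κ := by
    refine hT.ae_eq_const_of_ae_eq_comp_ae (Lp.aestronglyMeasurable _) ?_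
    have h1 : U (y : Lp ℝ 2 μ) = y := y.2
    have h2 := Lp.coeFn_compMeasurePreserving (y : Lp ℝ 2 μ) hTm
    rw [← hU, h1] at h2
    exact h2.symm
  have hL2 : Tendsto (fun n : ℕ => eLpNorm (fun x => (n : ℝ)⁻¹ * birkhoffSum T h n x - κ) 1 μ)
      atTop (𝓝 0) := by
    have h1 : Tendsto (fun n : ℕ => edist (birkhoffAverage ℝ U _root_.id n (hh.toLp h)) y) atTop
        (𝓝 0) := tendsto_iff_edist_tendsto_0.1 hlim
    refine tendsto_of_tendsto_of_tendsto_of_le_of_le tendsto_const_nhds h1 (fun _ => bot_le)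
      fun n => ?_
    have hm : AEStronglyMeasurable (fun x => (n : ℝ)⁻¹ * birkhoffSum T h n x - κ) μ :=
      ((memLp_birkhoffSum hTm hh n).aestronglyMeasurable.const_mul _).sub
        aestronglyMeasurable_const
    refine (eLpNorm_le_eLpNorm_of_exponent_le (by norm_num : (1 : ℝ≥0∞) ≤ 2) hm).trans ?_
    rw [Lp.edist_def]
    refine (eLpNorm_congr_ae ?_).le
    rw [birkhoffAverage, hsum]
    filter_upwards [hκ, Lp.coeFn_smul ((n : ℝ)⁻¹) ((memLp_birkhoffSum hTm hh n).toLp _),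
      (memLp_birkhoffSum hTm hh n).coeFn_toLp] with x h2 h3 h4
    rw [Pi.sub_apply, h2, h3, Pi.smul_apply, h4, smul_eq_mul]
  have hint : Integrable h μ := hh.integrable (by norm_num)
  -- The averages all have the integral of `h`, and their `L¹` limit is `κ`.
  have hκ' : ∫ x, h x ∂μ = κ := by
    have h1 : Tendsto (fun n : ℕ => ENNReal.ofReal |(∫ x, h x ∂μ) - κ|) atTop (𝓝 0) := by
      refine tendsto_of_tendsto_of_tendsto_of_le_of_le' tendsto_const_nhds hL2
        (Eventually.of_forall fun _ => bot_le) ?_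
      filter_upwards [eventually_gt_atTop 0] with n hn
      have hn0 : (n : ℝ) ≠ 0 := by exact_mod_cast hn.ne'
      have hi : Integrable (birkhoffSum T h n) μ :=
        memLp_one_iff_integrable.1 (memLp_birkhoffSum hTm (memLp_one_iff_integrable.2 hint) n)
      have h2 : (∫ x, h x ∂μ) - κ = ∫ x, ((n : ℝ)⁻¹ * birkhoffSum T h n x - κ) ∂μ := by
        rw [integral_sub (hi.const_mul _) (integrable_const _), integral_const_mul,
          integral_birkhoffSum hTm hint]
        simp [hn0]
      rw [h2, eLpNorm_one_eq_lintegral_enorm, ← Real.norm_eq_abs, ofReal_norm]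
      exact enorm_integral_le_lintegral_enorm _
    have h2 := tendsto_nhds_unique h1 tendsto_const_nhds
    rw [eq_comm, ENNReal.ofReal_eq_zero] at h2
    exact sub_eq_zero.1 (abs_nonpos_iff.1 h2)
  rw [hκ']
  exact hL2

variable {X : Set M}

lemma measurable_visits (hT : Measurable T) (hX : MeasurableSet X) (n : ℕ) :
    Measurable (visits T X n) := by
  have : visits T X n = fun x => ∑ j ∈ Finset.range n, X.indicator (1 : M → ℝ) (T^[j] x) := rfl
  rw [this]
  exact Finset.measurable_fun_sum _ fun j _ =>
    (measurable_one.indicator hX).comp (hT.iterate j)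

lemma tendsto_lintegral_visits [IsProbabilityMeasure μ] (hT : Ergodic T μ)
    (hX : MeasurableSet X) :
    Tendsto (fun n : ℕ => ∫⁻ x, ENNReal.ofReal |(n : ℝ)⁻¹ * visits T X n x - μ.real X| ∂μ)
      atTop (𝓝 0) := by
  have hh : MemLp (X.indicator (1 : M → ℝ)) 2 μ :=
    (memLp_const (1 : ℝ)).indicator hX
  have h := tendsto_eLpNorm_birkhoffAverage hT hh
  rw [integral_indicator_one hX] at h
  refine h.congr fun n => ?_
  rw [eLpNorm_one_eq_lintegral_enorm]
  refine lintegral_congr fun x => ?_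
  rw [← ofReal_norm, Real.norm_eq_abs]
  rfl

/-- The number of visits grows linearly, uniformly on long time intervals. -/
lemma tendsto_measure_exists_visits [IsProbabilityMeasure μ] (hT : Ergodic T μ)
    (hX : MeasurableSet X) {ε : ℝ} (hε : 0 < ε) :
    Tendsto (fun n : ℕ => μ {x | ∃ j ≤ n, ε * n < |visits T X j x - μ.real X * j|}) atTop
      (𝓝 0) := by
  set c := μ.real X with hc
  have hc0 : 0 ≤ c := measureReal_nonneg
  have hc1 : c ≤ 1 := measureReal_le_one
  -- Blocks of length `n / K` are shorter than `ε n / 2`, so it suffices to control the visits at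
  -- multiples of the block length. Their number is bounded independently of `n`.
  obtain ⟨K, hK⟩ := exists_nat_gt (2 / ε)
  have hK0 : (0 : ℝ) < K := lt_trans (by positivity) hK
  have hK1 : 0 < K := by exact_mod_cast hK0
  have hKε : 1 / (K : ℝ) < ε / 2 := by
    rw [div_lt_iff₀ hε] at hK
    rw [div_lt_iff₀ hK0]
    linarith
  have hq : Tendsto (fun n : ℕ => n / K) atTop atTop := Nat.tendsto_div_const_atTop hK1.ne'
  set D : ℕ → ℝ≥0∞ := fun m => ∫⁻ x, ENNReal.ofReal |(m : ℝ)⁻¹ * visits T X m x - c| ∂μ with hD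
  have hDlim : Tendsto D atTop (𝓝 0) := tendsto_lintegral_visits hT hX
  have hterm : ∀ i : ℕ, ∀ m n : ℕ, 0 < n → 0 < m → m = i * (n / K) → i ≤ 2 * K →
      μ {x | ε / 2 * n < |visits T X m x - c * m|} ≤ ENNReal.ofReal (4 / ε) * D m := by
    intro i m n hn hm0 hm hi
    have hn0 : (0 : ℝ) < n := by exact_mod_cast hn
    have hm0' : (0 : ℝ) < m := by exact_mod_cast hm0
    have hmn : (m : ℝ) ≤ 2 * n := by
      have h1 : m ≤ 2 * K * (n / K) := by rw [hm]; exact Nat.mul_le_mul_right _ hi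
      have h2 : K * (n / K) ≤ n := Nat.mul_div_le n K
      have h3 : m ≤ 2 * n := by
        calc m ≤ 2 * K * (n / K) := h1
          _ = 2 * (K * (n / K)) := by ring
          _ ≤ 2 * n := Nat.mul_le_mul_left 2 h2
      exact_mod_cast h3
    have hmeas : Measurable fun x => ENNReal.ofReal |(m : ℝ)⁻¹ * visits T X m x - c| := by
      have := measurable_visits hT.measurable hX m
      fun_prop
    have hsub : {x | ε / 2 * n < |visits T X m x - c * m|}
        ⊆ {x | ENNReal.ofReal (ε / 4) ≤ ENNReal.ofReal |(m : ℝ)⁻¹ * visits T X m x - c|} := by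
      intro x hx
      refine ENNReal.ofReal_le_ofReal ?_
      have hx' : ε / 2 * n < |visits T X m x - c * m| := hx
      have e : |visits T X m x - c * m| = m * |(m : ℝ)⁻¹ * visits T X m x - c| := by
        rw [← abs_of_pos hm0', ← abs_mul, abs_of_pos hm0', mul_sub, mul_inv_cancel_left₀ hm0'.ne',
          mul_comm c]
      rw [e] at hx'
      by_contra hlt
      push Not at hlt
      have : m * |(m : ℝ)⁻¹ * visits T X m x - c| ≤ 2 * n * (ε / 4) :=
        mul_le_mul hmn hlt.le (abs_nonneg _) (by positivity)
      linarith
    refine (measure_mono hsub).trans ?_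
    have hmk := mul_meas_ge_le_lintegral₀ (μ := μ) hmeas.aemeasurable (ENNReal.ofReal (ε / 4))
    have e4 : ENNReal.ofReal (4 / ε) * ENNReal.ofReal (ε / 4) = 1 := by
      rw [← ENNReal.ofReal_mul (by positivity), div_mul_div_comm, mul_comm, div_self (by positivity),
        ENNReal.ofReal_one]
    calc _ = ENNReal.ofReal (4 / ε) * (ENNReal.ofReal (ε / 4) *
          μ {x | ENNReal.ofReal (ε / 4) ≤ ENNReal.ofReal |(m : ℝ)⁻¹ * visits T X m x - c|}) := by
          rw [← mul_assoc, e4, one_mul]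
      _ ≤ _ := by gcongr
  -- Because `n / K` is rounded down, up to `2K` blocks may be needed to reach `n`. The block end `i
  -- = 0` never contributes and is given the bound 0, since `D` is only controlled at large
  -- arguments.
  have hcover : ∀ᶠ n : ℕ in atTop, μ {x | ∃ j ≤ n, ε * n < |visits T X j x - c * j|}
      ≤ ∑ i ∈ Finset.range (2 * K + 1), ENNReal.ofReal (4 / ε) * (if i = 0 then 0 else
        D (i * (n / K))) := by
    filter_upwards [eventually_ge_atTop K] with n hn
    have hnpos : 0 < n := hK1.trans_le hn
    have hn0 : (0 : ℝ) < n := by exact_mod_cast hnpos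
    have hqpos : 0 < n / K := Nat.div_pos hn hK1
    have hsub : {x | ∃ j ≤ n, ε * n < |visits T X j x - c * j|}
        ⊆ ⋃ i ∈ Finset.range (2 * K + 1), {x | ε / 2 * n <
          |visits T X (i * (n / K)) x - c * ((i * (n / K) : ℕ) : ℝ)|} := by
      rintro x ⟨j, hj, hx⟩
      refine mem_iUnion₂.2 ⟨j / (n / K), ?_, ?_⟩
      · rw [Finset.mem_range, Nat.lt_succ_iff]
        refine Nat.div_le_of_le_mul ?_
        have h1 : n < K * (n / K + 1) := Nat.lt_mul_div_succ n hK1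
        have h2 : K * (n / K + 1) ≤ K * (n / K + n / K) := Nat.mul_le_mul_left K (by omega)
        calc j ≤ n := hj
          _ ≤ K * (n / K + n / K) := (h1.trans_le h2).le
          _ = n / K * (2 * K) := by ring
      · have h1 : j / (n / K) * (n / K) + j % (n / K) = j := Nat.div_add_mod' j (n / K)
        have h2 := abs_visits_sub_le (T := T) (X := X) hc0 hc1 (j / (n / K) * (n / K))
          (j % (n / K)) x
        rw [h1] at h2
        have h3 : ((j % (n / K) : ℕ) : ℝ) ≤ ε / 2 * n := by
          have h4 : ((j % (n / K) : ℕ) : ℝ) ≤ ((n / K : ℕ) : ℝ) := by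
            exact_mod_cast (Nat.mod_lt j hqpos).le
          have h5 : ((n / K : ℕ) : ℝ) ≤ n / K := Nat.cast_div_le
          have h6 : (n : ℝ) / K = 1 / K * n := by ring
          rw [h6] at h5
          exact h4.trans (h5.trans (mul_le_mul_of_nonneg_right hKε.le hn0.le))
        have hx' : ε * n < |visits T X j x - c * j| := hx
        change ε / 2 * n < _
        linarith
    refine (measure_mono hsub).trans ((measure_biUnion_finset_le _ _).trans ?_)
    refine Finset.sum_le_sum fun i hi => ?_
    split_ifs with hi0
    · subst hi0
      have : {x | ε / 2 * n < |visits T X (0 * (n / K)) x - c * ((0 * (n / K) : ℕ) : ℝ)|} = ∅ := by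
        ext x
        simp only [zero_mul, visits, birkhoffSum_zero, Nat.cast_zero, mul_zero, sub_zero, abs_zero,
          mem_ofPred_eq, mem_empty_iff_false, iff_false, not_lt]
        positivity
      rw [this, measure_empty]
      exact bot_le
    · exact hterm i _ n hnpos (Nat.mul_pos (Nat.pos_of_ne_zero hi0) hqpos) rfl
        (Nat.lt_succ_iff.1 (Finset.mem_range.1 hi))
  have hsum : Tendsto (fun n : ℕ => ∑ i ∈ Finset.range (2 * K + 1), ENNReal.ofReal (4 / ε) *
      (if i = 0 then 0 else D (i * (n / K)))) atTop
      (𝓝 (∑ i ∈ Finset.range (2 * K + 1), ENNReal.ofReal (4 / ε) * 0)) := by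
    refine tendsto_finsetSum _ fun i _ => ?_
    refine ENNReal.Tendsto.const_mul ?_ (Or.inr ENNReal.ofReal_ne_top)
    split_ifs with hi
    · exact tendsto_const_nhds
    · exact hDlim.comp (tendsto_atTop_mono
        (fun n => Nat.le_mul_of_pos_left _ (Nat.pos_of_ne_zero hi)) hq)
  simp only [mul_zero, Finset.sum_const_zero] at hsum
  exact tendsto_of_tendsto_of_tendsto_of_le_of_le' tendsto_const_nhds hsum
    (Eventually.of_forall fun _ => bot_le) hcover

end MeanErgodic

end DecoratedLevy

namespace DecoratedLevy

/-! ### Return times along an orbit. -/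

section Returns

variable {M : Type*} {T : M → M} {X : Set M} {x : M}

/-- A point of `X` whose orbit visits `X` infinitely often. -/
structure IsRecurrent (T : M → M) (X : Set M) (x : M) : Prop where
  mem : x ∈ X
  frequently : ∃ᶠ n in atTop, T^[n] x ∈ X

/-- The time of the `k`-th return. -/
noncomputable def returnSum (T : M → M) (X : Set M) (x : M) (k : ℕ) : ℕ :=
  birkhoffSum (returnMap T X) (returnTime T X) k x

lemma returnSum_zero (x : M) : returnSum T X x 0 = 0 := birkhoffSum_zero _ _ _

lemma returnSum_succ (x : M) (k : ℕ) :
    returnSum T X x (k + 1) = returnSum T X x k + returnTime T X ((returnMap T X)^[k] x) :=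
  birkhoffSum_succ _ _ _ _

lemma iterate_returnSum (x : M) (k : ℕ) : T^[returnSum T X x k] x = (returnMap T X)^[k] x := by
  induction k with
  | zero => rw [returnSum_zero]; rfl
  | succ k ih =>
    rw [returnSum_succ, add_comm, Function.iterate_add_apply, ih, Function.iterate_succ_apply']
    rfl

/-- The excursions between returns concatenate: the induced sums are the original sums at the return
times. -/
lemma birkhoffSum_returnMap {E : Type*} [AddCommMonoid E] (v : M → E) (x : M) (k : ℕ) :
    birkhoffSum (returnMap T X) (fun y => birkhoffSum T v (returnTime T X y) y) k x
      = birkhoffSum T v (returnSum T X x k) x := by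
  induction k with
  | zero => rw [returnSum_zero, birkhoffSum_zero, birkhoffSum_zero]
  | succ k ih => rw [birkhoffSum_succ, ih, returnSum_succ, birkhoffSum_add, iterate_returnSum]

lemma trueExcursion_iterate {d : ℕ} (v : M → Vec d) (x : M) (k : ℕ) (t : I) :
    trueExcursion T X v ((returnMap T X)^[k] x) t
      = birkhoffSum T v (returnSum T X x k +
        ⌊(t : ℝ) * ((returnSum T X x (k + 1) - returnSum T X x k : ℕ) : ℝ)⌋₊) x
        - birkhoffSum T v (returnSum T X x k) x := by
  rw [returnSum_succ, Nat.add_sub_cancel_left, birkhoffSum_add, iterate_returnSum,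
    add_sub_cancel_left]
  rfl

lemma IsRecurrent.nonempty (h : IsRecurrent T X x) : {n | 1 ≤ n ∧ T^[n] x ∈ X}.Nonempty := by
  obtain ⟨n, hn, hmem⟩ := (frequently_atTop.1 h.frequently) 1
  exact ⟨n, hn, hmem⟩

lemma IsRecurrent.one_le_returnTime (h : IsRecurrent T X x) : 1 ≤ returnTime T X x :=
  (Nat.sInf_mem h.nonempty).1

lemma IsRecurrent.returnMap_mem (h : IsRecurrent T X x) : returnMap T X x ∈ X :=
  (Nat.sInf_mem h.nonempty).2

lemma iterate_notMem_of_lt_returnTime {n : ℕ} (h1 : 1 ≤ n) (h2 : n < returnTime T X x) :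
    T^[n] x ∉ X := fun h => Nat.notMem_of_lt_sInf h2 ⟨h1, h⟩

lemma IsRecurrent.returnMap (h : IsRecurrent T X x) : IsRecurrent T X (returnMap T X x) := by
  refine ⟨h.returnMap_mem, frequently_atTop.2 fun n => ?_⟩
  obtain ⟨m, hm, hmem⟩ := frequently_atTop.1 h.frequently (n + returnTime T X x)
  refine ⟨m - returnTime T X x, by omega, ?_⟩
  rw [DecoratedLevy.returnMap, ← Function.iterate_add_apply, Nat.sub_add_cancel (by omega)]
  exact hmem

lemma IsRecurrent.iterate (h : IsRecurrent T X x) (k : ℕ) :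
    IsRecurrent T X ((DecoratedLevy.returnMap T X)^[k] x) := by
  induction k with
  | zero => exact h
  | succ k ih => rw [Function.iterate_succ_apply']; exact ih.returnMap

lemma IsRecurrent.strictMono_returnSum (h : IsRecurrent T X x) : StrictMono (returnSum T X x) := by
  refine strictMono_nat_of_lt_succ fun k => ?_
  have := (h.iterate k).one_le_returnTime
  rw [returnSum_succ]
  omega

lemma IsRecurrent.visits_returnTime (h : IsRecurrent T X x) :
    visits T X (returnTime T X x) x = 1 := by
  have h1 := h.one_le_returnTime
  rw [visits, birkhoffSum, Finset.sum_eq_single 0]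
  · simp [h.mem]
  · intro j hj hj0
    exact indicator_of_notMem (iterate_notMem_of_lt_returnTime (Nat.one_le_iff_ne_zero.2 hj0)
      (Finset.mem_range.1 hj)) _
  · intro h0
    exact absurd (Finset.mem_range.2 h1) h0

/-- Each excursion contains exactly one visit, at its starting point. -/
lemma IsRecurrent.visits_returnSum (h : IsRecurrent T X x) (k : ℕ) :
    visits T X (returnSum T X x k) x = k := by
  induction k with
  | zero => rw [returnSum_zero, visits, birkhoffSum_zero, Nat.cast_zero]
  | succ k ih =>
    have h1 := (h.iterate k).visits_returnTime
    rw [visits] at ih h1 ⊢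
    rw [returnSum_succ, birkhoffSum_add, iterate_returnSum, ih, h1]
    push_cast
    rfl

lemma IsRecurrent.abs_visits_sub_le (h : IsRecurrent T X x) {k j : ℕ}
    (h1 : returnSum T X x k ≤ j) (h2 : j < returnSum T X x (k + 1)) :
    |visits T X j x - k| ≤ 1 := by
  have e1 := visits_mono (T := T) (X := X) x h1
  have e2 := visits_mono (T := T) (X := X) x h2.le
  simp only [h.visits_returnSum] at e1 e2
  push_cast at e2
  rw [abs_le]
  constructor <;> linarith

/-- The set of points whose orbit does not visit `X` before time `n`. -/
def avoiding (T : M → M) (X : Set M) (n : ℕ) : Set M := {x | ∀ j < n, T^[j] x ∉ X}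

lemma avoiding_succ (n : ℕ) : avoiding T X (n + 1) = Xᶜ ∩ T ⁻¹' avoiding T X n := by
  ext x
  constructor
  · intro h
    exact ⟨h 0 n.succ_pos, fun j hj => h (j + 1) (by omega)⟩
  · rintro ⟨h1, h2⟩ j hj
    rcases j with _ | j
    · exact h1
    · exact h2 j (by omega)

end Returns

/-! ### Kac's lemma. -/

section Kac

variable {M : Type*} [MeasurableSpace M] {μ : Measure M} {T : M → M} {X : Set M}

lemma measurableSet_avoiding (hT : Measurable T) (hX : MeasurableSet X) (n : ℕ) :
    MeasurableSet (avoiding T X n) := by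
  have : avoiding T X n = ⋂ j, ⋂ _ : j < n, (T^[j] ⁻¹' X)ᶜ := by
    ext x; simp [avoiding]
  rw [this]
  exact MeasurableSet.iInter fun j => MeasurableSet.iInter fun _ => (hT.iterate j hX).compl

/-- `T⁻¹` of the avoiding set has the same measure as that set, and its part off `X` is the next
avoiding set. The identity is what makes the sum in Kac's lemma telescope. -/
lemma measure_inter_preimage_avoiding (hT : MeasurePreserving T μ μ) (hX : MeasurableSet X)
    (n : ℕ) : μ (X ∩ T ⁻¹' avoiding T X n) + μ (avoiding T X (n + 1)) = μ (avoiding T X n) := by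
  have hm := measurableSet_avoiding hT.measurable hX n
  rw [avoiding_succ, ← hT.measure_preimage hm.nullMeasurableSet]
  have := measure_inter_add_sdiff (μ := μ) (T ⁻¹' avoiding T X n) hX
  rw [inter_comm X, inter_comm Xᶜ]
  exact this

variable [IsProbabilityMeasure μ]

lemma ae_isRecurrent (hT : MeasurePreserving T μ μ) (hX : MeasurableSet X) :
    ∀ᵐ x ∂(cond μ X), IsRecurrent T X x := by
  have h1 : ∀ᵐ x ∂μ, x ∈ X → ∃ᶠ n in atTop, T^[n] x ∈ X :=
    hT.conservative.ae_mem_imp_frequently_image_mem hX.nullMeasurableSet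
  have h2 : ∀ᵐ x ∂(cond μ X), x ∈ X := ae_cond_mem hX
  filter_upwards [cond_absolutelyContinuous.ae_le h1, h2] with x hx hxX
  exact ⟨hxX, hx hxX⟩

/-- On the avoiding set the average number of visits is 0, so it deviates from its limit by `μ(X) >
0`; convergence in `L¹` bounds the measure of such points. -/
lemma tendsto_measure_avoiding (hT : Ergodic T μ) (hX : MeasurableSet X) (hX0 : μ X ≠ 0) :
    Tendsto (fun n => μ (avoiding T X n)) atTop (𝓝 0) := by
  have hc : 0 < μ.real X := by
    rw [measureReal_def, ENNReal.toReal_pos_iff]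
    exact ⟨pos_iff_ne_zero.2 hX0, measure_lt_top μ X⟩
  have h := tendsto_lintegral_visits hT hX
  have h2 := ENNReal.Tendsto.const_mul h
    (Or.inr (ENNReal.ofReal_ne_top (r := (μ.real X)⁻¹)))
  rw [mul_zero] at h2
  refine tendsto_of_tendsto_of_tendsto_of_le_of_le tendsto_const_nhds h2 (fun _ => bot_le)
    fun n => ?_
  have hv : ∀ x ∈ avoiding T X n, visits T X n x = 0 := by
    intro x hx
    refine Finset.sum_eq_zero fun j hj => indicator_of_notMem (hx j (Finset.mem_range.1 hj)) _
  have h3 : ENNReal.ofReal (μ.real X) * μ (avoiding T X n)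
      ≤ ∫⁻ x, ENNReal.ofReal |(n : ℝ)⁻¹ * visits T X n x - μ.real X| ∂μ := by
    rw [← setLIntegral_const]
    refine (setLIntegral_mono' (measurableSet_avoiding hT.measurable hX n) fun x hx => ?_).trans
      (setLIntegral_le_lintegral _ _)
    rw [hv x hx, mul_zero, zero_sub, abs_neg, abs_of_pos hc]
  calc μ (avoiding T X n)
      = ENNReal.ofReal (μ.real X)⁻¹ * (ENNReal.ofReal (μ.real X) * μ (avoiding T X n)) := by
        rw [← mul_assoc, ← ENNReal.ofReal_mul (by positivity), inv_mul_cancel₀ hc.ne',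
          ENNReal.ofReal_one, one_mul]
    _ ≤ _ := by gcongr

/-- **Kac's lemma**. -/
lemma integral_returnTime (hT : Ergodic T μ) (hX : MeasurableSet X) (hX0 : μ X ≠ 0) :
    ∫ x, (returnTime T X x : ℝ) ∂(cond μ X) = (μ.real X)⁻¹ := by
  have hTm := hT.toMeasurePreserving
  have hrec := ae_isRecurrent hTm hX
  -- The return time is the sum over `n` of the indicators of `n < R`, and for recurrent points of
  -- `X` this event means that `T x` avoids `X` before time `n`.
  have hset : ∀ n, ∀ᵐ x ∂(cond μ X), (if n < returnTime T X x then (1 : ℝ≥0∞) else 0)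
      = (X ∩ T ⁻¹' avoiding T X n).indicator 1 x := by
    intro n
    filter_upwards [hrec] with x hx
    have hiff : n < returnTime T X x ↔ x ∈ X ∩ T ⁻¹' avoiding T X n := by
      constructor
      · intro hlt
        refine ⟨hx.mem, fun j hj => ?_⟩
        rw [← Function.iterate_succ_apply]
        exact iterate_notMem_of_lt_returnTime (by omega) (by omega)
      · rintro ⟨-, h2⟩
        by_contra hle
        have h3 := hx.one_le_returnTime
        have h4 := h2 (returnTime T X x - 1) (by omega)
        rw [← Function.iterate_succ_apply, Nat.succ_eq_add_one, Nat.sub_add_cancel h3] at h4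
        exact h4 hx.returnMap_mem
    by_cases hlt : n < returnTime T X x
    · rw [if_pos hlt, indicator_of_mem (hiff.1 hlt)]; rfl
    · rw [if_neg hlt, indicator_of_notMem fun h => hlt (hiff.2 h)]
  have hmeas : ∀ n, MeasurableSet (X ∩ T ⁻¹' avoiding T X n) := fun n =>
    hX.inter (hT.measurable (measurableSet_avoiding hT.measurable hX n))
  have hR : ∀ᵐ x ∂(cond μ X), ENNReal.ofReal (returnTime T X x : ℝ)
      = ∑' n, (X ∩ T ⁻¹' avoiding T X n).indicator (1 : M → ℝ≥0∞) x := by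
    filter_upwards [ae_all_iff.2 hset] with x hx
    simp only [← hx]
    rw [tsum_eq_sum (s := Finset.range (returnTime T X x)) fun n hn =>
      if_neg (by simpa using hn), ENNReal.ofReal_natCast, Finset.sum_congr rfl fun n hn =>
      if_pos (Finset.mem_range.1 hn)]
    simp
  have hlint : ∫⁻ x, ENNReal.ofReal (returnTime T X x : ℝ) ∂(cond μ X) = (μ X)⁻¹ := by
    rw [lintegral_congr_ae hR, lintegral_tsum fun n => (measurable_one.indicator (hmeas n)).aemeasurable]
    simp only [lintegral_indicator_one (hmeas _), cond_apply hX, ← inter_assoc, inter_self]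
    rw [ENNReal.tsum_mul_left]
    have hsum : HasSum (fun n => μ (X ∩ T ⁻¹' avoiding T X n)) 1 := by
      rw [ENNReal.summable.hasSum_iff_tendsto_nat]
      have hpart : ∀ N, ∑ n ∈ Finset.range N, μ (X ∩ T ⁻¹' avoiding T X n)
          = 1 - μ (avoiding T X N) := by
        intro N
        have : ∑ n ∈ Finset.range N, μ (X ∩ T ⁻¹' avoiding T X n) + μ (avoiding T X N) = 1 := by
          induction N with
          | zero =>
            have : avoiding T X 0 = univ := by ext x; simp [avoiding]
            simp [this]
          | succ N ih =>
            rw [Finset.sum_range_succ, add_assoc, measure_inter_preimage_avoiding hTm hX, ih]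
        rw [← this, ENNReal.add_sub_cancel_right (measure_ne_top _ _)]
      simp only [hpart]
      have := ENNReal.Tendsto.sub (tendsto_const_nhds (x := (1 : ℝ≥0∞)))
        (tendsto_measure_avoiding hT hX hX0) (Or.inl ENNReal.one_ne_top)
      simpa using this
    rw [hsum.tsum_eq, mul_one]
  have haem : AEStronglyMeasurable (fun x => (returnTime T X x : ℝ)) (cond μ X) := by
    have h1 : Measurable fun x =>
        (∑' n, (X ∩ T ⁻¹' avoiding T X n).indicator (1 : M → ℝ≥0∞) x).toReal :=
      (Measurable.tsum fun n => measurable_one.indicator (hmeas n)).ennreal_toReal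
    refine ⟨_, h1.stronglyMeasurable, ?_⟩
    filter_upwards [hR] with x hx
    rw [← hx, ENNReal.toReal_ofReal (Nat.cast_nonneg _)]
  rw [integral_eq_lintegral_of_nonneg_ae (Eventually.of_forall fun x => Nat.cast_nonneg _) haem,
    hlint, ENNReal.toReal_inv, measureReal_def]

end Kac

end DecoratedLevy

/-! ### A continuous mapping theorem with exceptional sets. -/

namespace DecoratedLevy

/-- A version of the continuous mapping theorem: if `U n → K` in distribution and, off exceptional
sets of vanishing measure, `Z n y` is close to `Φ (K x)` as soon as `U n y` is close to `K x`,
then `Z n → Φ ∘ K` in distribution. -/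
theorem tendstoInDistribution_of_approx {Y Ω E F : Type*} [MeasurableSpace Y] [MeasurableSpace Ω]
    [PseudoEMetricSpace E] [MeasurableSpace E] [BorelSpace E]
    [PseudoEMetricSpace F] [MeasurableSpace F] [BorelSpace F]
    {U : ℕ → Y → E} {Z : ℕ → Y → F} {K : Ω → E} {Φ : E → F}
    {ρ : Measure Y} [IsProbabilityMeasure ρ] {Pr : Measure Ω} [IsProbabilityMeasure Pr]
    (hU : TendstoInDistribution U atTop K (fun _ => ρ) Pr)
    (hZ : ∀ n, AEMeasurable (Z n) ρ) (hΦ : AEMeasurable (fun x => Φ (K x)) Pr)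
    {B : ℝ → ℕ → Set Y} (hanti : ∀ δ δ', δ ≤ δ' → ∀ n, B δ' n ⊆ B δ n)
    (hB : ∀ δ, 0 < δ → Tendsto (fun n => ρ (B δ n)) atTop (𝓝 0))
    (h : ∀ᵐ x ∂Pr, ∀ ε, 0 < ε → ∃ δ, 0 < δ ∧ ∀ᶠ n in atTop, ∀ y ∉ B δ n,
      edist (U n y) (K x) < ENNReal.ofReal δ → edist (Z n y) (Φ (K x)) ≤ ENNReal.ofReal ε) :
    TendstoInDistribution Z atTop (fun x => Φ (K x)) (fun _ => ρ) Pr where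
  forall_aemeasurable := hZ
  aemeasurable_limit := hΦ
  tendsto := by
    refine tendsto_of_forall_isOpen_le_liminf' fun G hG => ?_
    simp only [ProbabilityMeasure.coe_mk]
    rw [Measure.map_apply_of_aemeasurable hΦ hG.measurableSet]
    let r : ℕ → ℝ := fun k => 1 / ((k : ℝ) + 1)
    have hr : ∀ k, 0 < r k := fun k => Nat.one_div_pos_of_nat
    have hrm : Antitone r := fun i j hij => Nat.one_div_le_one_div hij
    -- The points `u` near which membership in `B (r k) n` is the only obstacle to `Z n y ∈ G`, for
    -- all `n ≥ k`. By hypothesis these sets exhaust almost all of the event that the limit lies in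
    -- `G`.
    let A : ℕ → Set E := fun k => {u | ∀ n ≥ k, ∀ y ∉ B (r k) n,
      edist (U n y) u < ENNReal.ofReal (r k) → Z n y ∈ G}
    have hA : Monotone A := by
      intro i j hij u hu n hn y hy hd
      exact hu n (hij.trans hn) y (fun hy' => hy (hanti _ _ (hrm hij) n hy'))
        (hd.trans_le (ENNReal.ofReal_le_ofReal (hrm hij)))
    -- `A k` itself need not be open or measurable. Its neighbourhood `O k` is open, so the
    -- portmanteau theorem applies, and `U n y ∈ O k` still means that `U n y` is `r k`-close to
    -- some point of `A k`.
    let O : ℕ → Set E := fun k => ⋃ u ∈ A k, Metric.eball u (ENNReal.ofReal (r k))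
    have hO : ∀ k, IsOpen (O k) := fun k => isOpen_biUnion fun u _ => Metric.isOpen_eball
    have hAO : ∀ k, A k ⊆ O k := fun k u hu =>
      mem_biUnion hu (Metric.mem_eball_self (by simpa using hr k))
    have hbound : ∀ k, Pr (K ⁻¹' A k) ≤ liminf (fun n => (ρ.map (Z n)) G) atTop := by
      intro k
      have h1 := ProbabilityMeasure.le_liminf_measure_open_of_tendsto hU.tendsto (hO k)
      simp only [ProbabilityMeasure.coe_mk] at h1
      rw [Measure.map_apply_of_aemeasurable hU.aemeasurable_limit (hO k).measurableSet] at h1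
      refine (measure_mono (preimage_mono (hAO k))).trans (h1.trans ?_)
      rw [← ENNReal.liminf_add_of_right_tendsto_zero (hB (r k) (hr k)) fun n => (ρ.map (Z n)) G]
      refine liminf_le_liminf ?_
      filter_upwards [eventually_ge_atTop k] with n hn
      rw [Measure.map_apply_of_aemeasurable (hU.forall_aemeasurable n) (hO k).measurableSet,
        Pi.add_apply, Measure.map_apply_of_aemeasurable (hZ n) hG.measurableSet]
      refine (measure_mono ?_).trans (measure_union_le _ _)
      intro y hy
      by_cases hyB : y ∈ B (r k) n
      · exact Or.inr hyB
      · obtain ⟨u, hu, hyu⟩ := mem_iUnion₂.1 hy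
        exact Or.inl (hu n hn y hyB hyu)
    have hmono : Monotone fun k => K ⁻¹' A k := fun i j hij => preimage_mono (hA hij)
    have hsub : ∀ᵐ x ∂Pr, x ∈ (fun x => Φ (K x)) ⁻¹' G → x ∈ ⋃ k, K ⁻¹' A k := by
      filter_upwards [h] with x hx hxG
      obtain ⟨ε, hε, hball⟩ := EMetric.isOpen_iff.1 hG _ hxG
      obtain ⟨ε', hε', hεε⟩ : ∃ ε' : ℝ, 0 < ε' ∧ ENNReal.ofReal ε' < ε := by
        obtain ⟨q, hq0, hq⟩ := ENNReal.lt_iff_exists_nnreal_btwn.1 hε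
        exact ⟨q, by simpa using hq0, by simpa using hq⟩
      obtain ⟨δ, hδ, hev⟩ := hx ε' hε'
      obtain ⟨N, hN⟩ := eventually_atTop.1 hev
      obtain ⟨k, hk⟩ := exists_nat_one_div_lt hδ
      have hrk : r (max k N) ≤ δ := (hrm (le_max_left k N)).trans hk.le
      refine mem_iUnion.2 ⟨max k N, fun n hn y hy hd => hball ?_⟩
      exact (hN n ((le_max_right _ _).trans hn) y (fun hy' => hy (hanti _ _ hrk n hy'))
        (hd.trans_le (ENNReal.ofReal_le_ofReal hrk))).trans_lt hεε
    calc Pr ((fun x => Φ (K x)) ⁻¹' G) ≤ Pr (⋃ k, K ⁻¹' A k) := measure_mono_ae hsub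
      _ = ⨆ k, Pr (K ⁻¹' A k) := hmono.measure_iUnion
      _ ≤ _ := iSup_le hbound

end DecoratedLevy

/-! ### Orbits as induced approximations. -/

namespace DecoratedLevy

variable {d : ℕ} {ι : Type*} {ω : ι → Sph d} {P : ι → Cadlag d}

lemma closestProfile_smul {r : ℝ} (hr : 0 < r) (V : Vec d) :
    closestProfile ω P (r • V) = closestProfile ω P V := by
  have h1 : ‖r • V‖⁻¹ • (r • V) = ‖V‖⁻¹ • V := by
    rw [norm_smul, Real.norm_of_nonneg hr.le, smul_smul, mul_inv_rev, mul_assoc,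
      inv_mul_cancel₀ hr.ne', mul_one]
  have h2 : r • V ≠ 0 ↔ V ≠ 0 := by simp [hr.ne']
  by_cases h : V ≠ 0 ∧ ∃ i, ∀ j, j ≠ i →
      dist (‖V‖⁻¹ • V) (ω i : Vec d) < dist (‖V‖⁻¹ • V) (ω j : Vec d)
  · obtain ⟨hV, i, hi⟩ := h
    rw [closestProfile_eq_of_forall_lt hV hi,
      closestProfile_eq_of_forall_lt (h2.2 hV) (by simpa only [h1] using hi)]
  · rw [closestProfile, closestProfile, dif_neg h, dif_neg]
    simpa only [h1, h2] using h

/-- Homogeneity lets the normalisation by `b n` pass through the comparison of excursions. -/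
lemma idealExcursion_smul {r : ℝ} (hr : 0 < r) (V : Vec d) (t : I) :
    idealExcursion ω P (r • V) t = r • idealExcursion ω P V t := by
  simp only [idealExcursion, closestProfile_smul hr, norm_smul, Real.norm_of_nonneg hr.le]
  module

lemma reparamEDist_smul_lt {u w : I → Vec d} {r D : ℝ} (hr : 0 < r)
    (h : reparamEDist u w < ENNReal.ofReal D) :
    reparamEDist (fun t => r • u t) (fun t => r • w t) < ENNReal.ofReal (r * D) := by
  obtain ⟨lam, hlam⟩ := iInf_lt_iff.1 h
  refine (iInf_le _ lam).trans_lt ?_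
  rw [ENNReal.ofReal_mul hr.le]
  refine lt_of_le_of_lt ?_
    (ENNReal.mul_lt_mul_right (ENNReal.ofReal_pos.2 hr).ne' ENNReal.ofReal_ne_top hlam)
  refine iSup_le fun t => ?_
  rw [edist_smul₀, ENNReal.smul_def, smul_eq_mul, ← enorm_eq_nnnorm, Real.enorm_of_nonneg hr.le]
  gcongr
  exact le_iSup (fun s => edist (u (lam s)) (w s)) t

lemma reparamEDist_lt_top {u w : I → Vec d} (hu : Bornology.IsBounded (range u))
    (hw : Bornology.IsBounded (range w)) : reparamEDist u w < ⊤ := by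
  obtain ⟨C, hC⟩ := hu.exists_norm_le
  obtain ⟨D, hD⟩ := hw.exists_norm_le
  refine (iInf_le _ (OrderIso.refl I)).trans_lt
    (lt_of_le_of_lt (iSup_le fun t => ?_) (ENNReal.ofReal_lt_top (r := C + D)))
  rw [edist_dist]
  refine ENNReal.ofReal_le_ofReal ((dist_le_norm_add_norm _ _).trans ?_)
  exact add_le_add (hC _ (mem_range_self _)) (hD _ (mem_range_self _))

variable {M : Type*} {T : M → M} {X : Set M}

lemma isBounded_range_trueExcursion (v : M → Vec d) (x : M) :
    Bornology.IsBounded (range (trueExcursion T X v x)) := by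
  refine ((Finset.range (returnTime T X x + 1)).finite_toSet.image
    fun k => birkhoffSum T v k x).isBounded.subset ?_
  rintro _ ⟨t, rfl⟩
  refine ⟨_, ?_, rfl⟩
  simp only [Finset.coe_range, mem_Iio, Nat.lt_succ_iff]
  refine Nat.floor_le_of_le ?_
  exact mul_le_of_le_one_left (Nat.cast_nonneg _) t.2.2

lemma isBounded_range_idealExcursion [Finite ι] (V : Vec d) :
    Bornology.IsBounded (range (idealExcursion ω P V)) := by
  obtain ⟨C, hC1, hC⟩ := exists_profile_bound P
  refine (isBounded_iff_forall_norm_le).2 ⟨(2 * C + 1) * ‖V‖, ?_⟩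
  rintro _ ⟨t, rfl⟩
  exact norm_idealExcursion_le hC1 hC V t

/-- `excursionDist` is a real number obtained by `toReal`, which would hide an infinite distance.
Both excursions are bounded, so the distance is finite and a bound on the real number is a genuine
one. -/
lemma reparamEDist_excursion_lt [Finite ι] {v : M → Vec d} {x : M} {D : ℝ}
    (h : excursionDist T X v ω P x < D) :
    reparamEDist (trueExcursion T X v x) (idealExcursion ω P (inducedObs T X v x))
      < ENNReal.ofReal D := by
  have h1 := reparamEDist_lt_top (isBounded_range_trueExcursion (T := T) (X := X) v x)
    (isBounded_range_idealExcursion (ω := ω) (P := P) (inducedObs T X v x))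
  rw [← ENNReal.ofReal_toReal h1.ne]
  exact (ENNReal.ofReal_lt_ofReal_iff (ENNReal.toReal_nonneg.trans_lt h)).2 h

lemma inducedObs_iterate (v : M → Vec d) (x : M) (k : ℕ) :
    inducedObs T X v ((returnMap T X)^[k] x)
      = birkhoffSum T v (returnSum T X x (k + 1)) x - birkhoffSum T v (returnSum T X x k) x := by
  rw [returnSum_succ, birkhoffSum_add, iterate_returnSum, add_sub_cancel_left]
  rfl

/-- Along a typical orbit, the sum process is well approximated by the process of the induced
system. -/
lemma exists_isInducedApprox [Finite ι] {v : M → Vec d} {x : M} (hx : IsRecurrent T X x)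
    {b : ℕ → ℝ} {n : ℕ} (hb : 0 < b n) {δ : ℝ} {c : I} {u : Cadlag d} (hn : 2 ≤ δ * n)
    (hvis : ∀ j ≤ n, |visits T X j x - c * j| ≤ δ / 2 * n)
    (hexc : ∀ k < n, (b n)⁻¹ * excursionDist T X v ω P ((returnMap T X)^[k] x) < δ)
    (hval : edist (sumProcess (returnMap T X) (inducedObs T X v) b n x) u < ENNReal.ofReal δ) :
    ∃ lam, IsInducedApprox ω P u c δ n n (fun k => (b n)⁻¹ • birkhoffSum T v k x)
      (returnSum T X x) lam := by
  have hn0 : (0 : ℝ) < n := by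
    rcases Nat.eq_zero_or_pos n with rfl | h
    · norm_num at hn
    · exact_mod_cast h
  obtain ⟨lam, h1, h2⟩ := exists_iso_of_j1EDist_lt hval
  have hbi := inv_pos.2 hb
  refine ⟨lam, by linarith, by linarith, hx.strictMono_returnSum, returnSum_zero x,
    hx.strictMono_returnSum.le_apply, ?_, ?_, ?_, h2⟩
  -- Between two returns the number of visits differs from `k` by at most 1, which is at most `δ n /
  -- 2`. The other half of the error is the deviation of the visits from `c j`.
  · intro k j hkj hjk hj
    have e1 := hx.abs_visits_sub_le hkj hjk
    have e2 := hvis j hj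
    have e3 : (k : ℝ) / n - c * ((j : ℝ) / n) = (k - c * j) / n := by ring
    rw [e3, abs_div, abs_of_pos hn0, div_le_iff₀ hn0]
    rw [abs_le] at *
    constructor <;> linarith
  · intro k hk
    have e := reparamEDist_smul_lt hbi (reparamEDist_excursion_lt (D := b n * δ) (by
      have := hexc k hk
      rwa [inv_mul_lt_iff₀ hb] at this))
    rw [inv_mul_cancel_left₀ hb.ne'] at e
    convert e using 2
    · ext1 t
      rw [trueExcursion_iterate, smul_sub]
    · rw [← smul_sub, ← inducedObs_iterate]
      ext1 t
      exact idealExcursion_smul hbi _ t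
  · intro t
    have e := h1 t
    have e2 : (fun k => (b n)⁻¹ • birkhoffSum (returnMap T X) (inducedObs T X v) k x)
        = (fun k => (b n)⁻¹ • birkhoffSum T v k x) ∘ returnSum T X x := by
      ext1 k
      rw [Function.comp_apply, ← birkhoffSum_returnMap]
      rfl
    rw [← e2]
    exact e

end DecoratedLevy

/-! ### Convergence under the conditioned measure. -/

namespace DecoratedLevy

variable {M : Type*} [MeasurableSpace M] {μ : Measure M} {T : M → M} {X : Set M} {d : ℕ}

lemma measurable_birkhoffSum (hT : Measurable T) {v : M → Vec d} (hv : Measurable v) (k : ℕ) :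
    Measurable fun x => birkhoffSum T v k x :=
  Finset.measurable_fun_sum _ fun j _ => hv.comp (hT.iterate j)

lemma measurable_decoratedSumProcess (hT : Measurable T) {v : M → Vec d} (hv : Measurable v)
    (b : ℕ → ℝ) (n : ℕ) : Measurable (decoratedSumProcess T v b n) := by
  rcases Nat.eq_zero_or_pos n with rfl | hn
  · have : decoratedSumProcess T v b 0 = fun _ => Decorated.ofStep 0 fun _ => 0 := by
      ext1 x
      refine Decorated.ofStep_congr fun k hk => ?_
      rw [Nat.le_zero.1 hk, birkhoffSum_zero, smul_zero]
    rw [this]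
    exact measurable_const
  · exact Decorated.measurable_ofStep hn fun k =>
      (measurable_birkhoffSum hT hv k).const_smul (b n)⁻¹

lemma tendsto_cond_of_tendsto (hX0 : μ X ≠ 0) {s : ℕ → Set M}
    (h : Tendsto (fun n => μ (s n)) atTop (𝓝 0)) :
    Tendsto (fun n => cond μ X (s n)) atTop (𝓝 0) := by
  have h1 := ENNReal.Tendsto.const_mul (a := (μ X)⁻¹) h (Or.inr (ENNReal.inv_ne_top.2 hX0))
  rw [mul_zero] at h1
  refine tendsto_of_tendsto_of_tendsto_of_le_of_le tendsto_const_nhds h1 (fun _ => bot_le)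
    fun n => ?_
  simp only [ProbabilityTheory.cond, Measure.smul_apply, smul_eq_mul]
  gcongr
  exact Measure.restrict_le_self

/-- The decorated sum process converges with respect to the measure conditioned on the base of
the induced system. -/
theorem tendstoInDistribution_decoratedSumProcess_cond [IsProbabilityMeasure μ]
    (hT : Ergodic T μ) (hX : MeasurableSet X) (hX0 : μ X ≠ 0) [IsProbabilityMeasure (cond μ X)]
    {v : M → Vec d} (hv : Measurable v) {ι : Type*} [Fintype ι] {ω : ι → Sph d}
    (hω : Function.Injective ω) {a : ι → ℝ} (ha : ∀ i, 0 < a i) {P : ι → Cadlag d}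
    (hP : ∀ i, IsProfile (P i) (ω i)) {α : ℝ} (hα0 : 0 < α) (hα2 : α < 2) (hα1 : α ≠ 1)
    {b : ℕ → ℝ} (hb : Tendsto b atTop atTop)
    {Ω : Type*} [MeasurableSpace Ω] {Pr : Measure Ω} [IsProbabilityMeasure Pr]
    {L : Ω → Cadlag d} (hL : IsStableLevy α (spectralMeasure a ω) L Pr)
    (hW : TendstoInDistribution (fun n => sumProcess (returnMap T X) (inducedObs T X v) b n)
      atTop L (fun _ => cond μ X) Pr)
    (hexc : TendstoInMeasure (cond μ X)
      (fun (n : ℕ) x => (b n)⁻¹ * (Finset.range (n + 1)).sup' Finset.nonempty_range_add_one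
        (fun j => excursionDist T X v ω P ((returnMap T X)^[j] x)))
      atTop (fun _ => (0 : ℝ)))
    {c : I} (hc : 0 < c) (hcX : (c : ℝ) = μ.real X) :
    TendstoInDistribution (fun n => decoratedSumProcess T v b n) atTop
      (fun x => decorate ω P hP ((L x).slow c hc)) (fun _ => cond μ X) Pr := by
  have hlim := hL.ae_tendsto_approximant_slow hω hP hα0 hα2 hα1 ha hc
  -- The exceptional points are those that are not recurrent, those whose visits deviate from linear
  -- growth, and those with an excursion far from the ideal one.
  let B : ℝ → ℕ → Set M := fun δ n => {x | ¬ IsRecurrent T X x} ∪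
    ({x | ∃ j ≤ n, δ / 2 * n < |visits T X j x - μ.real X * j|} ∪
    {x | ∃ k < n, δ ≤ (b n)⁻¹ * excursionDist T X v ω P ((returnMap T X)^[k] x)})
  refine tendstoInDistribution_of_approx (Φ := fun u => decorate ω P hP (u.slow c hc)) (B := B) hW
    (fun n => (measurable_decoratedSumProcess hT.measurable hv b n).aemeasurable)
    (aemeasurable_decorate_of_tendsto hP (fun t => hL.aemeasurable (c * t))
      (hlim.mono fun x hx => hx.2.2)) ?_ ?_ ?_
  · rintro δ δ' hδ n x (hx | ⟨j, hj, hx⟩ | ⟨k, hk, hx⟩)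
    · exact Or.inl hx
    · exact Or.inr (Or.inl ⟨j, hj, lt_of_le_of_lt (by gcongr) hx⟩)
    · exact Or.inr (Or.inr ⟨k, hk, hδ.trans hx⟩)
  · intro δ hδ
    have h1 := tendsto_cond_of_tendsto hX0 (tendsto_measure_exists_visits hT hX (half_pos hδ))
    have h2 := hexc (ENNReal.ofReal δ) (ENNReal.ofReal_pos.2 hδ)
    have h3 := h1.add h2
    rw [add_zero] at h3
    refine tendsto_of_tendsto_of_tendsto_of_le_of_le' tendsto_const_nhds h3
      (Eventually.of_forall fun _ => bot_le) ?_
    filter_upwards [hb.eventually_gt_atTop 0] with n hbn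
    refine (measure_union_le _ _).trans ?_
    have h0 : cond μ X {x | ¬ IsRecurrent T X x} = 0 := ae_isRecurrent hT.toMeasurePreserving hX
    rw [h0, zero_add]
    refine (measure_union_le _ _).trans (add_le_add_right (measure_mono ?_) _)
    rintro x ⟨k, hk, hx⟩
    rw [mem_ofPred_eq, edist_dist, Real.dist_0_eq_abs]
    refine ENNReal.ofReal_le_ofReal (hx.trans (le_trans ?_ (le_abs_self _)))
    refine mul_le_mul_of_nonneg_left ?_ (inv_pos.2 hbn).le
    exact Finset.le_sup' (fun j => excursionDist T X v ω P ((returnMap T X)^[j] x))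
      (Finset.mem_range.2 (hk.trans n.lt_succ_self))
  · filter_upwards [hlim] with x hx ε hε
    -- The threshold depends on the limit path, which the mapping theorem permits.
    obtain ⟨δ, hδ, h⟩ := edist_ofStep_decorate_le hω hP (L x) c hc hx.1 hx.2.1 hε
    refine ⟨δ, hδ, ?_⟩
    filter_upwards [hb.eventually_gt_atTop 0,
      (tendsto_natCast_atTop_atTop (R := ℝ)).eventually_ge_atTop (2 / δ)] with n hbn hn y hy hd
    simp only [B, mem_union, mem_ofPred_eq, not_or, not_not, not_exists, not_and, not_lt,
      not_le] at hy
    obtain ⟨lam, hlam⟩ := exists_isInducedApprox hy.1 hbn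
      (by rw [div_le_iff₀ hδ] at hn; linarith) (by rw [hcX]; exact hy.2.1) hy.2.2 hd
    exact h _ _ _ _ _ hlam

end DecoratedLevy

/-! ### Stability of step functions under a shift of the sequence. -/

namespace DecoratedLevy

/-- A step function is close to the step function of the shifted sequence. -/
lemma j1EDist_step_shift_le {d : ℕ} {n : ℕ} (hn : 4 ≤ n) (g : ℕ → Vec d) {η : ℝ}
    (hη : 2 / (n : ℝ) + ‖g 0‖ + ‖g 1‖ + ‖g n - g (n - 1)‖ + ‖g (n + 1) - g n‖ ≤ η) :
    j1EDist (Cadlag.step n g) (Cadlag.step n fun k => g (k + 1) - g 1)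
      ≤ ENNReal.ofReal (2 * η) := by
  have hn4 : (4 : ℝ) ≤ n := by exact_mod_cast hn
  have hn0 : (0 : ℝ) < n := by linarith
  have hi : (0 : ℝ) < 1 / n := by positivity
  have e2 : 2 / (n : ℝ) = 2 * (1 / n) := by ring
  have e1 : (n : ℝ) * (1 / n) = 1 := by field_simp
  have hi4 : 4 * (1 / (n : ℝ)) ≤ 1 := by
    have := mul_le_mul_of_nonneg_right hn4 hi.le
    linarith
  have a0 := norm_nonneg (g 0)
  have a1 := norm_nonneg (g 1)
  have a2 := norm_nonneg (g n - g (n - 1))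
  have a3 := norm_nonneg (g (n + 1) - g n)
  rw [e2] at hη
  generalize hq : 1 / (n : ℝ) = q at *
  refine j1EDist_le_of_reparamClose (f := fun t => g ⌊(n : ℝ) * t⌋₊)
    (g := fun t => g (⌊(n : ℝ) * t⌋₊ + 1) - g 1) (by linarith) ?_ ?_
  -- The time change is the translation by `-1/n` on `[2/n, 1 - 1/n)`. The first piece maps two
  -- cells to one, and the last maps one cell to two. On these pieces only the values at the ends of
  -- the sequence matter.
  · refine ReparamClose.glue (b := 2 * q) (b' := q) ?_
      (ReparamClose.glue (b := 1 - q) (b' := 1 - 2 * q) ?_ ?_ (by linarith) (by linarith))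
      (by linarith) (by linarith)
    · refine ReparamClose.of_forall_dist (by linarith) hi ?_
      rintro t ⟨ht0, ht1⟩ s ⟨hs0, hs1⟩
      refine Cadlag.dist_prod_le (by rw [abs_le]; constructor <;> linarith) ?_
      have h1 : ⌊(n : ℝ) * s⌋₊ = 0 := by rw [Nat.floor_eq_zero]; nlinarith
      have h2 : ⌊(n : ℝ) * t⌋₊ < 2 := by
        rw [Nat.floor_lt (by positivity)]; push_cast; nlinarith
      simp only [h1, zero_add, sub_self, dist_zero_right]
      interval_cases ⌊(n : ℝ) * t⌋₊ <;> linarith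
    · refine ⟨OrderIso.addRight (-q), ?_, ?_, fun t ht0 ht1 => ?_⟩
      · simp only [OrderIso.addRight_apply]; ring
      · simp only [OrderIso.addRight_apply]; ring
      · simp only [OrderIso.addRight_apply]
        refine Cadlag.dist_prod_le (by rw [abs_le]; constructor <;> linarith) ?_
        have h1 : (n : ℝ) * t = n * (t + -q) + (1 : ℕ) := by push_cast; linear_combination e1
        have h2 : 0 ≤ (n : ℝ) * (t + -q) := by nlinarith
        rw [h1, Nat.floor_add_natCast h2, dist_self_sub_right]
        linarith
    · refine ReparamClose.of_forall_dist (by linarith) (by linarith) ?_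
      rintro t ⟨ht0, ht1⟩ s ⟨hs0, hs1⟩
      refine Cadlag.dist_prod_le (by rw [abs_le]; constructor <;> linarith) ?_
      have hc1 : ((n - 1 : ℕ) : ℝ) = n - 1 := by rw [Nat.cast_sub (by omega)]; simp
      have hc2 : ((n - 2 : ℕ) : ℝ) = n - 2 := by rw [Nat.cast_sub (by omega)]; simp
      have h1 : ⌊(n : ℝ) * t⌋₊ = n - 1 := by
        rw [Nat.floor_eq_iff (by nlinarith), hc1]
        constructor <;> nlinarith
      have h2 : n - 2 ≤ ⌊(n : ℝ) * s⌋₊ := Nat.le_floor (by rw [hc2]; nlinarith)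
      have h3 : ⌊(n : ℝ) * s⌋₊ < n := by
        rw [Nat.floor_lt (by nlinarith)]; nlinarith
      simp only [h1]
      have h4 : ⌊(n : ℝ) * s⌋₊ + 1 = n - 1 ∨ ⌊(n : ℝ) * s⌋₊ + 1 = n := by omega
      rcases h4 with h4 | h4
      · rw [h4, dist_self_sub_right]; linarith
      · rw [h4, dist_comm, dist_eq_norm, sub_right_comm]
        exact (norm_sub_le _ _).trans (by linarith)
  · simp only [mul_one, Nat.floor_natCast]
    rw [dist_comm, dist_eq_norm, sub_right_comm]
    exact (norm_sub_le _ _).trans (by linarith)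

/-! ### Asymptotically invariant functions decorrelate. -/

section Averaging

variable {M : Type*} [MeasurableSpace M] {μ : Measure M} [IsProbabilityMeasure μ] {T : M → M}

lemma integrable_of_forall_abs_le {f : M → ℝ} (hf : Measurable f) {C : ℝ} (h : ∀ x, |f x| ≤ C) :
    Integrable f μ :=
  Integrable.of_bound hf.aestronglyMeasurable C (Eventually.of_forall h)

/-- Invariance of `μ` replaces `ψ · h ∘ T^j` by `ψ ∘ T · h ∘ T^{j+1}`. Returning from `ψ ∘ T` to `ψ`
costs one integral of `|ψ ∘ T - ψ|` per step. -/
lemma abs_integral_mul_sub_le (hT : MeasurePreserving T μ μ) {ψ h : M → ℝ} (hψ : Measurable ψ)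
    {B : ℝ} (hB : ∀ x, |ψ x| ≤ B) (hh : Measurable h) (h1 : ∀ x, |h x| ≤ 1) (j : ℕ) :
    |∫ x, ψ x * h x ∂μ - ∫ x, ψ x * h (T^[j] x) ∂μ| ≤ j * ∫ x, |ψ (T x) - ψ x| ∂μ := by
  have hint : ∀ (f k : M → ℝ), Measurable f → (∀ x, |f x| ≤ B) → Measurable k →
      (∀ x, |k x| ≤ 1) → Integrable (fun x => f x * k x) μ := by
    intro f k hf hfB hk hk1
    refine integrable_of_forall_abs_le (hf.mul hk) (C := B * 1) fun x => ?_
    rw [abs_mul]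
    exact mul_le_mul (hfB x) (hk1 x) (abs_nonneg _) ((abs_nonneg _).trans (hfB x))
  have hm : ∀ j, Measurable fun x => h (T^[j] x) := fun j => hh.comp (hT.measurable.iterate j)
  have hψT : Measurable fun x => ψ (T x) := hψ.comp hT.measurable
  induction j with
  | zero => simp
  | succ j ih =>
    have e : ∫ x, ψ x * h (T^[j] x) ∂μ = ∫ x, ψ (T x) * h (T^[j + 1] x) ∂μ := by
      have := hT.map_eq ▸ integral_map (f := fun x => ψ x * h (T^[j] x)) hT.measurable.aemeasurable
        (hψ.mul (hm j)).aestronglyMeasurable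
      simpa only [Function.iterate_succ_apply] using this
    have e2 : |∫ x, ψ x * h (T^[j] x) ∂μ - ∫ x, ψ x * h (T^[j + 1] x) ∂μ|
        ≤ ∫ x, |ψ (T x) - ψ x| ∂μ := by
      rw [e, ← integral_sub (hint _ _ hψT (fun x => hB _) (hm _) fun x => h1 _)
        (hint _ _ hψ hB (hm _) fun x => h1 _)]
      refine abs_integral_le_integral_abs.trans (integral_mono_of_nonneg
        (Eventually.of_forall fun x => abs_nonneg _) ?_ (Eventually.of_forall fun x => ?_))
      · exact ((integrable_of_forall_abs_le hψT fun x => hB _).sub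
          (integrable_of_forall_abs_le hψ hB)).abs
      · simp only [← sub_mul]
        rw [abs_mul]
        exact mul_le_of_le_one_right (abs_nonneg _) (h1 _)
    have := abs_sub_le (∫ x, ψ x * h x ∂μ) (∫ x, ψ x * h (T^[j] x) ∂μ)
      (∫ x, ψ x * h (T^[j + 1] x) ∂μ)
    push_cast
    linarith

/-- Asymptotically invariant bounded functions are asymptotically uncorrelated with every bounded
function, for an ergodic transformation. -/
lemma tendsto_integral_mul_sub (hT : Ergodic T μ) {ψ : ℕ → M → ℝ} (hψ : ∀ n, Measurable (ψ n))
    {B : ℝ} (hB : ∀ n x, |ψ n x| ≤ B)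
    (hinv : Tendsto (fun n => ∫ x, |ψ n (T x) - ψ n x| ∂μ) atTop (𝓝 0))
    {h : M → ℝ} (hh : Measurable h) (h1 : ∀ x, |h x| ≤ 1) :
    Tendsto (fun n => ∫ x, ψ n x * h x ∂μ - (∫ x, h x ∂μ) * ∫ x, ψ n x ∂μ) atTop (𝓝 0) := by
  set m := ∫ x, h x ∂μ
  have hTm := hT.toMeasurePreserving
  have hB0 : 0 ≤ B := by
    obtain ⟨x⟩ := μ.nonempty_of_neZero
    exact (abs_nonneg _).trans (hB 0 x)
  have hL2 : MemLp h 2 μ := MemLp.of_bound hh.aestronglyMeasurable 1 (Eventually.of_forall h1)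
  have havg := tendsto_eLpNorm_birkhoffAverage hT hL2
  let A : ℕ → M → ℝ := fun J x => (J : ℝ)⁻¹ * birkhoffSum T h J x - m
  have hmj : ∀ j, Measurable fun x => h (T^[j] x) := fun j => hh.comp (hT.measurable.iterate j)
  have hS : ∀ J, Measurable fun x => birkhoffSum T h J x := fun J =>
    Finset.measurable_fun_sum _ fun j _ => hmj j
  have hAm : ∀ J, Measurable (A J) := fun J => ((hS J).const_mul _).sub_const m
  have hintj : ∀ n j, Integrable (fun x => ψ n x * h (T^[j] x)) μ := fun n j => by
    refine integrable_of_forall_abs_le ((hψ n).mul (hmj j)) (C := B * 1) fun x => ?_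
    rw [abs_mul]
    exact mul_le_mul (hB n x) (h1 _) (abs_nonneg _) hB0
  have hψi : ∀ n, Integrable (ψ n) μ := fun n => integrable_of_forall_abs_le (hψ n) (hB n)
  have hSi : ∀ J, Integrable (fun x => birkhoffSum T h J x) μ := fun J =>
    integrable_finsetSum _ fun j _ => integrable_of_forall_abs_le (hmj j) fun x => h1 _
  have hAi : ∀ J, Integrable (A J) μ := fun J => ((hSi J).const_mul _).sub (integrable_const m)
  have hAe : Tendsto (fun J => ∫ x, |A J x| ∂μ) atTop (𝓝 0) := by
    have := (ENNReal.tendsto_toReal ENNReal.zero_ne_top).comp havg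
    rw [ENNReal.toReal_zero] at this
    refine this.congr fun J => ?_
    rw [Function.comp_apply, eLpNorm_one_eq_lintegral_enorm,
      ← integral_norm_eq_lintegral_enorm (hAm J).aestronglyMeasurable]
    rfl
  -- For fixed `J`, `h` may be replaced by its Birkhoff average of length `J`, at a cost that tends
  -- to 0 with `n`. The average is close to its mean in `L¹` for large `J`, so `J` is chosen first.
  have key : ∀ J : ℕ, 0 < J → ∀ n, |∫ x, ψ n x * h x ∂μ - m * ∫ x, ψ n x ∂μ|
      ≤ J * ∫ x, |ψ n (T x) - ψ n x| ∂μ + B * ∫ x, |A J x| ∂μ := by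
    intro J hJ n
    have hJ0 : (0 : ℝ) < J := by exact_mod_cast hJ
    set D := ∫ x, |ψ n (T x) - ψ n x| ∂μ
    have hD : 0 ≤ D := integral_nonneg fun x => abs_nonneg _
    set a := ∫ x, ψ n x * h x ∂μ
    have hAψ : ∫ x, ψ n x * A J x ∂μ
        = (J : ℝ)⁻¹ * ∑ j ∈ Finset.range J, ∫ x, ψ n x * h (T^[j] x) ∂μ
          - m * ∫ x, ψ n x ∂μ := by
      rw [← integral_finsetSum _ fun j _ => hintj n j, ← integral_const_mul, ← integral_const_mul,
        ← integral_sub]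
      · refine integral_congr_ae (Eventually.of_forall fun x => ?_)
        simp only [A, birkhoffSum, ← Finset.mul_sum]
        ring
      · exact (integrable_finsetSum _ fun j _ => hintj n j).const_mul _
      · exact (hψi n).const_mul _
    have h2 : |a - (J : ℝ)⁻¹ * ∑ j ∈ Finset.range J, ∫ x, ψ n x * h (T^[j] x) ∂μ| ≤ J * D := by
      have e : a - (J : ℝ)⁻¹ * ∑ j ∈ Finset.range J, ∫ x, ψ n x * h (T^[j] x) ∂μ
          = (J : ℝ)⁻¹ * ∑ j ∈ Finset.range J, (a - ∫ x, ψ n x * h (T^[j] x) ∂μ) := by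
        rw [Finset.sum_sub_distrib, Finset.sum_const, Finset.card_range, nsmul_eq_mul]
        field_simp
      rw [e, abs_mul, abs_of_pos (inv_pos.2 hJ0), inv_mul_le_iff₀ hJ0]
      refine (Finset.abs_sum_le_sum_abs _ _).trans ?_
      refine (Finset.sum_le_card_nsmul _ _ (J * D) fun j hj => ?_).trans (by simp)
      refine (abs_integral_mul_sub_le hTm (hψ n) (hB n) hh h1 j).trans ?_
      have : (j : ℝ) ≤ J := by exact_mod_cast (Finset.mem_range.1 hj).le
      gcongr
    have h3 : |∫ x, ψ n x * A J x ∂μ| ≤ B * ∫ x, |A J x| ∂μ := by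
      rw [← integral_const_mul]
      refine abs_integral_le_integral_abs.trans (integral_mono_of_nonneg
        (Eventually.of_forall fun x => abs_nonneg _) ((hAi J).abs.const_mul _)
        (Eventually.of_forall fun x => ?_))
      simp only [abs_mul]
      gcongr
      exact hB n x
    rw [hAψ] at h3
    rw [abs_le] at *
    constructor <;> linarith
  rw [Metric.tendsto_atTop]
  intro ε hε
  have hB1 : Tendsto (fun J => B * ∫ x, |A J x| ∂μ) atTop (𝓝 0) := by
    simpa using hAe.const_mul B
  obtain ⟨J, hJ, hJ0⟩ := ((hB1.eventually_lt_const (half_pos hε)).and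
    (eventually_gt_atTop 0)).exists
  have hD1 : Tendsto (fun n => (J : ℝ) * ∫ x, |ψ n (T x) - ψ n x| ∂μ) atTop (𝓝 0) := by
    simpa using hinv.const_mul (J : ℝ)
  obtain ⟨N, hN⟩ := eventually_atTop.1 (hD1.eventually_lt_const (half_pos hε))
  refine ⟨N, fun n hn => ?_⟩
  rw [Real.dist_0_eq_abs]
  have := key J hJ0 n
  have := hN n hn
  linarith

end Averaging

end DecoratedLevy

/-! ### From the conditioned measure to the invariant measure. -/

namespace DecoratedLevy

variable {M : Type*} [MeasurableSpace M] {μ : Measure M} [IsProbabilityMeasure μ] {T : M → M}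
  {d : ℕ} {v : M → Vec d} {b : ℕ → ℝ}

/-- The decorated sum process is asymptotically invariant. -/
lemma tendsto_measure_decoratedSumProcess_shift (hT : MeasurePreserving T μ μ) (hv : Measurable v)
    (hb : Tendsto b atTop atTop) {ε : ℝ} (hε : 0 < ε) :
    Tendsto (fun n => μ {x | ENNReal.ofReal ε <
      edist (decoratedSumProcess T v b n (T x)) (decoratedSumProcess T v b n x)}) atTop (𝓝 0) := by
  -- The shift moves the step function by at most `8δ < 9δ` in J₁, and decorated step functions are
  -- at most three times as far apart.
  set δ := ε / 27 with hδε
  have hδ : 0 < δ := by positivity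
  have hsmall : TendstoInMeasure μ (fun n x => (b n)⁻¹ • v x) atTop fun _ => 0 := by
    refine tendstoInMeasure_of_tendsto_ae
      (fun n => (hv.const_smul (b n)⁻¹).aestronglyMeasurable) (Eventually.of_forall fun x => ?_)
    simpa using (tendsto_inv_atTop_zero.comp hb).smul_const (v x)
  have hp := hsmall (ENNReal.ofReal δ) (ENNReal.ofReal_pos.2 hδ)
  -- Only the normalised values of `v` at times 0, `n - 1` and `n` enter the shift estimate. By
  -- invariance each of them is small with the same probability.
  set S : ℕ → Set M := fun n => {x | ENNReal.ofReal δ ≤ edist ((b n)⁻¹ • v x) 0} with hSdef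
  have hS : ∀ n, MeasurableSet (S n) := fun n =>
    measurableSet_le measurable_const ((hv.const_smul (b n)⁻¹).edist measurable_const)
  have hSx : ∀ n x, x ∉ S n → ‖(b n)⁻¹ • v x‖ ≤ δ := by
    intro n x hx
    rw [hSdef, mem_ofPred_eq, not_le, edist_dist, dist_zero_right,
      ENNReal.ofReal_lt_ofReal_iff hδ] at hx
    exact hx.le
  have h3 := (hp.add hp).add hp
  rw [add_zero, add_zero] at h3
  refine tendsto_of_tendsto_of_tendsto_of_le_of_le' tendsto_const_nhds h3
    (Eventually.of_forall fun _ => bot_le) ?_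
  filter_upwards [eventually_ge_atTop 4,
    (tendsto_natCast_atTop_atTop (R := ℝ)).eventually_ge_atTop (2 / δ)] with n hn hnδ
  have hpre : ∀ j, μ (T^[j] ⁻¹' S n) = μ (S n) := fun j =>
    (hT.iterate j).measure_preimage (hS n).nullMeasurableSet
  have hsub : {x | ENNReal.ofReal ε <
      edist (decoratedSumProcess T v b n (T x)) (decoratedSumProcess T v b n x)}
      ⊆ S n ∪ T^[n - 1] ⁻¹' S n ∪ T^[n] ⁻¹' S n := by
    intro x hx
    by_contra hxS
    simp only [mem_union, not_or, mem_preimage] at hxS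
    obtain ⟨⟨k1, k2⟩, k3⟩ := hxS
    rw [mem_ofPred_eq] at hx
    refine (not_le.2 hx) ?_
    have hn0 : (0 : ℝ) < n := by exact_mod_cast (show 0 < n by omega)
    let g : ℕ → Vec d := fun k => (b n)⁻¹ • birkhoffSum T v k x
    have hg0 : g 0 = 0 := by simp [g]
    have hgs : ∀ k, g (k + 1) - g k = (b n)⁻¹ • v (T^[k] x) := fun k => by
      simp only [g]
      rw [birkhoffSum_succ, smul_add, add_sub_cancel_left]
    have hg1 : g 1 = (b n)⁻¹ • v x := by simpa [hg0] using hgs 0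
    have hgn : g n - g (n - 1) = (b n)⁻¹ • v (T^[n - 1] x) := by
      have := hgs (n - 1)
      rwa [Nat.sub_add_cancel (by omega)] at this
    have hshift : decoratedSumProcess T v b n (T x)
        = Decorated.ofStep n fun k => g (k + 1) - g 1 := by
      refine Decorated.ofStep_congr fun k _ => ?_
      simp only [g]
      rw [birkhoffSum_succ', birkhoffSum_one, smul_add, add_sub_cancel_left]
    have h2n : 2 / (n : ℝ) ≤ δ := by
      rw [div_le_iff₀ hδ] at hnδ
      rw [div_le_iff₀ hn0]
      linarith
    have hj := j1EDist_step_shift_le hn g (η := 4 * δ) (by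
      rw [hg0, hg1, hgn, hgs n, norm_zero]
      have := hSx n _ k1
      have := hSx n _ k2
      have := hSx n _ k3
      linarith)
    have hj' := hj.trans_lt ((ENNReal.ofReal_lt_ofReal_iff (q := 9 * δ) (by positivity)).2
      (by linarith))
    have := Decorated.edist_ofStep_le (by omega) (by omega) hj'
    rw [hshift, edist_comm]
    refine this.trans_eq ?_
    rw [hδε]
    congr 1
    ring
  refine (measure_mono hsub).trans ((measure_union_le _ _).trans ?_)
  rw [hpre]
  refine add_le_add_left ((measure_union_le _ _).trans ?_) _
  rw [hpre]

/-- Where `Z n ∘ T` and `Z n` are close, the Lipschitz bound applies; elsewhere the integrand is at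
most `2 * B`, on a set of vanishing measure. -/
lemma tendsto_integral_abs_comp_sub {E : Type*} [PseudoEMetricSpace E] [MeasurableSpace E]
    [BorelSpace E] (hT : Measurable T) {Z : ℕ → M → E} (hZ : ∀ n, Measurable (Z n))
    (hinv : ∀ ε, 0 < ε →
      Tendsto (fun n => μ {x | ENNReal.ofReal ε < edist (Z n (T x)) (Z n x)}) atTop (𝓝 0))
    {φ : E → ℝ} {K : NNReal} (hφ : LipschitzWith K φ) {B : ℝ} (hB : ∀ w, |φ w| ≤ B) :
    Tendsto (fun n => ∫ x, |φ (Z n (T x)) - φ (Z n x)| ∂μ) atTop (𝓝 0) := by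
  have hm : ∀ n, Measurable fun x => |φ (Z n (T x)) - φ (Z n x)| := fun n =>
    ((hφ.continuous.measurable.comp ((hZ n).comp hT)).sub
      (hφ.continuous.measurable.comp (hZ n))).norm
  have h2B : ∀ n x, |φ (Z n (T x)) - φ (Z n x)| ≤ 2 * B := fun n x => by
    have := abs_sub (φ (Z n (T x))) (φ (Z n x))
    have := hB (Z n (T x))
    have := hB (Z n x)
    linarith
  rw [Metric.tendsto_atTop]
  intro ε hε
  set η := ε / 2 / (K + 1) with hη
  have hη0 : 0 < η := by positivity
  have hKη : K * η ≤ ε / 2 := by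
    rw [hη, mul_div_assoc']
    rw [div_le_iff₀ (by positivity)]
    nlinarith [K.coe_nonneg]
  set s : ℕ → Set M := fun n => {x | ε / 2 < |φ (Z n (T x)) - φ (Z n x)|}
  have hs : ∀ n, MeasurableSet (s n) := fun n => measurableSet_lt measurable_const (hm n)
  have hsub : ∀ n, s n ⊆ {x | ENNReal.ofReal η < edist (Z n (T x)) (Z n x)} := by
    intro n x hx
    by_contra hc
    rw [mem_ofPred_eq, not_lt] at hc
    have h1 := hφ.edist_le_mul_of_le hc
    rw [edist_dist, Real.dist_eq, ← ENNReal.ofReal_coe_nnreal, ← ENNReal.ofReal_mul K.coe_nonneg,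
      ENNReal.ofReal_le_ofReal_iff (by positivity)] at h1
    have : ε / 2 < |φ (Z n (T x)) - φ (Z n x)| := hx
    linarith
  have hlim : Tendsto (fun n => 2 * B * μ.real (s n)) atTop (𝓝 0) := by
    have h0 : Tendsto (fun n => μ (s n)) atTop (𝓝 0) :=
      tendsto_of_tendsto_of_tendsto_of_le_of_le tendsto_const_nhds (hinv η hη0)
        (fun _ => bot_le) fun n => measure_mono (hsub n)
    have := (ENNReal.tendsto_toReal ENNReal.zero_ne_top).comp h0
    simpa [Measure.real, Function.comp_def] using this.const_mul (2 * B)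
  obtain ⟨N, hN⟩ := eventually_atTop.1 (hlim.eventually_lt_const (half_pos hε))
  refine ⟨N, fun n hn => ?_⟩
  rw [Real.dist_0_eq_abs, abs_of_nonneg (integral_nonneg fun x => abs_nonneg _)]
  have hle : ∫ x, |φ (Z n (T x)) - φ (Z n x)| ∂μ
      ≤ ∫ x, (ε / 2 + (s n).indicator (fun _ => 2 * B) x) ∂μ := by
    refine integral_mono_of_nonneg (Eventually.of_forall fun x => abs_nonneg _)
      ((integrable_const _).add ((integrable_const _).indicator (hs n)))
      (Eventually.of_forall fun x => ?_)
    by_cases hx : x ∈ s n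
    · simp only [indicator_of_mem hx]
      have := h2B n x
      linarith
    · simp only [indicator_of_notMem hx, add_zero]
      exact not_lt.1 hx
  rw [integral_add (integrable_const _) ((integrable_const _).indicator (hs n)),
    integral_indicator_const _ (hs n), integral_const, smul_eq_mul, smul_eq_mul,
    probReal_univ, one_mul] at hle
  have := hN n hn
  linarith

/-- The integral under the conditioned measure is `∫ ψ 1_X dμ / μ(X)`, and `ψ n` is asymptotically
uncorrelated with the indicator of `X`. -/
lemma tendsto_integral_of_tendsto_cond (hT : Ergodic T μ) {X : Set M} (hX : MeasurableSet X)
    (hX0 : μ X ≠ 0) {ψ : ℕ → M → ℝ} (hψ : ∀ n, Measurable (ψ n)) {B : ℝ}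
    (hB : ∀ n x, |ψ n x| ≤ B)
    (hinv : Tendsto (fun n => ∫ x, |ψ n (T x) - ψ n x| ∂μ) atTop (𝓝 0)) {l : ℝ}
    (h : Tendsto (fun n => ∫ x, ψ n x ∂(cond μ X)) atTop (𝓝 l)) :
    Tendsto (fun n => ∫ x, ψ n x ∂μ) atTop (𝓝 l) := by
  have hc : μ.real X ≠ 0 := by
    rw [measureReal_def]
    exact (ENNReal.toReal_pos hX0 (measure_ne_top μ X)).ne'
  have hdec := tendsto_integral_mul_sub hT hψ hB hinv (h := X.indicator 1)
    (measurable_one.indicator hX) (fun x => by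
      by_cases hx : x ∈ X <;> simp [hx])
  rw [integral_indicator_one hX] at hdec
  have h2 := h.sub (hdec.const_mul (μ.real X)⁻¹)
  rw [mul_zero, sub_zero] at h2
  refine h2.congr fun n => ?_
  have e1 : ∫ x, ψ n x * X.indicator 1 x ∂μ = ∫ x in X, ψ n x ∂μ := by
    rw [← integral_indicator hX]
    congr 1
    ext1 x
    by_cases hx : x ∈ X <;> simp [hx]
  have e2 : ∫ x, ψ n x ∂(cond μ X) = (μ.real X)⁻¹ * ∫ x in X, ψ n x ∂μ := by
    rw [ProbabilityTheory.cond, integral_smul_measure, ENNReal.toReal_inv, smul_eq_mul,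
      measureReal_def]
  rw [e1, e2]
  field_simp
  ring

end DecoratedLevy

/-! ### The theorem. -/

open DecoratedLevy in
theorem theorem1 {M : Type*} [MeasurableSpace M] (μ : Measure M) [IsProbabilityMeasure μ]
    (T : M → M) (hT : Ergodic T μ)
    (X : Set M) (hX : MeasurableSet X) (hX0 : μ X ≠ 0)
    (hR : Integrable (fun x => (returnTime T X x : ℝ)) (cond μ X))
    {d : ℕ} (v : M → Vec d) (hv : Measurable v)
    {ι : Type*} [Fintype ι] (ω : ι → Sph d) (hω : Function.Injective ω)
    (a : ι → ℝ) (ha : ∀ i, 0 < a i) (ha1 : ∑ i, a i = 1)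
    (P : ι → Cadlag d) (hP : ∀ i, IsProfile (P i) (ω i))
    (α : ℝ) (hα0 : 0 < α) (hα2 : α < 2) (hα1 : α ≠ 1)
    (l : ℝ → ℝ) (hl : IsSlowlyVarying l)
    (b : ℕ → ℝ) (hb : Tendsto b atTop atTop)
    (hbl : Asymptotics.IsEquivalent atTop b (fun n => ((n : ℝ) * l (b n)) ^ (1 / α)))
    {Ω : Type*} [MeasurableSpace Ω] (Pr : Measure Ω) [IsProbabilityMeasure Pr]
    (L : Ω → Cadlag d) (hL : IsStableLevy α (spectralMeasure a ω) L Pr)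
    (hW : haveI : IsProbabilityMeasure (cond μ X) := cond_isProbabilityMeasure hX0
      TendstoInDistribution
        (fun n => sumProcess (returnMap T X) (inducedObs T X v) b n) atTop L
        (fun _ => cond μ X) Pr)
    (hexc : TendstoInMeasure (cond μ X)
      (fun (n : ℕ) x => (b n)⁻¹ * (Finset.range (n + 1)).sup' Finset.nonempty_range_add_one
        (fun j => excursionDist T X v ω P ((returnMap T X)^[j] x)))
      atTop (fun _ => (0 : ℝ))) :
    TendstoInDistribution (fun n => decoratedSumProcess T v b n) atTop
      (fun x => decorate ω P hP
        (Cadlag.scale ((∫ x, (returnTime T X x : ℝ) ∂(cond μ X)) ^ (-(1 / α))) (L x)))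
      (fun _ => μ) Pr := by
  have : IsProbabilityMeasure (cond μ X) := cond_isProbabilityMeasure hX0
  have hc : 0 < μ.real X := ENNReal.toReal_pos hX0 (measure_ne_top μ X)
  have hcI : (0 : I) < ⟨μ.real X, measureReal_nonneg, measureReal_le_one⟩ := hc
  -- Kac's lemma turns the scaling by the mean return time into `c^{1/α}` with `c = μ(X)`, the
  -- factor produced by self-similarity.
  have hr : (∫ x, (returnTime T X x : ℝ) ∂(cond μ X)) ^ (-(1 / α)) = μ.real X ^ (1 / α) := by
    rw [integral_returnTime hT hX hX0, Real.inv_rpow hc.le, Real.rpow_neg hc.le, inv_inv]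
  have hcond := tendstoInDistribution_decoratedSumProcess_cond hT hX hX0 hv hω ha hP hα0 hα2 hα1
    hb hL hW hexc hcI rfl
  have hZ := measurable_decoratedSumProcess hT.measurable hv b
  have hlim := aemeasurable_decorate_of_tendsto hP
    (fun t => (hL.aemeasurable t).const_smul (μ.real X ^ (1 / α)))
    (hL.ae_tendsto_approximant_scale hω hP hα0 hα2 hα1 ha (Real.rpow_pos_of_pos hc (1 / α)))
  rw [hr]
  refine ⟨fun n => (hZ n).aemeasurable, hlim, ?_⟩
  -- Testing with bounded Lipschitz functions is what makes the shift estimate usable: they turn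
  -- closeness in probability into closeness of integrals.
  refine tendsto_iff_forall_lipschitz_integral_tendsto.2 ?_
  rintro φ ⟨C, hC⟩ ⟨K, hφ⟩
  obtain ⟨B, hB⟩ : ∃ B, ∀ w, |φ w| ≤ B := by
    refine ⟨C + |φ (Decorated.ofStep 0 0)|, fun w => ?_⟩
    have h1 := hC w (Decorated.ofStep 0 0)
    rw [Real.dist_eq] at h1
    have h2 := abs_sub_abs_le_abs_sub (φ w) (φ (Decorated.ofStep 0 0))
    linarith
  have hmφ := hφ.continuous.measurable
  have h1 := tendsto_iff_forall_lipschitz_integral_tendsto.1 hcond.tendsto φ ⟨C, hC⟩ ⟨K, hφ⟩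
  simp only [ProbabilityMeasure.coe_mk] at h1 ⊢
  -- The limit of the integrals under `μ_X` is rewritten from the slowed down process to the scaled
  -- one.
  rw [integral_map hcond.aemeasurable_limit hmφ.aestronglyMeasurable,
    hL.integral_decorate_slow_eq hω hP hα0 hα2 hα1 ha hcI hφ.continuous hB] at h1
  rw [integral_map hlim hmφ.aestronglyMeasurable]
  simp only [integral_map (hZ _).aemeasurable hmφ.aestronglyMeasurable] at h1 ⊢
  exact tendsto_integral_of_tendsto_cond hT hX hX0 (fun n => hmφ.comp (hZ n)) (fun n x => hB _)
    (tendsto_integral_abs_comp_sub hT.measurable hZ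
      (fun ε hε => tendsto_measure_decoratedSumProcess_shift hT.toMeasurePreserving hv hb hε) hφ hB)
    h1
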